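/- **Setting.** Let $M$ be a connected (Hausdorff, second countable) smooth $n$-manifold, $g_0$ a smooth Riemannian metric and $\omega$ a smooth 1-form on $M$, and $\Lambda>0$ a smooth function on $V=\mathbb R\times M$. Let $t,\pi$ be the projections of $V$. The *standard (conformally) stationary spacetime* is $V$ with $$g=\Lambda\left(-dt^2+\pi^*\omega\otimes dt+dt\otimes\pi^*\omega+\pi^*g_0\right),$$ time-oriented so that $\partial_t$ is future-directed. Its *Fermat metrics* are $F^\pm(v)=\sqrt{g_0(v,v)+\omega(v)^2}\pm\omega(v)$, and $d^\pm(x,y)$ is the infimum of the $F^\pm$-lengths of the piecewise smooth curves from $x$ to $y$; so $d^-(x,y)=d^+(y,x)$. **Causal completions.** Write $p\ll q$ if there is a piecewise smooth future-directed timelike curve from $p$ to $q$, $I^-[S]=\{p: p\ll q \text{ for some } q\in S\}$, $I^\mp(p)$ for the past/future of a point, and $\downarrow S=I^-[\{p: p\ll q\ \forall q\in S\}]$. A *past set* is a non-empty $P$ with $P=I^-[P]$; it is an *IP* if it is not the union of two past sets both different from $P$, and a *TIP* if moreover $P\neq I^-(p)$ for all $p\in V$. Future sets, IFs, TIFs,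 $\uparrow$ are defined dually. $\hat V,\hat\partial V$ (resp. $\check V,\check\partial V$) are the sets of IPs, TIPs (resp. IFs, TIFs). An IP $P$ and an IF $F$ are *S-related*, $P\sim_S F$, if $F$ is a maximal IF in $\uparrow P$ and $P$ is a maximal IP in $\downarrow F$. The *c-completion* $\overline V$ consists of the S-related pairs $(P,F)$, the pairs $(P,\emptyset)$ with $P$ an IP S-related to no IF, and the pairs $(\emptyset,F)$ with $F$ an IF S-related to no IP. The *c-boundary* $\partial V$ consists of the pairs of $\overline V$ not of the form $(I^-(p),I^+(p))$, $p\in V$. For a sequence of IPs, $P\in\hat L(P_n)$ means that $P$ is an IP, $P\subset\mathrm{LI}(P_n)$ (points eventually in $P_n$) and $P$ is maximal among the IPs in $\mathrm{LS}(P_n)$ (points in infinitely many $P_n$); $\check L$ is dual; $(P,F)\in L(P_n,F_n)$ means $P\in\hat L(P_n)$ if $P\ne\emptyset$ and $F\in\check L(F_n)$ if $F\neq\emptyset$. A limit operator $\mathcal L$ defines a topology: $C$ is closed iff $\mathcal L(\sigma)\subset C$ for every sequence $\sigma$ in $C$. Thus $\hat V,\check V,\overline V$ are topological spaces, the boundaries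 are subspaces, and disjoint unions $\cup_d$ and quotients carry the usual topologies; in $(\hat V\cup_d\check V)/\!\sim_S$ and $(\hat\partial V\cup_d\check\partial V)/\!\sim_S$ one takes the equivalence relation generated by $\sim_S$. $\partial V$ is *simple as a point set* if each TIP and each TIF is a component of exactly one pair of $\partial V$; $\overline V$ is *simple* if moreover, for all $(P_n,F_n),(P,F)\in\overline V$, $P\in\hat L(P_n)$ or $F\in\check L(F_n)$ implies $(P,F)\in L(P_n,F_n)$. The natural map to a quotient sends $(P,F)$ to $[P]$ if $P\neq\emptyset$ and to $[F]$ if $F\ne\emptyset$. **Cauchy completions.** A sequence $\sigma$ is *forward* (*backward*) *Cauchy* if for each $\varepsilon>0$, $d^+(\sigma_n,\sigma_m)<\varepsilon$ (resp. $d^-(\sigma_n,\sigma_m)<\varepsilon$) for all large $n\le m$. $M_C^\pm$ is the set of classes of forward (backward) Cauchy sequences, where $\sigma\sim\tau$ if $\lim_n\lim_m d^\pm(\sigma_n,\tau_m)=\lim_n\lim_m d^\pm(\tau_n,\sigma_m)=0$. The points of $M$ are the classes of the convergent sequences, and $\partial_C^\pm M=M_C^\pm\setminus M$. A point of $M_C^+$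 and one of $M_C^-$ are identified if a common sequence represents both; $\partial_C^sM=\partial_C^+M\cap\partial_C^-M$ and $M_C^s=M\cup\partial_C^sM$. For points $x,y$ represented by $\sigma,\tau$ put $d^\pm(x,y)=\lim_n\lim_md^\pm(\sigma_n,\tau_m)\in[0,\infty]$; $d_Q^+$ is this function on $M_C^+$. It is a *generalized distance* if it is finite, $d_Q^+(x,y)=d_Q^+(y,x)=0$ iff $x=y$, it satisfies the triangle inequality, and $d_Q^+(x_n,x)\to0$ iff $d_Q^+(x,x_n)\to0$. $M_C^s$ has the topology of the balls of $\frac12(d_Q^+(x,y)+d_Q^+(y,x))$. For $p=(\Omega,x)$ with $\Omega\in\mathbb R$, $x\in M_C^+\cup M_C^-$, put $d_p^+=\Omega-d^+(\cdot,x)$ and $d_p^-=\Omega+d^-(\cdot,x)$. The boundary of $(M,d^+)$ is *forward evenly pairing* if for all $x^+\in\partial_C^+M\setminus\partial_C^sM$, $d^+(x^+,y)=\infty$ for some (equivalently any) $y\in M$, and *backward evenly pairing* if for all $x^-\in\partial_C^-M\setminus\partial_C^sM$, $d^+(y,x^-)=\infty$ for some (equivalently any) $y\in M$. **Busemann completions.**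 $C^\pm(M)$ is the set of piecewise smooth curves $c:[\alpha,\Omega)\to M$, $\Omega\le\infty$, with $F^\pm(\dot c)<1$. Put $$b_c^+(x)=\lim_{s\to\Omega}(s-d^+(x,c(s))),\qquad b_c^-(x)=\lim_{s\to\Omega}(-s+d^-(x,c(s))).$$ $B^+(M)$ (resp. $B^-(M)$) is the set of the $b_c^+$, $c\in C^+(M)$, that never take the value $\infty$ (resp. of the $b_c^-$, $c\in C^-(M)$, that never take $-\infty$), and $\mathcal B^\pm(M)$ consists of those obtained from a curve with $\Omega=\infty$. $B^+(M)$ has the topology of the limit operator: $f\in\mathcal L(f_n)$ iff $f\le\liminf f_n$ and no $g\in B^+(M)$, $g\ne f$, satisfies $f\le g\le\limsup f_n$; $B^-(M)$ has the dual one ($\limsup f_n\le f$, and no $g\neq f$ satisfies $\liminf f_n\le g\le f$). $M_B^\pm=B^\pm(M)/\mathbb R$ is the quotient space by additive constants; $M\subset M_B^\pm$ through $y\mapsto[\mp d^\pm(\cdot,y)]$, and $\partial_B^\pm M=M_B^\pm\setminus M$. Put $$P(f)=\{(t,x):t<f(x)\},\qquad F(f)=\{(t,x):t>f(x)\}.$$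 The *forward cone* with base $T$ is $(-\infty,\infty]\times T$ with $\{\infty\}\times T$ collapsed to one point, the apex; the *backward cone* is $[-\infty,\infty)\times T$ with $\{-\infty\}\times T$ collapsed; the cone with empty base is its apex. **Lines.** For $(P,F)\in\partial V$ and $k\in\mathbb R$ let $(P_k,F_k)$ be the pair of the translates of $P,F$ by $k$ in the $t$-direction (so $P(f)_k=P(f+k)$, $F(f)_k=F(f+k)$), and $L(P,F)=\{(P_k,F_k):k\in\mathbb R\}$. For pairs, $(P,F)\ll(P',F')$ means $F\cap P'\ne\emptyset$, and $(P,F)\le(P',F')$ means $P\subset P'$, $F'\subset F$ and ($P\neq\emptyset$ or $F'\neq\emptyset$). $L(P,F)$ is *timelike* if $(P_k,F_k)\ll(P_{l},F_{l})$ for all $k<l$; *horismotic* if $(P_k,F_k)\le(P_{l},F_{l})$ and $(P_k,F_k)\not\ll(P_{l},F_{l})$ for all $k<l$; *locally horismotic* if each $k$ has a $\delta>0$ such that, whenever $|l-k|<\delta$, the points with parameters $k$ and $l$ are related by $\le$ in one of the two orders and by $\ll$ in neither. **Theorem 1.2.** In this setting: 1. *Point set.* (1A) For each $x_0\in M$ there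 is a bijection from the forward cone with base $\partial_B^+M$ onto $\hat\partial V$ taking the apex to $i^+=V$ and $(t,[f])$ to $P(f)$ whenever $f\in B^+(M)$, $[f]\in\partial_B^+M$, $f(x_0)=t$; and a bijection from the backward cone with base $\partial_B^-M$ onto $\check\partial V$ taking the apex to $i^-=V$ and $(t,[f])$ to $F(f)$ whenever $f\in B^-(M)$, $[f]\in\partial_B^-M$, $f(x_0)=t$. (1B) If $(P,F)\in\partial V$ and $P\ne\emptyset$, then $P=P(b_c^+)$ for some $c\in C^+(M)$, and for every such $c$: (a) if $b_c^+\equiv\infty$, then $P=V$ and $F=\emptyset$; (b) if $b_c^+\in\mathcal B^+(M)$, then $F=\emptyset$; (c) if $b_c^+\in B^+(M)\setminus\mathcal B^+(M)$, then $b_c^+=d_p^+$ for some $p=(\Omega^+,x^+)\in\mathbb R\times\partial_C^+M$, $P=P(d_p^+)$, $F\subset F(d_p^-)$, and exactly one of the following holds: (c1) $F=\emptyset$; (c2) $F=F(d_{p'}^-)$ for some $p'=(\Omega^-,x^-)\in\mathbb R\times\partial_C^-M$ with $\Omega^--\Omega^+=d^+(x^+,x^-)$. If moreover $x^+\in\partial_C^sM$,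 then $F=F(d_p^-)$, $p'=p$ is the only $p'\in\mathbb R\times\partial^-_CM$ with $F=F(d_{p'}^-)$, $\uparrow P=F(d_p^-)$, and $(P,F')\in\overline V$ only for $F'=F(d_p^-)$. The dual result holds for the pairs with $F\neq\emptyset$. In general $p'$ in (c2) is not unique: there are such a spacetime over $\mathbb R^2$ and pairs $(P,F),(P,F')\in\partial V$ with $P,F,F'$ non-empty and $F\ne F'$. $\partial V$ is the union of the lines $L(P,F)$, $(P,F)\in\partial V$, and any two of these lines are equal or disjoint. If $(M,d^+)$ has a forward or backward evenly pairing boundary, then $\partial V$ is simple as a point set. If $\partial V$ is simple as a point set, the natural map $\partial V\to(\hat\partial V\cup_d\check\partial V)/\!\sim_S$ is a well-defined bijection. 2. *Causality.* Let $(P,F)\in\partial V$. The line $L(P,F)$ is timelike if $P=P(d_p^+)$ and $F=F(d_p^-)$ for some $p\in\mathbb R\times\partial_C^sM$; it is horismotic if $P=\emptyset$ or $F=\emptyset$; it is locally horismotic in all other cases. 3. *Topology.* (3A) If $M_B^+$ (resp. $M_B^-$) is Hausdorff, the bijection of (1A) onto $\hat\partial V$ (resp. $\check\partial V$) is a homeomorphism.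 (3B) If $M_C^s$ is locally compact and $d_Q^+$ is a generalized distance, then $\overline V$ is simple and the natural map $\overline V\to(\hat V\cup_d\check V)/\!\sim_S$ is a well-defined homeomorphism. If, in addition to the hypotheses of (3B), $M_B^+$ and $M_B^-$ are Hausdorff, then the natural map $\partial V\to(\hat\partial V\cup_d\check\partial V)/\!\sim_S$ is a well-defined homeomorphism (and the boundaries are topological cones as in (3A)). -/

import Mathlib

open Set Filter Topology
open scoped Manifold ContDiff ENNReal

noncomputable section

/-! ### Piecewise smooth curves -/

section Curves

variable {E : Type*} [NormedAddCommGroup E] [NormedSpace ℝ E] {H : Type*} [TopologicalSpace H]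
  (I : ModelWithCorners ℝ E H) {N : Type*} [TopologicalSpace N] [ChartedSpace H N]

/-- `γ` is smooth on `[a, b]` and all its velocities on `[a, b]` (one-sided at the end points)
satisfy the condition `A`. -/
def SmoothArc (A : ∀ p : N, TangentSpace I p → Prop) (γ : ℝ → N) (a b : ℝ) : Prop :=
  ContMDiffOn 𝓘(ℝ, ℝ) I ∞ γ (Icc a b) ∧
    ∀ s ∈ Icc a b, A (γ s) (mfderivWithin 𝓘(ℝ, ℝ) I γ (Icc a b) s (1 : ℝ))

/-- `γ` is piecewise smooth on `[a, b]`: for a finite partition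
`a = τ 0 < τ 1 < ⋯ < τ k = b`, `γ` is smooth on each `[τ j, τ (j+1)]`, with all velocities
(both one-sided ones at a break) satisfying `A`. -/
def PiecewiseSmooth (A : ∀ p : N, TangentSpace I p → Prop) (γ : ℝ → N) (a b : ℝ) : Prop :=
  ∃ (k : ℕ) (τ : ℕ → ℝ), τ 0 = a ∧ τ k = b ∧
    ∀ j < k, τ j < τ (j + 1) ∧ SmoothArc I A γ (τ j) (τ (j + 1))

/-- The length `∫ F(γ'(s)) ds` over `[a, b]` of a piecewise smooth curve, for a nonnegative
function `F` on the tangent bundle (the finitely many breaks do not matter). -/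
def finslerLength (F : ∀ p : N, TangentSpace I p → ℝ) (γ : ℝ → N) (a b : ℝ) : ℝ≥0∞ :=
  ∫⁻ s in Icc a b, ENNReal.ofReal (F (γ s) (mfderiv 𝓘(ℝ, ℝ) I γ s (1 : ℝ)))

/-- The distance `d_F(x, y)`: infimum of the lengths of the piecewise smooth curves
from `x` to `y`. -/
def finslerDist (F : ∀ p : N, TangentSpace I p → ℝ) (x y : N) : ℝ≥0∞ :=
  sInf {ℓ | ∃ (γ : ℝ → N) (a b : ℝ), PiecewiseSmooth I (fun _ _ => True) γ a b ∧
    γ a = x ∧ γ b = y ∧ ℓ = finslerLength I F γ a b}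

/-- The piecewise smooth curves `c : [α, Ω) → N`, `Ω ≤ ∞`, with `F(c') < 1`. The partition
`α = τ 0 < τ 1 < ⋯` increases to `Ω`. (Values of `toFun` outside `[α, Ω)` are irrelevant.) -/
structure SlowCurve (F : ∀ p : N, TangentSpace I p → ℝ) where
  toFun : ℝ → N
  α : ℝ
  Ω : EReal
  exists_partition : ∃ τ : ℕ → ℝ, τ 0 = α ∧ StrictMono τ ∧
    Tendsto (fun j => (τ j : EReal)) atTop (𝓝 Ω) ∧
    ∀ j, SmoothArc I (fun p v => F p v < 1) toFun (τ j) (τ (j + 1))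

end Curves

/-- The filter of real numbers `s` tending to `Ω ∈ (-∞, ∞]` from below. -/
def leftOf (Ω : EReal) : Filter ℝ := (𝓝[<] Ω).comap (fun s : ℝ => (s : EReal))

/-! ### Generalized distances and Cauchy completions -/

section Cauchy

variable {X : Type*}

/-- Generalized distances: finite, satisfying (a2), (a3) and (a4) ((a1) holds by the choice of
the codomain). -/
structure IsGeneralizedDist (d : X → X → ℝ≥0∞) : Prop where
  ne_top : ∀ x y, d x y ≠ ⊤
  eq_iff : ∀ x y, (d x y = 0 ∧ d y x = 0) ↔ x = y
  triangle : ∀ x y z, d x z ≤ d x y + d y z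
  lim_iff : ∀ (σ : ℕ → X) (x : X),
    Tendsto (fun n => d (σ n) x) atTop (𝓝 0) ↔ Tendsto (fun n => d x (σ n)) atTop (𝓝 0)

/-- Forward Cauchy sequences. -/
def IsForwardCauchy (d : X → X → ℝ≥0∞) (σ : ℕ → X) : Prop :=
  ∀ ε > 0, ∃ n₀, ∀ n m, n₀ ≤ n → n ≤ m → d (σ n) (σ m) < ε

/-- `lim_n d(y, σ n)`; written as an upper limit, which is the limit for all the sequences of
interest (forward or backward Cauchy ones). -/
def limDist (d : X → X → ℝ≥0∞) (y : X) (σ : ℕ → X) : ℝ≥0∞ :=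
  limsup (fun n => d y (σ n)) atTop

/-- The double limit `lim_n (lim_m d(σ n, τ m))`; written with upper limits, which are limits for
all the sequences of interest (forward Cauchy `σ`, forward or backward Cauchy `τ`). -/
def doubleLim (d : X → X → ℝ≥0∞) (σ τ : ℕ → X) : ℝ≥0∞ :=
  limsup (fun n => limsup (fun m => d (σ n) (τ m)) atTop) atTop

/-- The forward Cauchy completion: classes of forward Cauchy sequences, where `σ ∼ τ` means that
both double limits vanish (this is an equivalence relation). -/
def CauchyCompl (d : X → X → ℝ≥0∞) : Type _ :=
  Quot fun σ τ : {σ : ℕ → X // IsForwardCauchy d σ} =>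
    doubleLim d σ.1 τ.1 = 0 ∧ doubleLim d τ.1 σ.1 = 0

namespace CauchyCompl

variable {d : X → X → ℝ≥0∞}

/-- The class of a forward Cauchy sequence. -/
def mk (σ : ℕ → X) (h : IsForwardCauchy d σ) : CauchyCompl d := Quot.mk _ ⟨σ, h⟩

/-- A sequence representing a point of the completion. -/
def rep (z : CauchyCompl d) : ℕ → X := (Quot.out z).1

/-- The points of `X`, seen in the completion: the classes of the sequences converging in `X`. -/
def IsInterior (z : CauchyCompl d) : Prop :=
  ∃ (σ : ℕ → X) (h : IsForwardCauchy d σ), mk σ h = z ∧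
    ∃ x, Tendsto (fun n => d x (σ n)) atTop (𝓝 0)

/-- The extended quasi-distance `d_Q` on the completion. -/
def quasiDist (z w : CauchyCompl d) : ℝ≥0∞ := doubleLim d z.rep w.rep

end CauchyCompl

end Cauchy

/-! ### Topologies defined by limit operators -/

section LimitOperator

variable {X : Type*}

/-- The topology of a limit operator `L`: a set `C` is closed iff `L σ ⊆ C` for all sequences `σ`
in `C`. -/
@[reducible]
def limitTopology (L : (ℕ → X) → Set X)
    (hL : ∀ (σ : ℕ → X) (φ : ℕ → ℕ), StrictMono φ → L σ ⊆ L (σ ∘ φ)) : TopologicalSpace X :=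
  TopologicalSpace.ofClosed {C | ∀ σ : ℕ → X, (∀ n, σ n ∈ C) → L σ ⊆ C}
    (by
      intro σ hσ
      exact absurd (hσ 0) (by simp))
    (by
      intro A hA σ hσ x hx
      rw [mem_sInter]
      exact fun C hC => hA hC σ (fun n => mem_sInter.1 (hσ n) C hC) hx)
    (by
      intro A hA B hB σ hσ x hx
      by_cases h : ∃ᶠ n in atTop, σ n ∈ A
      · obtain ⟨φ, hφ, hA'⟩ := extraction_of_frequently_atTop h
        exact Or.inl (hA (σ ∘ φ) hA' (hL σ φ hφ hx))
      · have h' : ∃ᶠ n in atTop, σ n ∈ B := by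
          refine (Filter.Eventually.frequently ?_)
          filter_upwards [not_frequently.1 h] with n hn
          exact (hσ n).resolve_left hn
        obtain ⟨φ, hφ, hB'⟩ := extraction_of_frequently_atTop h'
        exact Or.inr (hB (σ ∘ φ) hB' (hL σ φ hφ hx)))

end LimitOperator

/-! ### Past sets, indecomposable sets and the c-completion for a chronological relation

The notions are given for a relation `r` (to be read `p ≪ q`); the future notions are the past
notions for the swapped relation `fun p q => r q p`. -/

namespace Causal

variable {V : Type*} (r : V → V → Prop)

/-- `I⁻[S]`. -/
def past (S : Set V) : Set V := {p | ∃ q ∈ S, r p q}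

/-- The common past `↓ S = I⁻[{p | p ≪ q for all q ∈ S}]`. -/
def commonPast (S : Set V) : Set V := past r {p | ∀ q ∈ S, r p q}

/-- Past sets: non-empty and equal to their past. -/
def IsPastSet (P : Set V) : Prop := P.Nonempty ∧ P = past r P

/-- Indecomposable past sets (IPs). -/
def IsIP (P : Set V) : Prop :=
  IsPastSet r P ∧ ∀ A B : Set V, IsPastSet r A → IsPastSet r B → A ∪ B = P → A = P ∨ B = P

/-- Terminal indecomposable past sets (TIPs): the IPs that are not the past of a point. -/
def IsTIP (P : Set V) : Prop := IsIP r P ∧ ¬ ∃ p, P = past r {p}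

/-- `P` is a maximal IP in the set `S`. -/
def IsMaximalIPIn (P S : Set V) : Prop :=
  IsIP r P ∧ P ⊆ S ∧ ∀ P', IsIP r P' → P ⊆ P' → P' ⊆ S → P' = P

/-- The inferior limit of a sequence of sets. -/
def limInf (σ : ℕ → Set V) : Set V := {p | ∀ᶠ n in atTop, p ∈ σ n}

/-- The superior limit of a sequence of sets. -/
def limSup (σ : ℕ → Set V) : Set V := {p | ∃ᶠ n in atTop, p ∈ σ n}

/-- The limit operator `L̂`: the IPs contained in the inferior limit and maximal in the superior
limit. -/
def hatL (σ : ℕ → Set V) : Set (Set V) := {P | P ⊆ limInf σ ∧ IsMaximalIPIn r P (limSup σ)}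

theorem hatL_subseq (σ : ℕ → Set V) (φ : ℕ → ℕ) (hφ : StrictMono φ) :
    hatL r σ ⊆ hatL r (σ ∘ φ) := by
  rintro P ⟨h1, h2, _, h4⟩
  have hinf : P ⊆ limInf (σ ∘ φ) := fun p hp => hφ.tendsto_atTop.eventually (h1 hp)
  have hsup : limSup (σ ∘ φ) ⊆ limSup σ := fun p hp =>
    hφ.tendsto_atTop.frequently (p := fun n => p ∈ σ n) hp
  exact ⟨hinf, h2, fun p hp => (hinf hp).frequently,
    fun P' hP' hPP' hP's => h4 P' hP' hPP' (hP's.trans hsup)⟩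

/-- The future causal completion `V̂`: all IPs. -/
def Completion : Type _ := {P : Set V // IsIP r P}

/-- The future causal boundary: all TIPs. -/
def boundary : Set (Completion r) := {P | IsTIP r P.1}

/-- The chronological topology on the set of IPs. -/
instance : TopologicalSpace (Completion r) :=
  limitTopology (fun σ => {P | P.1 ∈ hatL r fun n => (σ n).1})
    (fun σ φ hφ _ hP => hatL_subseq r (fun n => (σ n).1) φ hφ hP)

/-- Being S-related, for an IP `P` and an IF `F`. -/
def SRelated (P F : Set V) : Prop :=
  IsMaximalIPIn (fun p q => r q p) F (commonPast (fun p q => r q p) P) ∧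
    IsMaximalIPIn r P (commonPast r F)

/-- The c-completion as a set of pairs: S-related pairs `(P, F)`, and `(P, ∅)` or `(∅, F)` for the
indecomposable sets which are S-related to no indecomposable set. -/
def cCompletion : Set (Set V × Set V) :=
  {p | SRelated r p.1 p.2 ∨
    (IsIP r p.1 ∧ p.2 = ∅ ∧ ∀ F, ¬ SRelated r p.1 F) ∨
    (p.1 = ∅ ∧ IsIP (fun p q => r q p) p.2 ∧ ∀ P, ¬ SRelated r P p.2)}

/-- The c-boundary: the pairs not of the form `(I⁻(p), I⁺(p))`. -/
def cBoundary : Set (Set V × Set V) :=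
  {p | p ∈ cCompletion r ∧ ¬ ∃ v, p = (past r {v}, past (fun p q => r q p) {v})}

/-- The limit operator `L` for sequences of pairs. -/
def totalL (σ : ℕ → Set V × Set V) : Set (Set V × Set V) :=
  {p | (p.1 ≠ ∅ → p.1 ∈ hatL r fun n => (σ n).1) ∧
    (p.2 ≠ ∅ → p.2 ∈ hatL (fun p q => r q p) fun n => (σ n).2)}

/-- The c-completion as a space. -/
def CCompletion : Type _ := {p : Set V × Set V // p ∈ cCompletion r}

/-- The chronological topology on the c-completion. -/
instance : TopologicalSpace (CCompletion r) :=
  limitTopology (fun σ => {p | p.1 ∈ totalL r fun n => (σ n).1})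
    (fun σ φ hφ _ hp => ⟨fun h => hatL_subseq r (fun n => (σ n).1.1) φ hφ (hp.1 h),
      fun h => hatL_subseq _ (fun n => (σ n).1.2) φ hφ (hp.2 h)⟩)

/-- The c-boundary as a part of the space `CCompletion r`. -/
def cBoundarySet : Set (CCompletion r) := {p | p.1 ∈ cBoundary r}

/-- Simple as a point set: each TIP and each TIF determines a unique pair of the c-boundary. -/
def IsPointSimple : Prop :=
  (∀ P, IsTIP r P → ∃! F, (P, F) ∈ cBoundary r) ∧
    ∀ F, IsTIP (fun p q => r q p) F → ∃! P, (P, F) ∈ cBoundary r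

/-- Simple: simple as a point set, and `(P, F) ∈ L(P_n, F_n)` as soon as `P ∈ L̂(P_n)` or
`F ∈ Ľ(F_n)`. -/
def IsSimple : Prop :=
  IsPointSimple r ∧ ∀ (σ : ℕ → CCompletion r) (p : CCompletion r),
    ((p.1.1 ∈ hatL r fun n => (σ n).1.1) ∨
      p.1.2 ∈ hatL (fun p q => r q p) fun n => (σ n).1.2) →
    p.1 ∈ totalL r fun n => (σ n).1

/-- The quotient `(V̂ ∪_d V̌)/∼_S` of the disjoint union of the partial completions, with its
quotient topology. -/
def GluedCompletion : Type _ :=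
  Quot fun a b : Completion r ⊕ Completion (fun p q => r q p) =>
    ∃ P F, a = Sum.inl P ∧ b = Sum.inr F ∧ SRelated r P.1 F.1

instance : TopologicalSpace (GluedCompletion r) :=
  inferInstanceAs (TopologicalSpace (Quot _))

/-- The quotient `(∂̂V ∪_d ∂̌V)/∼_S` of the disjoint union of the partial boundaries, with its
quotient topology. -/
def GluedBoundary : Type _ :=
  Quot fun a b : boundary r ⊕ boundary (fun p q => r q p) =>
    ∃ P F, a = Sum.inl P ∧ b = Sum.inr F ∧ SRelated r P.1.1 F.1.1

instance : TopologicalSpace (GluedBoundary r) :=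
  inferInstanceAs (TopologicalSpace (Quot _))

/-- `e` is the natural map `(P, F) ↦ [P]` if `P ≠ ∅`, `(P, F) ↦ [F]` if `F ≠ ∅`. -/
def IsNaturalOnCompletion (e : CCompletion r → GluedCompletion r) : Prop :=
  ∀ p, (∀ P : Completion r, p.1.1 = P.1 → e p = Quot.mk _ (Sum.inl P)) ∧
    ∀ F : Completion (fun p q => r q p), p.1.2 = F.1 → e p = Quot.mk _ (Sum.inr F)

/-- `e` is the natural map `(P, F) ↦ [P]` if `P ≠ ∅`, `(P, F) ↦ [F]` if `F ≠ ∅`, on the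
c-boundary. -/
def IsNaturalOnBoundary (e : cBoundarySet r → GluedBoundary r) : Prop :=
  ∀ p, (∀ P : boundary r, p.1.1.1 = P.1.1 → e p = Quot.mk _ (Sum.inl P)) ∧
    ∀ F : boundary (fun p q => r q p), p.1.1.2 = F.1.1 → e p = Quot.mk _ (Sum.inr F)

/-- The chronological relation between pairs. -/
def PairChron (p q : Set V × Set V) : Prop := (p.2 ∩ q.1).Nonempty

/-- The causal relation between pairs. -/
def PairCausal (p q : Set V × Set V) : Prop :=
  (p.1.Nonempty ∨ q.2.Nonempty) ∧ p.1 ⊆ q.1 ∧ q.2 ⊆ p.2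

end Causal

/-! ### Cones -/

/-- The forward cone with base `T`: the quotient of `(-∞, ∞] × T` in which all the points
`(∞, x)` are identified to one point, the apex. The apex is added as a separate point before the
identification; for non-empty `T` this changes nothing, and for empty `T` the cone is its apex. -/
def ForwardCone (T : Type*) : Type _ :=
  Quot fun a b : (Ioi (⊥ : EReal) × T) ⊕ Unit =>
    ∃ x : Ioi (⊥ : EReal) × T, x.1.1 = ⊤ ∧ a = Sum.inl x ∧ b = Sum.inr ()

/-- The backward cone with base `T`: as the forward one, with `[-∞, ∞)` and `-∞`. -/
def BackwardCone (T : Type*) : Type _ :=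
  Quot fun a b : (Iio (⊤ : EReal) × T) ⊕ Unit =>
    ∃ x : Iio (⊤ : EReal) × T, x.1.1 = ⊥ ∧ a = Sum.inl x ∧ b = Sum.inr ()

instance (T : Type*) [TopologicalSpace T] : TopologicalSpace (ForwardCone T) :=
  inferInstanceAs (TopologicalSpace (Quot _))

instance (T : Type*) [TopologicalSpace T] : TopologicalSpace (BackwardCone T) :=
  inferInstanceAs (TopologicalSpace (Quot _))

/-- The point `(t, x)` of the forward cone. -/
def ForwardCone.mk {T : Type*} (t : Ioi (⊥ : EReal)) (x : T) : ForwardCone T :=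
  Quot.mk _ (Sum.inl (t, x))

/-- The apex of the forward cone. -/
def ForwardCone.apex {T : Type*} : ForwardCone T := Quot.mk _ (Sum.inr ())

/-- The point `(t, x)` of the backward cone. -/
def BackwardCone.mk {T : Type*} (t : Iio (⊤ : EReal)) (x : T) : BackwardCone T :=
  Quot.mk _ (Sum.inl (t, x))

/-- The apex of the backward cone. -/
def BackwardCone.apex {T : Type*} : BackwardCone T := Quot.mk _ (Sum.inr ())

/-! ### Function spaces: chronological limits and classes modulo constants -/

section Functions

variable {M : Type*}

/-- The forward limit operator on a set `B` of functions. -/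
def upperL (B : Set (M → EReal)) (σ : ℕ → B) : Set B :=
  {f | (∀ x, f.1 x ≤ liminf (fun n => (σ n).1 x) atTop) ∧
    ∀ g : B, (∀ x, f.1 x ≤ g.1 x) → (∀ x, g.1 x ≤ limsup (fun n => (σ n).1 x) atTop) → g = f}

/-- The backward limit operator on a set `B` of functions. -/
def lowerL (B : Set (M → EReal)) (σ : ℕ → B) : Set B :=
  {f | (∀ x, limsup (fun n => (σ n).1 x) atTop ≤ f.1 x) ∧
    ∀ g : B, (∀ x, g.1 x ≤ f.1 x) → (∀ x, liminf (fun n => (σ n).1 x) atTop ≤ g.1 x) → g = f}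

theorem limsup_subseq_le (u : ℕ → EReal) {φ : ℕ → ℕ} (hφ : StrictMono φ) :
    limsup (fun n => u (φ n)) atTop ≤ limsup u atTop := by
  have h : limsup (u ∘ φ) atTop = limsup u (map φ atTop) := rfl
  exact h.le.trans (limsup_le_limsup_of_le hφ.tendsto_atTop)

theorem le_liminf_subseq (u : ℕ → EReal) {φ : ℕ → ℕ} (hφ : StrictMono φ) :
    liminf u atTop ≤ liminf (fun n => u (φ n)) atTop := by
  have h : liminf (u ∘ φ) atTop = liminf u (map φ atTop) := rfl
  exact (liminf_le_liminf_of_le hφ.tendsto_atTop).trans h.ge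

theorem upperL_subseq (B : Set (M → EReal)) (σ : ℕ → B) (φ : ℕ → ℕ) (hφ : StrictMono φ) :
    upperL B σ ⊆ upperL B (σ ∘ φ) := fun _ hf =>
  ⟨fun x => (hf.1 x).trans (le_liminf_subseq (fun n => (σ n).1 x) hφ),
    fun g h1 h2 => hf.2 g h1 fun x => (h2 x).trans (limsup_subseq_le (fun n => (σ n).1 x) hφ)⟩

theorem lowerL_subseq (B : Set (M → EReal)) (σ : ℕ → B) (φ : ℕ → ℕ) (hφ : StrictMono φ) :
    lowerL B σ ⊆ lowerL B (σ ∘ φ) := fun _ hf =>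
  ⟨fun x => (limsup_subseq_le (fun n => (σ n).1 x) hφ).trans (hf.1 x),
    fun g h1 h2 => hf.2 g h1 fun x => (le_liminf_subseq (fun n => (σ n).1 x) hφ).trans (h2 x)⟩

/-- Equality up to a real additive constant. -/
def modConst (B : Set (M → EReal)) : Setoid B where
  r f g := ∃ k : ℝ, ∀ x, g.1 x = f.1 x + k
  iseqv :=
    { refl := fun f => ⟨0, fun x => by simp⟩
      symm := by
        rintro f g ⟨k, h⟩
        refine ⟨-k, fun x => ?_⟩
        rw [h x, add_assoc, ← EReal.coe_add]
        simp
      trans := by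
        rintro f g h ⟨k, hk⟩ ⟨l, hl⟩
        exact ⟨k + l, fun x => by rw [hl x, hk x, add_assoc, ← EReal.coe_add]⟩ }

/-- The past `P(f) = {(t, x) | t < f(x)}`. -/
def pastOf (f : M → EReal) : Set (ℝ × M) := {p | (p.1 : EReal) < f p.2}

/-- The future `F(f) = {(t, x) | t > f(x)}`. -/
def futureOf (f : M → EReal) : Set (ℝ × M) := {p | f p.2 < (p.1 : EReal)}

/-- The translate of a subset of `ℝ × M` by `k` in the time direction. -/
def timeShift (k : ℝ) (A : Set (ℝ × M)) : Set (ℝ × M) := {p | (p.1 - k, p.2) ∈ A}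

/-- Time translation by `k` is the operation `P(f) ↦ P(f + k)`. -/
theorem timeShift_pastOf (k : ℝ) (f : M → EReal) :
    timeShift k (pastOf f) = pastOf fun x => f x + k := by
  ext p
  simp only [timeShift, pastOf, mem_ofPred_eq, EReal.coe_sub]
  exact EReal.sub_lt_iff (Or.inl (EReal.coe_ne_bot k)) (Or.inl (EReal.coe_ne_top k))

/-- Time translation by `k` is the operation `F(f) ↦ F(f + k)`. -/
theorem timeShift_futureOf (k : ℝ) (f : M → EReal) :
    timeShift k (futureOf f) = futureOf fun x => f x + k := by
  ext p
  simp only [timeShift, futureOf, mem_ofPred_eq, EReal.coe_sub]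
  exact EReal.lt_sub_iff_add_lt (Or.inl (EReal.coe_ne_bot k)) (Or.inl (EReal.coe_ne_top k))

/-- The point with parameter `k` of the line over the pair `p = (P, F)`: if `P = P(b)` and
`F = F(b')` it is `(P(b + k), F(b' + k))`, and an empty component stays empty. -/
def linePoint (p : Set (ℝ × M) × Set (ℝ × M)) (k : ℝ) : Set (ℝ × M) × Set (ℝ × M) :=
  (timeShift k p.1, timeShift k p.2)

/-- The line `L(P, F)`. -/
def line (p : Set (ℝ × M) × Set (ℝ × M)) : Set (Set (ℝ × M) × Set (ℝ × M)) :=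
  {q | ∃ k : ℝ, q = linePoint p k}

/-- Timelike lines. -/
def IsTimelikeLine (p : Set (ℝ × M) × Set (ℝ × M)) : Prop :=
  ∀ k₁ k₂ : ℝ, k₁ < k₂ → Causal.PairChron (linePoint p k₁) (linePoint p k₂)

/-- Horismotic lines. -/
def IsHorismoticLine (p : Set (ℝ × M) × Set (ℝ × M)) : Prop :=
  ∀ k₁ k₂ : ℝ, k₁ < k₂ → Causal.PairCausal (linePoint p k₁) (linePoint p k₂) ∧
    ¬ Causal.PairChron (linePoint p k₁) (linePoint p k₂)

/-- Locally horismotic lines: close points of the line are causally related (in one of the two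
orders) and not chronologically related (in any order). -/
def IsLocallyHorismoticLine (p : Set (ℝ × M) × Set (ℝ × M)) : Prop :=
  ∀ k₁ : ℝ, ∃ δ > 0, ∀ k₂ : ℝ, |k₂ - k₁| < δ →
    (Causal.PairCausal (linePoint p k₁) (linePoint p k₂) ∨
      Causal.PairCausal (linePoint p k₂) (linePoint p k₁)) ∧
    ¬ Causal.PairChron (linePoint p k₁) (linePoint p k₂) ∧
    ¬ Causal.PairChron (linePoint p k₂) (linePoint p k₁)

end Functions

/-! ### Standard conformally stationary spacetimes -/

/-- The data of a standard conformally stationary spacetime `V = ℝ × M`,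
`g = Λ (-dt² + π^*ω ⊗ dt + dt ⊗ π^*ω + π^*g₀)`: a smooth Riemannian metric `g₀` and a smooth
`1`-form `ω` (the field `oneForm`) on `M`, and a smooth positive function `Λ` on `V`. -/
structure StandardStationary (n : ℕ) (M : Type*) [TopologicalSpace M]
    [ChartedSpace (EuclideanSpace ℝ (Fin n)) M] [IsManifold (𝓡 n) ∞ M] where
  g₀ : Bundle.ContMDiffRiemannianMetric (𝓡 n) ∞ (EuclideanSpace ℝ (Fin n))
    (fun x : M => TangentSpace (𝓡 n) x)
  oneForm : ∀ x : M, TangentSpace (𝓡 n) x →L[ℝ] ℝ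
  smooth_oneForm : ContMDiff (𝓡 n) ((𝓡 n).prod 𝓘(ℝ, EuclideanSpace ℝ (Fin n) →L[ℝ] ℝ)) ∞
    (fun x => Bundle.TotalSpace.mk' (EuclideanSpace ℝ (Fin n) →L[ℝ] ℝ)
      (E := fun x : M => TangentSpace (𝓡 n) x →L[ℝ] ℝ) x (oneForm x))
  Λ : ℝ × M → ℝ
  smooth_Λ : ContMDiff (𝓘(ℝ, ℝ).prod (𝓡 n)) 𝓘(ℝ, ℝ) ∞ Λ
  Λ_pos : ∀ p, 0 < Λ p

namespace StandardStationary

variable {n : ℕ} {M : Type*} [TopologicalSpace M] [ChartedSpace (EuclideanSpace ℝ (Fin n)) M]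
  [IsManifold (𝓡 n) ∞ M] (S : StandardStationary n M)

/-- The differential `dt` of the projection `t : ℝ × M → ℝ`. -/
def dt (p : ℝ × M) (u : TangentSpace (𝓘(ℝ, ℝ).prod (𝓡 n)) p) : ℝ :=
  mfderiv (𝓘(ℝ, ℝ).prod (𝓡 n)) 𝓘(ℝ, ℝ) Prod.fst p u

/-- The differential of the projection `π : ℝ × M → M`. -/
def dπ (p : ℝ × M) (u : TangentSpace (𝓘(ℝ, ℝ).prod (𝓡 n)) p) : TangentSpace (𝓡 n) p.2 :=
  mfderiv (𝓘(ℝ, ℝ).prod (𝓡 n)) (𝓡 n) Prod.snd p u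

/-- The Lorentzian metric `g`. -/
def metric (p : ℝ × M) (u v : TangentSpace (𝓘(ℝ, ℝ).prod (𝓡 n)) p) : ℝ :=
  S.Λ p * (-(dt p u * dt p v) + S.oneForm p.2 (dπ p u) * dt p v + dt p u * S.oneForm p.2 (dπ p v) +
    S.g₀.inner p.2 (dπ p u) (dπ p v))

/-- The vector field `K = ∂_t`: the velocity of `s ↦ (s, x)`. -/
def stationaryField (p : ℝ × M) : TangentSpace (𝓘(ℝ, ℝ).prod (𝓡 n)) p :=
  mfderiv 𝓘(ℝ, ℝ) (𝓘(ℝ, ℝ).prod (𝓡 n)) (fun s : ℝ => (s, p.2)) p.1 (1 : ℝ)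

/-- Future-directed timelike vectors; the time orientation is the one for which `∂_t` is
future-directed. -/
def IsFutureTimelike (p : ℝ × M) (u : TangentSpace (𝓘(ℝ, ℝ).prod (𝓡 n)) p) : Prop :=
  S.metric p u u < 0 ∧ S.metric p u (stationaryField p) < 0

/-- The chronological relation `p ≪ q`: there is a (piecewise smooth) future-directed timelike
curve from `p` to `q`. -/
def chron (p q : ℝ × M) : Prop :=
  ∃ (γ : ℝ → ℝ × M) (a b : ℝ), a < b ∧
    PiecewiseSmooth (𝓘(ℝ, ℝ).prod (𝓡 n)) S.IsFutureTimelike γ a b ∧ γ a = p ∧ γ b = q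

/-- The Fermat metric `F⁺`. -/
def fermatPlus (x : M) (v : TangentSpace (𝓡 n) x) : ℝ :=
  √(S.g₀.inner x v v + S.oneForm x v ^ 2) + S.oneForm x v

/-- The Fermat metric `F⁻`. -/
def fermatMinus (x : M) (v : TangentSpace (𝓡 n) x) : ℝ :=
  √(S.g₀.inner x v v + S.oneForm x v ^ 2) - S.oneForm x v

/-- The generalized distance `d⁺` of `F⁺`. -/
def distPlus (x y : M) : ℝ≥0∞ := finslerDist (𝓡 n) S.fermatPlus x y

/-- The generalized distance `d⁻` of `F⁻` (so `d⁻(x, y) = d⁺(y, x)`). -/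
def distMinus (x y : M) : ℝ≥0∞ := finslerDist (𝓡 n) S.fermatMinus x y

/-! #### Cauchy completions and boundaries -/

/-- The forward Cauchy completion `M_C⁺`. -/
abbrev CauchyPlus := CauchyCompl S.distPlus

/-- The backward Cauchy completion `M_C⁻`. -/
abbrev CauchyMinus := CauchyCompl S.distMinus

/-- The forward Cauchy boundary `∂_C⁺M`. -/
def cauchyBdryPlus : Set S.CauchyPlus := {z | ¬ z.IsInterior}

/-- The backward Cauchy boundary `∂_C⁻M`. -/
def cauchyBdryMinus : Set S.CauchyMinus := {z | ¬ z.IsInterior}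

/-- A point of `M_C⁺` and a point of `M_C⁻` are identified if they are represented by the same
sequence. -/
def SamePoint (z : S.CauchyPlus) (w : S.CauchyMinus) : Prop :=
  ∃ (σ : ℕ → M) (h : IsForwardCauchy S.distPlus σ) (h' : IsForwardCauchy S.distMinus σ),
    CauchyCompl.mk σ h = z ∧ CauchyCompl.mk σ h' = w

/-- The symmetrized Cauchy boundary `∂_C^s M = ∂_C⁺M ∩ ∂_C⁻M`, as a subset of `∂_C⁺M`. -/
def cauchyBdrySymm : Set S.CauchyPlus :=
  {z | z ∈ S.cauchyBdryPlus ∧ ∃ w ∈ S.cauchyBdryMinus, S.SamePoint z w}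

/-- The symmetrized Cauchy boundary `∂_C^s M = ∂_C⁺M ∩ ∂_C⁻M`, as a subset of `∂_C⁻M`. -/
def cauchyBdrySymm' : Set S.CauchyMinus :=
  {w | w ∈ S.cauchyBdryMinus ∧ ∃ z ∈ S.cauchyBdryPlus, S.SamePoint z w}

/-- `M_C^s = M ∪ ∂_C^s M`. -/
def CauchySymm : Type _ := {z : S.CauchyPlus // z.IsInterior ∨ z ∈ S.cauchyBdrySymm}

/-- The topology of `M_C^s`, generated by the balls of the extended symmetrized distance
`(d_Q(z, w) + d_Q(w, z)) / 2`. -/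
instance : TopologicalSpace S.CauchySymm :=
  TopologicalSpace.generateFrom {B | ∃ (z : S.CauchySymm) (ε : ℝ≥0∞),
    B = {w | (CauchyCompl.quasiDist z.1 w.1 + CauchyCompl.quasiDist w.1 z.1) / 2 < ε}}

/-- `(M, d⁺)` has a forward evenly pairing boundary: `d⁺(x⁺, y) = ∞` for all
`x⁺ ∈ ∂_C⁺M ∖ ∂_C^s M` and for some (equivalently, any) `y ∈ M`. -/
def ForwardEvenlyPairing : Prop :=
  ∀ z ∈ S.cauchyBdryPlus \ S.cauchyBdrySymm, ∃ y : M,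
    limsup (fun n => S.distPlus (z.rep n) y) atTop = ⊤

/-- `(M, d⁺)` has a backward evenly pairing boundary: `d⁺(y, x⁻) = ∞` for all
`x⁻ ∈ ∂_C⁻M ∖ ∂_C^s M` and for some (equivalently, any) `y ∈ M`. -/
def BackwardEvenlyPairing : Prop :=
  ∀ w ∈ S.cauchyBdryMinus \ S.cauchyBdrySymm', ∃ y : M,
    limsup (fun n => S.distPlus y (w.rep n)) atTop = ⊤

/-- The function `d_p⁺ = Ω - d⁺(·, x̄)` for `p = (Ω, x̄)`, where the point `x̄` of `M_C⁺` or `M_C⁻`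
is represented by the sequence `σ`. -/
def dPlusOf (Ω : ℝ) (σ : ℕ → M) (x : M) : EReal :=
  (Ω : EReal) - (limDist S.distPlus x σ : EReal)

/-- The function `d_p⁻ = Ω + d⁻(·, x̄)` for `p = (Ω, x̄)`, where the point `x̄` of `M_C⁺` or `M_C⁻`
is represented by the sequence `σ`. -/
def dMinusOf (Ω : ℝ) (σ : ℕ → M) (x : M) : EReal :=
  (Ω : EReal) + (limDist S.distMinus x σ : EReal)

/-! #### Busemann functions and Busemann completions -/

/-- The forward Busemann function `b_c⁺(x) = lim_{s → Ω} (s - d⁺(x, c(s)))` of `c ∈ C⁺(M)`; the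
limit exists because of monotonicity. -/
def busemannPlus (c : SlowCurve (𝓡 n) S.fermatPlus) (x : M) : EReal :=
  limsup (fun s : ℝ => (s : EReal) - (S.distPlus x (c.toFun s) : EReal)) (leftOf c.Ω)

/-- The backward Busemann function `b_c⁻(x) = lim_{s → Ω} (-s + d⁻(x, c(s)))` of `c ∈ C⁻(M)`; the
limit exists because of monotonicity. -/
def busemannMinus (c : SlowCurve (𝓡 n) S.fermatMinus) (x : M) : EReal :=
  liminf (fun s : ℝ => -(s : EReal) + (S.distMinus x (c.toFun s) : EReal)) (leftOf c.Ω)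

/-- `B⁺(M)`: the finite forward Busemann functions. -/
def BPlus : Set (M → EReal) := {f | (∃ c, f = S.busemannPlus c) ∧ ∀ x, f x ≠ ⊤}

/-- `B⁻(M)`: the finite backward Busemann functions. -/
def BMinus : Set (M → EReal) := {f | (∃ c, f = S.busemannMinus c) ∧ ∀ x, f x ≠ ⊥}

/-- The finite properly Busemann functions (forward): those of curves with `Ω = ∞`. -/
def properBPlus : Set (M → EReal) :=
  {f | (∃ c, c.Ω = ⊤ ∧ f = S.busemannPlus c) ∧ ∀ x, f x ≠ ⊤}

/-- The finite properly Busemann functions (backward). -/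
def properBMinus : Set (M → EReal) :=
  {f | (∃ c, c.Ω = ⊤ ∧ f = S.busemannMinus c) ∧ ∀ x, f x ≠ ⊥}

instance : TopologicalSpace S.BPlus := limitTopology (upperL S.BPlus) (upperL_subseq S.BPlus)

instance : TopologicalSpace S.BMinus := limitTopology (lowerL S.BMinus) (lowerL_subseq S.BMinus)

/-- The forward Busemann completion `M_B⁺ = B⁺(M)/ℝ`. -/
def BusemannPlus : Type _ := Quotient (modConst S.BPlus)

/-- The backward Busemann completion `M_B⁻ = B⁻(M)/ℝ`. -/
def BusemannMinus : Type _ := Quotient (modConst S.BMinus)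

/-- The class in `M_B⁺` of a function of `B⁺(M)`. -/
def classPlus (f : S.BPlus) : S.BusemannPlus := Quotient.mk (modConst S.BPlus) f

/-- The class in `M_B⁻` of a function of `B⁻(M)`. -/
def classMinus (f : S.BMinus) : S.BusemannMinus := Quotient.mk (modConst S.BMinus) f

/-- The quotient of the chronological topology. -/
instance : TopologicalSpace S.BusemannPlus :=
  inferInstanceAs (TopologicalSpace (Quotient (modConst S.BPlus)))

/-- The quotient of the chronological topology. -/
instance : TopologicalSpace S.BusemannMinus :=
  inferInstanceAs (TopologicalSpace (Quotient (modConst S.BMinus)))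

/-- The Busemann boundary `∂_B⁺M = M_B⁺ ∖ M`, where `y ∈ M` is the class of `-d⁺(·, y)`. -/
def busemannBdryPlus : Set S.BusemannPlus :=
  {z | ¬ ∃ (f : S.BPlus) (y : M), S.classPlus f = z ∧ ∀ x, f.1 x = -(S.distPlus x y : EReal)}

/-- The Busemann boundary `∂_B⁻M = M_B⁻ ∖ M`, where `y ∈ M` is the class of `d⁻(·, y)`. -/
def busemannBdryMinus : Set S.BusemannMinus :=
  {z | ¬ ∃ (f : S.BMinus) (y : M), S.classMinus f = z ∧ ∀ x, f.1 x = (S.distMinus x y : EReal)}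

/-! #### The causal boundaries -/

/-- The future causal boundary `∂̂V`. -/
abbrev futureBdry := Causal.boundary S.chron

/-- The past causal boundary `∂̌V`. -/
abbrev pastBdry := Causal.boundary (fun p q => S.chron q p)

end StandardStationary

end

/-! Everything is reduced to the generalized distance `d⁺`. A vector is future-directed timelike
exactly if `dt > F⁺(dπ)`. Integration along curves turns this into: `(t, x) ≪ (s, y)` if and only if
`d⁺(x, y) < s - t` (`StandardStationary.chron_iff`). Curves of speed less than `1` are
interchangeable with chronological sequences, so their Busemann functions are the suprema of `t_n -
d⁺(·, x_n)`. From there on, apart from the counterexample, the manifold enters only through the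
axioms of `LengthDist`. These axioms are invariant under reversal of the distance, and the time
reflection `(t, x) ↦ (-t, x)` exchanges a distance with its reversal. Statements about futures are
thus statements about pasts for the reversed distance.

Point set and causality. An IP is a directed past set (`IsChronological.isIP_iff`). With a countable
dense set it is exhausted by a chronological sequence, so the IPs are exactly the sets `P(f)` of
Busemann functions (`LengthDist.isIP_iff`). If the times of the sequence are bounded, it is forward
Cauchy over `M` and `f = Ω - d⁺(·, x⁺)` (`LengthDist.chain_bounded`). A non-empty partner `F` bounds
the times, which leaves only this case for pairs with two components. The past at `(Ω, x⁺)` precedes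
the future at `(Ω', x⁻)` if and only if `d⁺(x⁺, x⁻) ≤ Ω' - Ω` (`LengthDist.precedes_iff`), and
maximality forces equality. Over a symmetric point, one that is both forward and backward Cauchy,
the common future is itself an IF, hence the only partner. For a pair over a non-symmetric point,
`Ω' - Ω + d⁺(x, x⁺) + d⁺(x⁻, x)` stays above some `ε > 0`. This gap prevents nearby points of the
line from being chronologically related (`LengthDist.isLocallyHorismoticLine`).

Cones. If the Busemann completion is Hausdorff, limits are unique up to constants, and this makes
chronological limits pointwise limits (`LengthDist.tendsto_of_isUpperLim`). The spaces of functions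
then embed into sequences of extended reals by evaluation on a dense sequence. The normalized
functions of the boundary are sequentially compact, because pasts of points are approached only by
pasts of points (`LengthDist.exists_limit_normalized`). Hence the bijection with the quotient
topology of the cone is a homeomorphism (`LengthDist.exists_cone_equiv`).

Simplicity. If `d_Q⁺` is a generalized distance, every forward Cauchy sequence is backward Cauchy.
With local compactness, each such point has the compactness expressed by `IsNicePoint`: Busemann
functions converging to that of a nice point come eventually from symmetric points close to it
(`LengthDist.eventually_eq_sub_inDist`). Their unique partners are then close too. The total
topology is therefore determined by either component, and the natural maps are homeomorphisms.

Non-uniqueness. On the plane with Fermat metric `(1 + e⁻ˣ) √(dx² + dy²) - cos y dx`, the right end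
of the lane `y = 0` is reached at finite cost, and from the right ends of the lanes `y = ±π` one
returns at finite cost. The crossing from the middle lane to each outer lane costs `2` in the limit,
so the same past precedes two futures at time `2`. Explicit calibrations show that no IF following
this past contains both. -/

noncomputable section

set_option linter.unusedSectionVars false

/-! ### Arcs of speed less than one and the Finsler distance. -/

section
variable {E : Type*} [NormedAddCommGroup E] [NormedSpace ℝ E] {H : Type*} [TopologicalSpace H]
  {I : ModelWithCorners ℝ E H} {N : Type*} [TopologicalSpace N] [ChartedSpace H N]

/-- Continuous positively homogeneous functions on the tangent bundle, positive outside the zero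
section. -/
structure IsFinsler (F : ∀ p : N, TangentSpace I p → ℝ) [IsManifold I 1 N] : Prop where
  continuous : Continuous fun v : TangentBundle I N => F v.1 v.2
  pos : ∀ p (v : TangentSpace I p), v ≠ 0 → 0 < F p v
  smul : ∀ p (c : ℝ) (v : TangentSpace I p), 0 ≤ c → F p (c • v) = c * F p v

variable {F : ∀ p : N, TangentSpace I p → ℝ} {A : ∀ p : N, TangentSpace I p → Prop}
  {γ : ℝ → N} {a b : ℝ}

theorem IsFinsler.zero [IsManifold I 1 N] (hF : IsFinsler F) (p : N) : F p 0 = 0 := by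
  have := hF.smul p 0 0 le_rfl
  simpa using this

theorem IsFinsler.nonneg [IsManifold I 1 N] (hF : IsFinsler F) (p : N) (v : TangentSpace I p) :
    0 ≤ F p v := by
  by_cases h : v = 0
  · rw [h, hF.zero]
  · exact (hF.pos p v h).le

/-- The velocity of an arc on `[a, b]`, one-sided at the end points. -/
def arcVel (I : ModelWithCorners ℝ E H) (γ : ℝ → N) (a b s : ℝ) : TangentSpace I (γ s) :=
  mfderivWithin 𝓘(ℝ, ℝ) I γ (Icc a b) s (1 : ℝ)

theorem SmoothArc.continuousOn_lift [IsManifold I 1 N] (h : SmoothArc I A γ a b) (hab : a < b) :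
    ContinuousOn (fun s => (⟨γ s, arcVel I γ a b s⟩ : TangentBundle I N)) (Icc a b) := by
  have h1 := h.1.continuousOn_tangentMapWithin (by simp)
    ((uniqueDiffOn_Icc hab).uniqueMDiffOn)
  have h2 : Continuous (fun s : ℝ => (⟨s, (1 : ℝ)⟩ : TangentBundle 𝓘(ℝ, ℝ) ℝ)) := by
    have := (tangentBundleModelSpaceHomeomorph 𝓘(ℝ, ℝ)).symm.continuous.comp
      (show Continuous (fun s : ℝ => (s, (1 : ℝ))) by fun_prop)
    exact this
  exact h1.comp (t := _) h2.continuousOn (fun s hs => hs)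

theorem SmoothArc.continuousOn_speed [IsManifold I 1 N] (hF : IsFinsler F)
    (h : SmoothArc I A γ a b) (hab : a < b) :
    ContinuousOn (fun s => F (γ s) (arcVel I γ a b s)) (Icc a b) :=
  hF.continuous.comp_continuousOn (h.continuousOn_lift hab)

/-- There is no sign condition on `k`: positive values rescale the time of an arc, and `k = -1`
reverses it. -/
theorem SmoothArc.comp_affine (h : SmoothArc I A γ a b) {c d k m : ℝ} (hcd : c < d)
    (hmap : ∀ s ∈ Icc c d, k * s + m ∈ Icc a b) :
    ContMDiffOn 𝓘(ℝ, ℝ) I ∞ (fun s => γ (k * s + m)) (Icc c d) ∧ ∀ s ∈ Icc c d,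
      arcVel I (fun s => γ (k * s + m)) c d s = k • arcVel I γ a b (k * s + m) := by
  have hsm : ContMDiff 𝓘(ℝ, ℝ) 𝓘(ℝ, ℝ) ∞ (fun s : ℝ => k * s + m) := by
    apply ContDiff.contMDiff; fun_prop
  refine ⟨h.1.comp hsm.contMDiffOn hmap, fun s hs => ?_⟩
  have hu : UniqueMDiffWithinAt 𝓘(ℝ, ℝ) (Icc c d) s :=
    ((uniqueDiffOn_Icc hcd) s hs).uniqueMDiffWithinAt
  have hd0 : HasFDerivWithinAt (fun s : ℝ => k * s + m) (k • ContinuousLinearMap.id ℝ ℝ)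
      (Icc c d) s := by
    simpa using ((hasFDerivWithinAt_id s (Icc c d)).const_smul k).add_const m
  have hd := hd0.hasMFDerivWithinAt
  have hg : HasMFDerivWithinAt 𝓘(ℝ, ℝ) I γ (Icc a b) (k * s + m)
      (mfderivWithin 𝓘(ℝ, ℝ) I γ (Icc a b) (k * s + m)) :=
    ((h.1 _ (hmap s hs)).mdifferentiableWithinAt (by simp)).hasMFDerivWithinAt
  have := (HasMFDerivWithinAt.comp (g := γ) s hg hd
    (show Icc c d ⊆ (fun s => k * s + m) ⁻¹' Icc a b from hmap)).mfderivWithin hu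
  have h2 := congrArg (fun L : ℝ →L[ℝ] E => L 1) this
  refine Eq.trans h2 ?_
  change (mfderivWithin 𝓘(ℝ, ℝ) I γ (Icc a b) (k * s + m)) (k • (1 : ℝ)) = _
  exact map_smul (mfderivWithin 𝓘(ℝ, ℝ) I γ (Icc a b) (k * s + m)) k (1 : ℝ)

theorem SmoothArc.congr {γ' : ℝ → N} (h : SmoothArc I A γ a b) (he : EqOn γ' γ (Icc a b)) :
    SmoothArc I A γ' a b := by
  refine ⟨h.1.congr he, fun s hs => ?_⟩
  have h1 := h.2 s hs
  have h2 : mfderivWithin 𝓘(ℝ, ℝ) I γ' (Icc a b) s = mfderivWithin 𝓘(ℝ, ℝ) I γ (Icc a b) s :=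
    mfderivWithin_congr he (he hs)
  -- The type of a velocity depends on its base point, so the equality of base points is used
  -- through a generalized point `p`.
  have h3 : ∀ p : N, p = γ s → ∀ L : ℝ →L[ℝ] E, A (γ s) (L 1) → A p (L 1) := by
    rintro p rfl L h
    exact h
  exact h3 (γ' s) (he hs) (mfderivWithin 𝓘(ℝ, ℝ) I γ' (Icc a b) s)
    ((congrArg (fun L : ℝ →L[ℝ] E => A (γ s) (L 1)) h2).mpr h1)

theorem SmoothArc.mono {A' : ∀ p : N, TangentSpace I p → Prop} (h : SmoothArc I A γ a b)
    (hA : ∀ p v, A p v → A' p v) : SmoothArc I A' γ a b :=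
  ⟨h.1, fun s hs => hA _ _ (h.2 s hs)⟩

variable (I F) in
/-- `q` is reached from `p` by a single smooth arc of speed less than `1`, parametrized by the
first coordinate. -/
def ArcRel (p q : ℝ × N) : Prop :=
  p.1 < q.1 ∧ ∃ γ, SmoothArc I (fun p v => F p v < 1) γ p.1 q.1 ∧ γ p.1 = p.2 ∧ γ q.1 = q.2

/-- Running through `[c, d]` at the constant rate `(d - c) / T` takes time `T` and multiplies the
speed by this rate. -/
theorem ArcRel.of_subarc [IsManifold I 1 N] (hF : IsFinsler F) (h : SmoothArc I A γ a b)
    {c d T : ℝ} (t : ℝ) (hac : a ≤ c) (hcd : c < d) (hdb : d ≤ b)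
    (hT : ∀ s ∈ Icc c d, F (γ s) (arcVel I γ a b s) * (d - c) < T) :
    ArcRel I F (t, γ c) (t + T, γ d) := by
  have hT0 : 0 < T := lt_of_le_of_lt
    (mul_nonneg (hF.nonneg _ _) (sub_nonneg.2 hcd.le)) (hT c ⟨le_rfl, hcd.le⟩)
  have hk : 0 < (d - c) / T := div_pos (sub_pos.2 hcd) hT0
  have e1 : (d - c) / T * t + (c - (d - c) / T * t) = c := by ring
  have e2 : (d - c) / T * (t + T) + (c - (d - c) / T * t) = d := by
    field_simp
    ring
  have hmap : ∀ s ∈ Icc t (t + T), (d - c) / T * s + (c - (d - c) / T * t) ∈ Icc c d := by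
    rintro s ⟨h1, h2⟩
    have h3 := mul_le_mul_of_nonneg_left h1 hk.le
    have h4 := mul_le_mul_of_nonneg_left h2 hk.le
    constructor <;> linarith
  obtain ⟨h1, h2⟩ := h.comp_affine (c := t) (d := t + T) (by linarith)
    (fun s hs => Icc_subset_Icc hac hdb (hmap s hs))
  refine ⟨by simpa using hT0, fun s => γ ((d - c) / T * s + (c - (d - c) / T * t)), ⟨h1, ?_⟩, ?_, ?_⟩
  · intro s hs
    have h3 : F _ (arcVel I (fun s => γ ((d - c) / T * s + (c - (d - c) / T * t))) t (t + T) s) < 1 := by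
      rw [h2 s hs, hF.smul _ _ _ hk.le, div_mul_eq_mul_div, div_lt_one hT0, mul_comm]
      exact hT _ (hmap s hs)
    exact h3
  · simp only [e1]
  · simp only [e2]

/-- A single affine reparametrization would cost the maximal speed times `b - a`. By uniform
continuity, on short pieces the maximal speed exceeds the mean by less than `ε`, so reparametrizing
each piece by itself costs the length plus `ε (b - a)` in all. -/
theorem SmoothArc.transGen [IsManifold I 1 N] (hF : IsFinsler F) (h : SmoothArc I A γ a b)
    (hab : a < b) {ε : ℝ} (hε : 0 < ε) (t : ℝ) :
    Relation.TransGen (ArcRel I F) (t, γ a)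
      (t + ((∫ s in a..b, F (γ s) (arcVel I γ a b s)) + ε * (b - a)), γ b) := by
  set f := fun s => F (γ s) (arcVel I γ a b s) with hf
  have hfc : ContinuousOn f (Icc a b) := h.continuousOn_speed hF hab
  obtain ⟨δ, hδ, hu⟩ := Metric.uniformContinuousOn_iff.1
    (isCompact_Icc.uniformContinuousOn_of_continuous hfc) (ε / 2) (half_pos hε)
  obtain ⟨K, hK⟩ := exists_nat_gt ((b - a) / δ)
  have hba : 0 < b - a := sub_pos.2 hab
  have hK0 : (0 : ℝ) < K := lt_trans (div_pos hba hδ) hK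
  set w := (b - a) / K with hw
  have hw0 : 0 < w := div_pos hba hK0
  have hwδ : w < δ := by
    rw [hw, div_lt_iff₀ hK0]
    rw [div_lt_iff₀ hδ] at hK
    linarith
  have hKw : K * w = b - a := by rw [hw]; field_simp
  have hint : ∀ c d, a ≤ c → c ≤ d → d ≤ b → IntervalIntegrable f MeasureTheory.volume c d :=
    fun c d h1 h2 h3 => (hfc.mono (by rw [uIcc_of_le h2]; exact Icc_subset_Icc h1 h3)).intervalIntegrable
  have step : ∀ c d t, a ≤ c → d ≤ b → d = c + w →
      ArcRel I F (t, γ c) (t + ((∫ s in c..d, f s) + ε * (d - c)), γ d) := by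
    intro c d t h1 h2 h3
    have hcd : c < d := by linarith
    refine ArcRel.of_subarc hF h t h1 hcd h2 fun s hs => ?_
    have h4 : ∫ u in c..d, (f s - ε / 2) ≤ ∫ u in c..d, f u := by
      refine intervalIntegral.integral_mono_on hcd.le (by simp) (hint c d h1 hcd.le h2) ?_
      intro u hv
      have h5 := hu s (Icc_subset_Icc h1 h2 hs) u (Icc_subset_Icc h1 h2 hv) (by
        rw [Real.dist_eq, abs_lt]
        constructor <;> linarith [hs.1, hs.2, hv.1, hv.2])
      rw [Real.dist_eq, abs_lt] at h5
      linarith [h5.2]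
    simp only [intervalIntegral.integral_const, smul_eq_mul] at h4
    change f s * (d - c) < _
    nlinarith
  -- `Relation.TransGen` is not reflexive, so `i` counts the pieces minus one.
  have key : ∀ i : ℕ, i < K → Relation.TransGen (ArcRel I F) (t, γ a)
      (t + ((∫ s in a..(a + (i + 1) * w), f s) + ε * ((i + 1) * w)), γ (a + (i + 1) * w)) := by
    intro i
    induction i with
    | zero =>
      intro hi
      have := step a (a + w) t le_rfl (by
        have : (1 : ℝ) ≤ K := by exact_mod_cast hi
        nlinarith) rfl
      simpa using Relation.TransGen.single this
    | succ i ih =>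
      intro hi
      have h1 := ih (by omega)
      have hiK : ((i : ℝ) + 1 + 1) * w ≤ b - a := by
        have : (i : ℝ) + 1 + 1 ≤ K := by exact_mod_cast hi
        nlinarith
      have hi0 : 0 ≤ ((i : ℝ) + 1) * w := by positivity
      have h2 := step (a + (i + 1) * w) (a + (i + 1 + 1) * w)
        (t + ((∫ s in a..(a + (i + 1) * w), f s) + ε * ((i + 1) * w))) (by linarith) (by linarith)
        (by ring)
      have h3 := intervalIntegral.integral_add_adjacent_intervals
        (hint a (a + (i + 1) * w) le_rfl (by linarith) (by linarith))
        (hint (a + (i + 1) * w) (a + (i + 1 + 1) * w) (by linarith) (by linarith) (by linarith))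
      have h4 := h1.tail h2
      push_cast
      rw [← h3]
      convert h4 using 2
      ring
  obtain ⟨K', rfl⟩ : ∃ K', K = K' + 1 := ⟨K - 1, by
    have : 0 < K := by exact_mod_cast hK0
    omega⟩
  have h1 := key K' (Nat.lt_succ_self _)
  push_cast at hKw
  rw [hKw, add_sub_cancel] at h1
  exact h1

/-- `finslerLength` uses two-sided velocities and `arcVel` one-sided ones; they can differ only at
the two end points, a null set. -/
theorem SmoothArc.lintegral_eq [IsManifold I 1 N] (hF : IsFinsler F) (h : SmoothArc I A γ a b)
    (hab : a < b) : finslerLength I F γ a b =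
      ENNReal.ofReal (∫ s in a..b, F (γ s) (arcVel I γ a b s)) := by
  have hfc := h.continuousOn_speed hF hab
  rw [intervalIntegral.integral_of_le hab.le, ← MeasureTheory.integral_Icc_eq_integral_Ioc,
    MeasureTheory.ofReal_integral_eq_lintegral_ofReal (hfc.integrableOn_Icc)
      (Eventually.of_forall fun s => hF.nonneg _ _)]
  unfold finslerLength
  rw [← MeasureTheory.restrict_Ioo_eq_restrict_Icc]
  refine MeasureTheory.setLIntegral_congr_fun measurableSet_Ioo fun s hs => ?_
  simp only [arcVel]
  rw [mfderivWithin_of_mem_nhds (Icc_mem_nhds hs.1 hs.2)]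

theorem finslerLength_add {c : ℝ} (hab : a ≤ b) (hbc : b ≤ c) :
    finslerLength I F γ a c = finslerLength I F γ a b + finslerLength I F γ b c := by
  unfold finslerLength
  rw [← Icc_union_Ioc_eq_Icc hab hbc, MeasureTheory.lintegral_union measurableSet_Ioc,
    MeasureTheory.restrict_Ioc_eq_restrict_Icc]
  rw [disjoint_iff_forall_ne]
  rintro x hx _ hy rfl
  exact absurd hx.2 (not_le.2 hy.1)

theorem transGen_arcRel_shift {p q : ℝ × N} (h : Relation.TransGen (ArcRel I F) p q) : p.1 < q.1 := by
  induction h with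
  | single h => exact h.1
  | tail _ h ih => exact ih.trans h.1

theorem smoothArc_const (x : N) (hA : A x 0) : SmoothArc I A (fun _ => x) a b := by
  refine ⟨contMDiffOn_const, fun s _ => ?_⟩
  rw [mfderivWithin_const]
  exact hA

theorem transGen_of_finslerLength_lt [IsManifold I 1 N] (hF : IsFinsler F)
    (h : PiecewiseSmooth I (fun _ _ => True) γ a b) {T : ℝ} (t : ℝ)
    (hT : finslerLength I F γ a b < ENNReal.ofReal T) :
    Relation.TransGen (ArcRel I F) (t, γ a) (t + T, γ b) := by
  obtain ⟨k, τ, rfl, rfl, hτ⟩ := h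
  suffices H : ∀ j ≤ k, τ 0 ≤ τ j ∧ ∀ T : ℝ, finslerLength I F γ (τ 0) (τ j) < ENNReal.ofReal T →
      Relation.TransGen (ArcRel I F) (t, γ (τ 0)) (t + T, γ (τ j)) from (H k le_rfl).2 T hT
  intro j
  induction j with
  | zero =>
    -- With no piece to run through, the positive time `T` is spent at rest.
    refine fun _ => ⟨le_rfl, fun T hT => .single ⟨?_, fun _ => γ (τ 0), ?_, rfl, rfl⟩⟩
    · have := ENNReal.ofReal_pos.1 (bot_le.trans_lt hT)
      simpa using this
    · exact smoothArc_const _ (by rw [hF.zero]; exact one_pos)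
  | succ j ih =>
    intro hj
    obtain ⟨h1, h2⟩ := ih (by omega)
    obtain ⟨h3, h4⟩ := hτ j (by omega)
    refine ⟨h1.trans h3.le, fun T hT => ?_⟩
    rw [finslerLength_add h1 h3.le, h4.lintegral_eq hF h3] at hT
    set ℓ := ∫ s in τ j..τ (j + 1), F (γ s) (arcVel I γ (τ j) (τ (j + 1)) s) with hℓ
    have hℓ0 : 0 ≤ ℓ := intervalIntegral.integral_nonneg h3.le fun s _ => hF.nonneg _ _
    have hfin : finslerLength I F γ (τ 0) (τ j) ≠ ⊤ := fun h => by simp [h] at hT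
    obtain ⟨m, hm0, hm⟩ : ∃ m : ℝ, 0 ≤ m ∧ finslerLength I F γ (τ 0) (τ j) = ENNReal.ofReal m :=
      ⟨_, ENNReal.toReal_nonneg, (ENNReal.ofReal_toReal hfin).symm⟩
    rw [hm, ← ENNReal.ofReal_add hm0 hℓ0, ENNReal.ofReal_lt_ofReal_iff_of_nonneg (by positivity)] at hT
    -- The spare time `T - (m + ℓ)` is shared equally between the earlier pieces and the last one.
    have h5 := h2 (m + (T - (m + ℓ)) / 2) (by
      rw [hm, ENNReal.ofReal_lt_ofReal_iff_of_nonneg hm0]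
      linarith)
    have h6 := h4.transGen hF h3 (ε := (T - (m + ℓ)) / 2 / (τ (j + 1) - τ j))
      (div_pos (by linarith) (by linarith)) (t + (m + (T - (m + ℓ)) / 2))
    rw [div_mul_cancel₀ _ (by linarith), ← hℓ] at h6
    convert h5.trans h6 using 2
    ring

theorem partition_le {τ : ℕ → ℝ} {k : ℕ} (h : ∀ j < k, τ j < τ (j + 1)) {i : ℕ} (j : ℕ) (hij : i ≤ j)
    (hj : j ≤ k) : τ i ≤ τ j := by
  induction j, hij using Nat.le_induction with
  | base => exact le_rfl
  | succ j _ ih => exact (ih (by omega)).trans (h j (by omega)).le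

theorem exists_piecewiseSmooth_of_transGen {p q : ℝ × N} (h : Relation.TransGen (ArcRel I F) p q) :
    ∃ γ, PiecewiseSmooth I (fun p v => F p v < 1) γ p.1 q.1 ∧ γ p.1 = p.2 ∧ γ q.1 = q.2 := by
  induction h with
  | single h =>
    obtain ⟨h1, γ, h2, h3, h4⟩ := h
    refine ⟨γ, ⟨1, fun i => if i = 0 then p.1 else _, if_pos rfl, if_neg one_ne_zero, ?_⟩, h3, h4⟩
    intro j hj
    obtain rfl : j = 0 := by omega
    simpa using ⟨h1, h2⟩
  | @tail m q _ h ih =>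
    obtain ⟨γ, ⟨k, τ, hτ0, hτk, hτ⟩, h3, h4⟩ := ih
    obtain ⟨h5, γ', h6, h7, h8⟩ := h
    have hle : ∀ i j, i ≤ j → j ≤ k → τ i ≤ τ j := fun i j => partition_le (fun j hj => (hτ j hj).1) j
    have hpm : p.1 ≤ m.1 := by
      rw [← hτ0, ← hτk]
      exact hle 0 k (Nat.zero_le _) le_rfl
    refine ⟨fun s => if s ≤ m.1 then γ s else γ' s, ⟨k + 1, fun i => if i ≤ k then τ i else q.1,
      by simpa using hτ0, by simp, ?_⟩, by simp [hpm, h3], by simp [not_le.2 h5, h8]⟩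
    intro j hj
    beta_reduce
    rcases Nat.lt_succ_iff_lt_or_eq.1 hj with hj | rfl
    · rw [if_pos hj.le, if_pos (by omega : j + 1 ≤ k)]
      refine ⟨(hτ j hj).1, (hτ j hj).2.congr fun s hs => if_pos ?_⟩
      exact hs.2.trans (hτk ▸ hle (j + 1) k (by omega) le_rfl)
    · simp only [le_refl, if_true, Nat.not_succ_le_self, if_false]
      rw [hτk]
      refine ⟨h5, h6.congr fun s hs => ?_⟩
      split_ifs with h
      · rw [le_antisymm h hs.1, h4, h7]
      · rfl

theorem SmoothArc.finslerLength_lt [IsManifold I 1 N] (hF : IsFinsler F)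
    (h : SmoothArc I (fun p v => F p v < 1) γ a b) (hab : a < b) :
    finslerLength I F γ a b < ENNReal.ofReal (b - a) := by
  rw [h.lintegral_eq hF hab, ENNReal.ofReal_lt_ofReal_iff (by linarith)]
  have := intervalIntegral.integral_lt_integral_of_continuousOn_of_le_of_exists_lt hab
    (h.continuousOn_speed hF hab) (continuousOn_const (c := (1 : ℝ)))
    (fun s hs => (h.2 s (Ioc_subset_Icc_self hs)).le)
    ⟨a, left_mem_Icc.2 hab.le, h.2 a (left_mem_Icc.2 hab.le)⟩
  simpa using this

theorem PiecewiseSmooth.finslerLength_lt [IsManifold I 1 N] (hF : IsFinsler F)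
    (h : PiecewiseSmooth I (fun p v => F p v < 1) γ a b) (hab : a < b) :
    finslerLength I F γ a b < ENNReal.ofReal (b - a) := by
  obtain ⟨k, τ, rfl, rfl, hτ⟩ := h
  suffices H : ∀ j ≤ k, τ 0 ≤ τ j ∧ (0 < j →
      finslerLength I F γ (τ 0) (τ j) < ENNReal.ofReal (τ j - τ 0)) by
    refine (H k le_rfl).2 (Nat.pos_of_ne_zero ?_)
    rintro rfl
    exact lt_irrefl _ hab
  intro j
  induction j with
  | zero => exact fun _ => ⟨le_rfl, fun h => absurd h (lt_irrefl _)⟩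
  | succ j ih =>
    intro hj
    obtain ⟨h1, h2⟩ := ih (by omega)
    obtain ⟨h3, h4⟩ := hτ j (by omega)
    refine ⟨h1.trans h3.le, fun _ => ?_⟩
    have h5 := h4.finslerLength_lt hF h3
    rcases Nat.eq_zero_or_pos j with rfl | hj0
    · exact h5
    · rw [finslerLength_add h1 h3.le]
      refine (ENNReal.add_lt_add (h2 hj0) h5).trans_eq ?_
      rw [← ENNReal.ofReal_add (by linarith) (by linarith)]
      congr 1
      ring

/-- The distance `d(x, y)` is less than `T` exactly if one gets from `x` to `y` in time `T` at
speed less than `1`. -/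
theorem finslerDist_lt_iff [IsManifold I 1 N] (hF : IsFinsler F) {p q : ℝ × N} :
    finslerDist I F p.2 q.2 < ENNReal.ofReal (q.1 - p.1) ↔ Relation.TransGen (ArcRel I F) p q := by
  constructor
  · intro h
    obtain ⟨_, ⟨γ, a, b, h1, h2, h3, rfl⟩, h4⟩ := sInf_lt_iff.1 h
    have := transGen_of_finslerLength_lt hF h1 p.1 h4
    rw [h2, h3, add_sub_cancel] at this
    exact this
  · intro h
    obtain ⟨γ, h1, h2, h3⟩ := exists_piecewiseSmooth_of_transGen h
    have h1' : PiecewiseSmooth I (fun _ _ => True) γ p.1 q.1 := by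
      obtain ⟨k, τ, h4, h5, h6⟩ := h1
      exact ⟨k, τ, h4, h5, fun j hj => ⟨(h6 j hj).1, (h6 j hj).2.mono fun _ _ _ => trivial⟩⟩
    exact lt_of_le_of_lt (sInf_le ⟨γ, p.1, q.1, h1', h2, h3, rfl⟩)
      (h1.finslerLength_lt hF (transGen_arcRel_shift h))

/-- The derivative of `ψ` in the direction `v`. -/
def dirDeriv (I : ModelWithCorners ℝ E H) (ψ : N → ℝ) (p : N) (v : TangentSpace I p) : ℝ :=
  mfderiv I 𝓘(ℝ, ℝ) ψ p v

/-- Functions whose differential is bounded by `C F` are bounded by `C d`. -/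
theorem sub_le_mul_of_finslerDist_lt [IsManifold I 1 N] (hF : IsFinsler F) {ψ : N → ℝ} {C : ℝ}
    (hC : 0 ≤ C) (hψ : ContMDiff I 𝓘(ℝ, ℝ) 1 ψ)
    (hd : ∀ p (v : TangentSpace I p), dirDeriv I ψ p v ≤ C * F p v) {x y : N} {T : ℝ}
    (h : finslerDist I F x y < ENNReal.ofReal T) : ψ y - ψ x ≤ C * T := by
  have h1 : Relation.TransGen (ArcRel I F) (0, x) (T, y) :=
    (finslerDist_lt_iff hF).1 (by simpa using h)
  suffices H : ∀ p q : ℝ × N, Relation.TransGen (ArcRel I F) p q →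
      ψ q.2 - ψ p.2 ≤ C * (q.1 - p.1) by simpa using H _ _ h1
  have harc : ∀ p q : ℝ × N, ArcRel I F p q → ψ q.2 - ψ p.2 ≤ C * (q.1 - p.1) := by
    rintro ⟨a, x⟩ ⟨b, y⟩ ⟨hab, γ, h2, h3, h4⟩
    simp only at hab h2 h3 h4 ⊢
    rw [← h3, ← h4]
    clear h3 h4
    have hcomp : ∀ s ∈ Icc a b, HasDerivWithinAt (ψ ∘ γ)
        (dirDeriv I ψ (γ s) (arcVel I γ a b s)) (Icc a b) s := by
      intro s hs
      have h3 : HasMFDerivWithinAt 𝓘(ℝ, ℝ) I γ (Icc a b) s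
          (mfderivWithin 𝓘(ℝ, ℝ) I γ (Icc a b) s) :=
        ((h2.1 _ hs).mdifferentiableWithinAt (by simp)).hasMFDerivWithinAt
      have h4 : HasMFDerivAt I 𝓘(ℝ, ℝ) ψ (γ s) (mfderiv I 𝓘(ℝ, ℝ) ψ (γ s)) :=
        ((hψ _).mdifferentiableAt (by simp)).hasMFDerivAt
      have h5 : HasFDerivWithinAt (ψ ∘ γ) (show ℝ →L[ℝ] ℝ from
        (mfderiv I 𝓘(ℝ, ℝ) ψ (γ s)).comp (mfderivWithin 𝓘(ℝ, ℝ) I γ (Icc a b) s)) (Icc a b) s :=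
        (h4.comp_hasMFDerivWithinAt s h3).hasFDerivWithinAt
      exact h5.hasDerivWithinAt
    have h6 := Convex.image_sub_le_mul_sub_of_deriv_le (convex_Icc a b)
      (fun s hs => (hcomp s hs).continuousWithinAt) (C := C) (f := ψ ∘ γ)
      (fun s hs => ((hcomp s (interior_subset hs)).differentiableWithinAt.mono interior_subset))
      (fun s hs => by
        rw [interior_Icc] at hs
        have h7 := (hcomp s (Ioo_subset_Icc_self hs)).hasDerivAt (Icc_mem_nhds hs.1 hs.2)
        rw [h7.deriv]
        refine (hd _ _).trans ?_
        have h8 : F (γ s) (arcVel I γ a b s) < 1 := h2.2 s (Ioo_subset_Icc_self hs)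
        nlinarith) a ⟨le_rfl, hab.le⟩ b ⟨hab.le, le_rfl⟩ hab.le
    exact h6
  intro p q hpq
  induction hpq with
  | single h => exact harc _ _ h
  | tail _ h ih =>
    have := harc _ _ h
    linarith

/-- The finite paths are concatenated to one infinite path. This makes a chain of piecewise smooth
steps a chain of single arcs. -/
theorem exists_refine_transGen {α : Type*} {A : α → α → Prop} {u : ℕ → α}
    (h : ∀ n, Relation.TransGen A (u n) (u (n + 1))) :
    ∃ (v : ℕ → α) (φ : ℕ → ℕ), StrictMono φ ∧ φ 0 = 0 ∧ (∀ n, v (φ n) = u n) ∧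
      ∀ k, A (v k) (v (k + 1)) := by
  have hpath : ∀ a b, Relation.TransGen A a b →
      ∃ (m : ℕ) (p : ℕ → α), p 0 = a ∧ p (m + 1) = b ∧ ∀ i ≤ m, A (p i) (p (i + 1)) := by
    intro a b hab
    induction hab with
    | @single b h =>
      refine ⟨0, fun i => if i = 0 then a else b, rfl, rfl, fun i hi => ?_⟩
      obtain rfl : i = 0 := by omega
      simpa using h
    | @tail b c _ h ih =>
      obtain ⟨m, p, h0, h1, h2⟩ := ih
      refine ⟨m + 1, fun i => if i ≤ m + 1 then p i else c, by simp [h0], by simp, fun i hi => ?_⟩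
      rcases Nat.lt_or_ge m i with h3 | h3
      · obtain rfl : i = m + 1 := by omega
        simpa [h1] using h
      · simpa [h3, (by omega : i ≤ m + 1)] using h2 i h3
  choose m p hp0 hp1 hp using fun n => hpath _ _ (h n)
  -- State `(i, j)`: the walk is at the point `p i j` of the path `i`. The last point `p i (m i +
  -- 1)` equals `p (i + 1) 0` and is visited under the latter name.
  let st : ℕ → ℕ × ℕ := fun k => Nat.rec (0, 0)
    (fun _ s => if s.2 + 1 ≤ m s.1 then (s.1, s.2 + 1) else (s.1 + 1, 0)) k
  have st_succ : ∀ k, st (k + 1) =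
      if (st k).2 + 1 ≤ m (st k).1 then ((st k).1, (st k).2 + 1) else ((st k).1 + 1, 0) :=
    fun k => rfl
  have hst : ∀ k, (st k).2 ≤ m (st k).1 := by
    intro k
    induction k with
    | zero => exact Nat.zero_le _
    | succ k ih =>
      rw [st_succ]
      split_ifs with h
      · exact h
      · exact Nat.zero_le _
  have hrun : ∀ k i, st k = (i, 0) → ∀ j ≤ m i, st (k + j) = (i, j) := by
    intro k i hk j
    induction j with
    | zero => exact fun _ => hk
    | succ j ih =>
      intro hj
      rw [← add_assoc, st_succ, ih (by omega), if_pos hj]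
  let φ : ℕ → ℕ := fun n => ∑ i ∈ Finset.range n, (m i + 1)
  have hφ : ∀ n, st (φ n) = (n, 0) := by
    intro n
    induction n with
    | zero => rfl
    | succ n ih =>
      have h1 : φ (n + 1) = φ n + m n + 1 := by
        simp only [φ, Finset.sum_range_succ]
        ring
      rw [h1, st_succ, hrun _ _ ih _ le_rfl, if_neg (by simp)]
  refine ⟨fun k => p (st k).1 (st k).2, φ, strictMono_nat_of_lt_succ fun n => ?_, rfl, fun n => ?_,
    fun k => ?_⟩
  · simp only [φ, Finset.sum_range_succ]
    omega
  · simp only [hφ, hp0]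
  · have h1 := hp (st k).1 (st k).2 (hst k)
    simp only [st_succ]
    split_ifs with h
    · exact h1
    · have h2 : (st k).2 = m (st k).1 := by
        have := hst k
        omega
      rw [h2, hp1, ← hp0 ((st k).1 + 1)] at h1
      rw [h2]
      exact h1

/-- An infinite sequence of arcs is a curve of speed less than `1`. -/
theorem exists_slowCurve_of_arcRel {v : ℕ → ℝ × N} (h : ∀ k, ArcRel I F (v k) (v (k + 1))) :
    ∃ c : SlowCurve I F, c.α = (v 0).1 ∧ c.Ω = ⨆ k, ((v k).1 : EReal) ∧
      ∀ k, c.toFun (v k).1 = (v k).2 := by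
  choose hlt γ hγ h0 h1 using h
  have hmono : StrictMono fun k => (v k).1 := strictMono_nat_of_lt_succ hlt
  classical
  -- At time `s` the first arc ending after `s` is used. At a break this is the later of two arcs,
  -- which agrees there with the earlier one.
  let γ' : ℝ → N := fun s => if h : ∃ k, s < (v (k + 1)).1 then γ (Nat.find h) s else (v 0).2
  have heq : ∀ k, EqOn γ' (γ k) (Icc (v k).1 (v (k + 1)).1) := by
    intro k s hs
    rcases hs.2.lt_or_eq with h2 | h2
    · have hex : ∃ k, s < (v (k + 1)).1 := ⟨k, h2⟩
      have : Nat.find hex = k := by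
        refine (Nat.find_eq_iff _).2 ⟨h2, fun j hj => not_lt.2 ?_⟩
        exact (hmono.monotone (by omega : j + 1 ≤ k)).trans hs.1
      simp only [γ']
      rw [dif_pos hex, this]
    · have hex : ∃ k, s < (v (k + 1)).1 := ⟨k + 1, by rw [h2]; exact hmono (by omega)⟩
      have : Nat.find hex = k + 1 := by
        refine (Nat.find_eq_iff _).2 ⟨by rw [h2]; exact hmono (by omega), fun j hj => not_lt.2 ?_⟩
        rw [h2]
        exact hmono.monotone (by omega : j + 1 ≤ k + 1)
      simp only [γ']
      rw [dif_pos hex, this, h2, h0, h1]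
  refine ⟨⟨γ', (v 0).1, ⨆ k, ((v k).1 : EReal), fun k => (v k).1, rfl, hmono,
    tendsto_atTop_iSup (fun i j hij => EReal.coe_le_coe_iff.2 (hmono.monotone hij)),
    fun j => (hγ j).congr (heq j)⟩, rfl, rfl, fun k => ?_⟩
  rw [← h0 k]
  exact heq k ⟨le_rfl, (hlt k).le⟩

end

/-! ### Local comparison of Finsler functions with the norm. -/

section
variable {E : Type*} [NormedAddCommGroup E] [NormedSpace ℝ E] {H : Type*} [TopologicalSpace H]
  {I : ModelWithCorners ℝ E H} {N : Type*} [TopologicalSpace N] [ChartedSpace H N]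
  {F : ∀ p : N, TangentSpace I p → ℝ}

/-- In a trivialization, a Finsler function is locally comparable to the norm. -/
theorem IsFinsler.bounds [IsManifold I 1 N] [FiniteDimensional ℝ E] (hF : IsFinsler F) (x₀ : N) :
    ∃ c > 0, ∃ C > 0, ∀ᶠ x in 𝓝 x₀, ∀ v : TangentSpace I x,
      c * ‖(trivializationAt E (TangentSpace I) x₀ ⟨x, v⟩).2‖ ≤ F x v ∧
      F x v ≤ C * ‖(trivializationAt E (TangentSpace I) x₀ ⟨x, v⟩).2‖ := by
  set e := trivializationAt E (TangentSpace I : N → Type _) x₀ with he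
  have hx₀ : x₀ ∈ e.baseSet := FiberBundle.mem_baseSet_trivializationAt' x₀
  let G : N × E → ℝ := fun z => F (e.toOpenPartialHomeomorph.symm z).1 (e.toOpenPartialHomeomorph.symm z).2
  have hG : ContinuousOn G (e.baseSet ×ˢ univ) := by
    have := e.toOpenPartialHomeomorph.continuousOn_symm
    rw [show e.toOpenPartialHomeomorph.target = e.baseSet ×ˢ univ from e.target_eq] at this
    exact hF.continuous.comp_continuousOn this
  have hGv : ∀ x ∈ e.baseSet, ∀ v : TangentSpace I x, G (x, (e ⟨x, v⟩).2) = F x v := by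
    intro x hx v
    have h1 : ((x, (e ⟨x, v⟩).2) : N × E) = e ⟨x, v⟩ := by
      refine Prod.ext ?_ rfl
      exact (e.coe_fst' (x := ⟨x, v⟩) hx).symm
    have h2 : e.toOpenPartialHomeomorph.symm (e ⟨x, v⟩) = ⟨x, v⟩ :=
      e.toOpenPartialHomeomorph.left_inv (e.mem_source.2 hx)
    simp only [G]
    rw [h1]
    erw [h2]
  have hscale : ∀ x ∈ e.baseSet, ∀ v : TangentSpace I x, v ≠ 0 →
      0 < ‖(e ⟨x, v⟩).2‖ ∧ F x v = ‖(e ⟨x, v⟩).2‖ *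
        G (x, ‖(e ⟨x, v⟩).2‖⁻¹ • (e ⟨x, v⟩).2) := by
    intro x hx v hv
    have hlin : ∀ (k : ℝ), k • (e ⟨x, v⟩).2 = (e ⟨x, k • v⟩).2 := by
      intro k
      have := ((e.linear ℝ hx).map_smul k v).symm
      exact this
    have hne : (e ⟨x, v⟩).2 ≠ 0 := by
      intro h
      have h1 := hGv x hx v
      have h2 := hlin 0
      rw [zero_smul, zero_smul] at h2
      have h3 := hGv x hx 0
      rw [← h2, hF.zero] at h3
      rw [h, h3] at h1
      exact (hF.pos x v hv).ne h1
    have hpos : 0 < ‖(e ⟨x, v⟩).2‖ := norm_pos_iff.2 hne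
    refine ⟨hpos, ?_⟩
    rw [hlin, hGv x hx, hF.smul _ _ _ (inv_nonneg.2 hpos.le), mul_inv_cancel_left₀ hpos.ne']
  -- By homogeneity only the unit sphere matters. Its compactness gives bounds first over `x₀` and
  -- then over a neighbourhood.
  have hS : IsCompact (Metric.sphere (0 : E) 1) := isCompact_sphere 0 1
  have hcont : ∀ ξ : E, ContinuousAt G (x₀, ξ) := fun ξ =>
    hG.continuousAt ((e.open_baseSet.prod isOpen_univ).mem_nhds ⟨hx₀, mem_univ _⟩)
  have hGpos : ∀ ξ ∈ Metric.sphere (0 : E) 1, 0 < G (x₀, ξ) := by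
    intro ξ hξ
    refine hF.pos _ _ fun h => ?_
    have h1 := e.apply_symm_apply (x := (x₀, ξ)) (by rw [e.mem_target]; exact hx₀)
    have h4 : (e.toOpenPartialHomeomorph.symm (x₀, ξ)).1 = x₀ :=
      e.proj_symm_apply (by rw [e.mem_target]; exact hx₀)
    set w := e.toOpenPartialHomeomorph.symm (x₀, ξ) with hw
    have h2 : w = ⟨w.1, 0 • w.2⟩ := by
      conv_lhs => rw [show w = ⟨w.1, w.2⟩ from rfl]
      rw [h, smul_zero]
    have h3 : (e ⟨w.1, (0 : ℝ) • w.2⟩).2 = (0 : ℝ) • (e ⟨w.1, w.2⟩).2 :=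
      (e.linear ℝ (h4 ▸ hx₀)).map_smul (0 : ℝ) w.2
    rw [zero_smul] at h3
    have h5 : (e w).2 = ξ := by
      have := congrArg Prod.snd h1
      exact this
    rw [h2, zero_smul] at h5
    rw [zero_smul] at h3
    rw [h3] at h5
    simp [← h5] at hξ
  obtain ⟨c, hc, C, hC, hcC⟩ : ∃ c > 0, ∃ C > 0, ∀ ξ ∈ Metric.sphere (0 : E) 1,
      c < G (x₀, ξ) ∧ G (x₀, ξ) < C := by
    rcases (Metric.sphere (0 : E) 1).eq_empty_or_nonempty with h | h
    · exact ⟨1, one_pos, 1, one_pos, by simp [h]⟩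
    · have hc' : ContinuousOn (fun ξ => G (x₀, ξ)) (Metric.sphere (0 : E) 1) := fun ξ _ =>
        ((hcont ξ).comp (f := fun ξ => (x₀, ξ)) (by fun_prop)).continuousWithinAt
      obtain ⟨a, ha, ha'⟩ := hS.exists_isMinOn h hc'
      obtain ⟨b, hb, hb'⟩ := hS.exists_isMaxOn h hc'
      have h1 := hGpos a ha
      have h2 := hGpos b hb
      exact ⟨G (x₀, a) / 2, half_pos h1, G (x₀, b) + 1, by linarith, fun ξ hξ =>
        ⟨by have := ha' hξ; simp only [mem_ofPred_eq] at this; linarith,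
          by have := hb' hξ; simp only [mem_ofPred_eq] at this; linarith⟩⟩
  have hev : ∀ᶠ x in 𝓝 x₀, ∀ ξ ∈ Metric.sphere (0 : E) 1, c < G (x, ξ) ∧ G (x, ξ) < C := by
    refine hS.eventually_forall_of_forall_eventually fun ξ hξ => ?_
    exact ((hcont ξ).eventually (lt_mem_nhds (hcC ξ hξ).1)).and
      ((hcont ξ).eventually (gt_mem_nhds (hcC ξ hξ).2))
  refine ⟨c, hc, C, hC, ?_⟩
  filter_upwards [hev, e.open_baseSet.mem_nhds hx₀] with x hx hxe v
  by_cases hv : v = 0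
  · subst hv
    have h3 : (e ⟨x, (0 : ℝ) • (0 : TangentSpace I x)⟩).2 = (0 : ℝ) • (e ⟨x, 0⟩).2 :=
      (e.linear ℝ hxe).map_smul (0 : ℝ) _
    rw [zero_smul, zero_smul] at h3
    rw [h3, hF.zero]
    simp
  · obtain ⟨h1, h2⟩ := hscale x hxe v hv
    obtain ⟨h3, h4⟩ := hx (‖(e ⟨x, v⟩).2‖⁻¹ • (e ⟨x, v⟩).2) (by
      simp [norm_smul, h1.ne'])
    rw [h2]
    constructor <;> nlinarith

end

/-! ### The Fermat metrics are Finsler functions. -/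

namespace StandardStationary

variable {n : ℕ} {M : Type*} [TopologicalSpace M] [ChartedSpace (EuclideanSpace ℝ (Fin n)) M]
  [IsManifold (𝓡 n) ∞ M] (S : StandardStationary n M)

theorem continuous_oneForm :
    Continuous fun v : TangentBundle (𝓡 n) M => S.oneForm v.1 v.2 := by
  rw [continuous_iff_continuousAt]
  intro v
  have h1 : Continuous fun v : TangentBundle (𝓡 n) M => v.1 := FiberBundle.continuous_proj _ _
  have : ContinuousAt
      (fun v : TangentBundle (𝓡 n) M => Bundle.TotalSpace.mk' ℝ (E := Bundle.Trivial M ℝ) v.1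
        (S.oneForm v.1 v.2)) v :=
    (S.smooth_oneForm.continuous.comp h1).continuousAt.clm_bundle_apply
      (F₁ := EuclideanSpace ℝ (Fin n)) (F₂ := ℝ) (v := fun v : TangentBundle (𝓡 n) M => v.2)
      continuousAt_id
  simp only [FiberBundle.continuousAt_totalSpace] at this
  exact this.2

theorem continuous_inner :
    Continuous fun v : TangentBundle (𝓡 n) M => S.g₀.inner v.1 v.2 v.2 := by
  rw [continuous_iff_continuousAt]
  intro v
  have h1 : Continuous fun v : TangentBundle (𝓡 n) M => v.1 := FiberBundle.continuous_proj _ _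
  have : ContinuousAt
      (fun v : TangentBundle (𝓡 n) M => Bundle.TotalSpace.mk' ℝ (E := Bundle.Trivial M ℝ) v.1
        (S.g₀.inner v.1 v.2 v.2)) v :=
    (S.g₀.contMDiff.continuous.comp h1).continuousAt.clm_bundle_apply₂
      (F₁ := EuclideanSpace ℝ (Fin n)) (F₂ := EuclideanSpace ℝ (Fin n)) (F₃ := ℝ)
      (v := fun v : TangentBundle (𝓡 n) M => v.2) (w := fun v : TangentBundle (𝓡 n) M => v.2)
      continuousAt_id continuousAt_id
  simp only [FiberBundle.continuousAt_totalSpace] at this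
  exact this.2

theorem inner_nonneg (x : M) (v : TangentSpace (𝓡 n) x) : 0 ≤ S.g₀.inner x v v := by
  by_cases h : v = 0
  · simp [h]
  · exact (S.g₀.pos x v h).le

theorem isFinsler_plus : IsFinsler S.fermatPlus where
  continuous := by
    unfold fermatPlus
    exact (S.continuous_inner.add (S.continuous_oneForm.pow 2)).sqrt.add S.continuous_oneForm
  pos x v hv := by
    have := Real.lt_sqrt_of_sq_lt (x := -S.oneForm x v)
      (y := S.g₀.inner x v v + S.oneForm x v ^ 2) (by
        have := S.g₀.pos x v hv
        linarith [neg_sq (S.oneForm x v)])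
    unfold fermatPlus
    linarith
  smul x c v hc := by
    unfold fermatPlus
    simp only [map_smul, smul_apply, smul_eq_mul]
    rw [show c * (c * S.g₀.inner x v v) + (c * S.oneForm x v) ^ 2 =
      c ^ 2 * (S.g₀.inner x v v + S.oneForm x v ^ 2) by ring, Real.sqrt_mul (sq_nonneg c),
      Real.sqrt_sq hc]
    ring

theorem isFinsler_minus : IsFinsler S.fermatMinus where
  continuous := by
    unfold fermatMinus
    exact (S.continuous_inner.add (S.continuous_oneForm.pow 2)).sqrt.sub S.continuous_oneForm
  pos x v hv := by
    have := Real.lt_sqrt_of_sq_lt (x := S.oneForm x v)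
      (y := S.g₀.inner x v v + S.oneForm x v ^ 2) (by
        have := S.g₀.pos x v hv
        linarith)
    unfold fermatMinus
    linarith
  smul x c v hc := by
    unfold fermatMinus
    simp only [map_smul, smul_apply, smul_eq_mul]
    rw [show c * (c * S.g₀.inner x v v) + (c * S.oneForm x v) ^ 2 =
      c ^ 2 * (S.g₀.inner x v v + S.oneForm x v ^ 2) by ring, Real.sqrt_mul (sq_nonneg c),
      Real.sqrt_sq hc]
    ring

theorem fermatMinus_neg (x : M) (v : TangentSpace (𝓡 n) x) :
    S.fermatMinus x (-v) = S.fermatPlus x v := by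
  unfold fermatMinus fermatPlus
  simp

end StandardStationary

/-! ### The axioms on which the rest of the proof is based. -/

/-- Finite generalized distances with the properties of the distance of a Finsler metric on a
connected manifold. -/
structure LengthDist {X : Type*} (δ : X → X → ℝ) : Prop where
  nonneg : ∀ x y, 0 ≤ δ x y
  self : ∀ x, δ x x = 0
  triangle : ∀ x y z, δ x z ≤ δ x y + δ y z
  eq_of_eq_zero : ∀ x y, δ x y = 0 → x = y
  split : ∀ x y a b, 0 < a → 0 < b → δ x y < a + b → ∃ m, δ x m < a ∧ δ m y < b
  dense : ∃ D : ℕ → X, ∀ x, ∀ ε > 0, ∃ n, δ x (D n) < ε ∧ δ (D n) x < ε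
  compat : ∀ x, ∀ ε > 0, ∃ η > 0, ∀ y, (δ x y < η → δ y x < ε) ∧ (δ y x < η → δ x y < ε)
  locallyCompact : ∀ x, ∃ r > 0, ∀ y : ℕ → X, (∀ n, δ x (y n) ≤ r ∨ δ (y n) x ≤ r) →
    ∃ (z : X) (φ : ℕ → ℕ), StrictMono φ ∧ Tendsto (fun n => δ z (y (φ n))) atTop (𝓝 0) ∧
      Tendsto (fun n => δ (y (φ n)) z) atTop (𝓝 0)

/-- The axioms do not distinguish a distance from its reversal, so each result about pasts also
yields one about futures. -/
theorem LengthDist.swap {X : Type*} {δ : X → X → ℝ} (h : LengthDist δ) :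
    LengthDist fun x y => δ y x where
  nonneg x y := h.nonneg y x
  self := h.self
  triangle x y z := by rw [add_comm]; exact h.triangle z y x
  eq_of_eq_zero x y hxy := (h.eq_of_eq_zero y x hxy).symm
  split x y a b ha hb hxy := by
    obtain ⟨m, h1, h2⟩ := h.split y x b a hb ha (by rwa [add_comm])
    exact ⟨m, h2, h1⟩
  dense := by
    obtain ⟨D, hD⟩ := h.dense
    exact ⟨D, fun x ε hε => (hD x ε hε).imp fun n hn => hn.symm⟩
  compat x ε hε := by
    obtain ⟨η, h1, h2⟩ := h.compat x ε hε
    exact ⟨η, h1, fun y => (h2 y).symm⟩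
  locallyCompact x := by
    obtain ⟨r, h1, h2⟩ := h.locallyCompact x
    refine ⟨r, h1, fun y hy => ?_⟩
    obtain ⟨z, φ, h3, h4, h5⟩ := h2 y fun n => (hy n).symm
    exact ⟨z, φ, h3, h5, h4⟩

/-! ### The distance of a Finsler function satisfies the axioms. -/

section
variable {E : Type*} [NormedAddCommGroup E] [NormedSpace ℝ E] {H : Type*} [TopologicalSpace H]
  {I : ModelWithCorners ℝ E H} {N : Type*} [TopologicalSpace N] [ChartedSpace H N]
  {F : ∀ p : N, TangentSpace I p → ℝ} [IsManifold I 1 N]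

theorem trivializationAt_eq_mfderiv_extChartAt {x₀ x : N} (hx : x ∈ (chartAt H x₀).source)
    (v : TangentSpace I x) : (trivializationAt E (TangentSpace I) x₀ ⟨x, v⟩).2 =
      mfderiv I 𝓘(ℝ, E) (extChartAt I x₀) x v := by
  rw [← TangentBundle.continuousLinearMapAt_trivializationAt hx]
  exact (congrFun ((trivializationAt E (TangentSpace I) x₀).coe_linearMapAt_of_mem (R := ℝ)
    (by rwa [TangentBundle.trivializationAt_baseSet])) v).symm

theorem ArcRel.split (hF : IsFinsler F) {p q : ℝ × N} (h : ArcRel I F p q) {t : ℝ}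
    (h1 : p.1 < t) (h2 : t < q.1) : ∃ m, ArcRel I F p (t, m) ∧ ArcRel I F (t, m) q := by
  obtain ⟨h3, γ, h4, h5, h6⟩ := h
  have hspeed : ∀ s ∈ Icc p.1 q.1, F (γ s) (arcVel I γ p.1 q.1 s) < 1 := h4.2
  refine ⟨γ t, ?_, ?_⟩
  · have := ArcRel.of_subarc hF h4 (c := p.1) (d := t) (T := t - p.1) p.1 le_rfl h1 h2.le
      fun s hs => by
        have := hspeed s ⟨hs.1, hs.2.trans h2.le⟩
        nlinarith
    rwa [h5, add_sub_cancel] at this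
  · have := ArcRel.of_subarc hF h4 (c := t) (d := q.1) (T := q.1 - t) t h1.le h2 le_rfl
      fun s hs => by
        have := hspeed s ⟨h1.le.trans hs.1, hs.2⟩
        nlinarith
    rwa [h6, add_sub_cancel] at this

theorem exists_transGen_split (hF : IsFinsler F) {p q : ℝ × N}
    (h : Relation.TransGen (ArcRel I F) p q) {t : ℝ} (h1 : p.1 < t) (h2 : t < q.1) :
    ∃ m, Relation.TransGen (ArcRel I F) p (t, m) ∧ Relation.TransGen (ArcRel I F) (t, m) q := by
  induction h with
  | single h =>
    obtain ⟨m, h3, h4⟩ := h.split hF h1 h2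
    exact ⟨m, .single h3, .single h4⟩
  | @tail m q h h' ih =>
    rcases lt_trichotomy t m.1 with h3 | rfl | h3
    · obtain ⟨m', h4, h5⟩ := ih h3
      exact ⟨m', h4, h5.tail h'⟩
    · exact ⟨m.2, h, .single h'⟩
    · obtain ⟨m', h4, h5⟩ := h'.split hF h3 h2
      exact ⟨m', h.tail h4, .single h5⟩

theorem finslerDist_lt_iff' (hF : IsFinsler F) {x y : N} {T : ℝ} (t : ℝ) :
    finslerDist I F x y < ENNReal.ofReal T ↔
      Relation.TransGen (ArcRel I F) (t, x) (t + T, y) := by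
  rw [← finslerDist_lt_iff hF]
  simp

theorem finslerDist_self (hF : IsFinsler F) (x : N) : finslerDist I F x x = 0 := by
  refine le_antisymm (le_of_forall_gt fun ε hε => ?_) (zero_le)
  obtain ⟨δ, h1, h2⟩ := ENNReal.lt_iff_exists_real_btwn.1 hε
  have h3 : 0 < δ := ENNReal.ofReal_pos.1 h2.1
  refine lt_trans ((finslerDist_lt_iff' hF 0).2 (.single ⟨by simpa using h3, fun _ => x, ?_, rfl, rfl⟩)) h2.2
  exact smoothArc_const _ (by rw [hF.zero]; exact one_pos)

theorem finslerDist_triangle (hF : IsFinsler F) (x y z : N) :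
    finslerDist I F x z ≤ finslerDist I F x y + finslerDist I F y z := by
  by_cases h1 : finslerDist I F x y = ⊤
  · simp [h1]
  by_cases h2 : finslerDist I F y z = ⊤
  · simp [h2]
  refine ENNReal.le_of_forall_pos_le_add fun ε hε _ => ?_
  have hε' : (0 : ℝ) < ε := hε
  have key : ∀ u v : N, finslerDist I F u v ≠ ⊤ →
      finslerDist I F u v < ENNReal.ofReal ((finslerDist I F u v).toReal + ε / 2) := fun u v h => by
    conv_lhs => rw [← ENNReal.ofReal_toReal h]
    rw [ENNReal.ofReal_lt_ofReal_iff (by positivity)]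
    linarith
  have h3 := (finslerDist_lt_iff' hF 0).1 (key x y h1)
  have h4 := (finslerDist_lt_iff' hF (0 + ((finslerDist I F x y).toReal + (ε : ℝ) / 2))).1 (key y z h2)
  have h5 := (finslerDist_lt_iff hF).2 (h3.trans h4)
  refine h5.le.trans ?_
  conv_rhs => rw [← ENNReal.ofReal_toReal h1, ← ENNReal.ofReal_toReal h2,
    ← ENNReal.ofReal_coe_nnreal (p := ε), ← ENNReal.ofReal_add (by positivity) (by positivity),
    ← ENNReal.ofReal_add (by positivity) (by positivity)]
  refine ENNReal.ofReal_le_ofReal ?_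
  simp only
  linarith

theorem continuous_dirDeriv {ψ : N → ℝ} (hψ : ContMDiff I 𝓘(ℝ, ℝ) 1 ψ) :
    Continuous fun v : TangentBundle I N => dirDeriv I ψ v.1 v.2 := by
  have h1 := hψ.continuous_tangentMap le_rfl
  have h2 := (tangentBundleModelSpaceHomeomorph 𝓘(ℝ, ℝ)).continuous
  exact continuous_snd.comp (h2.comp h1)

/-- A function with compact support has a differential bounded by a multiple of `F`. -/
theorem exists_dirDeriv_le [FiniteDimensional ℝ E] (hF : IsFinsler F) {ψ : N → ℝ}
    (hψ : ContMDiff I 𝓘(ℝ, ℝ) 1 ψ) (hc : HasCompactSupport ψ) :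
    ∃ K, 0 ≤ K ∧ ∀ p v, |dirDeriv I ψ p v| ≤ K * F p v := by
  have hsmul : ∀ p (c : ℝ) (v : TangentSpace I p), dirDeriv I ψ p (c • v) = c * dirDeriv I ψ p v :=
    fun p c v => (mfderiv I 𝓘(ℝ, ℝ) ψ p).map_smul c v
  -- Adding `|dψ|` to `F` gives again a Finsler function; both are locally comparable to the norm,
  -- hence to each other.
  have hG : IsFinsler fun p v => F p v + |dirDeriv I ψ p v| :=
    { continuous := hF.continuous.add (continuous_dirDeriv hψ).abs
      pos := fun p v hv => add_pos_of_pos_of_nonneg (hF.pos p v hv) (abs_nonneg _)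
      smul := fun p c v hc => by
        rw [hF.smul p c v hc, hsmul, abs_mul, abs_of_nonneg hc]
        ring }
  have hloc : ∀ x, ∃ K, 0 ≤ K ∧ ∀ᶠ p in 𝓝 x, ∀ v, |dirDeriv I ψ p v| ≤ K * F p v := by
    intro x
    obtain ⟨c, hc, C, hC, h1⟩ := hF.bounds x
    obtain ⟨c', hc', C', hC', h2⟩ := hG.bounds x
    refine ⟨C' / c, by positivity, ?_⟩
    filter_upwards [h1, h2] with p h3 h4 v
    have h5 := (h3 v).1
    have h6 := (h4 v).2
    have h7 := hF.nonneg p v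
    rw [div_mul_eq_mul_div, le_div_iff₀ hc]
    calc |dirDeriv I ψ p v| * c ≤ (F p v + |dirDeriv I ψ p v|) * c := by nlinarith
      _ ≤ C' * ‖(trivializationAt E (TangentSpace I) x ⟨p, v⟩).2‖ * c := by nlinarith
      _ ≤ C' * F p v := by nlinarith
  have hcomp : ∃ K, 0 ≤ K ∧ ∀ p ∈ tsupport ψ, ∀ v, |dirDeriv I ψ p v| ≤ K * F p v := by
    refine IsCompact.induction_on (p := fun s => ∃ K, 0 ≤ K ∧ ∀ p ∈ s, ∀ v,
      |dirDeriv I ψ p v| ≤ K * F p v) hc ⟨0, le_rfl, by simp⟩ ?_ ?_ ?_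
    · rintro s t hst ⟨K, h1, h2⟩
      exact ⟨K, h1, fun p hp => h2 p (hst hp)⟩
    · rintro s t ⟨K, h1, h2⟩ ⟨K', h3, h4⟩
      refine ⟨max K K', le_max_of_le_left h1, ?_⟩
      rintro p (hp | hp) v
      · exact (h2 p hp v).trans (mul_le_mul_of_nonneg_right (le_max_left _ _) (hF.nonneg p v))
      · exact (h4 p hp v).trans (mul_le_mul_of_nonneg_right (le_max_right _ _) (hF.nonneg p v))
    · intro x _
      obtain ⟨K, h1, h2⟩ := hloc x
      exact ⟨_, mem_nhdsWithin_of_mem_nhds h2, K, h1, fun p hp => hp⟩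
  obtain ⟨K, hK, h⟩ := hcomp
  refine ⟨K, hK, fun p v => ?_⟩
  by_cases hp : p ∈ tsupport ψ
  · exact h p hp v
  · have h1 : ψ =ᶠ[𝓝 p] fun _ => (0 : ℝ) := notMem_tsupport_iff_eventuallyEq.1 hp
    have h2 : dirDeriv I ψ p v = 0 := by
      have := congrArg (fun L : TangentSpace I p →L[ℝ] ℝ => L v) (h1.mfderiv_eq (I := I) (I' := 𝓘(ℝ, ℝ)))
      refine this.trans ?_
      rw [mfderiv_const]
      rfl
    rw [h2, abs_zero]
    exact mul_nonneg hK (hF.nonneg p v)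

/-- Points close to `x` for the distance are close to `x` in the manifold. -/
theorem exists_mem_of_finslerDist_lt [T2Space N] [FiniteDimensional ℝ E] [IsManifold I ∞ N]
    (hF : IsFinsler F) {x : N} {U : Set N}
    (hU : U ∈ 𝓝 x) : ∃ η : ℝ, 0 < η ∧ ∀ y, finslerDist I F x y < ENNReal.ofReal η ∨
      finslerDist I F y x < ENNReal.ofReal η → y ∈ U := by
  obtain ⟨f, -, hf⟩ := (SmoothBumpFunction.nhds_basis_support (I := I) hU).mem_iff.1 hU
  have hsm : ContMDiff I 𝓘(ℝ, ℝ) 1 f := f.contMDiff.of_le (by simp)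
  obtain ⟨K, hK, h⟩ := exists_dirDeriv_le hF hsm f.hasCompactSupport
  -- Within distance `1 / (K + 1)` the bump function changes by less than `1`. As it is `1` at `x`,
  -- it stays nonzero.
  have hη : 0 < 1 / (K + 1) := by positivity
  have hKη : K * (1 / (K + 1)) < 1 := by
    rw [mul_one_div, div_lt_one (by positivity)]
    linarith
  refine ⟨1 / (K + 1), hη, fun y hy => hf ?_⟩
  have hfx : f x = 1 := f.eq_one
  have hneg : ∀ p (v : TangentSpace I p), dirDeriv I (fun z => -f z) p v = -dirDeriv I f p v := by
    intro p v
    have := congrArg (fun L : TangentSpace I p →L[ℝ] ℝ => L v)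
      (mfderiv_neg (I := I) (x := p) (f := f))
    exact this
  rw [Function.mem_support]
  rcases hy with hy | hy
  · have := sub_le_mul_of_finslerDist_lt hF hK (ψ := fun z => -f z) hsm.neg
      (fun p v => by
        rw [hneg]
        exact (neg_le_abs _).trans (h p v)) hy
    rw [hfx] at this
    intro h0
    rw [h0] at this
    linarith
  · have := sub_le_mul_of_finslerDist_lt hF hK hsm (fun p v => (le_abs_self _).trans (h p v)) hy
    rw [hfx] at this
    intro h0
    rw [h0] at this
    linarith

end

section
variable {n : ℕ} {M : Type*} [TopologicalSpace M] [ChartedSpace (EuclideanSpace ℝ (Fin n)) M]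
  [IsManifold (𝓡 n) ∞ M] {F : ∀ p : M, TangentSpace (𝓡 n) p → ℝ}

/-- Complement of `exists_mem_of_finslerDist_lt`: near `x`, a segment in the chart has `F`-length at
most `C` times its coordinate length. -/
theorem eventually_finslerDist_lt (hF : IsFinsler F) (x : M) {ε : ℝ} (hε : 0 < ε) :
    ∀ᶠ y in 𝓝 x, finslerDist (𝓡 n) F x y < ENNReal.ofReal ε ∧
      finslerDist (𝓡 n) F y x < ENNReal.ofReal ε := by
  obtain ⟨c, hc, C, hC, hb⟩ := hF.bounds x
  set φ := extChartAt (𝓡 n) x with hφ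
  have h1 : ∀ᶠ u in 𝓝 (φ x), u ∈ φ.target ∧ ∀ v : TangentSpace (𝓡 n) (φ.symm u),
      F (φ.symm u) v ≤ C * ‖(trivializationAt (EuclideanSpace ℝ (Fin n)) (TangentSpace (𝓡 n)) x
        ⟨φ.symm u, v⟩).2‖ := by
    have h2 : ContinuousAt φ.symm (φ x) := continuousAt_extChartAt_symm x
    have h3 : φ.symm (φ x) = x := extChartAt_to_inv x
    have hb' : ∀ᶠ y in 𝓝 (φ.symm (φ x)), ∀ v : TangentSpace (𝓡 n) y, c * ‖(trivializationAt
        (EuclideanSpace ℝ (Fin n)) (TangentSpace (𝓡 n)) x ⟨y, v⟩).2‖ ≤ F y v ∧ F y v ≤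
        C * ‖(trivializationAt (EuclideanSpace ℝ (Fin n)) (TangentSpace (𝓡 n)) x ⟨y, v⟩).2‖ := by
      rw [h3]
      exact hb
    filter_upwards [h2.eventually hb', (isOpen_extChartAt_target x).mem_nhds (mem_extChartAt_target x)]
      with u h4 h5
    exact ⟨h5, fun v => (h4 v).2⟩
  obtain ⟨ρ, hρ, hball⟩ := Metric.eventually_nhds_iff_ball.1 h1
  have key : ∀ u ∈ Metric.ball (φ x) ρ, ∀ w ∈ Metric.ball (φ x) ρ, C * ‖w - u‖ < ε →
      finslerDist (𝓡 n) F (φ.symm u) (φ.symm w) < ENNReal.ofReal ε := by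
    intro u hu w hw hlt
    set ℓ : ℝ → EuclideanSpace ℝ (Fin n) := fun s => u + s • (w - u) with hℓ
    have hmem : ∀ s ∈ Icc (0 : ℝ) 1, ℓ s ∈ Metric.ball (φ x) ρ := by
      intro s hs
      have := (convex_ball (φ x) ρ).add_smul_sub_mem hu hw hs
      exact this
    have hℓs : ContMDiff 𝓘(ℝ, ℝ) (𝓡 n) ∞ ℓ := by
      apply ContDiff.contMDiff
      fun_prop
    have hsm : ContMDiffOn 𝓘(ℝ, ℝ) (𝓡 n) ∞ (fun s => φ.symm (ℓ s)) (Icc 0 1) :=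
      (contMDiffOn_extChartAt_symm (n := ∞) x).comp hℓs.contMDiffOn fun s hs => (hball _ (hmem s hs)).1
    have harc : SmoothArc (𝓡 n) (fun _ _ => True) (fun s => φ.symm (ℓ s)) 0 1 :=
      ⟨hsm, fun _ _ => trivial⟩
    have hvel : ∀ s ∈ Icc (0 : ℝ) 1, (trivializationAt (EuclideanSpace ℝ (Fin n))
        (TangentSpace (𝓡 n)) x ⟨φ.symm (ℓ s), arcVel (𝓡 n) (fun s => φ.symm (ℓ s)) 0 1 s⟩).2 =
          w - u := by
      intro s hs
      have hu1 : UniqueMDiffWithinAt 𝓘(ℝ, ℝ) (Icc (0 : ℝ) 1) s :=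
        ((uniqueDiffOn_Icc one_pos) s hs).uniqueMDiffWithinAt
      have hsrc : φ.symm (ℓ s) ∈ (chartAt (EuclideanSpace ℝ (Fin n)) x).source := by
        have := φ.map_target (hball _ (hmem s hs)).1
        rwa [hφ, extChartAt_source] at this
      have h2 : HasMFDerivWithinAt 𝓘(ℝ, ℝ) (𝓡 n) (fun s => φ.symm (ℓ s)) (Icc 0 1) s
          (mfderivWithin 𝓘(ℝ, ℝ) (𝓡 n) (fun s => φ.symm (ℓ s)) (Icc 0 1) s) :=
        ((hsm s hs).mdifferentiableWithinAt (by simp)).hasMFDerivWithinAt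
      have h3 := (mdifferentiableAt_extChartAt (I := 𝓡 n) hsrc).hasMFDerivAt
      have h4 := h3.comp_hasMFDerivWithinAt s h2
      have h5 : HasFDerivWithinAt (φ ∘ fun s => φ.symm (ℓ s)) (show ℝ →L[ℝ] EuclideanSpace ℝ (Fin n)
        from (mfderiv (𝓡 n) 𝓘(ℝ, EuclideanSpace ℝ (Fin n)) φ (φ.symm (ℓ s))).comp
          (mfderivWithin 𝓘(ℝ, ℝ) (𝓡 n) (fun s => φ.symm (ℓ s)) (Icc 0 1) s)) (Icc 0 1) s :=
        h4.hasFDerivWithinAt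
      have h6 := h5.hasDerivWithinAt.congr (f₁ := ℓ)
        (fun s hs => (φ.right_inv (hball _ (hmem s hs)).1).symm)
        (φ.right_inv (hball _ (hmem s hs)).1).symm
      have h7 : HasDerivWithinAt ℓ (w - u) (Icc 0 1) s := by
        have : HasDerivAt ℓ ((1 : ℝ) • (w - u)) s :=
          ((hasDerivAt_id s).smul_const (w - u)).const_add u
        rw [one_smul] at this
        exact this.hasDerivWithinAt
      have h8 := ((uniqueDiffOn_Icc one_pos) s hs).eq_deriv _ h6 h7
      rw [← h8]
      have h9 : ∀ v : TangentSpace (𝓡 n) (φ.symm (ℓ s)), (trivializationAt (EuclideanSpace ℝ (Fin n))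
          (TangentSpace (𝓡 n)) x ⟨φ.symm (ℓ s), v⟩).2 =
          mfderiv (𝓡 n) 𝓘(ℝ, EuclideanSpace ℝ (Fin n)) φ (φ.symm (ℓ s)) v := fun v => by
        exact trivializationAt_eq_mfderiv_extChartAt hsrc v
      exact h9 _
    have := ArcRel.of_subarc hF harc (c := 0) (d := 1) (T := ε) 0 le_rfl one_pos le_rfl
      fun s hs => by
        have h2 := (hball _ (hmem s hs)).2 (arcVel (𝓡 n) (fun s => φ.symm (ℓ s)) 0 1 s)
        rw [hvel s hs] at h2
        rw [sub_zero, mul_one]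
        exact h2.trans_lt hlt
    have h2 := (finslerDist_lt_iff hF).2 (.single this)
    simpa [hℓ] using h2
  have hcont : ContinuousAt φ x := continuousAt_extChartAt x
  have h2 : ∀ᶠ y in 𝓝 x, φ y ∈ Metric.ball (φ x) ρ := hcont (Metric.ball_mem_nhds _ hρ)
  have h3 : ∀ᶠ y in 𝓝 x, φ y ∈ Metric.ball (φ x) (ε / C) :=
    hcont (Metric.ball_mem_nhds _ (div_pos hε hC))
  filter_upwards [h2, h3, extChartAt_source_mem_nhds (I := 𝓡 n) x] with y h4 h5 h6
  rw [Metric.mem_ball, dist_eq_norm, lt_div_iff₀ hC, mul_comm] at h5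
  have h7 := key _ (Metric.mem_ball_self hρ) _ h4 h5
  have h8 := key _ h4 _ (Metric.mem_ball_self hρ) (by rwa [norm_sub_rev])
  rw [φ.left_inv h6, φ.left_inv (mem_extChartAt_source x)] at h7 h8
  exact ⟨h7, h8⟩

theorem finslerDist_ne_top [ConnectedSpace M] (hF : IsFinsler F) (x y : M) :
    finslerDist (𝓡 n) F x y ≠ ⊤ := by
  have hcl : IsClopen {y | finslerDist (𝓡 n) F x y < ⊤} := by
    constructor
    · rw [← isOpen_compl_iff, isOpen_iff_mem_nhds]
      intro z hz
      filter_upwards [eventually_finslerDist_lt hF z one_pos] with w hw hw'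
      exact hz ((finslerDist_triangle hF x w z).trans_lt
        (ENNReal.add_lt_top.2 ⟨hw', hw.2.trans ENNReal.ofReal_lt_top⟩))
    · rw [isOpen_iff_mem_nhds]
      intro z hz
      filter_upwards [eventually_finslerDist_lt hF z one_pos] with w hw
      exact (finslerDist_triangle hF x z w).trans_lt
        (ENNReal.add_lt_top.2 ⟨hz, hw.1.trans ENNReal.ofReal_lt_top⟩)
  have := hcl.eq_univ ⟨x, by simp [finslerDist_self hF x]⟩
  exact (this ▸ mem_univ y : y ∈ {y | finslerDist (𝓡 n) F x y < ⊤}).ne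

/-- The balls of both directions form neighbourhood bases of the manifold topology (`hnhds`,
`hbasis`). Separation, density, compatibility of the two directions and local compactness are read
off from this. -/
theorem lengthDist_finslerDist [T2Space M] [SecondCountableTopology M] [ConnectedSpace M]
    (hF : IsFinsler F) : LengthDist fun x y : M => (finslerDist (𝓡 n) F x y).toReal := by
  have hfin := finslerDist_ne_top hF
  have hlt : ∀ x y T, (finslerDist (𝓡 n) F x y).toReal < T ↔
      finslerDist (𝓡 n) F x y < ENNReal.ofReal T := fun x y T =>
    (ENNReal.lt_ofReal_iff_toReal_lt (hfin x y)).symm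
  have hnhds : ∀ (x : M) (ε : ℝ), 0 < ε → ∀ᶠ y in 𝓝 x, (finslerDist (𝓡 n) F x y).toReal < ε ∧
      (finslerDist (𝓡 n) F y x).toReal < ε := fun x ε hε => by
    simp only [hlt]
    exact eventually_finslerDist_lt hF x hε
  have hbasis : ∀ (x : M), ∀ U ∈ 𝓝 x, ∃ η : ℝ, 0 < η ∧ ∀ y, (finslerDist (𝓡 n) F x y).toReal < η ∨
      (finslerDist (𝓡 n) F y x).toReal < η → y ∈ U := fun x U hU => by
    simp only [hlt]
    exact exists_mem_of_finslerDist_lt hF hU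
  have hself : ∀ x : M, (finslerDist (𝓡 n) F x x).toReal = 0 := fun x => by
    rw [finslerDist_self hF]; rfl
  have : LocallyCompactSpace M := Manifold.locallyCompact_of_finiteDimensional (𝓡 n)
  refine ⟨fun x y => ENNReal.toReal_nonneg, hself, fun x y z => ?_, fun x y h => ?_,
    fun x y a b ha hb h => ?_, ?_, fun x ε hε => ?_, fun x => ?_⟩
  · rw [← ENNReal.toReal_add (hfin _ _) (hfin _ _)]
    exact ENNReal.toReal_mono (ENNReal.add_ne_top.2 ⟨hfin _ _, hfin _ _⟩) (finslerDist_triangle hF x y z)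
  · by_contra hne
    obtain ⟨η, hη, h1⟩ := hbasis x _ (isOpen_compl_singleton.mem_nhds hne)
    exact h1 y (Or.inl (by rw [h]; exact hη)) rfl
  · rw [hlt] at h
    obtain ⟨m, h1, h2⟩ := exists_transGen_split hF ((finslerDist_lt_iff' hF 0).1 h) (t := a)
      (by simpa using ha) (by simpa using hb)
    refine ⟨m, ?_, ?_⟩
    · rw [hlt]
      simpa using (finslerDist_lt_iff hF).2 h1
    · rw [hlt]
      simpa using (finslerDist_lt_iff hF).2 h2
  · refine ⟨TopologicalSpace.denseSeq M, fun x ε hε => ?_⟩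
    obtain ⟨_, ⟨n, rfl⟩, hy⟩ := (TopologicalSpace.denseRange_denseSeq M).inter_nhds_nonempty
      (hnhds x ε hε)
    exact ⟨n, hy⟩
  · obtain ⟨η, hη, h⟩ := hbasis x _ (hnhds x ε hε)
    exact ⟨η, hη, fun y => ⟨fun h1 => (h y (Or.inl h1)).2, fun h1 => (h y (Or.inr h1)).1⟩⟩
  · obtain ⟨K, hK, hKx⟩ := exists_compact_mem_nhds x
    obtain ⟨η, hη, h⟩ := hbasis x K hKx
    refine ⟨η / 2, half_pos hη, fun y hy => ?_⟩
    obtain ⟨z, -, φ, hφ, hz⟩ := hK.tendsto_subseq fun n => h (y n)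
      ((hy n).imp (fun h => h.trans_lt (half_lt_self hη)) fun h => h.trans_lt (half_lt_self hη))
    refine ⟨z, φ, hφ, ?_, ?_⟩ <;>
    · refine tendsto_order.2 ⟨fun a ha => .of_forall fun k => ha.trans_le ENNReal.toReal_nonneg,
        fun a ha => ?_⟩
      filter_upwards [hz.eventually (hnhds z a ha)] with k hk
      first | exact hk.1 | exact hk.2

end

/-! ### Chronological sequences and their Busemann functions. -/

section
variable {X : Type*}

/-- The chronological relation on `ℝ × X` given by a generalized distance. -/
def distRel (δ : X → X → ℝ) (p q : ℝ × X) : Prop := δ p.2 q.2 < q.1 - p.1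

/-- Chronological sequences. -/
def IsChronChain (δ : X → X → ℝ) (u : ℕ → ℝ × X) : Prop := ∀ n, distRel δ (u n) (u (n + 1))

/-- The Busemann function of a chronological sequence. -/
def chainBusemann (δ : X → X → ℝ) (u : ℕ → ℝ × X) (x : X) : EReal :=
  ⨆ n, (((u n).1 - δ x (u n).2 : ℝ) : EReal)

/-- The set of the Busemann functions of chronological sequences. -/
def chainFun (δ : X → X → ℝ) : Set (X → EReal) :=
  {f | ∃ u, IsChronChain δ u ∧ f = chainBusemann δ u}

variable {δ : X → X → ℝ}

namespace LengthDist

theorem distRel_trans (h : LengthDist δ) {p q r : ℝ × X} (h1 : distRel δ p q) (h2 : distRel δ q r) :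
    distRel δ p r := by
  have := h.triangle p.2 q.2 r.2
  unfold distRel at *
  linarith

theorem distRel_lt (h : LengthDist δ) {p q : ℝ × X} (h1 : distRel δ p q) : p.1 < q.1 := by
  have := h.nonneg p.2 q.2
  unfold distRel at h1
  linarith

theorem chain_rel (h : LengthDist δ) {u : ℕ → ℝ × X} (hu : IsChronChain δ u) {i j : ℕ}
    (hij : i < j) : distRel δ (u i) (u j) := by
  induction j, hij using Nat.le_induction with
  | base => exact hu i
  | succ j _ ih => exact h.distRel_trans ih (hu j)

theorem chain_strictMono (h : LengthDist δ) {u : ℕ → ℝ × X} (hu : IsChronChain δ u) :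
    StrictMono fun n => (u n).1 :=
  fun _ _ hij => h.distRel_lt (h.chain_rel hu hij)

theorem sub_lt_sub (h : LengthDist δ) {p q : ℝ × X} (h1 : distRel δ p q) (x : X) :
    p.1 - δ x p.2 < q.1 - δ x q.2 := by
  have := h.triangle x p.2 q.2
  unfold distRel at h1
  linarith

theorem chain_sub_mono (h : LengthDist δ) {u : ℕ → ℝ × X} (hu : IsChronChain δ u) (x : X) :
    StrictMono fun n => (u n).1 - δ x (u n).2 :=
  fun _ _ hij => h.sub_lt_sub (h.chain_rel hu hij) x

theorem tendsto_chainBusemann (h : LengthDist δ) {u : ℕ → ℝ × X} (hu : IsChronChain δ u) (x : X) :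
    Tendsto (fun n => (((u n).1 - δ x (u n).2 : ℝ) : EReal)) atTop (𝓝 (chainBusemann δ u x)) :=
  tendsto_atTop_iSup fun _ _ hij => EReal.coe_le_coe_iff.2 ((h.chain_sub_mono hu x).monotone hij)

end LengthDist
end

/-! ### Curves of speed less than one and chronological sequences. -/

theorem ArcRel.reverse {E : Type*} [NormedAddCommGroup E] [NormedSpace ℝ E] {H : Type*}
    [TopologicalSpace H] {I : ModelWithCorners ℝ E H} {N : Type*} [TopologicalSpace N]
    [ChartedSpace H N] {F F' : ∀ p : N, TangentSpace I p → ℝ} (hF : ∀ p v, F' p (-v) = F p v)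
    {p q : ℝ × N} (h : ArcRel I F p q) : ArcRel I F' (-q.1, q.2) (-p.1, p.2) := by
  obtain ⟨h1, γ, h2, h3, h4⟩ := h
  obtain ⟨h5, h6⟩ := h2.comp_affine (c := -q.1) (d := -p.1) (k := -1) (m := 0) (by simpa using h1)
    (fun s hs => ⟨by linarith [hs.2], by linarith [hs.1]⟩)
  refine ⟨by simpa using h1, _, ⟨h5, fun s hs => ?_⟩, by simpa using h4, by simpa using h3⟩
  have h7 := h2.2 (-1 * s + 0) ⟨by linarith [hs.2], by linarith [hs.1]⟩
  have h8 : F' _ (arcVel I (fun s => γ (-1 * s + 0)) (-q.1) (-p.1) s) < 1 := by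
    rw [h6 s hs, neg_one_smul, hF]
    exact h7
  exact h8

theorem tendsto_leftOf {τ : ℕ → ℝ} {Ω : EReal} (h1 : Tendsto (fun j => (τ j : EReal)) atTop (𝓝 Ω))
    (h2 : ∀ᶠ j in atTop, (τ j : EReal) < Ω) : Tendsto τ atTop (leftOf Ω) :=
  tendsto_comap_iff.2 (tendsto_nhdsWithin_iff.2 ⟨h1, h2⟩)

theorem leftOf_neBot {τ : ℕ → ℝ} {Ω : EReal} (h1 : StrictMono τ)
    (h2 : Tendsto (fun j => (τ j : EReal)) atTop (𝓝 Ω)) :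
    (∀ j, (τ j : EReal) < Ω) ∧ (leftOf Ω).NeBot ∧ ∀ j, ∀ᶠ s in leftOf Ω, τ j < s ∧ (s : EReal) < Ω := by
  have hlt : ∀ j, (τ j : EReal) < Ω := fun j =>
    (EReal.coe_lt_coe_iff.2 (h1 (Nat.lt_succ_self j))).trans_le
      (ge_of_tendsto h2 ((eventually_ge_atTop (j + 1)).mono fun k hk =>
        EReal.coe_le_coe_iff.2 (h1.monotone hk)))
  refine ⟨hlt, (tendsto_leftOf h2 (.of_forall hlt)).neBot, fun j => ?_⟩
  have h3 : ∀ᶠ z : EReal in 𝓝[<] Ω, (τ j : EReal) < z ∧ z < Ω := Ioo_mem_nhdsLT (hlt j)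
  filter_upwards [(tendsto_comap (f := fun s : ℝ => (s : EReal))).eventually h3] with s hs
  exact ⟨EReal.coe_lt_coe_iff.1 hs.1, hs.2⟩

section
variable {n : ℕ} {M : Type*} [TopologicalSpace M] [ChartedSpace (EuclideanSpace ℝ (Fin n)) M]
  [IsManifold (𝓡 n) ∞ M] {F : ∀ p : M, TangentSpace (𝓡 n) p → ℝ}

variable (F) in
/-- The real-valued distance of a Finsler function. -/
def finslerReal (x y : M) : ℝ := (finslerDist (𝓡 n) F x y).toReal

theorem distRel_iff_transGen [ConnectedSpace M] (hF : IsFinsler F) {p q : ℝ × M} :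
    distRel (finslerReal F) p q ↔ Relation.TransGen (ArcRel (𝓡 n) F) p q := by
  rw [← finslerDist_lt_iff hF, ENNReal.lt_ofReal_iff_toReal_lt (finslerDist_ne_top hF _ _)]
  rfl

theorem coe_finslerReal [ConnectedSpace M] (hF : IsFinsler F) (x y : M) :
    ((finslerReal F x y : ℝ) : EReal) = (finslerDist (𝓡 n) F x y : EReal) := by
  unfold finslerReal
  rw [← EReal.toReal_coe_ennreal]
  exact EReal.coe_toReal (by simpa using finslerDist_ne_top hF x y) (EReal.coe_ennreal_ne_bot _)

/-- By the triangle inequality `s - d(x, c(s))` is monotone along the curve, so its limit can be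
computed at the points of the partition. -/
theorem SlowCurve.exists_chain [T2Space M] [SecondCountableTopology M] [ConnectedSpace M]
    (hF : IsFinsler F) (c : SlowCurve (𝓡 n) F) :
    ∃ u, IsChronChain (finslerReal F) u ∧ Tendsto (fun j => ((u j).1 : EReal)) atTop (𝓝 c.Ω) ∧
      (leftOf c.Ω).NeBot ∧
      ∀ x, Tendsto (fun s : ℝ => (s : EReal) - (finslerDist (𝓡 n) F x (c.toFun s) : EReal))
        (leftOf c.Ω) (𝓝 (chainBusemann (finslerReal F) u x)) := by
  obtain ⟨τ, h0, h1, h2, h3⟩ := c.exists_partition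
  obtain ⟨hlt, hne, hev⟩ := leftOf_neBot h1 h2
  have hL := lengthDist_finslerDist hF
  have hchain : IsChronChain (finslerReal F) fun j => (τ j, c.toFun (τ j)) := fun j =>
    (distRel_iff_transGen hF).2 (.single ⟨h1 (Nat.lt_succ_self j), c.toFun, h3 j, rfl, rfl⟩)
  have hsub : ∀ j a b, τ j ≤ a → a < b → b ≤ τ (j + 1) →
      distRel (finslerReal F) (a, c.toFun a) (b, c.toFun b) := by
    intro j a b h4 h5 h6
    have h7 := ArcRel.of_subarc hF (h3 j) (c := a) (d := b) (T := b - a) a h4 h5 h6 fun s hs => by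
      have : F (c.toFun s) (arcVel (𝓡 n) c.toFun (τ j) (τ (j + 1)) s) < 1 :=
        (h3 j).2 s ⟨h4.trans hs.1, hs.2.trans h6⟩
      nlinarith
    rw [add_sub_cancel] at h7
    exact (distRel_iff_transGen hF).2 (.single h7)
  have hcoe : ∀ x s, ((s - finslerReal F x (c.toFun s) : ℝ) : EReal) =
      (s : EReal) - (finslerDist (𝓡 n) F x (c.toFun s) : EReal) := fun x s => by
    rw [EReal.coe_sub, coe_finslerReal hF]
  refine ⟨fun j => (τ j, c.toFun (τ j)), hchain, h2, hne, fun x => ?_⟩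
  simp only [← hcoe]
  have hpiece : ∀ s, τ 0 < s → (s : EReal) < c.Ω → ∃ j, τ j ≤ s ∧ s < τ (j + 1) := by
    intro s hs hs'
    have hex : ∃ j, s < τ j := by
      obtain ⟨j, hj⟩ := (h2.eventually (lt_mem_nhds hs')).exists
      exact ⟨j, EReal.coe_lt_coe_iff.1 hj⟩
    classical
    obtain ⟨j, hj⟩ : ∃ j, Nat.find hex = j + 1 := Nat.exists_eq_succ_of_ne_zero fun h => by
      have := Nat.find_spec hex
      rw [h] at this
      exact lt_asymm this hs
    refine ⟨j, not_lt.1 (Nat.find_min hex (by omega)), ?_⟩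
    rw [← hj]
    exact Nat.find_spec hex
  have hle : ∀ (i : ℕ) s t, (s = t ∨ distRel (finslerReal F) (s, c.toFun s) (t, c.toFun t)) →
      s - finslerReal F x (c.toFun s) ≤ t - finslerReal F x (c.toFun t) := by
    rintro - s t (rfl | h)
    · exact le_rfl
    · exact (hL.sub_lt_sub h x).le
  refine tendsto_order.2 ⟨fun a ha => ?_, fun a ha => ?_⟩
  · obtain ⟨i, hi⟩ := lt_iSup_iff.1 ha
    filter_upwards [hev i, hev 0] with s hs hs0
    obtain ⟨j, hj1, hj2⟩ := hpiece s hs0.1 hs.2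
    refine hi.trans_le (EReal.coe_le_coe_iff.2 ?_)
    have hij : i ≤ j := by
      by_contra hlt
      exact absurd (h1.monotone (by omega : j + 1 ≤ i)) (not_le.2 (hs.1.trans hj2))
    refine ((hL.chain_sub_mono hchain x).monotone hij).trans (hle 0 _ _ ?_)
    exact hj1.eq_or_lt.imp id fun h => hsub j _ _ le_rfl h hj2.le
  · filter_upwards [hev 0] with s hs0
    obtain ⟨j, hj1, hj2⟩ := hpiece s hs0.1 hs0.2
    refine lt_of_le_of_lt ?_ ha
    refine le_trans (EReal.coe_le_coe_iff.2 (hle 0 _ _ (Or.inr (hsub j _ _ hj1 hj2 le_rfl)))) ?_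
    exact le_iSup (fun j => ((τ j - finslerReal F x (c.toFun (τ j)) : ℝ) : EReal)) (j + 1)

/-- Each step of the sequence is a finite path of arcs. After refinement to single arcs these form a
curve through all points of the sequence, and the limit along the curve is the limit along these
points. -/
theorem exists_slowCurve_of_chain [T2Space M] [SecondCountableTopology M] [ConnectedSpace M]
    (hF : IsFinsler F) {u : ℕ → ℝ × M} (hu : IsChronChain (finslerReal F) u) :
    ∃ c : SlowCurve (𝓡 n) F, Tendsto (fun j => ((u j).1 : EReal)) atTop (𝓝 c.Ω) ∧
      (leftOf c.Ω).NeBot ∧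
      ∀ x, Tendsto (fun s : ℝ => (s : EReal) - (finslerDist (𝓡 n) F x (c.toFun s) : EReal))
        (leftOf c.Ω) (𝓝 (chainBusemann (finslerReal F) u x)) := by
  obtain ⟨v, φ, hφ, -, hvφ, hv⟩ := exists_refine_transGen fun n => (distRel_iff_transGen hF).1 (hu n)
  obtain ⟨c, -, hΩ, hc⟩ := exists_slowCurve_of_arcRel hv
  have hL := lengthDist_finslerDist hF
  have hmono : StrictMono fun k => (v k).1 := strictMono_nat_of_lt_succ fun k => (hv k).1
  have hlim : Tendsto (fun k => ((v k).1 : EReal)) atTop (𝓝 c.Ω) := by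
    rw [hΩ]
    exact tendsto_atTop_iSup fun i j hij => EReal.coe_le_coe_iff.2 (hmono.monotone hij)
  have hlimu : Tendsto (fun j => ((u j).1 : EReal)) atTop (𝓝 c.Ω) := by
    simpa [Function.comp_def, hvφ] using hlim.comp hφ.tendsto_atTop
  obtain ⟨u', -, -, hne, h⟩ := c.exists_chain hF
  refine ⟨c, hlimu, hne, fun x => ?_⟩
  convert h x using 2
  have h3 : Tendsto (fun j => (u j).1) atTop (leftOf c.Ω) :=
    tendsto_leftOf hlimu (.of_forall fun j =>
      (leftOf_neBot (hL.chain_strictMono hu) hlimu).1 j)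
  refine tendsto_nhds_unique (hL.tendsto_chainBusemann hu x) ?_
  convert (h x).comp h3 using 2 with j
  have h4 := hc (φ j)
  rw [hvφ] at h4
  simp only [Function.comp, h4]
  rw [EReal.coe_sub, ← coe_finslerReal hF]
  rfl

end

/-! ### The chronological relation and the Busemann functions in terms of the distance. -/

namespace StandardStationary

variable {n : ℕ} {M : Type*} [TopologicalSpace M] [ChartedSpace (EuclideanSpace ℝ (Fin n)) M]
  [IsManifold (𝓡 n) ∞ M] (S : StandardStationary n M)

theorem fermatPlus_neg (x : M) (v : TangentSpace (𝓡 n) x) :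
    S.fermatPlus x (-v) = S.fermatMinus x v := by
  rw [← S.fermatMinus_neg, neg_neg]

/-- Reversing a curve exchanges the two Fermat metrics. -/
theorem distMinus_eq (x y : M) : S.distMinus x y = S.distPlus y x := by
  have key : ∀ (F F' : ∀ p : M, TangentSpace (𝓡 n) p → ℝ) (_ : IsFinsler F) (_ : IsFinsler F'),
      (∀ p v, F' p (-v) = F p v) → ∀ x y : M, finslerDist (𝓡 n) F' y x ≤ finslerDist (𝓡 n) F x y := by
    intro F F' hF hF' hneg x y
    refine le_of_forall_gt fun a ha => ?_
    obtain ⟨T, h1, h2⟩ := ENNReal.lt_iff_exists_real_btwn.1 ha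
    refine lt_trans ?_ h2.2
    have h3 := (finslerDist_lt_iff' hF 0).1 h2.1
    have h4 : ∀ p q : ℝ × M, Relation.TransGen (ArcRel (𝓡 n) F) p q →
        Relation.TransGen (ArcRel (𝓡 n) F') (-q.1, q.2) (-p.1, p.2) := by
      intro p q hpq
      induction hpq with
      | single h => exact .single (h.reverse hneg)
      | tail _ h ih => exact .head (h.reverse hneg) ih
    simpa using (finslerDist_lt_iff hF').2 (h4 _ _ h3)
  exact le_antisymm (key _ _ S.isFinsler_plus S.isFinsler_minus S.fermatMinus_neg y x)
    (key _ _ S.isFinsler_minus S.isFinsler_plus S.fermatPlus_neg x y)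

theorem stationaryField_eq (p : ℝ × M) :
    dt (n := n) p (stationaryField p) = 1 ∧ dπ (n := n) p (stationaryField p) = 0 := by
  have h : HasMFDerivAt 𝓘(ℝ, ℝ) (𝓘(ℝ, ℝ).prod (𝓡 n)) (fun s : ℝ => (s, p.2)) p.1
      ((ContinuousLinearMap.id ℝ (TangentSpace 𝓘(ℝ, ℝ) p.1)).prod 0) :=
    (hasMFDerivAt_id p.1).prodMk (hasMFDerivAt_const p.2 p.1)
  have h2 := congrArg (fun L : ℝ →L[ℝ] ℝ × EuclideanSpace ℝ (Fin n) => L 1) h.mfderiv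
  unfold dt dπ
  rw [mfderiv_fst, mfderiv_snd]
  exact ⟨congrArg Prod.fst h2, congrArg Prod.snd h2⟩

/-- Future-directed timelike vectors are those with `dt(u) > F⁺(dπ(u))`. -/
theorem isFutureTimelike_iff (p : ℝ × M) (u : TangentSpace (𝓘(ℝ, ℝ).prod (𝓡 n)) p) :
    S.IsFutureTimelike p u ↔ S.fermatPlus p.2 (dπ p u) < dt p u := by
  obtain ⟨h1, h2⟩ := stationaryField_eq (n := n) p
  unfold IsFutureTimelike metric fermatPlus
  rw [h1, h2]
  simp only [map_zero, mul_zero, add_zero, mul_one]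
  have hΛ := S.Λ_pos p
  set a := S.g₀.inner p.2 (dπ p u) (dπ p u)
  set w := S.oneForm p.2 (dπ p u)
  set t := dt p u
  have ha : 0 ≤ a := S.inner_nonneg _ _
  rw [mul_neg_iff, mul_neg_iff]
  simp only [hΛ, true_and, not_lt.2 hΛ.le, false_and, or_false]
  constructor
  · rintro ⟨h3, h4⟩
    have h5 : √(a + w ^ 2) < t - w := by
      rw [Real.sqrt_lt' (by linarith)]
      nlinarith
    linarith
  · intro h
    have h5 : √(a + w ^ 2) < t - w := by linarith
    have h6 := Real.sqrt_nonneg (a + w ^ 2)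
    have h7 := Real.sq_sqrt (show 0 ≤ a + w ^ 2 by positivity)
    constructor
    · nlinarith
    · linarith

variable [T2Space M] [SecondCountableTopology M] [ConnectedSpace M]

/-- The real-valued distance `d⁺`. -/
def dist : M → M → ℝ := finslerReal S.fermatPlus

theorem lengthDist : LengthDist S.dist := lengthDist_finslerDist S.isFinsler_plus

theorem coe_distPlus (x y : M) : (S.distPlus x y : EReal) = (S.dist x y : EReal) :=
  (coe_finslerReal S.isFinsler_plus x y).symm

theorem ofReal_dist (x y : M) : S.distPlus x y = ENNReal.ofReal (S.dist x y) :=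
  (ENNReal.ofReal_toReal (finslerDist_ne_top S.isFinsler_plus x y)).symm

theorem finslerReal_minus : finslerReal S.fermatMinus = fun x y => S.dist y x := by
  ext x y
  exact congrArg ENNReal.toReal (S.distMinus_eq x y)

/-- The elapsed time minus the `F⁺`-length of the projected curve has derivative `dt - F⁺(dπ) > 0`,
so the time elapsed along the arc exceeds that length strictly. -/
theorem arcRel_of_timelike {γ : ℝ → ℝ × M} {a b : ℝ} (hab : a < b)
    (h : SmoothArc (𝓘(ℝ, ℝ).prod (𝓡 n)) S.IsFutureTimelike γ a b) :
    distRel S.dist (γ a) (γ b) := by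
  have h1 : ∀ s ∈ Icc a b, HasMFDerivWithinAt 𝓘(ℝ, ℝ) (𝓘(ℝ, ℝ).prod (𝓡 n)) γ (Icc a b) s
      (mfderivWithin 𝓘(ℝ, ℝ) (𝓘(ℝ, ℝ).prod (𝓡 n)) γ (Icc a b) s) := fun s hs =>
    ((h.1 s hs).mdifferentiableWithinAt (by simp)).hasMFDerivWithinAt
  have hu : ∀ s ∈ Icc a b, UniqueMDiffWithinAt 𝓘(ℝ, ℝ) (Icc a b) s := fun s hs =>
    ((uniqueDiffOn_Icc hab) s hs).uniqueMDiffWithinAt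
  set V := fun s => mfderivWithin 𝓘(ℝ, ℝ) (𝓘(ℝ, ℝ).prod (𝓡 n)) γ (Icc a b) s (1 : ℝ) with hV
  have hx : SmoothArc (𝓡 n) (fun _ _ => True) (fun s => (γ s).2) a b :=
    ⟨contMDiff_snd.comp_contMDiffOn h.1, fun _ _ => trivial⟩
  have hxv : ∀ s ∈ Icc a b, arcVel (𝓡 n) (fun s => (γ s).2) a b s = dπ (γ s) (V s) := by
    intro s hs
    have h2 := ((mdifferentiableAt_snd (I := 𝓘(ℝ, ℝ)) (I' := 𝓡 n)
      (x := γ s)).hasMFDerivAt.comp_hasMFDerivWithinAt s (h1 s hs)).mfderivWithin (hu s hs)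
    exact congrArg (fun L : ℝ →L[ℝ] EuclideanSpace ℝ (Fin n) => L 1) h2
  have htv : ∀ s ∈ Icc a b, HasDerivWithinAt (fun s => (γ s).1) (dt (γ s) (V s)) (Icc a b) s := by
    intro s hs
    have h2 : HasFDerivWithinAt (fun s => (γ s).1) (show ℝ →L[ℝ] ℝ from
        (mfderiv (𝓘(ℝ, ℝ).prod (𝓡 n)) 𝓘(ℝ, ℝ) Prod.fst (γ s)).comp
          (mfderivWithin 𝓘(ℝ, ℝ) (𝓘(ℝ, ℝ).prod (𝓡 n)) γ (Icc a b) s)) (Icc a b) s :=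
      ((mdifferentiableAt_fst (I := 𝓘(ℝ, ℝ)) (I' := 𝓡 n)
        (x := γ s)).hasMFDerivAt.comp_hasMFDerivWithinAt s (h1 s hs)).hasFDerivWithinAt
    exact h2.hasDerivWithinAt
  have htl : ∀ s ∈ Icc a b, S.fermatPlus (γ s).2 (arcVel (𝓡 n) (fun s => (γ s).2) a b s) <
      dt (γ s) (V s) := fun s hs => by
    rw [hxv s hs, ← S.isFutureTimelike_iff]
    exact h.2 s hs
  set f := fun s => S.fermatPlus (γ s).2 (arcVel (𝓡 n) (fun s => (γ s).2) a b s) with hf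
  have hfc : ContinuousOn f (Icc a b) := hx.continuousOn_speed S.isFinsler_plus hab
  have hint : ∫ s in a..b, f s < (γ b).1 - (γ a).1 := by
    have hfi : ∀ c d, c ∈ Icc a b → d ∈ Icc a b →
        IntervalIntegrable f MeasureTheory.volume c d := fun c d hc hd =>
      (hfc.mono (uIcc_subset_Icc hc hd)).intervalIntegrable
    have hstrict : StrictMonoOn (fun s => (γ s).1 - ∫ u in a..s, f u) (Icc a b) := by
      refine strictMonoOn_of_deriv_pos (convex_Icc a b) ?_ fun s hs => ?_
      · refine ContinuousOn.sub (fun s hs => (htv s hs).continuousWithinAt) ?_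
        have := intervalIntegral.continuousOn_primitive_interval (μ := MeasureTheory.volume)
          (f := f) (a := a) (b := b) (by rw [uIcc_of_le hab.le]; exact hfc.integrableOn_Icc)
        rwa [uIcc_of_le hab.le] at this
      · rw [interior_Icc] at hs
        have hmem := Ioo_subset_Icc_self hs
        have hnh := Icc_mem_nhds hs.1 hs.2
        have h2 := (htv s hmem).hasDerivAt hnh
        have h3 := intervalIntegral.integral_hasDerivAt_right (hfi a s ⟨le_rfl, hab.le⟩ hmem)
          (hfc.stronglyMeasurableAtFilter_nhdsWithin measurableSet_Icc s |>.filter_mono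
            (by rw [nhdsWithin_eq_nhds.2 hnh])) (hfc.continuousAt hnh)
        exact lt_of_lt_of_eq (sub_pos.2 (htl s hmem)) (HasDerivAt.deriv (h2.sub h3)).symm
    have := hstrict ⟨le_rfl, hab.le⟩ ⟨hab.le, le_rfl⟩ hab
    simp only [intervalIntegral.integral_same] at this
    linarith
  have h3 : finslerDist (𝓡 n) S.fermatPlus (γ a).2 (γ b).2 ≤ ENNReal.ofReal (∫ s in a..b, f s) := by
    refine sInf_le ⟨fun s => (γ s).2, a, b, ⟨1, fun i => if i = 0 then a else b, rfl, rfl, ?_⟩, rfl,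
      rfl, (hx.lintegral_eq S.isFinsler_plus hab).symm⟩
    intro j hj
    obtain rfl : j = 0 := by omega
    exact ⟨hab, hx⟩
  have h4 : 0 ≤ ∫ s in a..b, f s :=
    intervalIntegral.integral_nonneg hab.le fun s _ => S.isFinsler_plus.nonneg _ _
  have h5 := ENNReal.toReal_le_of_le_ofReal h4 h3
  exact h5.trans_lt hint

/-- The chronological relation in terms of `d⁺`. -/
theorem chron_iff (p q : ℝ × M) : S.chron p q ↔ distRel S.dist p q := by
  constructor
  · rintro ⟨γ, a, b, hab, ⟨k, τ, rfl, rfl, hτ⟩, rfl, rfl⟩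
    have H : ∀ j ≤ k, j = 0 ∨ distRel S.dist (γ (τ 0)) (γ (τ j)) := by
      intro j
      induction j with
      | zero => exact fun _ => Or.inl rfl
      | succ j ih =>
        intro hj
        have h1 := S.arcRel_of_timelike (hτ j hj).1 (hτ j hj).2
        rcases ih (by omega) with rfl | h2
        · exact Or.inr h1
        · exact Or.inr (S.lengthDist.distRel_trans h2 h1)
    rcases H k le_rfl with rfl | h
    · exact absurd hab (lt_irrefl _)
    · exact h
  · intro h
    have h1 := (distRel_iff_transGen S.isFinsler_plus).1 h
    obtain ⟨γ, ⟨k, τ, h2, h3, hτ⟩, h4, h5⟩ := exists_piecewiseSmooth_of_transGen h1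
    -- A curve of speed less than `1` is lifted to its graph, for which `dt = 1 > F⁺`.
    refine ⟨fun s => (s, γ s), p.1, q.1, transGen_arcRel_shift h1, ⟨k, τ, h2, h3, fun j hj =>
      ⟨(hτ j hj).1, contMDiffOn_id.prodMk (hτ j hj).2.1, fun s hs => ?_⟩⟩, Prod.ext rfl h4,
      Prod.ext rfl h5⟩
    rw [isFutureTimelike_iff]
    have h6 : HasMFDerivWithinAt 𝓘(ℝ, ℝ) (𝓡 n) γ (Icc (τ j) (τ (j + 1))) s
        (mfderivWithin 𝓘(ℝ, ℝ) (𝓡 n) γ (Icc (τ j) (τ (j + 1))) s) :=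
      (((hτ j hj).2.1 s hs).mdifferentiableWithinAt (by simp)).hasMFDerivWithinAt
    have h7 := ((hasMFDerivWithinAt_id (Icc (τ j) (τ (j + 1))) s).prodMk h6).mfderivWithin
      ((uniqueDiffOn_Icc (hτ j hj).1) s hs).uniqueMDiffWithinAt
    have h8 := (hτ j hj).2.2 s hs
    unfold dt dπ
    rw [mfderiv_fst, mfderiv_snd]
    have h9 := congrArg (fun L : ℝ →L[ℝ] ℝ × EuclideanSpace ℝ (Fin n) => L 1) h7
    have h10 : S.fermatPlus (γ s) (mfderivWithin 𝓘(ℝ, ℝ) (𝓡 n) γ (Icc (τ j) (τ (j + 1))) s (1 : ℝ)) <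
      (1 : ℝ) := h8
    have h11 := congrArg Prod.fst h9
    have h12 := congrArg Prod.snd h9
    refine lt_of_eq_of_lt (congrArg (S.fermatPlus (γ s)) ?_) (lt_of_lt_of_eq h10 ?_)
    · exact h12
    · exact h11.symm

theorem busemannPlus_eq_chain (c : SlowCurve (𝓡 n) S.fermatPlus) :
    ∃ u, IsChronChain S.dist u ∧ Tendsto (fun j => ((u j).1 : EReal)) atTop (𝓝 c.Ω) ∧
      S.busemannPlus c = chainBusemann S.dist u := by
  obtain ⟨u, h1, h2, h3, h4⟩ := c.exists_chain S.isFinsler_plus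
  exact ⟨u, h1, h2, funext fun x => (h4 x).limsup_eq⟩

theorem exists_busemannPlus_eq {u : ℕ → ℝ × M} (hu : IsChronChain S.dist u) :
    ∃ c : SlowCurve (𝓡 n) S.fermatPlus, Tendsto (fun j => ((u j).1 : EReal)) atTop (𝓝 c.Ω) ∧
      S.busemannPlus c = chainBusemann S.dist u := by
  obtain ⟨c, h1, h2, h4⟩ := exists_slowCurve_of_chain S.isFinsler_plus hu
  exact ⟨c, h1, funext fun x => (h4 x).limsup_eq⟩

theorem tendsto_neg_of_tendsto_sub {ℓ : Filter ℝ} {g : ℝ → ENNReal} {L : EReal}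
    (h : Tendsto (fun s : ℝ => (s : EReal) - (g s : EReal)) ℓ (𝓝 L)) :
    Tendsto (fun s : ℝ => -(s : EReal) + (g s : EReal)) ℓ (𝓝 (-L)) := by
  convert ((continuous_neg (G := EReal)).tendsto L).comp h using 2 with s
  simp only [Function.comp]
  rw [EReal.neg_sub (Or.inl (EReal.coe_ne_bot s)) (Or.inl (EReal.coe_ne_top s))]

/-- The backward Busemann functions are the negatives of the Busemann functions for the reversed
distance. -/
theorem busemannMinus_eq_chain (c : SlowCurve (𝓡 n) S.fermatMinus) :
    ∃ u, IsChronChain (fun x y => S.dist y x) u ∧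
      Tendsto (fun j => ((u j).1 : EReal)) atTop (𝓝 c.Ω) ∧
      S.busemannMinus c = fun x => -chainBusemann (fun x y => S.dist y x) u x := by
  obtain ⟨u, h1, h2, h3, h4⟩ := c.exists_chain S.isFinsler_minus
  rw [S.finslerReal_minus] at h1 h4
  exact ⟨u, h1, h2, funext fun x => (tendsto_neg_of_tendsto_sub (h4 x)).liminf_eq⟩

theorem exists_busemannMinus_eq {u : ℕ → ℝ × M} (hu : IsChronChain (fun x y => S.dist y x) u) :
    ∃ c : SlowCurve (𝓡 n) S.fermatMinus, Tendsto (fun j => ((u j).1 : EReal)) atTop (𝓝 c.Ω) ∧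
      S.busemannMinus c = fun x => -chainBusemann (fun x y => S.dist y x) u x := by
  rw [← S.finslerReal_minus] at hu
  obtain ⟨c, h1, h2, h4⟩ := exists_slowCurve_of_chain S.isFinsler_minus hu
  rw [S.finslerReal_minus] at h4
  exact ⟨c, h1, funext fun x => (tendsto_neg_of_tendsto_sub (h4 x)).liminf_eq⟩

end StandardStationary

/-! ### Indecomposable sets and S-relation for an abstract chronological relation. -/

namespace Causal

variable {V : Type*} {r : V → V → Prop}

/-- Transitive and dense relations. -/
structure IsChronological (r : V → V → Prop) : Prop where
  trans : ∀ p q s, r p q → r q s → r p s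
  dense : ∀ p q, r p q → ∃ m, r p m ∧ r m q

theorem IsChronological.swap (h : IsChronological r) : IsChronological fun p q => r q p where
  trans p q s h1 h2 := h.trans s q p h2 h1
  dense p q h1 := (h.dense q p h1).imp fun _ hm => hm.symm

theorem IsChronological.past_past (h : IsChronological r) (S : Set V) :
    past r (past r S) = past r S := by
  ext p
  constructor
  · rintro ⟨q, ⟨s, hs, hqs⟩, hpq⟩
    exact ⟨s, hs, h.trans _ _ _ hpq hqs⟩
  · rintro ⟨s, hs, hps⟩
    obtain ⟨m, h1, h2⟩ := h.dense _ _ hps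
    exact ⟨m, ⟨s, hs, h2⟩, h1⟩

/-- Indecomposable past sets are the directed ones. -/
theorem IsChronological.isIP_iff (h : IsChronological r) {P : Set V} :
    IsIP r P ↔ P.Nonempty ∧ (∀ p q, r p q → q ∈ P → p ∈ P) ∧
      ∀ p ∈ P, ∀ q ∈ P, ∃ s ∈ P, r p s ∧ r q s := by
  constructor
  · rintro ⟨⟨hne, hP⟩, hind⟩
    refine ⟨hne, fun p q hpq hq => by rw [hP]; exact ⟨q, hq, hpq⟩, fun p hp q hq => ?_⟩
    have hpP := hp
    rw [hP] at hpP
    obtain ⟨s, hs, hps⟩ := hpP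
    -- `P` is the union of the pasts of its points after `p` and of its points not after `p`. The
    -- second past omits `p` and is therefore not `P`, or it is empty. So `P` is the first past; as
    -- it contains `q`, a point of `P` is after both.
    have hA : IsPastSet r (past r (P ∩ {s | r p s})) :=
      ⟨⟨p, s, ⟨hs, hps⟩, hps⟩, (h.past_past _).symm⟩
    have hU : past r (P ∩ {s | r p s}) ∪ past r (P \ {s | r p s}) = P := by
      conv_rhs => rw [hP]
      ext x
      constructor
      · rintro (⟨y, hy, hxy⟩ | ⟨y, hy, hxy⟩)
        · exact ⟨y, hy.1, hxy⟩
        · exact ⟨y, hy.1, hxy⟩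
      · rintro ⟨y, hy, hxy⟩
        by_cases hpy : r p y
        · exact Or.inl ⟨y, ⟨hy, hpy⟩, hxy⟩
        · exact Or.inr ⟨y, ⟨hy, hpy⟩, hxy⟩
    have hfin : past r (P ∩ {s | r p s}) = P → ∃ s ∈ P, r p s ∧ r q s := by
      intro hAP
      have hq' := hq
      rw [← hAP] at hq'
      obtain ⟨y, hy, hqy⟩ := hq'
      exact ⟨y, hy.1, hy.2, hqy⟩
    rcases (past r (P \ {s | r p s})).eq_empty_or_nonempty with hB | hB
    · rw [hB, union_empty] at hU
      exact hfin hU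
    · rcases hind _ _ hA ⟨hB, (h.past_past _).symm⟩ hU with h1 | h1
      · exact hfin h1
      · rw [← h1] at hp
        obtain ⟨y, hy, hpy⟩ := hp
        exact absurd hpy hy.2
  · rintro ⟨hne, hlow, hdir⟩
    refine ⟨⟨hne, ?_⟩, fun A B hA hB hAB => ?_⟩
    · ext p
      constructor
      · intro hp
        obtain ⟨s, hs, hps, -⟩ := hdir p hp p hp
        exact ⟨s, hs, hps⟩
      · rintro ⟨q, hq, hpq⟩
        exact hlow p q hpq hq
    · by_contra hcon
      push Not at hcon
      have hAs : A ⊆ P := hAB ▸ subset_union_left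
      have hBs : B ⊆ P := hAB ▸ subset_union_right
      obtain ⟨a, ha, haA⟩ := exists_of_ssubset (hAs.ssubset_of_ne hcon.1)
      obtain ⟨b, hb, hbB⟩ := exists_of_ssubset (hBs.ssubset_of_ne hcon.2)
      obtain ⟨s, hs, has, hbs⟩ := hdir a ha b hb
      rw [← hAB] at hs
      rcases hs with hs | hs
      · exact haA (by rw [hA.2]; exact ⟨s, hs, has⟩)
      · exact hbB (by rw [hB.2]; exact ⟨s, hs, hbs⟩)

theorem IsIP.nonempty {P : Set V} (hP : IsIP r P) : P.Nonempty := hP.1.1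

theorem IsIP.ne_empty {P : Set V} (hP : IsIP r P) : P ≠ ∅ := hP.1.1.ne_empty

/-- Every indecomposable past set in `S` is contained in a maximal one. -/
theorem IsChronological.exists_isMaximalIPIn (h : IsChronological r) {P S : Set V} (hP : IsIP r P)
    (hPS : P ⊆ S) : ∃ P', P ⊆ P' ∧ IsMaximalIPIn r P' S := by
  -- Zorn's lemma applies because directedness passes to unions of chains.
  obtain ⟨m, hPm, hm⟩ := zorn_subset_nonempty {Q | IsIP r Q ∧ Q ⊆ S} (by
    rintro c hc hchain ⟨Q₀, hQ₀⟩
    refine ⟨⋃₀ c, ⟨h.isIP_iff.2 ⟨?_, ?_, ?_⟩, sUnion_subset fun Q hQ => (hc hQ).2⟩,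
      fun Q hQ => subset_sUnion_of_mem hQ⟩
    · obtain ⟨x, hx⟩ := (hc hQ₀).1.nonempty
      exact ⟨x, Q₀, hQ₀, hx⟩
    · rintro p q hpq ⟨Q, hQ, hq⟩
      exact ⟨Q, hQ, (h.isIP_iff.1 (hc hQ).1).2.1 p q hpq hq⟩
    · rintro p ⟨Q, hQ, hp⟩ q ⟨Q', hQ', hq⟩
      rcases hchain.total hQ hQ' with hs | hs
      · obtain ⟨s, h1, h2⟩ := (h.isIP_iff.1 (hc hQ').1).2.2 p (hs hp) q hq
        exact ⟨s, ⟨Q', hQ', h1⟩, h2⟩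
      · obtain ⟨s, h1, h2⟩ := (h.isIP_iff.1 (hc hQ).1).2.2 p hp q (hs hq)
        exact ⟨s, ⟨Q, hQ, h1⟩, h2⟩) P ⟨hP, hPS⟩
  exact ⟨m, hPm, hm.prop.1, hm.prop.2, fun P' hP' hmP' hP'S =>
    (hm.eq_of_subset ⟨hP', hP'S⟩ hmP').symm⟩

/-- All points of `P` precede all points of `F`. -/
def Precedes (r : V → V → Prop) (P F : Set V) : Prop := ∀ p ∈ P, ∀ q ∈ F, r p q

/-- Each point of an IF has an earlier point in the same IF, so taking the future once more in the
definition of `↑P` costs nothing. -/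
theorem subset_commonFuture_iff (h : IsChronological r) {P F : Set V}
    (hF : IsIP (fun p q => r q p) F) :
    F ⊆ commonPast (fun p q => r q p) P ↔ Precedes r P F := by
  constructor
  · intro hs p hp q hq
    obtain ⟨q', h1, h2⟩ := hs hq
    exact h.trans _ _ _ (h1 p hp) h2
  · intro hs q hq
    obtain ⟨q', hq', h1, -⟩ := (h.swap.isIP_iff.1 hF).2.2 q hq q hq
    exact ⟨q', fun p hp => hs p hp q' hq', h1⟩

theorem subset_commonPast_iff (h : IsChronological r) {P F : Set V} (hP : IsIP r P) :
    P ⊆ commonPast r F ↔ Precedes r P F := by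
  rw [subset_commonFuture_iff (r := fun p q => r q p) h.swap hP]
  exact ⟨fun hh p hp q hq => hh q hq p hp, fun hh p hp q hq => hh q hq p hp⟩

/-- Both maximality conditions are expressed through the one symmetric condition `Precedes`; the
common pasts and futures disappear. -/
theorem sRelated_iff (h : IsChronological r) {P F : Set V} :
    SRelated r P F ↔ IsIP r P ∧ IsIP (fun p q => r q p) F ∧ Precedes r P F ∧
      (∀ F', IsIP (fun p q => r q p) F' → F ⊆ F' → Precedes r P F' → F' = F) ∧
      ∀ P', IsIP r P' → P ⊆ P' → Precedes r P' F → P' = P := by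
  constructor
  · rintro ⟨⟨hF, hF1, hF2⟩, hP, hP1, hP2⟩
    exact ⟨hP, hF, (subset_commonPast_iff h hP).1 hP1, fun F' hF' h1 h2 =>
      hF2 F' hF' h1 ((subset_commonFuture_iff h hF').2 h2), fun P' hP' h1 h2 =>
      hP2 P' hP' h1 ((subset_commonPast_iff h hP').2 h2)⟩
  · rintro ⟨hP, hF, hPF, h1, h2⟩
    exact ⟨⟨hF, (subset_commonFuture_iff h hF).2 hPF, fun F' hF' h3 h4 =>
      h1 F' hF' h3 ((subset_commonFuture_iff h hF').1 h4)⟩, hP, (subset_commonPast_iff h hP).2 hPF,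
      fun P' hP' h3 h4 => h2 P' hP' h3 ((subset_commonPast_iff h hP').1 h4)⟩

theorem sRelated_swap {P F : Set V} : SRelated (fun p q => r q p) F P ↔ SRelated r P F := by
  constructor <;> rintro ⟨h1, h2⟩ <;> exact ⟨h2, h1⟩

theorem mem_cCompletion_of_left {P F : Set V} (h : (P, F) ∈ cCompletion r) (hP : P ≠ ∅)
    (hF : F ≠ ∅) : SRelated r P F := by
  rcases h with h | ⟨-, h, -⟩ | ⟨h, -⟩
  · exact h
  · exact absurd h hF
  · exact absurd h hP

theorem mem_cCompletion_isIP {P F : Set V} (h : (P, F) ∈ cCompletion r) (hP : P ≠ ∅) :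
    IsIP r P := by
  rcases h with h | ⟨h, -⟩ | ⟨h, -⟩
  · exact h.2.1
  · exact h
  · exact absurd h hP

theorem mem_cCompletion_swap {P F : Set V} :
    (F, P) ∈ cCompletion (fun p q => r q p) ↔ (P, F) ∈ cCompletion r := by
  have key : ∀ (r : V → V → Prop) (P F : Set V), (P, F) ∈ cCompletion r →
      (F, P) ∈ cCompletion (fun p q => r q p) := by
    rintro r P F (h | ⟨h1, h2, h3⟩ | ⟨h1, h2, h3⟩)
    · exact Or.inl (sRelated_swap.2 h)
    · exact Or.inr (Or.inr ⟨h2, h1, fun F' hF' => h3 F' (sRelated_swap.1 hF')⟩)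
    · exact Or.inr (Or.inl ⟨h2, h1, fun F' hF' => h3 F' (sRelated_swap.1 hF')⟩)
  exact ⟨key _ F P, key r P F⟩

theorem mem_cBoundary_swap {P F : Set V} :
    (F, P) ∈ cBoundary (fun p q => r q p) ↔ (P, F) ∈ cBoundary r := by
  refine and_congr mem_cCompletion_swap (not_congr (exists_congr fun v => ?_))
  simp only [Prod.mk.injEq]
  exact and_comm

/-- Every IP is a component of a pair of the c-completion. -/
theorem exists_mem_cCompletion {P : Set V} (hP : IsIP r P) : ∃ F, (P, F) ∈ cCompletion r := by
  by_cases h : ∃ F, SRelated r P F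
  · exact h.imp fun F hF => Or.inl hF
  · exact ⟨∅, Or.inr (Or.inl ⟨hP, rfl, not_exists.1 h⟩)⟩

theorem left_ne_or_right_ne {P F : Set V} (h : (P, F) ∈ cCompletion r) : P ≠ ∅ ∨ F ≠ ∅ := by
  rcases h with h | ⟨h, -⟩ | ⟨-, h, -⟩
  · exact Or.inl h.2.1.ne_empty
  · exact Or.inl h.ne_empty
  · exact Or.inr h.ne_empty

/-- If no IP is S-related to two IFs, the second component is determined by a non-empty first
one. -/
theorem eq_of_mem_cCompletion {P F F' : Set V} (hP : IsIP r P)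
    (hu : ∀ F F', SRelated r P F → SRelated r P F' → F = F')
    (h : (P, F) ∈ cCompletion r) (h' : (P, F') ∈ cCompletion r) : F = F' := by
  rcases h with h | ⟨-, h, h2⟩ | ⟨h, -⟩
  · rcases h' with h' | ⟨-, -, h2'⟩ | ⟨h', -⟩
    · exact hu F F' h h'
    · exact absurd h (h2' F)
    · exact absurd h' hP.ne_empty
  · rcases h' with h' | ⟨-, h', -⟩ | ⟨h', -⟩
    · exact absurd h' (h2 F')
    · exact h.trans h'.symm
    · exact absurd h' hP.ne_empty
  · exact absurd h hP.ne_empty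

/-! ### Transport along a bijection -/

section Transport

variable {W : Type*} (e : W ≃ V)

theorem past_preimage (S : Set V) :
    past (fun p q => r (e p) (e q)) (e ⁻¹' S) = e ⁻¹' past r S := by
  ext p
  constructor
  · rintro ⟨q, hq, hpq⟩
    exact ⟨e q, hq, hpq⟩
  · rintro ⟨q, hq, hpq⟩
    exact ⟨e.symm q, by simpa using hq, by simpa using hpq⟩

theorem isPastSet_preimage {S : Set V} :
    IsPastSet (fun p q => r (e p) (e q)) (e ⁻¹' S) ↔ IsPastSet r S := by
  unfold IsPastSet
  rw [past_preimage, e.surjective.preimage_injective.eq_iff]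
  refine and_congr_left fun _ => ⟨?_, fun h => h.preimage e.surjective⟩
  rintro ⟨x, hx⟩
  exact ⟨e x, hx⟩

theorem forall_set_preimage {p : Set W → Prop} : (∀ A, p A) ↔ ∀ A : Set V, p (e ⁻¹' A) :=
  ⟨fun h A => h _, fun h A => by
    have := h (e.symm ⁻¹' A)
    rwa [← preimage_comp, e.symm_comp_self, preimage_id] at this⟩

theorem isIP_preimage {S : Set V} :
    IsIP (fun p q => r (e p) (e q)) (e ⁻¹' S) ↔ IsIP r S := by
  unfold IsIP
  rw [isPastSet_preimage, forall_set_preimage e]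
  refine and_congr_right fun _ => forall_congr' fun A => ?_
  rw [forall_set_preimage e]
  refine forall_congr' fun B => ?_
  rw [isPastSet_preimage, isPastSet_preimage, ← preimage_union, e.surjective.preimage_injective.eq_iff,
    e.surjective.preimage_injective.eq_iff, e.surjective.preimage_injective.eq_iff]

theorem isTIP_preimage {S : Set V} :
    IsTIP (fun p q => r (e p) (e q)) (e ⁻¹' S) ↔ IsTIP r S := by
  unfold IsTIP
  rw [isIP_preimage]
  refine and_congr_right fun _ => not_congr ⟨?_, ?_⟩
  · rintro ⟨p, hp⟩
    refine ⟨e p, e.surjective.preimage_injective ?_⟩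
    rw [hp, ← past_preimage]
    congr 1
    ext x
    simp
  · rintro ⟨p, hp⟩
    refine ⟨e.symm p, ?_⟩
    rw [hp, ← past_preimage]
    congr 1
    ext x
    simp [e.eq_symm_apply]

theorem isMaximalIPIn_preimage {P S : Set V} :
    IsMaximalIPIn (fun p q => r (e p) (e q)) (e ⁻¹' P) (e ⁻¹' S) ↔ IsMaximalIPIn r P S := by
  unfold IsMaximalIPIn
  rw [isIP_preimage, e.surjective.preimage_subset_preimage_iff]
  refine and_congr_right fun _ => and_congr_right fun _ => ?_
  rw [forall_set_preimage e]
  refine forall_congr' fun B => ?_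
  rw [isIP_preimage, e.surjective.preimage_subset_preimage_iff,
    e.surjective.preimage_subset_preimage_iff, e.surjective.preimage_injective.eq_iff]

theorem commonPast_preimage (S : Set V) :
    commonPast (fun p q => r (e p) (e q)) (e ⁻¹' S) = e ⁻¹' commonPast r S := by
  unfold commonPast
  rw [← past_preimage]
  congr 1
  ext p
  exact ⟨fun h q hq => by simpa using h (e.symm q) (by simpa using hq), fun h q hq => h (e q) hq⟩

theorem hatL_preimage {P : Set V} {σ : ℕ → Set V} :
    e ⁻¹' P ∈ hatL (fun p q => r (e p) (e q)) (fun n => e ⁻¹' σ n) ↔ P ∈ hatL r σ := by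
  have h1 : limInf (fun n => e ⁻¹' σ n) = e ⁻¹' limInf σ := rfl
  have h2 : limSup (fun n => e ⁻¹' σ n) = e ⁻¹' limSup σ := rfl
  unfold hatL
  rw [mem_ofPred_eq, mem_ofPred_eq, h1, h2, isMaximalIPIn_preimage,
    e.surjective.preimage_subset_preimage_iff]

theorem sRelated_preimage {P F : Set V} :
    SRelated (fun p q => r (e p) (e q)) (e ⁻¹' P) (e ⁻¹' F) ↔ SRelated r P F := by
  unfold SRelated
  rw [commonPast_preimage, commonPast_preimage (r := fun p q => r q p), isMaximalIPIn_preimage,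
    isMaximalIPIn_preimage (r := fun p q => r q p)]

theorem mem_cCompletion_preimage {P F : Set V} :
    (e ⁻¹' P, e ⁻¹' F) ∈ cCompletion (fun p q => r (e p) (e q)) ↔ (P, F) ∈ cCompletion r := by
  have h0 : ∀ A : Set V, e ⁻¹' A = ∅ ↔ A = ∅ := fun A => by
    rw [← preimage_empty (f := e), e.surjective.preimage_injective.eq_iff]
  refine or_congr (sRelated_preimage e) (or_congr ?_ ?_)
  · refine and_congr (isIP_preimage e) (and_congr (h0 F) ?_)
    rw [forall_set_preimage e]
    exact forall_congr' fun A => not_congr (sRelated_preimage e)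
  · refine and_congr (h0 P) (and_congr (isIP_preimage (r := fun p q => r q p) e) ?_)
    rw [forall_set_preimage e]
    exact forall_congr' fun A => not_congr (sRelated_preimage e)

theorem mem_cBoundary_preimage {P F : Set V} :
    (e ⁻¹' P, e ⁻¹' F) ∈ cBoundary (fun p q => r (e p) (e q)) ↔ (P, F) ∈ cBoundary r := by
  refine and_congr (mem_cCompletion_preimage e) (not_congr ⟨?_, ?_⟩)
  · rintro ⟨v, hv⟩
    refine ⟨e v, ?_⟩
    have hs : ({v} : Set W) = e ⁻¹' {e v} := by ext x; simp
    rw [hs, past_preimage, past_preimage (r := fun p q => r q p)] at hv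
    rw [Prod.mk.injEq] at hv
    exact Prod.ext (e.surjective.preimage_injective hv.1) (e.surjective.preimage_injective hv.2)
  · rintro ⟨v, hv⟩
    refine ⟨e.symm v, ?_⟩
    have hs : ({e.symm v} : Set W) = e ⁻¹' {v} := by ext x; simp [e.eq_symm_apply]
    rw [hs, past_preimage, past_preimage (r := fun p q => r q p)]
    rw [Prod.mk.injEq] at hv
    rw [hv.1, hv.2]

end Transport

end Causal

/-! ### Cauchy sequences, the points they define, and their distance functions. -/

section
variable {X : Type*}

/-- Sequences that decrease up to arbitrarily small errors converge. Distances to a forward Cauchy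
sequence are of this kind, those from it are of the kind in the next lemma. -/
theorem ENNReal.tendsto_limsup_of_eventually_le_add {a : ℕ → ℝ≥0∞}
    (h : ∀ ε > 0, ∃ n₀, ∀ n m, n₀ ≤ n → n ≤ m → a m ≤ a n + ε) :
    Tendsto a atTop (𝓝 (limsup a atTop)) := by
  refine tendsto_of_le_liminf_of_limsup_le ?_ le_rfl
  refine ENNReal.le_of_forall_pos_le_add fun ε hε _ => ?_
  obtain ⟨n₀, hn₀⟩ := h ε (by exact_mod_cast hε)
  rw [← tsub_le_iff_right]
  refine le_liminf_of_le (by isBoundedDefault) ?_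
  filter_upwards [eventually_ge_atTop n₀] with n hn
  rw [tsub_le_iff_right]
  refine limsup_le_of_le (by isBoundedDefault) ?_
  filter_upwards [eventually_ge_atTop n] with m hm
  exact hn₀ n m hn hm

theorem ENNReal.tendsto_limsup_of_eventually_le_add' {a : ℕ → ℝ≥0∞}
    (h : ∀ ε > 0, ∃ n₀, ∀ n m, n₀ ≤ n → n ≤ m → a n ≤ a m + ε) :
    Tendsto a atTop (𝓝 (limsup a atTop)) := by
  refine tendsto_of_le_liminf_of_limsup_le ?_ le_rfl
  refine ENNReal.le_of_forall_pos_le_add fun ε hε _ => ?_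
  obtain ⟨n₀, hn₀⟩ := h ε (by exact_mod_cast hε)
  refine limsup_le_of_le (by isBoundedDefault) ?_
  filter_upwards [eventually_ge_atTop n₀] with n hn
  rw [← tsub_le_iff_right]
  refine le_liminf_of_le (by isBoundedDefault) ?_
  filter_upwards [eventually_ge_atTop n] with m hm
  rw [tsub_le_iff_right]
  exact hn₀ n m hn hm

/-- A real distance as an extended distance. -/
def ofRealDist (δ : X → X → ℝ) : X → X → ℝ≥0∞ := fun x y => ENNReal.ofReal (δ x y)

/-- The distance from `x` to the limit of `σ`. -/
def inDist (δ : X → X → ℝ) (σ : ℕ → X) (x : X) : ℝ := (limDist (ofRealDist δ) x σ).toReal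

/-- The distance from the limit of `σ` to `x`. -/
def outDist (δ : X → X → ℝ) (σ : ℕ → X) (x : X) : ℝ≥0∞ :=
  limDist (ofRealDist fun x y => δ y x) x σ

variable {δ : X → X → ℝ} {σ τ : ℕ → X}

namespace LengthDist

theorem isForwardCauchy_iff :
    IsForwardCauchy (ofRealDist δ) σ ↔
      ∀ ε > 0, ∃ n₀, ∀ n m, n₀ ≤ n → n ≤ m → δ (σ n) (σ m) < ε := by
  constructor
  · intro hσ ε hε
    obtain ⟨n₀, hn⟩ := hσ (ENNReal.ofReal ε) (by simpa using hε)
    exact ⟨n₀, fun n m h1 h2 => (ENNReal.ofReal_lt_ofReal_iff hε).1 (hn n m h1 h2)⟩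
  · intro hσ ε hε
    obtain ⟨ε', h1, h2⟩ := ENNReal.lt_iff_exists_real_btwn.1 hε
    obtain ⟨n₀, hn⟩ := hσ ε' (by simpa using h2.1)
    refine ⟨n₀, fun n m h3 h4 => lt_trans ?_ h2.2⟩
    exact (ENNReal.ofReal_lt_ofReal_iff (by simpa using h2.1)).2 (hn n m h3 h4)

theorem isForwardCauchy_comp (hσ : IsForwardCauchy (ofRealDist δ) σ) {φ : ℕ → ℕ}
    (hφ : StrictMono φ) : IsForwardCauchy (ofRealDist δ) (σ ∘ φ) := fun ε hε => by
  obtain ⟨n₀, hn⟩ := hσ ε hε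
  exact ⟨n₀, fun n m h1 h2 => hn _ _ (h1.trans (hφ.id_le n)) (hφ.monotone h2)⟩

variable (h : LengthDist δ)
include h

theorem ofRealDist_triangle (x y z : X) :
    ofRealDist δ x z ≤ ofRealDist δ x y + ofRealDist δ y z := by
  unfold ofRealDist
  rw [← ENNReal.ofReal_add (h.nonneg _ _) (h.nonneg _ _)]
  exact ENNReal.ofReal_le_ofReal (h.triangle _ _ _)

theorem tendsto_limDist (hσ : IsForwardCauchy (ofRealDist δ) σ) (x : X) :
    Tendsto (fun n => ofRealDist δ x (σ n)) atTop (𝓝 (limDist (ofRealDist δ) x σ)) := by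
  refine ENNReal.tendsto_limsup_of_eventually_le_add fun ε hε => ?_
  obtain ⟨n₀, hn⟩ := hσ ε hε
  exact ⟨n₀, fun n m h1 h2 => (h.ofRealDist_triangle x (σ n) (σ m)).trans
    (by gcongr; exact (hn n m h1 h2).le)⟩

theorem tendsto_outDist (hσ : IsForwardCauchy (ofRealDist δ) σ) (x : X) :
    Tendsto (fun n => ofRealDist δ (σ n) x) atTop (𝓝 (outDist δ σ x)) := by
  refine ENNReal.tendsto_limsup_of_eventually_le_add'
    (a := fun n => ofRealDist δ (σ n) x) fun ε hε => ?_
  obtain ⟨n₀, hn⟩ := hσ ε hε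
  refine ⟨n₀, fun n m h1 h2 => (h.ofRealDist_triangle (σ n) (σ m) x).trans ?_⟩
  rw [add_comm]
  gcongr
  exact (hn n m h1 h2).le

/-- Distances into the limit of a forward Cauchy sequence are finite, whereas distances out of it
may be infinite. This is why `inDist` is real and `outDist` is not. -/
theorem limDist_ne_top (hσ : IsForwardCauchy (ofRealDist δ) σ) (x : X) :
    limDist (ofRealDist δ) x σ ≠ ⊤ := by
  obtain ⟨n₀, hn⟩ := hσ 1 one_pos
  refine ne_top_of_le_ne_top (b := ofRealDist δ x (σ n₀) + 1) ?_ ?_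
  · exact ENNReal.add_ne_top.2 ⟨ENNReal.ofReal_ne_top, ENNReal.one_ne_top⟩
  · refine limsup_le_of_le (by isBoundedDefault) ?_
    filter_upwards [eventually_ge_atTop n₀] with m hm
    exact (h.ofRealDist_triangle x (σ n₀) (σ m)).trans (by gcongr; exact (hn _ _ le_rfl hm).le)

theorem ofReal_inDist (hσ : IsForwardCauchy (ofRealDist δ) σ) (x : X) :
    limDist (ofRealDist δ) x σ = ENNReal.ofReal (inDist δ σ x) :=
  (ENNReal.ofReal_toReal (h.limDist_ne_top hσ x)).symm

theorem tendsto_inDist (hσ : IsForwardCauchy (ofRealDist δ) σ) (x : X) :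
    Tendsto (fun n => δ x (σ n)) atTop (𝓝 (inDist δ σ x)) := by
  refine ((ENNReal.tendsto_toReal (h.limDist_ne_top hσ x)).comp (h.tendsto_limDist hσ x)).congr
    fun n => ?_
  exact ENNReal.toReal_ofReal (h.nonneg _ _)

theorem inDist_nonneg (σ : ℕ → X) (x : X) : 0 ≤ inDist δ σ x := ENNReal.toReal_nonneg

theorem inDist_comp (hσ : IsForwardCauchy (ofRealDist δ) σ) {φ : ℕ → ℕ} (hφ : StrictMono φ) :
    inDist δ (σ ∘ φ) = inDist δ σ :=
  funext fun x => tendsto_nhds_unique (h.tendsto_inDist (isForwardCauchy_comp hσ hφ) x)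
    ((h.tendsto_inDist hσ x).comp hφ.tendsto_atTop)

theorem inDist_le (hσ : IsForwardCauchy (ofRealDist δ) σ) (x y : X) :
    inDist δ σ x ≤ δ x y + inDist δ σ y :=
  le_of_tendsto_of_tendsto' (h.tendsto_inDist hσ x) ((h.tendsto_inDist hσ y).const_add _)
    fun n => h.triangle x y (σ n)

theorem tendsto_inDist_self (hσ : IsForwardCauchy (ofRealDist δ) σ) :
    Tendsto (fun n => inDist δ σ (σ n)) atTop (𝓝 0) := by
  rw [Metric.tendsto_atTop]
  intro ε hε
  obtain ⟨n₀, hn⟩ := isForwardCauchy_iff.1 hσ (ε / 2) (by linarith)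
  refine ⟨n₀, fun n hn' => ?_⟩
  have h1 : inDist δ σ (σ n) ≤ ε / 2 := le_of_tendsto (h.tendsto_inDist hσ (σ n))
    ((eventually_ge_atTop n).mono fun m hm => (hn n m hn' hm).le)
  rw [Real.dist_eq, sub_zero, abs_of_nonneg (h.inDist_nonneg _ _)]
  linarith

theorem isForwardCauchy_const (x : X) : IsForwardCauchy (ofRealDist δ) fun _ => x :=
  isForwardCauchy_iff.2 fun ε hε => ⟨0, fun _ _ _ _ => by rwa [h.self]⟩

theorem inDist_const (x : X) : inDist δ (fun _ => x) = fun y => δ y x :=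
  funext fun y => tendsto_nhds_unique (h.tendsto_inDist (h.isForwardCauchy_const x) y)
    tendsto_const_nhds

/-- Distance functions `Ω - inDist σ` determine `Ω` and `inDist σ`. -/
theorem eq_of_sub_inDist_eq (hσ : IsForwardCauchy (ofRealDist δ) σ)
    (hτ : IsForwardCauchy (ofRealDist δ) τ) {Ω Ω' : ℝ}
    (he : ∀ x, Ω - inDist δ σ x = Ω' - inDist δ τ x) : Ω = Ω' ∧ inDist δ σ = inDist δ τ := by
  have key : ∀ {σ τ : ℕ → X} {Ω Ω' : ℝ}, IsForwardCauchy (ofRealDist δ) σ →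
      (∀ x, Ω - inDist δ σ x = Ω' - inDist δ τ x) → Ω ≤ Ω' := by
    intro σ τ Ω Ω' hσ he
    -- `Ω` is the limit of the left-hand function along `σ` itself, while `Ω'` is an upper bound of
    -- the right-hand one.
    have h1 := (h.tendsto_inDist_self hσ).const_sub Ω
    rw [sub_zero] at h1
    refine le_of_tendsto' h1 fun n => ?_
    rw [he]
    have := h.inDist_nonneg τ (σ n)
    linarith
  have h1 : Ω = Ω' := le_antisymm (key hσ he) (key hτ fun x => (he x).symm)
  refine ⟨h1, funext fun x => ?_⟩
  have := he x
  linarith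

/-! #### Classes of Cauchy sequences -/

theorem inDist_le_of_doubleLim (hσ : IsForwardCauchy (ofRealDist δ) σ)
    (hτ : IsForwardCauchy (ofRealDist δ) τ) (h0 : doubleLim (ofRealDist δ) σ τ = 0) (x : X) :
    inDist δ τ x ≤ inDist δ σ x := by
  refine le_of_forall_pos_le_add fun ε hε => ?_
  have h1 : ∀ᶠ n in atTop, limDist (ofRealDist δ) (σ n) τ < ENNReal.ofReal ε :=
    eventually_lt_of_limsup_lt (lt_of_eq_of_lt h0 (by simpa using hε))
  refine ge_of_tendsto ((h.tendsto_inDist hσ x).add_const ε) ?_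
  filter_upwards [h1] with n hn
  rw [h.ofReal_inDist hτ, ENNReal.ofReal_lt_ofReal_iff hε] at hn
  have := h.inDist_le hτ x (σ n)
  linarith

theorem doubleLim_eq_zero (hσ : IsForwardCauchy (ofRealDist δ) σ)
    (he : inDist δ σ = inDist δ τ) (hτ : IsForwardCauchy (ofRealDist δ) τ) :
    doubleLim (ofRealDist δ) σ τ = 0 := by
  have h1 : ∀ n, limsup (fun m => ofRealDist δ (σ n) (τ m)) atTop =
      ENNReal.ofReal (inDist δ σ (σ n)) := fun n => by
    rw [he]
    exact h.ofReal_inDist hτ (σ n)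
  unfold doubleLim
  simp only [h1]
  have h2 := (ENNReal.continuous_ofReal.tendsto 0).comp (h.tendsto_inDist_self hσ)
  rw [ENNReal.ofReal_zero] at h2
  exact h2.limsup_eq

/-- A point of the completion is determined by its distance function. From here on points are
compared through `inDist` instead of double limits. -/
theorem mk_eq_mk_iff (hσ : IsForwardCauchy (ofRealDist δ) σ)
    (hτ : IsForwardCauchy (ofRealDist δ) τ) :
    CauchyCompl.mk σ hσ = CauchyCompl.mk τ hτ ↔ inDist δ σ = inDist δ τ := by
  constructor
  · intro he
    exact congrArg (Quot.lift (fun σ : {σ // IsForwardCauchy (ofRealDist δ) σ} => inDist δ σ.1)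
      fun a b hab => funext fun x => le_antisymm (h.inDist_le_of_doubleLim b.2 a.2 hab.2 x)
        (h.inDist_le_of_doubleLim a.2 b.2 hab.1 x)) he
  · intro he
    exact Quot.sound ⟨h.doubleLim_eq_zero hσ he hτ, h.doubleLim_eq_zero hτ he.symm hσ⟩

omit h in
theorem isForwardCauchy_rep {d : X → X → ℝ≥0∞} (z : CauchyCompl d) : IsForwardCauchy d z.rep :=
  (Quot.out z).2

omit h in
theorem mk_rep {d : X → X → ℝ≥0∞} (z : CauchyCompl d) :
    CauchyCompl.mk z.rep (isForwardCauchy_rep z) = z := Quot.out_eq z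

theorem inDist_rep_mk (hσ : IsForwardCauchy (ofRealDist δ) σ) :
    inDist δ (CauchyCompl.mk σ hσ).rep = inDist δ σ :=
  (h.mk_eq_mk_iff (isForwardCauchy_rep _) hσ).1 (mk_rep _)

theorem eq_mk_iff (z : CauchyCompl (ofRealDist δ)) (hσ : IsForwardCauchy (ofRealDist δ) σ) :
    z = CauchyCompl.mk σ hσ ↔ inDist δ z.rep = inDist δ σ := by
  rw [← h.mk_eq_mk_iff (isForwardCauchy_rep z) hσ, mk_rep]

theorem ext_inDist {z w : CauchyCompl (ofRealDist δ)} :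
    z = w ↔ inDist δ z.rep = inDist δ w.rep := by
  rw [← h.eq_mk_iff z (isForwardCauchy_rep w), mk_rep]

theorem tendsto_swap {x : X} {y : ℕ → X} (hy : Tendsto (fun n => δ x (y n)) atTop (𝓝 0)) :
    Tendsto (fun n => δ (y n) x) atTop (𝓝 0) := by
  rw [Metric.tendsto_atTop]
  intro ε hε
  obtain ⟨η, hη, h1⟩ := h.compat x ε hε
  refine eventually_atTop.1 ?_
  filter_upwards [hy.eventually_lt_const hη] with n hn
  rw [Real.dist_eq, sub_zero, abs_of_nonneg (h.nonneg _ _)]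
  exact (h1 (y n)).1 hn

theorem inDist_eq_of_tendsto (hσ : IsForwardCauchy (ofRealDist δ) σ) {x : X}
    (hx : Tendsto (fun n => δ x (σ n)) atTop (𝓝 0)) : inDist δ σ = fun y => δ y x := by
  funext y
  have h1 := h.tendsto_inDist hσ y
  refine le_antisymm ?_ ?_
  · refine le_of_tendsto_of_tendsto' h1 (by simpa using hx.const_add (δ y x)) fun n => ?_
    exact h.triangle _ _ _
  · refine ge_of_tendsto' (by simpa using h1.add (h.tendsto_swap hx)) fun n => ?_
    exact h.triangle _ _ _

theorem isInterior_mk_iff (hσ : IsForwardCauchy (ofRealDist δ) σ) :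
    (CauchyCompl.mk σ hσ).IsInterior ↔ ∃ x, inDist δ σ = fun y => δ y x := by
  have hcv : ∀ (τ : ℕ → X) (x : X), Tendsto (fun n => ofRealDist δ x (τ n)) atTop (𝓝 0) ↔
      Tendsto (fun n => δ x (τ n)) atTop (𝓝 0) := fun τ x => by
    constructor
    · intro h1
      refine ((ENNReal.tendsto_toReal ENNReal.zero_ne_top).comp h1).congr fun n => ?_
      exact ENNReal.toReal_ofReal (h.nonneg _ _)
    · intro h1
      have := (ENNReal.continuous_ofReal.tendsto 0).comp h1
      rwa [ENNReal.ofReal_zero] at this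
  constructor
  · rintro ⟨τ, hτ, he, x, hx⟩
    exact ⟨x, ((h.mk_eq_mk_iff hτ hσ).1 he).symm.trans
      (h.inDist_eq_of_tendsto hτ ((hcv τ x).1 hx))⟩
  · rintro ⟨x, hx⟩
    refine ⟨σ, hσ, rfl, x, (hcv σ x).2 ?_⟩
    have := h.tendsto_inDist hσ x
    simpa only [hx, h.self] using this

theorem outDist_congr (hσ : IsForwardCauchy (ofRealDist δ) σ)
    (hτ : IsForwardCauchy (ofRealDist δ) τ) (he : inDist δ σ = inDist δ τ) :
    outDist δ σ = outDist δ τ := by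
  have key : ∀ {σ τ : ℕ → X}, IsForwardCauchy (ofRealDist δ) σ → IsForwardCauchy (ofRealDist δ) τ →
      inDist δ σ = inDist δ τ → ∀ x, outDist δ σ x ≤ outDist δ τ x := by
    intro σ τ hσ hτ he x
    have h1 : ∀ n, ofRealDist δ (σ n) x ≤ limDist (ofRealDist δ) (σ n) τ + outDist δ τ x := fun n =>
      le_of_tendsto_of_tendsto' tendsto_const_nhds
        ((h.tendsto_limDist hτ (σ n)).add (h.tendsto_outDist hτ x)) fun m =>
        h.ofRealDist_triangle (σ n) (τ m) x
    have h2 : Tendsto (fun n => limDist (ofRealDist δ) (σ n) τ) atTop (𝓝 0) := by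
      have h2 := (ENNReal.continuous_ofReal.tendsto 0).comp (h.tendsto_inDist_self hσ)
      rw [ENNReal.ofReal_zero] at h2
      refine h2.congr fun n => ?_
      rw [h.ofReal_inDist hτ, ← he]
      rfl
    have h3 := h2.add_const (outDist δ τ x)
    rw [zero_add] at h3
    exact le_of_tendsto_of_tendsto' (h.tendsto_outDist hσ x) h3 h1
  exact funext fun x => le_antisymm (key hσ hτ he x) (key hτ hσ he.symm x)

/-- For symmetric Cauchy sequences, `outDist` is given by the dual of `inDist`. -/
theorem outDist_eq (hσ' : IsForwardCauchy (ofRealDist fun x y => δ y x) σ) (x : X) :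
    outDist δ σ x = ENNReal.ofReal (inDist (fun x y => δ y x) σ x) :=
  h.swap.ofReal_inDist hσ' x

/-! #### Busemann functions of chronological sequences -/

omit h in
theorem bot_lt_chainFun {f : X → EReal} (hf : f ∈ chainFun δ) (x : X) : ⊥ < f x := by
  obtain ⟨u, -, rfl⟩ := hf
  exact lt_of_lt_of_le (EReal.bot_lt_coe _) (le_iSup (fun n => (((u n).1 - δ x (u n).2 : ℝ) : EReal)) 0)

theorem chainFun_le {f : X → EReal} (hf : f ∈ chainFun δ) (x y : X) :
    f y ≤ f x + (δ x y : EReal) := by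
  obtain ⟨u, -, rfl⟩ := hf
  refine iSup_le fun n => ?_
  refine le_trans ?_ (add_le_add_left
    (le_iSup (fun n => (((u n).1 - δ x (u n).2 : ℝ) : EReal)) n) _)
  rw [← EReal.coe_add, EReal.coe_le_coe_iff]
  have := h.triangle x y (u n).2
  linarith

theorem chainFun_ne_top {f : X → EReal} (hf : f ∈ chainFun δ) {x : X} (hx : f x ≠ ⊤) (y : X) :
    f y ≠ ⊤ :=
  ne_top_of_le_ne_top (EReal.add_ne_top hx (EReal.coe_ne_top _)) (h.chainFun_le hf x y)

omit h in
theorem chainFun_add {f : X → EReal} (hf : f ∈ chainFun δ) (k : ℝ) :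
    (fun x => f x + (k : EReal)) ∈ chainFun δ := by
  obtain ⟨u, hu, rfl⟩ := hf
  refine ⟨fun n => ((u n).1 + k, (u n).2), fun n => ?_, funext fun x => ?_⟩
  · have := hu n
    unfold distRel at *
    simp only
    linarith
  · unfold chainBusemann
    refine le_antisymm ?_ ?_
    · rw [← EReal.le_sub_iff_add_le (Or.inl (EReal.coe_ne_bot k)) (Or.inl (EReal.coe_ne_top k))]
      refine iSup_le fun n => ?_
      rw [EReal.le_sub_iff_add_le (Or.inl (EReal.coe_ne_bot k)) (Or.inl (EReal.coe_ne_top k)),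
        ← EReal.coe_add]
      refine le_iSup_of_le n (EReal.coe_le_coe_iff.2 ?_)
      linarith
    · refine iSup_le fun n => ?_
      refine le_trans ?_ (add_le_add_left
        (le_iSup (fun n => (((u n).1 - δ x (u n).2 : ℝ) : EReal)) n) _)
      rw [← EReal.coe_add, EReal.coe_le_coe_iff]
      linarith

/-- This is the Busemann function of the sequence that rests at one point at the times `0, 1, 2, …`.
-/
theorem top_mem_chainFun [Nonempty X] : (fun _ => ⊤ : X → EReal) ∈ chainFun δ := by
  obtain ⟨y⟩ := ‹Nonempty X›
  refine ⟨fun n => (n, y), fun n => by unfold distRel; simp [h.self], funext fun x => ?_⟩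
  symm
  unfold chainBusemann
  rw [iSup_eq_top]
  intro b hb
  obtain ⟨c, hc, -⟩ := EReal.lt_iff_exists_real_btwn.1 hb
  obtain ⟨n, hn⟩ := exists_nat_gt (c + δ x y)
  refine ⟨n, hc.trans (EReal.coe_lt_coe_iff.2 ?_)⟩
  simp only
  linarith

/-- A chronological sequence with bounded times is forward Cauchy, and its Busemann function is
`Ω - inDist`. -/
theorem chain_bounded {u : ℕ → ℝ × X} (hu : IsChronChain δ u) {Ω : ℝ}
    (hΩ : Tendsto (fun n => (u n).1) atTop (𝓝 Ω)) :
    IsForwardCauchy (ofRealDist δ) (fun n => (u n).2) ∧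
      chainBusemann δ u = fun x => ((Ω - inDist δ (fun n => (u n).2) x : ℝ) : EReal) := by
  have hc : IsForwardCauchy (ofRealDist δ) (fun n => (u n).2) := by
    refine isForwardCauchy_iff.2 fun ε hε => ?_
    obtain ⟨n₀, hn⟩ := Metric.cauchySeq_iff.1 hΩ.cauchySeq ε hε
    refine ⟨n₀, fun n m h1 h2 => ?_⟩
    rcases h2.eq_or_lt with rfl | h2
    · rwa [h.self]
    · have h3 := h.chain_rel hu h2
      have h4 := hn m (h1.trans h2.le) n h1
      rw [Real.dist_eq] at h4
      exact h3.trans_le ((le_abs_self _).trans h4.le)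
  refine ⟨hc, funext fun x => tendsto_nhds_unique (h.tendsto_chainBusemann hu x) ?_⟩
  exact (continuous_coe_real_ereal.tendsto _).comp (hΩ.sub (h.tendsto_inDist hc x))

/-- A sufficiently fast subsequence can be run through in finite time: the time left at the `k`-th
point is `2 · 2⁻ᵏ`, so the step to the next point lasts `2⁻ᵏ`. -/
theorem exists_chain_of_isForwardCauchy (hσ : IsForwardCauchy (ofRealDist δ) σ) (Ω : ℝ) :
    ∃ φ : ℕ → ℕ, StrictMono φ ∧ IsChronChain δ (fun k => (Ω - 2 * (1 / 2 : ℝ) ^ k, σ (φ k))) := by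
  have h1 : ∀ k : ℕ, ∀ᶠ n in atTop, ∀ m, n ≤ m → δ (σ n) (σ m) < (1 / 2 : ℝ) ^ k := fun k => by
    obtain ⟨n₀, hn⟩ := isForwardCauchy_iff.1 hσ ((1 / 2 : ℝ) ^ k) (by positivity)
    filter_upwards [eventually_ge_atTop n₀] with n h1 m h2 using hn n m h1 h2
  obtain ⟨φ, hφ, h2⟩ := extraction_forall_of_eventually h1
  refine ⟨φ, hφ, fun k => ?_⟩
  have := h2 k (φ (k + 1)) (hφ (Nat.lt_succ_self k)).le
  unfold distRel
  simp only [pow_succ]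
  linarith

theorem sub_inDist_mem_chainFun (hσ : IsForwardCauchy (ofRealDist δ) σ) (Ω : ℝ) :
    (fun x => ((Ω - inDist δ σ x : ℝ) : EReal)) ∈ chainFun δ := by
  obtain ⟨φ, hφ, hu⟩ := h.exists_chain_of_isForwardCauchy hσ Ω
  refine ⟨_, hu, ?_⟩
  have hΩ : Tendsto (fun k : ℕ => Ω - 2 * (1 / 2 : ℝ) ^ k) atTop (𝓝 Ω) := by
    have := ((tendsto_pow_atTop_nhds_zero_of_lt_one (r := (1 / 2 : ℝ)) (by norm_num)
      (by norm_num)).const_mul 2).const_sub Ω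
    simpa using this
  rw [(h.chain_bounded hu hΩ).2]
  have := h.inDist_comp hσ hφ
  funext x
  rw [← this]
  rfl

theorem sub_dist_mem_chainFun (t : ℝ) (y : X) :
    (fun x => ((t - δ x y : ℝ) : EReal)) ∈ chainFun δ := by
  have := h.sub_inDist_mem_chainFun (h.isForwardCauchy_const y) t
  rwa [h.inDist_const] at this

/-- A Busemann function for which the times are bounded. -/
theorem chain_of_bddAbove {u : ℕ → ℝ × X} (hu : IsChronChain δ u)
    (hb : BddAbove (range fun n => (u n).1)) :
    ∃ Ω, Tendsto (fun n => (u n).1) atTop (𝓝 Ω) :=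
  ⟨_, tendsto_atTop_ciSup (h.chain_strictMono hu).monotone hb⟩

end LengthDist

end

/-! ### Indecomposable sets as pasts and futures of Busemann functions. -/

section
variable {X : Type*}

theorem pastOf_subset_pastOf_iff {f g : X → EReal} : pastOf f ⊆ pastOf g ↔ ∀ x, f x ≤ g x := by
  constructor
  · intro hs x
    by_contra hx
    obtain ⟨t, h1, h2⟩ := EReal.lt_iff_exists_real_btwn.1 (not_le.1 hx)
    have h3 : (t, x) ∈ pastOf g := hs (show (t, x) ∈ pastOf f from h2)
    exact lt_asymm h1 h3
  · intro hfg p hp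
    exact lt_of_lt_of_le (show (p.1 : EReal) < f p.2 from hp) (hfg p.2)

theorem pastOf_injective : Function.Injective (pastOf : (X → EReal) → Set (ℝ × X)) :=
  fun _ _ he => funext fun x => le_antisymm (pastOf_subset_pastOf_iff.1 he.le x)
    (pastOf_subset_pastOf_iff.1 he.ge x)

theorem pastOf_top : pastOf (fun _ : X => ⊤) = univ :=
  eq_univ_of_forall fun _ => EReal.coe_lt_top _

/-- The time reflection `(t, x) ↦ (-t, x)`. -/
def timeReflect (X : Type*) : ℝ × X ≃ ℝ × X where
  toFun p := (-p.1, p.2)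
  invFun p := (-p.1, p.2)
  left_inv p := by simp
  right_inv p := by simp

theorem timeReflect_preimage_pastOf (f : X → EReal) :
    timeReflect X ⁻¹' pastOf f = futureOf fun x => -f x := by
  ext p
  change ((-p.1 : ℝ) : EReal) < f p.2 ↔ -f p.2 < (p.1 : EReal)
  rw [EReal.coe_neg, EReal.neg_lt_comm]

theorem timeReflect_preimage_preimage (A : Set (ℝ × X)) :
    timeReflect X ⁻¹' (timeReflect X ⁻¹' A) = A := by
  ext p
  simp [timeReflect]

theorem timeReflect_preimage_futureOf (f : X → EReal) :
    timeReflect X ⁻¹' futureOf f = pastOf fun x => -f x := by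
  have := timeReflect_preimage_pastOf fun x => -f x
  simp only [neg_neg] at this
  rw [← this, timeReflect_preimage_preimage]

theorem futureOf_injective : Function.Injective (futureOf : (X → EReal) → Set (ℝ × X)) := by
  intro f g he
  have := congrArg (fun A => timeReflect X ⁻¹' A) he
  simp only [timeReflect_preimage_futureOf] at this
  exact funext fun x => neg_injective (congrFun (pastOf_injective this) x)

variable {δ : X → X → ℝ}

/-- Time reflection is an isomorphism from the reversed chronology to the chronology of the reversed
distance. All dual statements are obtained through it. -/
theorem distRel_swap_eq (δ : X → X → ℝ) :
    (fun p q => distRel δ q p) =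
      fun p q => distRel (fun x y => δ y x) (timeReflect X p) (timeReflect X q) := by
  funext p q
  unfold distRel timeReflect
  simp only [Equiv.coe_fn_mk, eq_iff_iff]
  constructor <;> intro h <;> linarith

theorem isIP_swap_iff {F : Set (ℝ × X)} : Causal.IsIP (fun p q => distRel δ q p) F ↔
    Causal.IsIP (distRel fun x y => δ y x) (timeReflect X ⁻¹' F) := by
  rw [distRel_swap_eq]
  conv_lhs => rw [← timeReflect_preimage_preimage F]
  exact Causal.isIP_preimage _

theorem hatL_swap_iff {F : Set (ℝ × X)} {σ : ℕ → Set (ℝ × X)} :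
    F ∈ Causal.hatL (fun p q => distRel δ q p) σ ↔
    timeReflect X ⁻¹' F ∈ Causal.hatL (distRel fun x y => δ y x) fun n => timeReflect X ⁻¹' σ n := by
  rw [distRel_swap_eq]
  conv_lhs => rw [← timeReflect_preimage_preimage F]
  have : σ = fun n => timeReflect X ⁻¹' (timeReflect X ⁻¹' σ n) :=
    funext fun n => (timeReflect_preimage_preimage _).symm
  conv_lhs => rw [this]
  exact Causal.hatL_preimage _

theorem isTIP_swap_iff {F : Set (ℝ × X)} : Causal.IsTIP (fun p q => distRel δ q p) F ↔
    Causal.IsTIP (distRel fun x y => δ y x) (timeReflect X ⁻¹' F) := by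
  rw [distRel_swap_eq]
  conv_lhs => rw [← timeReflect_preimage_preimage F]
  exact Causal.isTIP_preimage _

theorem mem_cBoundary_reflect_iff {P F : Set (ℝ × X)} :
    (timeReflect X ⁻¹' F, timeReflect X ⁻¹' P) ∈ Causal.cBoundary (distRel fun x y => δ y x) ↔
      (P, F) ∈ Causal.cBoundary (distRel δ) := by
  rw [← Causal.mem_cBoundary_swap (r := distRel δ), distRel_swap_eq,
    ← Causal.mem_cBoundary_preimage (timeReflect X)]
  simp only [timeReflect_preimage_preimage]

theorem mem_cCompletion_reflect_iff {P F : Set (ℝ × X)} :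
    (timeReflect X ⁻¹' F, timeReflect X ⁻¹' P) ∈ Causal.cCompletion (distRel fun x y => δ y x) ↔
      (P, F) ∈ Causal.cCompletion (distRel δ) := by
  rw [← Causal.mem_cCompletion_swap (r := distRel δ), distRel_swap_eq,
    ← Causal.mem_cCompletion_preimage (timeReflect X)]
  simp only [timeReflect_preimage_preimage]

theorem pastOf_chainBusemann (u : ℕ → ℝ × X) :
    pastOf (chainBusemann δ u) = Causal.past (distRel δ) (range u) := by
  ext p
  change (p.1 : EReal) < chainBusemann δ u p.2 ↔ _
  unfold chainBusemann
  rw [lt_iSup_iff]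
  constructor
  · rintro ⟨n, hn⟩
    refine ⟨u n, ⟨n, rfl⟩, ?_⟩
    rw [EReal.coe_lt_coe_iff] at hn
    unfold distRel
    linarith
  · rintro ⟨_, ⟨n, rfl⟩, hn⟩
    refine ⟨n, EReal.coe_lt_coe_iff.2 ?_⟩
    unfold distRel at hn
    linarith

theorem past_singleton (p : ℝ × X) :
    Causal.past (distRel δ) {p} = pastOf fun x => ((p.1 - δ x p.2 : ℝ) : EReal) := by
  ext q
  constructor
  · rintro ⟨_, rfl, h⟩
    refine EReal.coe_lt_coe_iff.2 ?_
    unfold distRel at h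
    linarith
  · intro h
    refine ⟨p, rfl, ?_⟩
    have := EReal.coe_lt_coe_iff.1 h
    unfold distRel
    linarith

theorem future_singleton (p : ℝ × X) : Causal.past (fun p q => distRel δ q p) {p} =
    futureOf fun x => ((p.1 + δ p.2 x : ℝ) : EReal) := by
  ext q
  constructor
  · rintro ⟨_, rfl, h⟩
    refine EReal.coe_lt_coe_iff.2 ?_
    unfold distRel at h
    linarith
  · intro h
    refine ⟨p, rfl, ?_⟩
    have := EReal.coe_lt_coe_iff.1 h
    unfold distRel
    linarith

namespace LengthDist

variable (h : LengthDist δ)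
include h

theorem isChronological : Causal.IsChronological (distRel δ) where
  trans _ _ _ := h.distRel_trans
  dense p q hpq := by
    unfold distRel at hpq ⊢
    -- Rest at the point `p.2` for half of the spare time.
    refine ⟨((p.1 + (q.1 - δ p.2 q.2)) / 2, p.2), ?_, ?_⟩
    · rw [h.self]
      simp only
      linarith
    · simp only
      linarith

theorem isIP_pastOf {f : X → EReal} (hf : f ∈ chainFun δ) :
    Causal.IsIP (distRel δ) (pastOf f) := by
  obtain ⟨u, hu, rfl⟩ := hf
  rw [pastOf_chainBusemann, h.isChronological.isIP_iff]
  refine ⟨⟨u 0, u 1, ⟨1, rfl⟩, hu 0⟩, ?_, ?_⟩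
  · rintro p q hpq ⟨s, hs, hqs⟩
    exact ⟨s, hs, h.distRel_trans hpq hqs⟩
  · rintro p ⟨_, ⟨n, rfl⟩, hp⟩ q ⟨_, ⟨m, rfl⟩, hq⟩
    have key : ∀ k, u k ∈ Causal.past (distRel δ) (range u) := fun k => ⟨u (k + 1), ⟨k + 1, rfl⟩, hu k⟩
    rcases lt_trichotomy n m with hnm | rfl | hnm
    · exact ⟨u m, key m, h.distRel_trans hp (h.chain_rel hu hnm), hq⟩
    · exact ⟨u n, key n, hp, hq⟩
    · exact ⟨u n, key n, hp, h.distRel_trans hq (h.chain_rel hu hnm)⟩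

/-- The indecomposable past sets are the pasts of the Busemann functions. -/
theorem isIP_iff {P : Set (ℝ × X)} :
    Causal.IsIP (distRel δ) P ↔ ∃ f ∈ chainFun δ, P = pastOf f := by
  constructor
  swap
  · rintro ⟨f, hf, rfl⟩
    exact h.isIP_pastOf hf
  intro hP
  obtain ⟨⟨p₀, hp₀⟩, hlow, hdir⟩ := h.isChronological.isIP_iff.1 hP
  obtain ⟨D, hD⟩ := h.dense
  -- The points of `P` with rational time over the dense sequence form a countable cofinal set.
  have hbtw : ∀ p ∈ P, ∃ c : ℚ × ℕ, ((c.1 : ℝ), D c.2) ∈ P ∧ distRel δ p ((c.1 : ℝ), D c.2) := by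
    intro p hp
    obtain ⟨p', hp', hpp', -⟩ := hdir p hp p hp
    unfold distRel at hpp'
    set ε := (p'.1 - p.1 - δ p.2 p'.2) / 4 with hε
    obtain ⟨k, hk1, hk2⟩ := hD p.2 ε (by linarith)
    obtain ⟨q, hq1, hq2⟩ := exists_rat_btwn (show p.1 + ε < p.1 + 2 * ε by linarith)
    refine ⟨(q, k), hlow _ p' ?_ hp', ?_⟩
    · have := h.triangle (D k) p.2 p'.2
      unfold distRel
      simp only
      linarith
    · unfold distRel
      simp only
      linarith
  have : Nonempty {c : ℚ × ℕ // ((c.1 : ℝ), D c.2) ∈ P} := by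
    obtain ⟨c, hc, -⟩ := hbtw p₀ hp₀
    exact ⟨⟨c, hc⟩⟩
  obtain ⟨e, he⟩ := exists_surjective_nat {c : ℚ × ℕ // ((c.1 : ℝ), D c.2) ∈ P}
  choose! s hsP hs1 hs2 using hdir
  -- By directedness `u (n + 1)` can be chosen in `P` after both `u n` and the `n`-th point of the
  -- countable cofinal set. The sequence then passes beyond every point of `P`.
  let u : ℕ → {p // p ∈ P} := fun n => Nat.rec ⟨p₀, hp₀⟩
    (fun n v => ⟨s v.1 (((e n).1.1 : ℝ), D (e n).1.2), hsP _ v.2 _ (e n).2⟩) n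
  have hu : ∀ n, (u (n + 1)).1 = s (u n).1 (((e n).1.1 : ℝ), D (e n).1.2) := fun n => rfl
  refine ⟨chainBusemann δ fun n => (u n).1, ⟨fun n => (u n).1, fun n => ?_, rfl⟩, ?_⟩
  · change distRel δ (u n).1 (u (n + 1)).1
    rw [hu]
    exact hs1 _ (u n).2 _ (e n).2
  · rw [pastOf_chainBusemann]
    ext p
    constructor
    · intro hp
      obtain ⟨c, hc, hpc⟩ := hbtw p hp
      obtain ⟨n, hn⟩ := he ⟨c, hc⟩
      refine ⟨(u (n + 1)).1, ⟨n + 1, rfl⟩, h.distRel_trans hpc ?_⟩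
      rw [hu, hn]
      exact hs2 _ (u n).2 _ hc
    · rintro ⟨_, ⟨n, rfl⟩, hp⟩
      exact hlow _ _ hp (u n).2

/-- The indecomposable future sets. -/
theorem isIF_iff {F : Set (ℝ × X)} : Causal.IsIP (fun p q => distRel δ q p) F ↔
    ∃ g ∈ chainFun (fun x y => δ y x), F = futureOf fun x => -g x := by
  rw [isIP_swap_iff, h.swap.isIP_iff]
  refine exists_congr fun g => and_congr_right fun _ => ?_
  rw [← timeReflect_preimage_pastOf]
  constructor
  · intro he
    rw [← he, timeReflect_preimage_preimage]
  · intro he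
    rw [he, timeReflect_preimage_preimage]

/-- The limit operator on pasts of functions. -/
theorem mem_hatL_iff {f : X → EReal} {φ : ℕ → X → EReal} :
    pastOf f ∈ Causal.hatL (distRel δ) (fun n => pastOf (φ n)) ↔
      f ∈ chainFun δ ∧ (∀ x, f x ≤ liminf (fun n => φ n x) atTop) ∧
      ∀ g ∈ chainFun δ, (∀ x, f x ≤ g x) → (∀ x, g x ≤ limsup (fun n => φ n x) atTop) → g = f := by
  have h1 : ∀ f : X → EReal, pastOf f ⊆ Causal.limInf (fun n => pastOf (φ n)) ↔
      ∀ x, f x ≤ liminf (fun n => φ n x) atTop := by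
    intro f
    constructor
    · intro hs x
      refine le_of_forall_lt fun c hc => ?_
      obtain ⟨t, ht1, ht2⟩ := EReal.lt_iff_exists_real_btwn.1 hc
      refine ht1.trans_le (le_liminf_of_le (by isBoundedDefault) ?_)
      have : (t, x) ∈ Causal.limInf (fun n => pastOf (φ n)) := hs ht2
      exact Eventually.mono this fun n hn => le_of_lt hn
    · intro hs p hp
      have := lt_of_lt_of_le (show (p.1 : EReal) < f p.2 from hp) (hs p.2)
      exact eventually_lt_of_lt_liminf this
  have h2 : ∀ g : X → EReal, pastOf g ⊆ Causal.limSup (fun n => pastOf (φ n)) ↔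
      ∀ x, g x ≤ limsup (fun n => φ n x) atTop := by
    intro g
    constructor
    · intro hs x
      refine le_of_forall_lt fun c hc => ?_
      obtain ⟨t, ht1, ht2⟩ := EReal.lt_iff_exists_real_btwn.1 hc
      have : (t, x) ∈ Causal.limSup (fun n => pastOf (φ n)) := hs ht2
      exact ht1.trans_le (le_limsup_of_frequently_le (Frequently.mono this fun n hn => le_of_lt hn)
        (by isBoundedDefault))
    · intro hs p hp
      have := lt_of_lt_of_le (show (p.1 : EReal) < g p.2 from hp) (hs p.2)
      exact frequently_lt_of_lt_limsup (by isBoundedDefault) this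
  constructor
  · rintro ⟨h3, h4, h5, h6⟩
    obtain ⟨g, hg, hgf⟩ := h.isIP_iff.1 h4
    rw [pastOf_injective hgf]
    rw [pastOf_injective hgf] at h6 h3
    exact ⟨hg, (h1 _).1 h3, fun k hk h7 h8 => pastOf_injective
      (h6 _ (h.isIP_pastOf hk) (pastOf_subset_pastOf_iff.2 h7) ((h2 k).2 h8))⟩
  · rintro ⟨hf, h3, h4⟩
    refine ⟨(h1 f).2 h3, h.isIP_pastOf hf, fun p hp => ((h1 f).2 h3 hp).frequently, ?_⟩
    intro P' hP' h5 h6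
    obtain ⟨g, hg, rfl⟩ := h.isIP_iff.1 hP'
    rw [h4 g hg (pastOf_subset_pastOf_iff.1 h5) ((h2 g).1 h6)]

end LengthDist
end

/-! ### Pasts and futures of points of the Cauchy completions, and their S-relation. -/

section
variable {X : Type*}

/-- The past of the point at time `Ω` over the limit of `σ`. -/
def pastPoint (δ : X → X → ℝ) (Ω : ℝ) (σ : ℕ → X) : Set (ℝ × X) :=
  pastOf fun x => ((Ω - inDist δ σ x : ℝ) : EReal)

/-- The future of the point at time `Ω` over the limit of the backward sequence `τ`. -/
def futurePoint (δ : X → X → ℝ) (Ω : ℝ) (τ : ℕ → X) : Set (ℝ × X) :=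
  futureOf fun x => ((Ω + inDist (fun x y => δ y x) τ x : ℝ) : EReal)

variable {δ : X → X → ℝ} {σ τ : ℕ → X} {P F : Set (ℝ × X)} {Ω Ω' : ℝ}

theorem mem_pastPoint {p : ℝ × X} : p ∈ pastPoint δ Ω σ ↔ p.1 < Ω - inDist δ σ p.2 :=
  EReal.coe_lt_coe_iff

theorem mem_futurePoint {p : ℝ × X} :
    p ∈ futurePoint δ Ω τ ↔ Ω + inDist (fun x y => δ y x) τ p.2 < p.1 := EReal.coe_lt_coe_iff

theorem timeReflect_preimage_pastPoint (Ω : ℝ) (τ : ℕ → X) :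
    timeReflect X ⁻¹' pastPoint (fun x y => δ y x) Ω τ = futurePoint δ (-Ω) τ := by
  ext p
  rw [mem_preimage, mem_pastPoint, mem_futurePoint]
  simp only [timeReflect, Equiv.coe_fn_mk]
  constructor <;> intro h <;> linarith

theorem timeReflect_preimage_futurePoint (Ω : ℝ) (σ : ℕ → X) :
    timeReflect X ⁻¹' futurePoint (fun x y => δ y x) Ω σ = pastPoint δ (-Ω) σ := by
  ext p
  rw [mem_preimage, mem_pastPoint, mem_futurePoint]
  simp only [timeReflect, Equiv.coe_fn_mk]
  constructor <;> intro h <;> linarith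

theorem precedes_reflect_iff :
    Causal.Precedes (distRel fun x y => δ y x) (timeReflect X ⁻¹' F) (timeReflect X ⁻¹' P) ↔
      Causal.Precedes (distRel δ) P F := by
  have key : ∀ p q, distRel (fun x y => δ y x) (timeReflect X q) (timeReflect X p) ↔
      distRel δ p q := fun p q => (iff_of_eq (congrFun₂ (distRel_swap_eq δ) q p)).symm
  constructor
  · intro h p hp q hq
    rw [← key]
    exact h _ (by simpa [timeReflect] using hq) _ (by simpa [timeReflect] using hp)
  · intro h q hq p hp
    have := (key _ _).2 (h _ hp _ hq)
    simpa [timeReflect] using this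

namespace LengthDist

variable (h : LengthDist δ)
include h

theorem isIP_pastPoint (hσ : IsForwardCauchy (ofRealDist δ) σ) (Ω : ℝ) :
    Causal.IsIP (distRel δ) (pastPoint δ Ω σ) :=
  h.isIP_pastOf (h.sub_inDist_mem_chainFun hσ Ω)

theorem isIF_futurePoint (hτ : IsForwardCauchy (ofRealDist fun x y => δ y x) τ) (Ω : ℝ) :
    Causal.IsIP (fun p q => distRel δ q p) (futurePoint δ Ω τ) := by
  rw [isIP_swap_iff, ← neg_neg Ω, ← timeReflect_preimage_pastPoint, timeReflect_preimage_preimage]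
  exact h.swap.isIP_pastPoint hτ _

theorem past_singleton_eq (p : ℝ × X) :
    Causal.past (distRel δ) {p} = pastPoint δ p.1 fun _ => p.2 := by
  rw [past_singleton, pastPoint, h.inDist_const]

theorem future_singleton_eq (p : ℝ × X) :
    Causal.past (fun p q => distRel δ q p) {p} = futurePoint δ p.1 fun _ => p.2 := by
  rw [future_singleton, futurePoint, h.swap.inDist_const]

/-- A past set with a point in its common future comes from a chronological sequence with bounded
times. -/
theorem eq_pastPoint_of_chain {u : ℕ → ℝ × X} (hu : IsChronChain δ u)
    (hP : Causal.Precedes (distRel δ) (pastOf (chainBusemann δ u)) F) (hF : F.Nonempty) :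
    ∃ Ω, Tendsto (fun n => (u n).1) atTop (𝓝 Ω) := by
  obtain ⟨q, hq⟩ := hF
  refine h.chain_of_bddAbove hu ⟨q.1, ?_⟩
  rintro _ ⟨n, rfl⟩
  rw [pastOf_chainBusemann] at hP
  exact (h.distRel_lt (hP (u n) ⟨u (n + 1), ⟨n + 1, rfl⟩, hu n⟩ q hq)).le

theorem exists_pastPoint (hP : Causal.IsIP (distRel δ) P) (hPF : Causal.Precedes (distRel δ) P F)
    (hF : F.Nonempty) :
    ∃ Ω σ, IsForwardCauchy (ofRealDist δ) σ ∧ P = pastPoint δ Ω σ := by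
  obtain ⟨_, ⟨u, hu, rfl⟩, rfl⟩ := h.isIP_iff.1 hP
  obtain ⟨Ω, hΩ⟩ := h.eq_pastPoint_of_chain hu hPF hF
  obtain ⟨h1, h2⟩ := h.chain_bounded hu hΩ
  exact ⟨Ω, _, h1, by rw [h2]; rfl⟩

theorem exists_futurePoint (hF : Causal.IsIP (fun p q => distRel δ q p) F)
    (hPF : Causal.Precedes (distRel δ) P F) (hP : P.Nonempty) :
    ∃ Ω τ, IsForwardCauchy (ofRealDist fun x y => δ y x) τ ∧ F = futurePoint δ Ω τ := by
  obtain ⟨Ω, τ, h1, h2⟩ := h.swap.exists_pastPoint (isIP_swap_iff.1 hF)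
    (precedes_reflect_iff.2 hPF) (hP.preimage (timeReflect X).surjective)
  exact ⟨-Ω, τ, h1, by
    rw [← timeReflect_preimage_pastPoint, ← h2, timeReflect_preimage_preimage]⟩

/-- Pointwise, the left side says `δ x y ≤ Ω' - Ω + inDist σ x + inDist τ y`, the second distance
function being the reversed one. For `x = σ n` and `y = τ m` both distance terms tend to `0` and the
double limit remains; the converse is the triangle inequality through these points. -/
theorem precedes_iff (hσ : IsForwardCauchy (ofRealDist δ) σ)
    (hτ : IsForwardCauchy (ofRealDist fun x y => δ y x) τ) :
    Causal.Precedes (distRel δ) (pastPoint δ Ω σ) (futurePoint δ Ω' τ) ↔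
      (doubleLim (ofRealDist δ) σ τ : EReal) ≤ ((Ω' - Ω : ℝ) : EReal) := by
  constructor
  · intro hp
    have h1 : ∀ x y, δ x y ≤ Ω' - Ω + inDist δ σ x + inDist (fun x y => δ y x) τ y := by
      intro x y
      by_contra hcon
      push Not at hcon
      set ε := (δ x y - (Ω' - Ω + inDist δ σ x + inDist (fun x y => δ y x) τ y)) / 2 with hε
      have := hp (Ω - inDist δ σ x - ε, x) (mem_pastPoint.2 (by simp only; linarith))
        (Ω' + inDist (fun x y => δ y x) τ y + ε, y) (mem_futurePoint.2 (by simp only; linarith))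
      unfold distRel at this
      simp only at this
      linarith
    have h2 : ∀ n, 0 ≤ Ω' - Ω + inDist δ σ (σ n) := by
      intro n
      have := (h.swap.tendsto_inDist_self hτ).const_add (Ω' - Ω + inDist δ σ (σ n))
      rw [add_zero] at this
      exact ge_of_tendsto' this fun m => (h.nonneg (σ n) (τ m)).trans (h1 _ _)
    have h2' : 0 ≤ Ω' - Ω := by
      have := (h.tendsto_inDist_self hσ).const_add (Ω' - Ω)
      rw [add_zero] at this
      exact ge_of_tendsto' this h2
    have h3 : ∀ n, limsup (fun m => ofRealDist δ (σ n) (τ m)) atTop ≤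
        ENNReal.ofReal (Ω' - Ω + inDist δ σ (σ n)) := by
      intro n
      have h4 := (ENNReal.continuous_ofReal.tendsto _).comp
        ((h.swap.tendsto_inDist_self hτ).const_add (Ω' - Ω + inDist δ σ (σ n)))
      rw [add_zero] at h4
      rw [← h4.limsup_eq]
      exact limsup_le_limsup (Eventually.of_forall fun m => ENNReal.ofReal_le_ofReal (h1 _ _))
        (by isBoundedDefault) (by isBoundedDefault)
    have h5 : doubleLim (ofRealDist δ) σ τ ≤ ENNReal.ofReal (Ω' - Ω) := by
      have h4 := (ENNReal.continuous_ofReal.tendsto _).comp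
        ((h.tendsto_inDist_self hσ).const_add (Ω' - Ω))
      rw [add_zero] at h4
      rw [← h4.limsup_eq]
      exact limsup_le_limsup (Eventually.of_forall h3)
        (by isBoundedDefault) (by isBoundedDefault)
    calc (doubleLim (ofRealDist δ) σ τ : EReal) ≤ (ENNReal.ofReal (Ω' - Ω) : EReal) := by
          exact_mod_cast h5
      _ = _ := by rw [EReal.coe_ennreal_ofReal, max_eq_left h2']
  · intro hd
    have h0 : 0 ≤ Ω' - Ω := by
      have := (EReal.coe_ennreal_nonneg (doubleLim (ofRealDist δ) σ τ)).trans hd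
      exact_mod_cast this
    have hd' : doubleLim (ofRealDist δ) σ τ ≤ ENNReal.ofReal (Ω' - Ω) := by
      have h1 : ((Ω' - Ω : ℝ) : EReal) = (ENNReal.ofReal (Ω' - Ω) : EReal) := by
        rw [EReal.coe_ennreal_ofReal, max_eq_left h0]
      rw [h1] at hd
      exact_mod_cast hd
    intro p hp q hq
    rw [mem_pastPoint] at hp
    rw [mem_futurePoint] at hq
    unfold distRel
    suffices δ p.2 q.2 ≤ inDist δ σ p.2 + (Ω' - Ω) + inDist (fun x y => δ y x) τ q.2 by linarith
    refine le_of_forall_pos_le_add fun ε hε => ?_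
    have h1 : ∀ᶠ n in atTop, limsup (fun m => ofRealDist δ (σ n) (τ m)) atTop <
        ENNReal.ofReal (Ω' - Ω + ε) := eventually_lt_of_limsup_lt
      (lt_of_le_of_lt hd' ((ENNReal.ofReal_lt_ofReal_iff (by linarith)).2 (by linarith)))
    have h2 : ∀ᶠ n in atTop, δ p.2 q.2 ≤
        δ p.2 (σ n) + (Ω' - Ω + ε) + inDist (fun x y => δ y x) τ q.2 := by
      filter_upwards [h1] with n hn
      have h3 := eventually_lt_of_limsup_lt hn
      refine ge_of_tendsto ((h.swap.tendsto_inDist hτ q.2).const_add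
        (δ p.2 (σ n) + (Ω' - Ω + ε))) ?_
      filter_upwards [h3] with m hm
      have h4 := (ENNReal.ofReal_lt_ofReal_iff (by linarith)).1 hm
      have h5 := h.triangle p.2 (σ n) q.2
      have h6 := h.triangle (σ n) (τ m) q.2
      linarith
    have h3 := ge_of_tendsto (((h.tendsto_inDist hσ p.2).add_const (Ω' - Ω + ε)).add_const
      (inDist (fun x y => δ y x) τ q.2)) h2
    linarith

/-- For S-related sets the difference of the times is the distance of the end points. -/
theorem coe_sub_eq_doubleLim (hσ : IsForwardCauchy (ofRealDist δ) σ)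
    (hτ : IsForwardCauchy (ofRealDist fun x y => δ y x) τ)
    (hS : Causal.SRelated (distRel δ) (pastPoint δ Ω σ) (futurePoint δ Ω' τ)) :
    ((Ω' - Ω : ℝ) : EReal) = (doubleLim (ofRealDist δ) σ τ : EReal) := by
  obtain ⟨-, -, h1, h2, -⟩ := (Causal.sRelated_iff h.isChronological).1 hS
  rw [h.precedes_iff hσ hτ] at h1
  refine le_antisymm (not_lt.1 fun hlt => ?_) h1
  -- If the time difference were larger than the distance, the future over `τ` could begin earlier,
  -- at `Ω + c`, and still follow the past, against its maximality.
  obtain ⟨c, hc1, hc2⟩ := EReal.lt_iff_exists_real_btwn.1 hlt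
  rw [EReal.coe_lt_coe_iff] at hc2
  have h3 := h2 (futurePoint δ (Ω + c) τ) (h.isIF_futurePoint hτ _) (fun p hp => by
    rw [mem_futurePoint] at hp ⊢
    linarith) ((h.precedes_iff hσ hτ).2 (by rw [add_sub_cancel_left]; exact hc1.le))
  have h4 : (Ω' + inDist (fun x y => δ y x) τ (τ 0), τ 0) ∈ futurePoint δ (Ω + c) τ :=
    mem_futurePoint.2 (by simp only; linarith)
  rw [h3, mem_futurePoint] at h4
  exact lt_irrefl _ h4

/-- The hypothesis is tested on the points over `σ n` at times just below `Ω - inDist δ σ (σ n)`;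
these times tend to `Ω`. -/
theorem add_outDist_le (hσ : IsForwardCauchy (ofRealDist δ) σ) {q : ℝ × X}
    (hq : ∀ p ∈ pastPoint δ Ω σ, distRel δ p q) :
    (Ω : EReal) + (outDist δ σ q.2 : EReal) ≤ (q.1 : EReal) := by
  have h1 : ∀ n, δ (σ n) q.2 ≤ q.1 - Ω + inDist δ σ (σ n) := by
    intro n
    refine le_of_forall_pos_le_add fun ε hε => ?_
    have := hq (Ω - inDist δ σ (σ n) - ε, σ n) (mem_pastPoint.2 (by simp only; linarith))
    unfold distRel at this
    simp only at this
    linarith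
  have h2 : Tendsto (fun n => q.1 - Ω + inDist δ σ (σ n)) atTop (𝓝 (q.1 - Ω)) := by
    simpa using (h.tendsto_inDist_self hσ).const_add (q.1 - Ω)
  have h3 : 0 ≤ q.1 - Ω := ge_of_tendsto' h2 fun n => (h.nonneg _ _).trans (h1 n)
  have h4 : outDist δ σ q.2 ≤ ENNReal.ofReal (q.1 - Ω) :=
    le_of_tendsto_of_tendsto' (h.tendsto_outDist hσ q.2)
      ((ENNReal.continuous_ofReal.tendsto _).comp h2) fun n => ENNReal.ofReal_le_ofReal (h1 n)
  calc (Ω : EReal) + (outDist δ σ q.2 : EReal)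
      ≤ (Ω : EReal) + (ENNReal.ofReal (q.1 - Ω) : EReal) := by
        gcongr
        exact_mod_cast h4
    _ = (q.1 : EReal) := by
        rw [EReal.coe_ennreal_ofReal, max_eq_left h3, ← EReal.coe_add]
        simp

theorem commonFuture_subset (hσ : IsForwardCauchy (ofRealDist δ) σ) :
    Causal.commonPast (fun p q => distRel δ q p) (pastPoint δ Ω σ) ⊆
      futureOf fun x => (Ω : EReal) + (outDist δ σ x : EReal) := by
  rintro q ⟨q', hq', hqq⟩
  have h1 := h.add_outDist_le hσ hq'
  have h2 : outDist δ σ q.2 ≤ outDist δ σ q'.2 + ofRealDist δ q'.2 q.2 :=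
    le_of_tendsto_of_tendsto' (h.tendsto_outDist hσ q.2)
      ((h.tendsto_outDist hσ q'.2).add_const _) fun n => h.ofRealDist_triangle _ _ _
  have h3 : (ofRealDist δ q'.2 q.2 : EReal) = (δ q'.2 q.2 : EReal) := by
    rw [ofRealDist, EReal.coe_ennreal_ofReal, max_eq_left (h.nonneg _ _)]
  change (Ω : EReal) + (outDist δ σ q.2 : EReal) < (q.1 : EReal)
  calc (Ω : EReal) + (outDist δ σ q.2 : EReal)
      ≤ (Ω : EReal) + ((outDist δ σ q'.2 + ofRealDist δ q'.2 q.2 : ℝ≥0∞) : EReal) := by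
        gcongr
        exact_mod_cast h2
    _ = (Ω : EReal) + (outDist δ σ q'.2 : EReal) + (δ q'.2 q.2 : EReal) := by
        rw [EReal.coe_ennreal_add, h3, add_assoc]
    _ ≤ (q'.1 : EReal) + (δ q'.2 q.2 : EReal) := by gcongr
    _ < (q.1 : EReal) := by
        rw [← EReal.coe_add, EReal.coe_lt_coe_iff]
        unfold distRel at hqq
        linarith

theorem subset_futureOf_outDist (hσ : IsForwardCauchy (ofRealDist δ) σ)
    (hF : Causal.IsIP (fun p q => distRel δ q p) F)
    (hPF : Causal.Precedes (distRel δ) (pastPoint δ Ω σ) F) :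
    F ⊆ futureOf fun x => (Ω : EReal) + (outDist δ σ x : EReal) :=
  ((Causal.subset_commonFuture_iff h.isChronological hF).2 hPF).trans (h.commonFuture_subset hσ)

theorem futureOf_outDist_eq (hσ' : IsForwardCauchy (ofRealDist fun x y => δ y x) σ) :
    (futureOf fun x => (Ω : EReal) + (outDist δ σ x : EReal)) = futurePoint δ Ω σ := by
  unfold futurePoint
  congr 1
  funext x
  rw [h.outDist_eq hσ', EReal.coe_ennreal_ofReal, max_eq_left (h.swap.inDist_nonneg _ _),
    EReal.coe_add]

/-! #### Points over symmetric Cauchy sequences -/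

theorem precedes_symm (hσ : IsForwardCauchy (ofRealDist δ) σ)
    (hσ' : IsForwardCauchy (ofRealDist fun x y => δ y x) σ) :
    Causal.Precedes (distRel δ) (pastPoint δ Ω σ) (futurePoint δ Ω σ) := by
  rw [h.precedes_iff hσ hσ', h.doubleLim_eq_zero hσ rfl hσ]
  simp

theorem commonFuture_symm (hσ : IsForwardCauchy (ofRealDist δ) σ)
    (hσ' : IsForwardCauchy (ofRealDist fun x y => δ y x) σ) :
    Causal.commonPast (fun p q => distRel δ q p) (pastPoint δ Ω σ) = futurePoint δ Ω σ :=
  ((h.commonFuture_subset hσ).trans (h.futureOf_outDist_eq hσ').le).antisymm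
    ((Causal.subset_commonFuture_iff h.isChronological (h.isIF_futurePoint hσ' _)).2
      (h.precedes_symm hσ hσ'))

theorem subset_futurePoint (hσ : IsForwardCauchy (ofRealDist δ) σ)
    (hσ' : IsForwardCauchy (ofRealDist fun x y => δ y x) σ)
    (hF : Causal.IsIP (fun p q => distRel δ q p) F)
    (hPF : Causal.Precedes (distRel δ) (pastPoint δ Ω σ) F) : F ⊆ futurePoint δ Ω σ :=
  (h.subset_futureOf_outDist hσ hF hPF).trans (h.futureOf_outDist_eq hσ').le

theorem subset_pastPoint (hσ : IsForwardCauchy (ofRealDist δ) σ)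
    (hσ' : IsForwardCauchy (ofRealDist fun x y => δ y x) σ)
    (hP : Causal.IsIP (distRel δ) P)
    (hPF : Causal.Precedes (distRel δ) P (futurePoint δ Ω σ)) : P ⊆ pastPoint δ Ω σ := by
  rw [← neg_neg Ω, ← timeReflect_preimage_pastPoint] at hPF
  rw [← timeReflect_preimage_preimage P, ← precedes_reflect_iff] at hPF
  simp only [timeReflect_preimage_preimage] at hPF
  rw [← neg_neg Ω, ← timeReflect_preimage_futurePoint]
  have h1 := h.swap.subset_futurePoint hσ' hσ (F := timeReflect X ⁻¹' P) (Ω := -Ω) (by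
    rw [isIP_swap_iff, timeReflect_preimage_preimage]
    exact hP) hPF
  intro p hp
  exact h1 (by rwa [← mem_preimage, timeReflect_preimage_preimage])

theorem sRelated_symm (hσ : IsForwardCauchy (ofRealDist δ) σ)
    (hσ' : IsForwardCauchy (ofRealDist fun x y => δ y x) σ) :
    Causal.SRelated (distRel δ) (pastPoint δ Ω σ) (futurePoint δ Ω σ) :=
  (Causal.sRelated_iff h.isChronological).2 ⟨h.isIP_pastPoint hσ _, h.isIF_futurePoint hσ' _,
    h.precedes_symm hσ hσ', fun _ hF' h1 h2 => (h.subset_futurePoint hσ hσ' hF' h2).antisymm h1,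
    fun _ hP' h1 h2 => (h.subset_pastPoint hσ hσ' hP' h2).antisymm h1⟩

/-- `futurePoint δ Ω σ` follows the past set and contains every IF that does so. It is thus the only
maximal one. -/
theorem sRelated_pastPoint_iff (hσ : IsForwardCauchy (ofRealDist δ) σ)
    (hσ' : IsForwardCauchy (ofRealDist fun x y => δ y x) σ) :
    Causal.SRelated (distRel δ) (pastPoint δ Ω σ) F ↔ F = futurePoint δ Ω σ := by
  constructor
  · intro hS
    obtain ⟨-, h1, h2, h3, -⟩ := (Causal.sRelated_iff h.isChronological).1 hS
    exact (h3 _ (h.isIF_futurePoint hσ' _) (h.subset_futurePoint hσ hσ' h1 h2)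
      (h.precedes_symm hσ hσ')).symm
  · rintro rfl
    exact h.sRelated_symm hσ hσ'

theorem sRelated_futurePoint_iff (hσ : IsForwardCauchy (ofRealDist δ) σ)
    (hσ' : IsForwardCauchy (ofRealDist fun x y => δ y x) σ) :
    Causal.SRelated (distRel δ) P (futurePoint δ Ω σ) ↔ P = pastPoint δ Ω σ := by
  constructor
  · intro hS
    obtain ⟨h1, -, h2, -, h3⟩ := (Causal.sRelated_iff h.isChronological).1 hS
    exact (h3 _ (h.isIP_pastPoint hσ _) (h.subset_pastPoint hσ hσ' h1 h2)
      (h.precedes_symm hσ hσ')).symm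
  · rintro rfl
    exact h.sRelated_symm hσ hσ'

theorem mem_cCompletion_pastPoint_iff (hσ : IsForwardCauchy (ofRealDist δ) σ)
    (hσ' : IsForwardCauchy (ofRealDist fun x y => δ y x) σ) :
    (pastPoint δ Ω σ, F) ∈ Causal.cCompletion (distRel δ) ↔ F = futurePoint δ Ω σ := by
  constructor
  · intro hm
    exact Causal.eq_of_mem_cCompletion (h.isIP_pastPoint hσ _) (fun F F' h1 h2 =>
      ((h.sRelated_pastPoint_iff hσ hσ').1 h1).trans ((h.sRelated_pastPoint_iff hσ hσ').1 h2).symm)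
      hm (Or.inl (h.sRelated_symm hσ hσ'))
  · rintro rfl
    exact Or.inl (h.sRelated_symm hσ hσ')

theorem mem_cCompletion_futurePoint_iff (hσ : IsForwardCauchy (ofRealDist δ) σ)
    (hσ' : IsForwardCauchy (ofRealDist fun x y => δ y x) σ) :
    (P, futurePoint δ Ω σ) ∈ Causal.cCompletion (distRel δ) ↔ P = pastPoint δ Ω σ := by
  constructor
  · intro hm
    exact Causal.eq_of_mem_cCompletion (r := fun p q => distRel δ q p) (h.isIF_futurePoint hσ' _)
      (fun P P' h1 h2 => ((h.sRelated_futurePoint_iff hσ hσ').1 (Causal.sRelated_swap.1 h1)).trans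
        ((h.sRelated_futurePoint_iff hσ hσ').1 (Causal.sRelated_swap.1 h2)).symm)
      (Causal.mem_cCompletion_swap.2 hm) (Or.inl (Causal.sRelated_swap.2 (h.sRelated_symm hσ hσ')))
  · rintro rfl
    exact Or.inl (h.sRelated_symm hσ hσ')

end LengthDist
end

/-! ### Lines, terminal sets, simplicity as a point set, and causality of the lines. -/

section
variable {X : Type*}

/-- Pairs `(P(d_p⁺), F(d_p⁻))` for a point over a symmetric Cauchy sequence. -/
def IsSymmPair (δ : X → X → ℝ) (P F : Set (ℝ × X)) : Prop :=
  ∃ Ω σ, IsForwardCauchy (ofRealDist δ) σ ∧ IsForwardCauchy (ofRealDist fun x y => δ y x) σ ∧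
    P = pastPoint δ Ω σ ∧ F = futurePoint δ Ω σ

/-- The time translation as a bijection. -/
def timeTranslate (X : Type*) (k : ℝ) : ℝ × X ≃ ℝ × X where
  toFun p := (p.1 - k, p.2)
  invFun p := (p.1 + k, p.2)
  left_inv p := by simp
  right_inv p := by simp

theorem linePoint_linePoint (p : Set (ℝ × X) × Set (ℝ × X)) (k l : ℝ) :
    linePoint (linePoint p k) l = linePoint p (k + l) := by
  unfold linePoint timeShift
  refine Prod.ext (Set.ext fun q => ?_) (Set.ext fun q => ?_) <;>
  · simp only [mem_ofPred_eq, sub_sub]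
    rw [add_comm l k]

theorem linePoint_zero (p : Set (ℝ × X) × Set (ℝ × X)) : linePoint p 0 = p := by
  unfold linePoint timeShift
  refine Prod.ext (Set.ext fun q => ?_) (Set.ext fun q => ?_) <;> simp

theorem line_eq_or_disjoint (p q : Set (ℝ × X) × Set (ℝ × X)) :
    line p = line q ∨ Disjoint (line p) (line q) := by
  by_cases hd : Disjoint (line p) (line q)
  · exact Or.inr hd
  left
  obtain ⟨_, ⟨k, rfl⟩, l, hl⟩ := not_disjoint_iff.1 hd
  have key : ∀ (p q : Set (ℝ × X) × Set (ℝ × X)) (k l : ℝ), linePoint p k = linePoint q l →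
      line p ⊆ line q := by
    rintro p q k l he _ ⟨m, rfl⟩
    refine ⟨l + (m - k), ?_⟩
    rw [← linePoint_linePoint, ← he, linePoint_linePoint]
    simp
  exact (key p q k l hl).antisymm (key q p l k hl.symm)

variable {δ : X → X → ℝ} {σ τ : ℕ → X} {P F : Set (ℝ × X)} {Ω Ω' : ℝ}

/-- Time translations are automorphisms of the chronology. -/
theorem linePoint_mem_cBoundary {p : Set (ℝ × X) × Set (ℝ × X)}
    (hp : p ∈ Causal.cBoundary (distRel δ)) (k : ℝ) :
    linePoint p k ∈ Causal.cBoundary (distRel δ) := by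
  have h1 : distRel δ = fun p q => distRel δ (timeTranslate X k p) (timeTranslate X k q) := by
    funext p q
    simp [distRel, timeTranslate]
  rw [h1]
  exact (Causal.mem_cBoundary_preimage (timeTranslate X k)).2 hp

theorem cBoundary_eq_iUnion_line :
    Causal.cBoundary (distRel δ) = ⋃ p ∈ Causal.cBoundary (distRel δ), line p := by
  refine Subset.antisymm (fun p hp => mem_iUnion₂.2 ⟨p, hp, 0, (linePoint_zero p).symm⟩) ?_
  refine iUnion₂_subset fun p hp => ?_
  rintro _ ⟨k, rfl⟩
  exact linePoint_mem_cBoundary hp k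

theorem Causal.mem_cBoundary_of_isTIP {V : Type*} {r : V → V → Prop} {P F : Set V}
    (hm : (P, F) ∈ cCompletion r) (hP : IsTIP r P) : (P, F) ∈ cBoundary r :=
  ⟨hm, fun ⟨v, hv⟩ => hP.2 ⟨v, (Prod.mk.inj hv).1⟩⟩

theorem Causal.mem_cBoundary_of_isTIF {V : Type*} {r : V → V → Prop} {P F : Set V}
    (hm : (P, F) ∈ cCompletion r) (hF : IsTIP (fun p q => r q p) F) : (P, F) ∈ cBoundary r :=
  ⟨hm, fun ⟨v, hv⟩ => hF.2 ⟨v, (Prod.mk.inj hv).2⟩⟩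

namespace LengthDist

variable (h : LengthDist δ)
include h

/-- Points of the spacetime are symmetric points given by constant sequences, so the past of a point
is paired only with its future. Consequently the non-empty components of a boundary pair are
terminal. -/
theorem mem_cCompletion_past_iff (v : ℝ × X) :
    (Causal.past (distRel δ) {v}, F) ∈ Causal.cCompletion (distRel δ) ↔
      F = Causal.past (fun p q => distRel δ q p) {v} := by
  rw [h.past_singleton_eq, h.future_singleton_eq]
  exact h.mem_cCompletion_pastPoint_iff (h.isForwardCauchy_const _) (h.swap.isForwardCauchy_const _)

theorem mem_cCompletion_future_iff (v : ℝ × X) :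
    (P, Causal.past (fun p q => distRel δ q p) {v}) ∈ Causal.cCompletion (distRel δ) ↔
      P = Causal.past (distRel δ) {v} := by
  rw [h.past_singleton_eq, h.future_singleton_eq]
  exact h.mem_cCompletion_futurePoint_iff (h.isForwardCauchy_const _)
    (h.swap.isForwardCauchy_const _)

theorem isTIP_of_mem_cBoundary (hm : (P, F) ∈ Causal.cBoundary (distRel δ)) (hP : P ≠ ∅) :
    Causal.IsTIP (distRel δ) P := by
  refine ⟨Causal.mem_cCompletion_isIP hm.1 hP, ?_⟩
  rintro ⟨v, rfl⟩
  exact hm.2 ⟨v, by rw [(h.mem_cCompletion_past_iff v).1 hm.1]⟩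

theorem isTIF_of_mem_cBoundary (hm : (P, F) ∈ Causal.cBoundary (distRel δ)) (hF : F ≠ ∅) :
    Causal.IsTIP (fun p q => distRel δ q p) F := by
  refine ⟨Causal.mem_cCompletion_isIP (Causal.mem_cCompletion_swap.2 hm.1) hF, ?_⟩
  rintro ⟨v, rfl⟩
  exact hm.2 ⟨v, by rw [(h.mem_cCompletion_future_iff v).1 hm.1]⟩

theorem isTIP_pastPoint_iff (hσ : IsForwardCauchy (ofRealDist δ) σ) :
    Causal.IsTIP (distRel δ) (pastPoint δ Ω σ) ↔ ¬ (CauchyCompl.mk σ hσ).IsInterior := by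
  rw [h.isInterior_mk_iff, Causal.IsTIP, and_iff_right (h.isIP_pastPoint hσ _)]
  refine not_congr ⟨?_, ?_⟩
  · rintro ⟨v, hv⟩
    rw [h.past_singleton_eq] at hv
    have h1 := fun x => EReal.coe_eq_coe_iff.1 (congrFun (pastOf_injective hv) x)
    have h2 := (h.eq_of_sub_inDist_eq hσ (h.isForwardCauchy_const v.2) h1).2
    rw [h.inDist_const] at h2
    exact ⟨_, h2⟩
  · rintro ⟨x, hx⟩
    refine ⟨(Ω, x), ?_⟩
    rw [past_singleton, pastPoint, hx]

theorem isTIF_futurePoint_iff (hτ : IsForwardCauchy (ofRealDist fun x y => δ y x) τ) :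
    Causal.IsTIP (fun p q => distRel δ q p) (futurePoint δ Ω τ) ↔
      ¬ (CauchyCompl.mk τ hτ).IsInterior := by
  rw [isTIP_swap_iff, ← neg_neg Ω, ← timeReflect_preimage_pastPoint, timeReflect_preimage_preimage]
  exact h.swap.isTIP_pastPoint_iff hτ

theorem pastPoint_eq_iff (hσ : IsForwardCauchy (ofRealDist δ) σ)
    (hτ : IsForwardCauchy (ofRealDist δ) τ) :
    pastPoint δ Ω σ = pastPoint δ Ω' τ ↔ Ω = Ω' ∧ inDist δ σ = inDist δ τ := by
  constructor
  · intro he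
    exact h.eq_of_sub_inDist_eq hσ hτ fun x =>
      EReal.coe_eq_coe_iff.1 (congrFun (pastOf_injective he) x)
  · rintro ⟨rfl, he⟩
    unfold pastPoint
    rw [he]

theorem futurePoint_eq_iff (hσ : IsForwardCauchy (ofRealDist fun x y => δ y x) σ)
    (hτ : IsForwardCauchy (ofRealDist fun x y => δ y x) τ) :
    futurePoint δ Ω σ = futurePoint δ Ω' τ ↔
      Ω = Ω' ∧ inDist (fun x y => δ y x) σ = inDist (fun x y => δ y x) τ := by
  rw [← neg_neg Ω, ← neg_neg Ω', ← timeReflect_preimage_pastPoint, ← timeReflect_preimage_pastPoint,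
    (timeReflect X).surjective.preimage_injective.eq_iff, h.swap.pastPoint_eq_iff hσ hτ]
  simp

/-- The sequence of a symmetric point is interior in both completions or in none. -/
theorem isInterior_mk_iff_swap (hσ : IsForwardCauchy (ofRealDist δ) σ)
    (hσ' : IsForwardCauchy (ofRealDist fun x y => δ y x) σ) :
    (CauchyCompl.mk σ hσ).IsInterior ↔ (CauchyCompl.mk σ hσ').IsInterior := by
  have key : ∀ {δ : X → X → ℝ} (h : LengthDist δ) (hσ : IsForwardCauchy (ofRealDist δ) σ)
      (hσ' : IsForwardCauchy (ofRealDist fun x y => δ y x) σ),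
      (CauchyCompl.mk σ hσ).IsInterior → (CauchyCompl.mk σ hσ').IsInterior := by
    intro δ h hσ hσ' hi
    rw [h.isInterior_mk_iff] at hi
    rw [h.swap.isInterior_mk_iff]
    obtain ⟨x, hx⟩ := hi
    refine ⟨x, h.swap.inDist_eq_of_tendsto hσ' (h.tendsto_swap ?_)⟩
    have := h.tendsto_inDist hσ x
    simpa only [hx, h.self] using this
  exact ⟨key h hσ hσ', key h.swap hσ' hσ⟩

/-- If all S-related terminal sets come from symmetric Cauchy sequences, the boundary is simple as
a point set. -/
theorem isPointSimple_of_isSymmPair (hs : ∀ P F, Causal.SRelated (distRel δ) P F →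
      Causal.IsTIP (distRel δ) P → IsSymmPair δ P F) :
    Causal.IsPointSimple (distRel δ) := by
  constructor
  · intro P hP
    obtain ⟨F, hF⟩ := Causal.exists_mem_cCompletion hP.1
    refine ⟨F, Causal.mem_cBoundary_of_isTIP hF hP, fun F' hF' => ?_⟩
    refine Causal.eq_of_mem_cCompletion hP.1 (fun F F' h1 h2 => ?_) hF'.1 hF
    obtain ⟨Ω, σ, hσ, hσ', rfl, rfl⟩ := hs P F h1 hP
    exact ((h.sRelated_pastPoint_iff hσ hσ').1 h2).symm
  · intro F hF
    obtain ⟨P, hP⟩ := Causal.exists_mem_cCompletion hF.1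
    rw [Causal.mem_cCompletion_swap] at hP
    refine ⟨P, Causal.mem_cBoundary_of_isTIF hP hF, fun P' hP' => ?_⟩
    refine Causal.eq_of_mem_cCompletion hF.1 (fun P P' h1 h2 => ?_)
      (Causal.mem_cCompletion_swap.2 hP'.1) (Causal.mem_cCompletion_swap.2 hP)
    rw [Causal.sRelated_swap] at h1 h2
    have hT : Causal.IsTIP (distRel δ) P := by
      refine h.isTIP_of_mem_cBoundary (F := F) (Causal.mem_cBoundary_of_isTIF (Or.inl h1) hF) ?_
      exact h1.2.1.ne_empty
    obtain ⟨Ω, σ, hσ, hσ', rfl, rfl⟩ := hs P F h1 hT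
    exact ((h.sRelated_futurePoint_iff hσ hσ').1 h2).symm

/-- A criterion for simplicity as a point set in terms of distances from boundary points. -/
theorem isPointSimple_of_outDist (hs : ∀ σ : ℕ → X, IsForwardCauchy (ofRealDist δ) σ →
      (¬ ∃ x, inDist δ σ = fun y => δ y x) → (∀ y, outDist δ σ y ≠ ⊤) →
      ∃ τ, IsForwardCauchy (ofRealDist δ) τ ∧ IsForwardCauchy (ofRealDist fun x y => δ y x) τ ∧
        inDist δ σ = inDist δ τ) :
    Causal.IsPointSimple (distRel δ) := by
  refine h.isPointSimple_of_isSymmPair fun P F hS hP => ?_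
  obtain ⟨h1, h2, h3, -, -⟩ := (Causal.sRelated_iff h.isChronological).1 hS
  obtain ⟨Ω, σ, hσ, rfl⟩ := h.exists_pastPoint h1 h3 h2.nonempty
  have hi : ¬ ∃ x, inDist δ σ = fun y => δ y x := by
    rw [← h.isInterior_mk_iff hσ]
    exact (h.isTIP_pastPoint_iff hσ).1 hP
  -- A partner lies in the region `t > Ω + outDist`. Hence `outDist` is finite at one point, and by
  -- the triangle inequality everywhere.
  have hfin : ∀ y, outDist δ σ y ≠ ⊤ := by
    intro y hy
    obtain ⟨q, hq⟩ := h2.nonempty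
    have h4 : (Ω : EReal) + (outDist δ σ q.2 : EReal) < (q.1 : EReal) :=
      h.subset_futureOf_outDist hσ h2 h3 hq
    have h5 : outDist δ σ y ≤ outDist δ σ q.2 + ofRealDist δ q.2 y :=
      le_of_tendsto_of_tendsto' (h.tendsto_outDist hσ y)
        ((h.tendsto_outDist hσ q.2).add_const _) fun n => h.ofRealDist_triangle _ _ _
    rw [hy, top_le_iff, ENNReal.add_eq_top] at h5
    rcases h5 with h5 | h5
    · rw [h5] at h4
      simp at h4
    · exact ENNReal.ofReal_ne_top h5
  obtain ⟨τ, hτ, hτ', he⟩ := hs σ hσ hi hfin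
  have he' := (h.pastPoint_eq_iff (Ω := Ω) hσ hτ).2 ⟨rfl, he⟩
  rw [he'] at hS ⊢
  exact ⟨Ω, τ, hτ, hτ', rfl, (h.sRelated_pastPoint_iff hτ hτ').1 hS⟩

theorem isPointSimple_swap_iff :
    Causal.IsPointSimple (distRel fun x y => δ y x) ↔ Causal.IsPointSimple (distRel δ) := by
  have key : ∀ {δ : X → X → ℝ}, Causal.IsPointSimple (distRel fun x y => δ y x) →
      Causal.IsPointSimple (distRel δ) := by
    rintro δ ⟨h1, h2⟩
    constructor
    · intro P hP
      have hP' : Causal.IsTIP (fun p q => distRel (fun x y => δ y x) q p) (timeReflect X ⁻¹' P) := by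
        rw [isTIP_swap_iff, timeReflect_preimage_preimage]
        exact hP
      obtain ⟨F, hF, hu⟩ := h2 _ hP'
      refine ⟨timeReflect X ⁻¹' F, ?_, fun F' hF' => ?_⟩
      · change (P, _) ∈ _
        rw [← mem_cBoundary_reflect_iff, timeReflect_preimage_preimage]
        exact hF
      · rw [← timeReflect_preimage_preimage F']
        congr 1
        exact hu _ (mem_cBoundary_reflect_iff.2 hF')
    · intro F hF
      obtain ⟨P, hP, hu⟩ := h1 _ (isTIP_swap_iff.1 hF)
      refine ⟨timeReflect X ⁻¹' P, ?_, fun P' hP' => ?_⟩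
      · change (_, F) ∈ _
        rw [← mem_cBoundary_reflect_iff, timeReflect_preimage_preimage]
        exact hP
      · rw [← timeReflect_preimage_preimage P']
        congr 1
        exact hu _ (mem_cBoundary_reflect_iff.2 hP')
  exact ⟨key, fun hh => key hh⟩

/-! #### Causality of the lines -/

/-- Over `σ n` the future begins just after `Ω + k₁` and the past ends just before `Ω + k₂`, with
errors tending to `0`. For large `n` the midpoint of these two times lies in both sets. -/
theorem isTimelikeLine_of_isSymmPair (hs : IsSymmPair δ P F) : IsTimelikeLine (P, F) := by
  obtain ⟨Ω, σ, hσ, hσ', rfl, rfl⟩ := hs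
  intro k₁ k₂ hk
  have h1 := ((h.tendsto_inDist_self hσ).add (h.swap.tendsto_inDist_self hσ'))
  rw [add_zero] at h1
  obtain ⟨n, hn⟩ := (h1.eventually_lt_const (sub_pos.2 hk)).exists
  refine ⟨((Ω + k₁ + inDist (fun x y => δ y x) σ (σ n) + (Ω + k₂ - inDist δ σ (σ n))) / 2, σ n),
    mem_futurePoint.2 ?_, mem_pastPoint.2 ?_⟩ <;> simp only <;> linarith

theorem timeShift_subset_left (hm : (P, F) ∈ Causal.cCompletion (distRel δ)) {k₁ k₂ : ℝ}
    (hk : k₁ ≤ k₂) : timeShift k₁ P ⊆ timeShift k₂ P := by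
  rcases hk.eq_or_lt with rfl | hk
  · exact Subset.rfl
  intro p hp
  refine (h.isChronological.isIP_iff.1 (Causal.mem_cCompletion_isIP hm
    (nonempty_iff_ne_empty.1 ⟨_, hp⟩))).2.1 _ _ ?_ hp
  unfold distRel
  simp only [h.self]
  linarith

theorem timeShift_subset_right (hm : (P, F) ∈ Causal.cCompletion (distRel δ)) {k₁ k₂ : ℝ}
    (hk : k₁ ≤ k₂) : timeShift k₂ F ⊆ timeShift k₁ F := by
  rcases hk.eq_or_lt with rfl | hk
  · exact Subset.rfl
  intro p hp
  refine (h.isChronological.swap.isIP_iff.1 (Causal.mem_cCompletion_isIP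
    (Causal.mem_cCompletion_swap.2 hm) (nonempty_iff_ne_empty.1 ⟨_, hp⟩))).2.1 _ _ ?_ hp
  unfold distRel
  simp only [h.self]
  linarith

theorem pairCausal_linePoint (hm : (P, F) ∈ Causal.cCompletion (distRel δ)) {k₁ k₂ : ℝ}
    (hk : k₁ ≤ k₂) : Causal.PairCausal (linePoint (P, F) k₁) (linePoint (P, F) k₂) := by
  refine ⟨?_, h.timeShift_subset_left hm hk, h.timeShift_subset_right hm hk⟩
  rcases Causal.left_ne_or_right_ne hm with hne | hne
  · exact Or.inl ((nonempty_iff_ne_empty.2 hne).preimage (timeTranslate X k₁).surjective)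
  · exact Or.inr ((nonempty_iff_ne_empty.2 hne).preimage (timeTranslate X k₂).surjective)

theorem isHorismoticLine_of_eq_empty (hm : (P, F) ∈ Causal.cCompletion (distRel δ))
    (he : P = ∅ ∨ F = ∅) : IsHorismoticLine (P, F) := by
  intro k₁ k₂ hk
  refine ⟨h.pairCausal_linePoint hm hk.le, ?_⟩
  rintro ⟨p, hp1, hp2⟩
  rcases he with rfl | rfl
  · exact hp2
  · exact hp1

/-- A pair with non-empty components is symmetric, or its line is locally horismotic. -/
theorem isLocallyHorismoticLine (hS : Causal.SRelated (distRel δ) P F)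
    (hns : ¬ IsSymmPair δ P F) : IsLocallyHorismoticLine (P, F) := by
  obtain ⟨h1, h2, h3, -, -⟩ := (Causal.sRelated_iff h.isChronological).1 hS
  obtain ⟨Ω, σ, hσ, rfl⟩ := h.exists_pastPoint h1 h3 h2.nonempty
  obtain ⟨Ω', τ, hτ, rfl⟩ := h.exists_futurePoint h2 h3 h1.nonempty
  have hcomp : ∀ x y, δ x y ≤ Ω' - Ω + inDist δ σ x + inDist (fun x y => δ y x) τ y := by
    intro x y
    by_contra hcon
    push Not at hcon
    set ε := (δ x y - (Ω' - Ω + inDist δ σ x + inDist (fun x y => δ y x) τ y)) / 2 with hε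
    have := h3 (Ω - inDist δ σ x - ε, x) (mem_pastPoint.2 (by simp only; linarith))
      (Ω' + inDist (fun x y => δ y x) τ y + ε, y) (mem_futurePoint.2 (by simp only; linarith))
    unfold distRel at this
    simp only at this
    linarith
  have hΩ : 0 ≤ Ω' - Ω := by
    have := (EReal.coe_ennreal_nonneg (doubleLim (ofRealDist δ) σ τ)).trans
      ((h.precedes_iff hσ hτ).1 h3)
    exact_mod_cast this
  -- This sum is the time by which the future over `x` begins later than the past ends. If it were
  -- not bounded away from `0`, there would be points `x n` along which all its terms tend to `0`.
  -- By `hcomp` they form a sequence that is Cauchy in both directions, with the same limits as `σ`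
  -- and `τ`; the pair would be symmetric.
  have hε : ∃ ε > 0, ∀ x, ε ≤ Ω' - Ω + inDist (fun x y => δ y x) τ x + inDist δ σ x := by
    by_contra hcon
    push Not at hcon
    have h4 : ∀ n : ℕ, ∃ x, Ω' - Ω + inDist (fun x y => δ y x) τ x + inDist δ σ x < 1 / (n + 1 : ℝ) :=
      fun n => hcon _ (by positivity)
    choose x hx using h4
    have hlim := tendsto_one_div_add_atTop_nhds_zero_nat (𝕜 := ℝ)
    have h5 : Tendsto (fun n => inDist δ σ (x n)) atTop (𝓝 0) :=
      squeeze_zero (fun n => h.inDist_nonneg _ _) (fun n => by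
        have := hx n
        have := h.swap.inDist_nonneg τ (x n)
        linarith) hlim
    have h6 : Tendsto (fun n => inDist (fun x y => δ y x) τ (x n)) atTop (𝓝 0) :=
      squeeze_zero (fun n => h.swap.inDist_nonneg _ _) (fun n => by
        have := hx n
        have := h.inDist_nonneg σ (x n)
        linarith) hlim
    have hΩ' : Ω' = Ω := by
      refine le_antisymm ?_ (by linarith)
      have : Ω' - Ω ≤ 0 := ge_of_tendsto' hlim fun n => by
        have := hx n
        have := h.inDist_nonneg σ (x n)
        have := h.swap.inDist_nonneg τ (x n)
        linarith
      linarith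
    subst hΩ'
    simp only [sub_self, zero_add] at hcomp
    have h7 : ∀ ε > 0, ∃ n₀, ∀ n m, n₀ ≤ n → n₀ ≤ m → δ (x n) (x m) < ε := by
      intro ε hε
      obtain ⟨n₀, hn₀⟩ := eventually_atTop.1 ((h5.eventually_lt_const (half_pos hε)).and
        (h6.eventually_lt_const (half_pos hε)))
      exact ⟨n₀, fun n m hn hm => by
        have := hcomp (x n) (x m)
        have := (hn₀ n hn).1
        have := (hn₀ m hm).2
        linarith⟩
    have hc : IsForwardCauchy (ofRealDist δ) x := isForwardCauchy_iff.2 fun ε hε => by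
      obtain ⟨n₀, hn⟩ := h7 ε hε
      exact ⟨n₀, fun n m h1 h2 => hn n m h1 (h1.trans h2)⟩
    have hc' : IsForwardCauchy (ofRealDist fun x y => δ y x) x :=
      isForwardCauchy_iff.2 fun ε hε => by
        obtain ⟨n₀, hn⟩ := h7 ε hε
        exact ⟨n₀, fun n m h1 h2 => hn m n (h1.trans h2) h1⟩
    refine hns ⟨Ω', x, hc, hc', (h.pastPoint_eq_iff hσ hc).2 ⟨rfl, funext fun y => ?_⟩,
      (h.futurePoint_eq_iff hτ hc').2 ⟨rfl, funext fun y => ?_⟩⟩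
    · refine le_antisymm ?_ ?_
      · refine ge_of_tendsto' (by simpa using (h.tendsto_inDist hc y).add h5) fun n => ?_
        exact h.inDist_le hσ y (x n)
      · exact le_of_tendsto_of_tendsto' (h.tendsto_inDist hc y)
          (by simpa using h6.const_add (inDist δ σ y)) fun n => hcomp y (x n)
    · refine le_antisymm ?_ ?_
      · refine ge_of_tendsto' (by simpa using (h.swap.tendsto_inDist hc' y).add h6) fun n => ?_
        exact h.swap.inDist_le hτ y (x n)
      · exact le_of_tendsto_of_tendsto' (h.swap.tendsto_inDist hc' y)
          (by simpa using h5.add_const (inDist (fun x y => δ y x) τ y)) fun n => hcomp (x n) y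
  obtain ⟨ε, hε, hε'⟩ := hε
  -- A common point of the future shifted by `k₁` and the past shifted by `k₂` requires `k₂ - k₁` to
  -- exceed the gap.
  have hch : ∀ k₁ k₂ : ℝ, k₂ - k₁ < ε → ¬ Causal.PairChron
      (linePoint (pastPoint δ Ω σ, futurePoint δ Ω' τ) k₁)
      (linePoint (pastPoint δ Ω σ, futurePoint δ Ω' τ) k₂) := by
    rintro k₁ k₂ hk ⟨p, hp1, hp2⟩
    have h4 := mem_futurePoint.1 (show (p.1 - k₁, p.2) ∈ futurePoint δ Ω' τ from hp1)
    have h5 := mem_pastPoint.1 (show (p.1 - k₂, p.2) ∈ pastPoint δ Ω σ from hp2)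
    have := hε' p.2
    simp only at h4 h5
    linarith
  intro k₁
  refine ⟨ε, hε, fun k₂ hk => ⟨?_, ?_, ?_⟩⟩
  · rcases le_total k₁ k₂ with hk' | hk'
    · exact Or.inl (h.pairCausal_linePoint (Or.inl hS) hk')
    · exact Or.inr (h.pairCausal_linePoint (Or.inl hS) hk')
  · exact hch _ _ ((le_abs_self _).trans_lt hk)
  · exact hch _ _ (by rw [← neg_sub]; exact (neg_le_abs _).trans_lt hk)

end LengthDist
end

/-! ### Gluing of the partial completions and the natural maps. -/

theorem isClosed_limitTopology {X : Type*} (L : (ℕ → X) → Set X)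
    (hL : ∀ (σ : ℕ → X) (φ : ℕ → ℕ), StrictMono φ → L σ ⊆ L (σ ∘ φ)) {K : Set X} :
    IsClosed[limitTopology L hL] K ↔ ∀ σ : ℕ → X, (∀ n, σ n ∈ K) → L σ ⊆ K := by
  let _ := limitTopology L hL
  rw [← isOpen_compl_iff]
  change Kᶜᶜ ∈ _ ↔ _
  rw [compl_compl]
  rfl

/-- Gluing two sets along a relation is the same as the union of two injective images in which the
related points, and only these, are identified. -/
theorem exists_glue {A B C : Type*} [TopologicalSpace A] [TopologicalSpace B] [TopologicalSpace C]
    (R : A → B → Prop) (α : A → C) (β : B → C) (hα : Function.Injective α)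
    (hβ : Function.Injective β) (hR : ∀ a b, R a b ↔ α a = β b)
    (hs : ∀ c, (∃ a, α a = c) ∨ ∃ b, β b = c) :
    ∃ e : C → Quot (fun x y : A ⊕ B => ∃ a b, x = Sum.inl a ∧ y = Sum.inr b ∧ R a b),
      Function.Bijective e ∧ (∀ a, e (α a) = Quot.mk _ (Sum.inl a)) ∧
      (∀ b, e (β b) = Quot.mk _ (Sum.inr b)) ∧
      ((∀ K : Set C, IsClosed K ↔ IsClosed (α ⁻¹' K) ∧ IsClosed (β ⁻¹' K)) → IsHomeomorph e) := by
  -- The natural map is constructed as the inverse of the map that `α` and `β` induce on the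
  -- quotient.
  let q : Quot (fun x y : A ⊕ B => ∃ a b, x = Sum.inl a ∧ y = Sum.inr b ∧ R a b) → C :=
    Quot.lift (Sum.elim α β) (by
      rintro _ _ ⟨a, b, rfl, rfl, hab⟩
      exact (hR a b).1 hab)
  have hq : Function.Bijective q := by
    constructor
    · rintro ⟨x⟩ ⟨y⟩ hxy
      have hxy' : Sum.elim α β x = Sum.elim α β y := hxy
      rcases x with a | b <;> rcases y with a' | b'
      · exact congrArg (fun a => Quot.mk _ (Sum.inl a)) (hα hxy')
      · exact Quot.sound ⟨a, b', rfl, rfl, (hR a b').2 hxy'⟩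
      · exact (Quot.sound ⟨a', b, rfl, rfl, (hR a' b).2 hxy'.symm⟩).symm
      · exact congrArg (fun a => Quot.mk _ (Sum.inr a)) (hβ hxy')
    · intro c
      rcases hs c with ⟨a, ha⟩ | ⟨b, hb⟩
      · exact ⟨Quot.mk _ (Sum.inl a), ha⟩
      · exact ⟨Quot.mk _ (Sum.inr b), hb⟩
  let E := Equiv.ofBijective q hq
  refine ⟨E.symm, E.symm.bijective, fun a => E.symm_apply_eq.2 rfl, fun b => E.symm_apply_eq.2 rfl,
    fun hK => ?_⟩
  have key : ∀ K : Set C, IsClosed (q ⁻¹' K) ↔ IsClosed K := by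
    intro K
    rw [hK, ← isQuotientMap_quot_mk.isClosed_preimage, isClosed_sum_iff]
    rfl
  let H : C ≃ₜ Quot (fun x y : A ⊕ B => ∃ a b, x = Sum.inl a ∧ y = Sum.inr b ∧ R a b) :=
    { E.symm with
      continuous_toFun := continuous_iff_isClosed.2 fun K hK' => by
        rw [← key]
        convert hK' using 1
        ext x
        exact (iff_of_eq (congrArg (· ∈ K) (E.symm_apply_apply x)))
      continuous_invFun := continuous_iff_isClosed.2 fun K hK' => (key K).2 hK' }
  exact H.isHomeomorph

namespace Causal

variable {V : Type*} {r : V → V → Prop}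

theorem isClosed_completion_iff {K : Set (Completion r)} : IsClosed K ↔
    ∀ σ : ℕ → Completion r, (∀ n, σ n ∈ K) → {P : Completion r | P.1 ∈ hatL r fun n => (σ n).1} ⊆ K :=
  isClosed_limitTopology (fun σ => {P : Completion r | P.1 ∈ hatL r fun n => (σ n).1})
    (fun σ φ hφ _ hP => hatL_subseq r (fun n => (σ n).1) φ hφ hP)

theorem isClosed_cCompletion_iff {K : Set (CCompletion r)} : IsClosed K ↔
    ∀ σ : ℕ → CCompletion r, (∀ n, σ n ∈ K) →
      {p : CCompletion r | p.1 ∈ totalL r fun n => (σ n).1} ⊆ K :=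
  isClosed_limitTopology (fun σ => {p : CCompletion r | p.1 ∈ totalL r fun n => (σ n).1})
    (fun σ φ hφ _ hp => ⟨fun h => hatL_subseq r (fun n => (σ n).1.1) φ hφ (hp.1 h),
      fun h => hatL_subseq _ (fun n => (σ n).1.2) φ hφ (hp.2 h)⟩)

/-- Uniqueness of the partner of the terminal sets. -/
theorem exists_natural_boundary
    (hP : ∀ P F, (P, F) ∈ cBoundary r → P ≠ ∅ → IsTIP r P)
    (hF : ∀ P F, (P, F) ∈ cBoundary r → F ≠ ∅ → IsTIP (fun p q => r q p) F)
    (hs : IsPointSimple r) :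
    ∃ e : cBoundarySet r → GluedBoundary r, Function.Bijective e ∧ IsNaturalOnBoundary r e ∧
      ((∀ K : Set (cBoundarySet r), IsClosed K ↔
        IsClosed {P : boundary r | ∀ c : cBoundarySet r, c.1.1.1 = P.1.1 → c ∈ K} ∧
        IsClosed {F : boundary fun p q => r q p |
          ∀ c : cBoundarySet r, c.1.1.2 = F.1.1 → c ∈ K}) → IsHomeomorph e) := by
  choose f hf hfu using fun P : boundary r => hs.1 P.1.1 P.2
  choose g hg hgu using fun F : boundary (fun p q => r q p) => hs.2 F.1.1 F.2
  -- `α` and `β` complete a terminal set by its unique partner. They identify exactly the S-related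
  -- sets.
  let α : boundary r → cBoundarySet r := fun P => ⟨⟨(P.1.1, f P), (hf P).1⟩, hf P⟩
  let β : boundary (fun p q => r q p) → cBoundarySet r := fun F => ⟨⟨(g F, F.1.1), (hg F).1⟩, hg F⟩
  have hα : ∀ (P : boundary r) (c : cBoundarySet r), α P = c ↔ c.1.1.1 = P.1.1 := by
    intro P c
    constructor
    · rintro rfl
      rfl
    · intro hc
      refine Subtype.ext (Subtype.ext (Prod.ext hc.symm ?_))
      refine (hfu P _ ?_).symm
      have := c.2
      change (c.1.1.1, c.1.1.2) ∈ cBoundary r at this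
      rwa [hc] at this
  have hβ : ∀ (F : boundary fun p q => r q p) (c : cBoundarySet r),
      β F = c ↔ c.1.1.2 = F.1.1 := by
    intro F c
    constructor
    · rintro rfl
      rfl
    · intro hc
      refine Subtype.ext (Subtype.ext (Prod.ext ?_ hc.symm))
      refine (hgu F _ ?_).symm
      have := c.2
      change (c.1.1.1, c.1.1.2) ∈ cBoundary r at this
      rwa [hc] at this
  obtain ⟨e, h1, h2, h3, h4⟩ := exists_glue (A := boundary r) (B := boundary fun p q => r q p)
    (fun P F => SRelated r P.1.1 F.1.1) α β
    (fun P P' he => Subtype.ext (Subtype.ext ((hα P' (α P)).1 he.symm)))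
    (fun F F' he => Subtype.ext (Subtype.ext ((hβ F' (β F)).1 he.symm)))
    (fun P F => by
      rw [hα]
      constructor
      · intro hR
        exact (hgu F _ (mem_cBoundary_of_isTIP (Or.inl hR) P.2)).symm
      · intro he
        refine mem_cCompletion_of_left ?_ P.2.1.ne_empty F.2.1.ne_empty
        rw [← he]
        exact (hg F).1)
    (fun c => by
      rcases left_ne_or_right_ne c.1.2 with hne | hne
      · exact Or.inl ⟨⟨⟨c.1.1.1, (hP _ c.1.1.2 c.2 hne).1⟩, hP _ c.1.1.2 c.2 hne⟩, (hα _ _).2 rfl⟩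
      · exact Or.inr ⟨⟨⟨c.1.1.2, (hF c.1.1.1 _ c.2 hne).1⟩, hF c.1.1.1 _ c.2 hne⟩, (hβ _ _).2 rfl⟩)
  refine ⟨e, h1, fun c => ⟨fun P hc => ?_, fun F hc => ?_⟩, fun hK => h4 fun K => ?_⟩
  · rw [← (hα P c).2 hc]
    exact h2 P
  · rw [← (hβ F c).2 hc]
    exact h3 F
  · have e1 : {P : boundary r | ∀ c : cBoundarySet r, c.1.1.1 = P.1.1 → c ∈ K} = α ⁻¹' K := by
      ext P
      exact ⟨fun hh => hh _ rfl, fun hh c hc => (hα P c).2 hc ▸ hh⟩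
    have e2 : {F : boundary fun p q => r q p | ∀ c : cBoundarySet r, c.1.1.2 = F.1.1 → c ∈ K} =
        β ⁻¹' K := by
      ext F
      exact ⟨fun hh => hh _ rfl, fun hh c hc => (hβ F c).2 hc ▸ hh⟩
    rw [hK K, e1, e2]

/-- The closed sets of the c-completion, if it is simple with unique partners. -/
theorem exists_natural_completion
    (hP : ∀ P, IsIP r P → ∃! F, (P, F) ∈ cCompletion r)
    (hF : ∀ F, IsIP (fun p q => r q p) F → ∃! P, (P, F) ∈ cCompletion r)
    (hs : IsSimple r) :
    ∃ (α : Completion r → CCompletion r) (β : Completion (fun p q => r q p) → CCompletion r)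
      (e : CCompletion r → GluedCompletion r), IsHomeomorph e ∧ IsNaturalOnCompletion r e ∧
      (∀ P c, α P = c ↔ c.1.1 = P.1) ∧ (∀ F c, β F = c ↔ c.1.2 = F.1) ∧
      ∀ K : Set (CCompletion r), IsClosed K ↔ IsClosed (α ⁻¹' K) ∧ IsClosed (β ⁻¹' K) := by
  choose f hf hfu using fun P : Completion r => hP P.1 P.2
  choose g hg hgu using fun F : Completion (fun p q => r q p) => hF F.1 F.2
  let α : Completion r → CCompletion r := fun P => ⟨(P.1, f P), hf P⟩
  let β : Completion (fun p q => r q p) → CCompletion r := fun F => ⟨(g F, F.1), hg F⟩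
  have hα : ∀ (P : Completion r) (c : CCompletion r), α P = c ↔ c.1.1 = P.1 := by
    intro P c
    constructor
    · rintro rfl
      rfl
    · intro hc
      refine Subtype.ext (Prod.ext hc.symm ?_)
      refine (hfu P _ ?_).symm
      have := c.2
      change (c.1.1, c.1.2) ∈ cCompletion r at this
      rwa [hc] at this
  have hβ : ∀ (F : Completion fun p q => r q p) (c : CCompletion r),
      β F = c ↔ c.1.2 = F.1 := by
    intro F c
    constructor
    · rintro rfl
      rfl
    · intro hc
      refine Subtype.ext (Prod.ext ?_ hc.symm)
      refine (hgu F _ ?_).symm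
      have := c.2
      change (c.1.1, c.1.2) ∈ cCompletion r at this
      rwa [hc] at this
  have hK : ∀ K : Set (CCompletion r), IsClosed K ↔ IsClosed (α ⁻¹' K) ∧ IsClosed (β ⁻¹' K) := by
    intro K
    rw [isClosed_cCompletion_iff, isClosed_completion_iff, isClosed_completion_iff]
    constructor
    · intro hK
      -- Here simplicity is used: convergence of one component implies convergence of the pair.
      exact ⟨fun σ hσ P hPL => hK (fun n => α (σ n)) hσ (hs.2 _ _ (Or.inl hPL)),
        fun σ hσ F hFL => hK (fun n => β (σ n)) hσ (hs.2 _ _ (Or.inr hFL))⟩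
    · rintro ⟨hK1, hK2⟩ σ hσ c hc
      rcases left_ne_or_right_ne c.2 with hne | hne
      · have h1 := hc.1 hne
        -- A point of the limit belongs to almost all first components. These are therefore
        -- non-empty, and a tail of the sequence lies in the image of `α`.
        obtain ⟨x, hx⟩ := nonempty_iff_ne_empty.2 hne
        obtain ⟨N, hN⟩ := eventually_atTop.1 (h1.1 hx)
        have h2 : ∀ n, IsIP r (σ (n + N)).1.1 := fun n =>
          mem_cCompletion_isIP (σ (n + N)).2 (nonempty_iff_ne_empty.1 ⟨x, hN _ (by omega)⟩)
        have h3 : StrictMono fun n : ℕ => n + N := fun a b hab => by simpa using hab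
        have h4 := @hK1 (fun n => ⟨_, h2 n⟩) (fun n => by
          change α _ ∈ K
          rw [(hα ⟨_, h2 n⟩ (σ (n + N))).2 rfl]
          exact hσ _) ⟨c.1.1, h1.2.1⟩ (hatL_subseq r (fun n => (σ n).1.1) _ h3 h1)
        have h5 : α ⟨c.1.1, h1.2.1⟩ ∈ K := h4
        rwa [(hα ⟨c.1.1, h1.2.1⟩ c).2 rfl] at h5
      · have h1 := hc.2 hne
        obtain ⟨x, hx⟩ := nonempty_iff_ne_empty.2 hne
        obtain ⟨N, hN⟩ := eventually_atTop.1 (h1.1 hx)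
        have h2 : ∀ n, IsIP (fun p q => r q p) (σ (n + N)).1.2 := fun n =>
          mem_cCompletion_isIP (mem_cCompletion_swap.2 (σ (n + N)).2)
            (nonempty_iff_ne_empty.1 ⟨x, hN _ (by omega)⟩)
        have h3 : StrictMono fun n : ℕ => n + N := fun a b hab => by simpa using hab
        have h4 := @hK2 (fun n => ⟨_, h2 n⟩) (fun n => by
          change β _ ∈ K
          rw [(hβ ⟨_, h2 n⟩ (σ (n + N))).2 rfl]
          exact hσ _) ⟨c.1.2, h1.2.1⟩ (hatL_subseq _ (fun n => (σ n).1.2) _ h3 h1)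
        have h5 : β ⟨c.1.2, h1.2.1⟩ ∈ K := h4
        rwa [(hβ ⟨c.1.2, h1.2.1⟩ c).2 rfl] at h5
  obtain ⟨e, h1, h2, h3, h4⟩ := exists_glue (A := Completion r) (B := Completion fun p q => r q p)
    (fun P F => SRelated r P.1 F.1) α β
    (fun P P' he => Subtype.ext ((hα P' (α P)).1 he.symm))
    (fun F F' he => Subtype.ext ((hβ F' (β F)).1 he.symm))
    (fun P F => by
      rw [hα]
      constructor
      · intro hR
        exact (hgu F _ (Or.inl hR)).symm
      · intro he
        refine mem_cCompletion_of_left ?_ P.2.ne_empty F.2.ne_empty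
        rw [← he]
        exact hg F)
    (fun c => by
      rcases left_ne_or_right_ne c.2 with hne | hne
      · exact Or.inl ⟨⟨c.1.1, mem_cCompletion_isIP c.2 hne⟩, (hα _ _).2 rfl⟩
      · exact Or.inr ⟨⟨c.1.2, mem_cCompletion_isIP (mem_cCompletion_swap.2 c.2) hne⟩,
          (hβ _ _).2 rfl⟩)
  refine ⟨α, β, e, h4 hK, fun c => ⟨fun P hc => ?_, fun F hc => ?_⟩, hα, hβ, hK⟩
  · rw [← (hα P c).2 hc]
    exact h2 P
  · rw [← (hβ F c).2 hc]
    exact h3 F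

/-- If the boundaries are closed, the natural map of the boundary of a simple completion is a
homeomorphism. -/
theorem exists_natural_boundary_homeomorph
    (hP : ∀ P F, (P, F) ∈ cBoundary r → P ≠ ∅ → IsTIP r P)
    (hF : ∀ P F, (P, F) ∈ cBoundary r → F ≠ ∅ → IsTIP (fun p q => r q p) F)
    (hP' : ∀ P, IsIP r P → ∃! F, (P, F) ∈ cCompletion r)
    (hF' : ∀ F, IsIP (fun p q => r q p) F → ∃! P, (P, F) ∈ cCompletion r)
    (hs : IsSimple r) (hc : IsClosed (boundary r)) (hc' : IsClosed (boundary fun p q => r q p)) :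
    ∃ e : cBoundarySet r → GluedBoundary r, IsHomeomorph e ∧ IsNaturalOnBoundary r e := by
  obtain ⟨e, h1, h2, h3⟩ := exists_natural_boundary hP hF hs.1
  refine ⟨e, h3 fun K => ?_, h2⟩
  obtain ⟨α, β, -, -, -, hα, hβ, hK⟩ := exists_natural_completion hP' hF' hs
  have hα' : ∀ P, α P ∈ cBoundarySet r ↔ P ∈ boundary r := by
    intro P
    have h4 := (hα P _).1 rfl
    constructor
    · intro h5
      have := hP (α P).1.1 (α P).1.2 h5 (h4 ▸ P.2.ne_empty)
      rwa [h4] at this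
    · intro h5
      refine mem_cBoundary_of_isTIP (P := (α P).1.1) (F := (α P).1.2) (α P).2 ?_
      rwa [h4]
  have hβ' : ∀ F, β F ∈ cBoundarySet r ↔ F ∈ boundary fun p q => r q p := by
    intro F
    have h4 := (hβ F _).1 rfl
    constructor
    · intro h5
      have := hF (β F).1.1 (β F).1.2 h5 (h4 ▸ F.2.ne_empty)
      rwa [h4] at this
    · intro h5
      refine mem_cBoundary_of_isTIF (P := (β F).1.1) (F := (β F).1.2) (β F).2 ?_
      rwa [h4]
  have hcB : IsClosed (cBoundarySet r) := by
    rw [hK]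
    constructor
    · convert hc using 1
      ext P
      exact hα' P
    · convert hc' using 1
      ext F
      exact hβ' F
  -- All three boundaries are closed, so relatively closed subsets are closed, and the criterion
  -- `hK` for the completion restricts to the boundary.
  rw [hcB.isClosedEmbedding_subtypeVal.isClosed_iff_image_isClosed,
    hc.isClosedEmbedding_subtypeVal.isClosed_iff_image_isClosed,
    hc'.isClosedEmbedding_subtypeVal.isClosed_iff_image_isClosed, hK]
  refine and_congr (iff_of_eq (congrArg _ ?_)) (iff_of_eq (congrArg _ ?_))
  · ext P
    constructor
    · rintro ⟨c, hcK, hcP⟩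
      have hcα := (hα P c.1).1 hcP.symm
      refine ⟨⟨P, (hα' P).1 (hcP ▸ c.2)⟩, fun c' hc' => ?_, rfl⟩
      have : c' = c := Subtype.ext (((hα P c'.1).2 hc').symm.trans ((hα P c.1).2 hcα))
      rwa [this]
    · rintro ⟨P, hPK, rfl⟩
      exact ⟨⟨α P.1, (hα' P.1).2 P.2⟩, hPK _ ((hα P.1 _).1 rfl), rfl⟩
  · ext P
    constructor
    · rintro ⟨c, hcK, hcP⟩
      have hcα := (hβ P c.1).1 hcP.symm
      refine ⟨⟨P, (hβ' P).1 (hcP ▸ c.2)⟩, fun c' hc' => ?_, rfl⟩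
      have : c' = c := Subtype.ext (((hβ P c'.1).2 hc').symm.trans ((hβ P c.1).2 hcα))
      rwa [this]
    · rintro ⟨P, hPK, rfl⟩
      exact ⟨⟨β P.1, (hβ' P.1).2 P.2⟩, hPK _ ((hβ P.1 _).1 rfl), rfl⟩

end Causal

/-! ### Convergence of Busemann functions to those of nice points. -/

section
variable {X : Type*} {δ : X → X → ℝ} {σ : ℕ → X} {Ω : ℝ}

/-- A symmetric Cauchy sequence whose limit has a sequentially compact forward neighbourhood in the
symmetric completion, on which the two distances are comparable. -/
structure IsNicePoint (δ : X → X → ℝ) (σ : ℕ → X) : Prop where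
  forward : IsForwardCauchy (ofRealDist δ) σ
  backward : IsForwardCauchy (ofRealDist fun x y => δ y x) σ
  compact : ∃ r > 0, ∀ y : ℕ → X, (∀ k, inDist (fun x y => δ y x) σ (y k) ≤ r) →
    ∃ φ : ℕ → ℕ, StrictMono φ ∧ IsForwardCauchy (ofRealDist δ) (y ∘ φ) ∧
      IsForwardCauchy (ofRealDist fun x y => δ y x) (y ∘ φ)
  compat : ∀ ε > 0, ∃ η > 0, ∀ y, inDist (fun x y => δ y x) σ y < η → inDist δ σ y < ε

namespace LengthDist

variable (h : LengthDist δ)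
include h

theorem dist_le_inDist_add (hσ : IsForwardCauchy (ofRealDist δ) σ)
    (hσ' : IsForwardCauchy (ofRealDist fun x y => δ y x) σ) (x y : X) :
    δ x y ≤ inDist δ σ x + inDist (fun x y => δ y x) σ y :=
  ge_of_tendsto' ((h.tendsto_inDist hσ x).add (h.swap.tendsto_inDist hσ' y)) fun _ =>
    h.triangle _ _ _

/-- Sequences for which a bounded part of the Busemann functions escapes produce a larger limit. -/
theorem eventually_outDist_lt (hσ : IsNicePoint δ σ) {φ : ℕ → X → EReal}
    (hφ : ∀ᶠ n in atTop, φ n ∈ chainFun δ)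
    (hlow : ∀ x, ((Ω - inDist δ σ x : ℝ) : EReal) ≤ liminf (fun n => φ n x) atTop)
    (hmax : ∀ g ∈ chainFun δ, (∀ x, ((Ω - inDist δ σ x : ℝ) : EReal) ≤ g x) →
      (∀ x, g x ≤ limsup (fun n => φ n x) atTop) →
      g = fun x => ((Ω - inDist δ σ x : ℝ) : EReal))
    {r : ℝ} (hr : 0 < r) (hr0 : ∀ y : ℕ → X, (∀ k, inDist (fun x y => δ y x) σ (y k) ≤ r) →
      ∃ φ : ℕ → ℕ, StrictMono φ ∧ IsForwardCauchy (ofRealDist δ) (y ∘ φ) ∧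
      IsForwardCauchy (ofRealDist fun x y => δ y x) (y ∘ φ)) :
    ∀ᶠ n in atTop, ∀ u, IsChronChain δ u → φ n = chainBusemann δ u →
      ∀ᶠ k in atTop, inDist (fun x y => δ y x) σ (u k).2 < r := by
  by_contra hcon
  rw [Filter.not_eventually] at hcon
  push Not at hcon
  have key : ∀ η > 0, ∃ᶠ n in atTop, φ n ∈ chainFun δ ∧ ∃ y,
      |inDist (fun x y => δ y x) σ y - r / 2| ≤ 2 * η ∧
      ((Ω + r / 2 - 2 * η : ℝ) : EReal) ≤ φ n y := by
    intro η hη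
    obtain ⟨m, hm1, hm2⟩ := (((h.tendsto_inDist_self hσ.forward).eventually_lt_const hη).and
      ((h.swap.tendsto_inDist_self hσ.backward).eventually_lt_const hη)).exists
    have h1 : ∀ᶠ n in atTop, ((Ω - η : ℝ) : EReal) < φ n (σ m) := by
      refine eventually_lt_of_lt_liminf (lt_of_lt_of_le ?_ (hlow (σ m)))
      exact EReal.coe_lt_coe_iff.2 (by linarith)
    refine (hcon.and_eventually (h1.and hφ)).mono ?_
    rintro n ⟨⟨u, hu, hun, hk⟩, h2, h3⟩
    refine ⟨h3, ?_⟩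
    rw [hun] at h2 ⊢
    obtain ⟨k₀, hk₀⟩ := lt_iSup_iff.1 h2
    rw [EReal.coe_lt_coe_iff] at hk₀
    obtain ⟨k, hkk, hkr⟩ := (frequently_atTop.1 hk) k₀
    have h4 : Ω - η < (u k).1 - δ (σ m) (u k).2 :=
      hk₀.trans_le ((h.chain_sub_mono hu (σ m)).monotone hkk)
    have h5 := h.swap.inDist_le hσ.backward (u k).2 (σ m)
    -- `y` is taken at distance about `r / 2` on an almost shortest way from `σ m` to a far point of
    -- the sequence. From `σ m` to `y` the function `φ n` gains about `r / 2`.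
    obtain ⟨y, hy1, hy2⟩ := h.split (σ m) (u k).2 (r / 2) (δ (σ m) (u k).2 - r / 2 + η)
      (by linarith) (by linarith) (by linarith)
    have h6 := h.swap.inDist_le hσ.backward y (σ m)
    have h7 := h.dist_le_inDist_add hσ.forward hσ.backward (σ m) y
    have h8 := h.triangle (σ m) y (u k).2
    refine ⟨y, abs_le.2 ⟨by linarith, by linarith⟩, ?_⟩
    refine le_trans (EReal.coe_le_coe_iff.2 ?_)
      (le_iSup (fun n => (((u n).1 - δ y (u n).2 : ℝ) : EReal)) k)
    linarith
  have hη : ∀ j : ℕ, (0 : ℝ) < r / 4 * (1 / (j + 1)) := fun j => by positivity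
  have hη1 : ∀ j : ℕ, r / 4 * (1 / ((j : ℝ) + 1)) ≤ r / 4 := fun j => by
    have : 1 / ((j : ℝ) + 1) ≤ 1 := by
      rw [div_le_one (by positivity)]
      linarith [Nat.cast_nonneg (α := ℝ) j]
    nlinarith
  have hη2 : Tendsto (fun j : ℕ => 2 * (r / 4 * (1 / ((j : ℝ) + 1)))) atTop (𝓝 0) := by
    simpa using (tendsto_one_div_add_atTop_nhds_zero_nat.const_mul (r / 4)).const_mul 2
  choose ν hν hνφ y hy1 hy2 using fun j : ℕ => frequently_atTop.1 (key _ (hη j)) j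
  have hout : Tendsto (fun j => inDist (fun x y => δ y x) σ (y j)) atTop (𝓝 (r / 2)) := by
    rw [tendsto_iff_dist_tendsto_zero]
    exact squeeze_zero (fun _ => dist_nonneg) (fun j => hy1 j) hη2
  -- The points `y` accumulate at a point of the completion whose function, with time `Ω + r / 2`,
  -- lies between the limit and the upper limit.
  obtain ⟨κ, hκ, hψ, -⟩ := hr0 y fun k => by
    have := (abs_le.1 (hy1 k)).2
    have := hη1 k
    linarith
  have hle : ∀ x, ((Ω - inDist δ σ x : ℝ) : EReal) ≤
      ((Ω + r / 2 - inDist δ (y ∘ κ) x : ℝ) : EReal) := by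
    intro x
    have : inDist δ (y ∘ κ) x ≤ inDist δ σ x + r / 2 :=
      le_of_tendsto_of_tendsto' (h.tendsto_inDist hψ x)
        ((hout.comp hκ.tendsto_atTop).const_add _) fun j =>
        h.dist_le_inDist_add hσ.forward hσ.backward x _
    exact EReal.coe_le_coe_iff.2 (by linarith)
  have hls : ∀ x, ((Ω + r / 2 - inDist δ (y ∘ κ) x : ℝ) : EReal) ≤
      limsup (fun n => φ n x) atTop := by
    intro x
    refine le_of_forall_lt fun c' hc' => ?_
    obtain ⟨c, hcc, hc⟩ := EReal.lt_iff_exists_real_btwn.1 hc'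
    refine hcc.trans_le ?_
    rw [EReal.coe_lt_coe_iff] at hc
    have h1 : Tendsto (fun j => Ω + r / 2 - 2 * (r / 4 * (1 / ((κ j : ℝ) + 1))) - δ x (y (κ j)))
        atTop (𝓝 (Ω + r / 2 - 0 - inDist δ (y ∘ κ) x)) :=
      ((hη2.comp hκ.tendsto_atTop).const_sub _).sub (h.tendsto_inDist hψ x)
    rw [sub_zero] at h1
    refine le_limsup_of_frequently_le (frequently_atTop.2 fun N => ?_) (by isBoundedDefault)
    obtain ⟨j, hj1, hj2⟩ := ((h1.eventually_const_lt hc).and (eventually_ge_atTop N)).exists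
    refine ⟨ν (κ j), (hj2.trans (hκ.id_le j)).trans (hν _), ?_⟩
    have h2 := (hy2 (κ j)).trans (h.chainFun_le (hνφ (κ j)) x (y (κ j)))
    rw [← EReal.sub_le_iff_le_add (Or.inl (EReal.coe_ne_bot _)) (Or.inl (EReal.coe_ne_top _)),
      ← EReal.coe_sub] at h2
    exact le_trans (EReal.coe_le_coe_iff.2 hj1.le) h2
  -- By maximality this function is the limit itself, but it tends to `Ω + r / 2` along `y ∘ κ`,
  -- whereas the limit is bounded by `Ω`.
  have heq := hmax _ (h.sub_inDist_mem_chainFun hψ _) hle hls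
  have h9 : r / 2 ≤ 0 := ge_of_tendsto' (h.tendsto_inDist_self hψ) fun j => by
    have h1 := EReal.coe_eq_coe_iff.1 (congrFun heq ((y ∘ κ) j))
    have h2 := h.inDist_nonneg σ ((y ∘ κ) j)
    linarith
  linarith

/-- If Busemann functions converge to the one of a nice point, they are of the same kind. -/
theorem eventually_eq_sub_inDist (hσ : IsNicePoint δ σ) {φ : ℕ → X → EReal}
    (hφ : ∀ᶠ n in atTop, φ n ∈ chainFun δ)
    (hlow : ∀ x, ((Ω - inDist δ σ x : ℝ) : EReal) ≤ liminf (fun n => φ n x) atTop)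
    (hmax : ∀ g ∈ chainFun δ, (∀ x, ((Ω - inDist δ σ x : ℝ) : EReal) ≤ g x) →
      (∀ x, g x ≤ limsup (fun n => φ n x) atTop) →
      g = fun x => ((Ω - inDist δ σ x : ℝ) : EReal))
    {ε : ℝ} (hε : 0 < ε) :
    ∀ᶠ n in atTop, ∃ Ω' τ, IsForwardCauchy (ofRealDist δ) τ ∧
      IsForwardCauchy (ofRealDist fun x y => δ y x) τ ∧ |Ω' - Ω| ≤ ε ∧
      (∀ k, inDist (fun x y => δ y x) σ (τ k) ≤ ε ∧ inDist δ σ (τ k) ≤ ε) ∧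
      φ n = fun x => ((Ω' - inDist δ τ x : ℝ) : EReal) := by
  obtain ⟨r₀, hr₀, hr₀'⟩ := hσ.compact
  have step1 : ∀ r > 0, ∀ᶠ n in atTop, ∀ u, IsChronChain δ u → φ n = chainBusemann δ u →
      ∀ᶠ k in atTop, inDist (fun x y => δ y x) σ (u k).2 < min r r₀ := fun r hr =>
    h.eventually_outDist_lt hσ hφ hlow hmax (lt_min hr hr₀) fun y hy =>
      hr₀' y fun k => (hy k).trans (min_le_right _ _)
  -- If the times infinitely often exceeded `Ω + ε` while the sequences stay within `ε / 2` of the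
  -- point, the limit raised by `ε / 2` would still be below the upper limit, against maximality.
  have step2 : ∀ᶠ n in atTop, ∀ u, IsChronChain δ u → φ n = chainBusemann δ u →
      ∀ k, (u k).1 ≤ Ω + ε := by
    by_contra hcon
    rw [Filter.not_eventually] at hcon
    push Not at hcon
    have h1 : ∀ x, ((Ω - inDist δ σ x : ℝ) : EReal) + ((ε / 2 : ℝ) : EReal) ≤
        limsup (fun n => φ n x) atTop := by
      intro x
      refine le_limsup_of_frequently_le ((hcon.and_eventually (step1 (ε / 2) (half_pos hε))).mono ?_)
        (by isBoundedDefault)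
      rintro n ⟨⟨u, hu, hun, k, hk⟩, h2⟩
      obtain ⟨k', hk1, hk2⟩ := ((h2 u hu hun).and (eventually_ge_atTop k)).exists
      have h3 := (h.chain_strictMono hu).monotone hk2
      have h4 := h.dist_le_inDist_add hσ.forward hσ.backward x (u k').2
      have h5 := hk1.trans_le (min_le_left _ _)
      rw [hun, ← EReal.coe_add]
      refine le_trans (EReal.coe_le_coe_iff.2 ?_)
        (le_iSup (fun n => (((u n).1 - δ x (u n).2 : ℝ) : EReal)) k')
      linarith
    have h2 := hmax _ (chainFun_add (h.sub_inDist_mem_chainFun hσ.forward Ω) (ε / 2)) (fun x => by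
      rw [← EReal.coe_add, EReal.coe_le_coe_iff]
      linarith) h1
    have h3 := congrFun h2 (σ 0)
    rw [← EReal.coe_add, EReal.coe_eq_coe_iff] at h3
    linarith
  obtain ⟨η, hη, hηε⟩ := hσ.compat ε hε
  obtain ⟨m, hm⟩ := ((h.tendsto_inDist_self hσ.forward).eventually_lt_const hε).exists
  have step3 : ∀ᶠ n in atTop, ((Ω - ε : ℝ) : EReal) < φ n (σ m) := by
    refine eventually_lt_of_lt_liminf (lt_of_lt_of_le ?_ (hlow (σ m)))
    exact EReal.coe_lt_coe_iff.2 (by linarith)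
  filter_upwards [step1 (min ε η) (lt_min hε hη), step2, step3, hφ] with n h1 h2 h3 h4
  obtain ⟨u, hu, hun⟩ := h4
  have h5 := h1 u hu hun
  have h6 := h2 u hu hun
  rw [hun] at h3
  obtain ⟨k₀, hk₀⟩ := lt_iSup_iff.1 h3
  rw [EReal.coe_lt_coe_iff] at hk₀
  obtain ⟨Ω', hΩ'⟩ := h.chain_of_bddAbove hu ⟨Ω + ε, by rintro _ ⟨k, rfl⟩; exact h6 k⟩
  obtain ⟨hc, he⟩ := h.chain_bounded hu hΩ'
  obtain ⟨K, hK⟩ := eventually_atTop.1 h5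
  have hKm : StrictMono fun k : ℕ => k + K := fun a b hab => by simpa using hab
  -- With bounded times the sequence is forward Cauchy. Being close to the nice point, it has a
  -- subsequence that is also backward Cauchy, and this represents the same function.
  obtain ⟨κ, hκ, hκ1, hκ2⟩ := hr₀' (fun k => (u (k + K)).2) fun k =>
    ((hK _ (by omega)).trans_le (min_le_right _ _)).le
  refine ⟨Ω', _, hκ1, hκ2, abs_le.2 ⟨?_, ?_⟩, fun k => ?_, ?_⟩
  · have h7 : (u k₀).1 ≤ Ω' := (h.chain_strictMono hu).monotone.ge_of_tendsto hΩ' k₀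
    have h8 := h.nonneg (σ m) (u k₀).2
    linarith
  · have := le_of_tendsto' hΩ' h6
    linarith
  · have h7 := hK (κ k + K) (by omega)
    exact ⟨(h7.trans_le ((min_le_left _ _).trans (min_le_left _ _))).le,
      (hηε _ (h7.trans_le ((min_le_left _ _).trans (min_le_right _ _)))).le⟩
  · rw [hun, he]
    have := h.inDist_comp hc (hKm.comp hκ)
    funext x
    rw [← this]
    rfl

/-- Points are nice. -/
theorem isNicePoint_const (x : X) : IsNicePoint δ fun _ => x := by
  have hi : inDist (fun x y => δ y x) (fun _ => x) = fun y => δ x y := h.swap.inDist_const x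
  refine ⟨h.isForwardCauchy_const x, h.swap.isForwardCauchy_const x, ?_, ?_⟩
  · obtain ⟨r, hr, h1⟩ := h.locallyCompact x
    refine ⟨r, hr, fun y hy => ?_⟩
    rw [hi] at hy
    obtain ⟨z, φ, hφ, h2, h3⟩ := h1 y fun n => Or.inl (hy n)
    have key : ∀ ε > 0, ∃ n₀, ∀ n m, n₀ ≤ n → n₀ ≤ m → δ (y (φ n)) (y (φ m)) < ε := by
      intro ε hε
      obtain ⟨n₀, hn₀⟩ := eventually_atTop.1 ((h2.eventually_lt_const (half_pos hε)).and
        (h3.eventually_lt_const (half_pos hε)))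
      exact ⟨n₀, fun n m hn hm => by
        have := h.triangle (y (φ n)) z (y (φ m))
        have := (hn₀ n hn).2
        have := (hn₀ m hm).1
        linarith⟩
    refine ⟨φ, hφ, isForwardCauchy_iff.2 fun ε hε => ?_, isForwardCauchy_iff.2 fun ε hε => ?_⟩
    · obtain ⟨n₀, hn⟩ := key ε hε
      exact ⟨n₀, fun n m h1 h2 => hn n m h1 (h1.trans h2)⟩
    · obtain ⟨n₀, hn⟩ := key ε hε
      exact ⟨n₀, fun n m h1 h2 => hn m n (h1.trans h2) h1⟩
  · intro ε hε
    obtain ⟨η, hη, h1⟩ := h.compat x ε hε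
    refine ⟨η, hη, fun y hy => ?_⟩
    rw [hi] at hy
    rw [h.inDist_const]
    exact (h1 y).1 hy

/-- Limits which are distance functions from points are only reached by such functions. -/
theorem eventually_eq_sub_dist {φ : ℕ → X → EReal} {x₀ : X}
    (hφ : ∀ᶠ n in atTop, φ n ∈ chainFun δ)
    (hlow : ∀ x, ((Ω - δ x x₀ : ℝ) : EReal) ≤ liminf (fun n => φ n x) atTop)
    (hmax : ∀ g ∈ chainFun δ, (∀ x, ((Ω - δ x x₀ : ℝ) : EReal) ≤ g x) →
      (∀ x, g x ≤ limsup (fun n => φ n x) atTop) →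
      g = fun x => ((Ω - δ x x₀ : ℝ) : EReal)) :
    ∀ᶠ n in atTop, ∃ (Ω' : ℝ) (y : X), φ n = fun x => ((Ω' - δ x y : ℝ) : EReal) := by
  obtain ⟨r, hr, h1⟩ := h.locallyCompact x₀
  have h2 := h.eventually_eq_sub_inDist (Ω := Ω) (h.isNicePoint_const x₀) hφ
    (by rw [h.inDist_const]; exact hlow) (by rw [h.inDist_const]; exact hmax) hr
  rw [h.swap.inDist_const] at h2
  filter_upwards [h2] with n hn
  obtain ⟨Ω', τ, hτ, -, -, h3, h4⟩ := hn
  obtain ⟨z, κ, hκ, h5, -⟩ := h1 τ fun k => Or.inl (h3 k).1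
  refine ⟨Ω', z, ?_⟩
  rw [h4, ← h.inDist_comp hτ hκ, h.inDist_eq_of_tendsto (isForwardCauchy_comp hτ hκ) h5]

/-- The future causal boundary is closed. -/
theorem isClosed_boundary : IsClosed (Causal.boundary (distRel δ)) := by
  rw [Causal.isClosed_completion_iff]
  intro σ hσ P hP
  refine ⟨P.2, ?_⟩
  rintro ⟨v, hv⟩
  choose f hf hfσ using fun n => h.isIP_iff.1 (σ n).2
  rw [past_singleton] at hv
  have hP' : P.1 ∈ Causal.hatL (distRel δ) fun n => (σ n).1 := hP
  simp only [hfσ, hv] at hP'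
  obtain ⟨-, h1, h2⟩ := h.mem_hatL_iff.1 hP'
  obtain ⟨n, Ω, y, hy⟩ := (h.eventually_eq_sub_dist (Eventually.of_forall hf) h1 h2).exists
  refine (hσ n).2 ⟨(Ω, y), ?_⟩
  rw [hfσ, hy, past_singleton]

end LengthDist
end

/-! ### Nice points from local compactness, and simplicity of the completion. -/

section
variable {X : Type*} {δ : X → X → ℝ} {σ τ : ℕ → X} {Ω : ℝ}

/-- Local compactness in the topology generated by the balls of a pseudo-distance. -/
theorem exists_subseq_of_locallyCompact {Y : Type*} (d : Y → Y → ℝ≥0∞) (h0 : ∀ y, d y y = 0)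
    (ht : ∀ x y z, d x z ≤ d x y + d y z) [T : TopologicalSpace Y]
    (hT : T = TopologicalSpace.generateFrom {B | ∃ (z : Y) (ε : ℝ≥0∞), B = {w | d z w < ε}})
    [LocallyCompactSpace Y] (z : Y) :
    ∃ ρ > 0, ∀ y : ℕ → Y, (∀ k, d z (y k) < ρ) →
      ∃ (w : Y) (φ : ℕ → ℕ), StrictMono φ ∧ Tendsto (fun k => d w (y (φ k))) atTop (𝓝 0) := by
  -- Every ball containing `z` contains a ball about `z`, by the triangle inequality; symmetry of
  -- `d` is not needed.
  have h1 : comap (d z) (𝓝 0) ≤ 𝓝 z := by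
    have h2 : Tendsto id (comap (d z) (𝓝 0)) (𝓝 z) := by
      rw [hT, TopologicalSpace.tendsto_nhds_generateFrom_iff]
      rintro _ ⟨z', ε, rfl⟩ hz
      have hz' : d z' z < ε := hz
      refine ⟨Iio (ε - d z' z), Iio_mem_nhds (tsub_pos_of_lt hz'), fun w hw => ?_⟩
      have hw' : d z w < ε - d z' z := hw
      change d z' w < ε
      exact (ht z' z w).trans_lt (lt_tsub_iff_left.1 hw')
    exact h2
  obtain ⟨K, hK, hKz⟩ := exists_compact_mem_nhds z
  obtain ⟨U, hU, hUK⟩ := h1 hKz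
  obtain ⟨ρ, hρ, hρU⟩ := (ENNReal.nhds_zero_basis.mem_iff).1 hU
  refine ⟨ρ, hρ, fun y hy => ?_⟩
  have hyK : ∀ k, y k ∈ K := fun k => hUK (hρU (hy k))
  obtain ⟨w, -, hw⟩ := hK.exists_mapClusterPt (f := atTop) (u := y)
    (tendsto_principal.2 (Eventually.of_forall hyK))
  have h3 : ∀ j : ℕ, ∃ᶠ k in atTop, d w (y k) < ((j : ℝ≥0∞) + 1)⁻¹ := fun j => by
    refine mapClusterPt_iff_frequently.1 hw {v | d w v < ((j : ℝ≥0∞) + 1)⁻¹} ?_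
    refine IsOpen.mem_nhds ?_ ?_
    · rw [hT]
      exact TopologicalSpace.isOpen_generateFrom_of_mem ⟨w, _, rfl⟩
    · change d w w < _
      rw [h0]
      simp
  obtain ⟨φ, hφ, h4⟩ := extraction_forall_of_frequently h3
  refine ⟨w, φ, hφ, ?_⟩
  have h5 : Tendsto (fun j : ℕ => ((j : ℝ≥0∞) + 1)⁻¹) atTop (𝓝 0) := by
    have := (ENNReal.tendsto_inv_nat_nhds_zero.comp (tendsto_add_atTop_nat 1))
    simpa [Function.comp_def] using this
  exact tendsto_of_tendsto_of_tendsto_of_le_of_le tendsto_const_nhds h5 (fun _ => zero_le)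
    fun j => (h4 j).le

namespace LengthDist

variable (h : LengthDist δ)
include h

/-- A point as an element of the completion. -/
def toCompl (x : X) : CauchyCompl (ofRealDist δ) := CauchyCompl.mk _ (h.isForwardCauchy_const x)

theorem inDist_toCompl (x : X) : inDist δ (h.toCompl x).rep = fun y => δ y x := by
  rw [toCompl, h.inDist_rep_mk, h.inDist_const]

theorem quasiDist_toCompl_right (z : CauchyCompl (ofRealDist δ)) (y : X) :
    CauchyCompl.quasiDist z (h.toCompl y) = outDist δ z.rep y := by
  unfold CauchyCompl.quasiDist doubleLim
  have h1 : ∀ n, limsup (fun m => ofRealDist δ (z.rep n) ((h.toCompl y).rep m)) atTop =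
      ofRealDist δ (z.rep n) y := fun n => by
    refine (h.ofReal_inDist (isForwardCauchy_rep _) _).trans ?_
    rw [h.inDist_toCompl]
    rfl
  simp only [h1]
  rfl

theorem quasiDist_toCompl_left (z : CauchyCompl (ofRealDist δ)) (y : X) :
    CauchyCompl.quasiDist (h.toCompl y) z = ENNReal.ofReal (inDist δ z.rep y) := by
  unfold CauchyCompl.quasiDist doubleLim
  set ρ := (h.toCompl y).rep with hρ
  have hρc : IsForwardCauchy (ofRealDist δ) ρ := isForwardCauchy_rep _
  have h1 : ∀ n, limsup (fun m => ofRealDist δ (ρ n) (z.rep m)) atTop =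
      ENNReal.ofReal (inDist δ z.rep (ρ n)) := fun n =>
    h.ofReal_inDist (isForwardCauchy_rep _) _
  simp only [h1]
  -- The chosen representative `ρ` need not be constant, but it converges to `y`.
  have h2 : Tendsto (fun n => δ (ρ n) y) atTop (𝓝 0) := by
    have := h.tendsto_inDist_self hρc
    rwa [h.inDist_toCompl] at this
  have h3 : Tendsto (fun n => δ y (ρ n)) atTop (𝓝 0) := h.swap.tendsto_swap h2
  have h4 : Tendsto (fun n => inDist δ z.rep (ρ n)) atTop (𝓝 (inDist δ z.rep y)) := by
    refine tendsto_of_tendsto_of_tendsto_of_le_of_le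
      (g := fun n => inDist δ z.rep y - δ y (ρ n)) (h := fun n => δ (ρ n) y + inDist δ z.rep y)
      (by simpa using h3.const_sub (inDist δ z.rep y))
      (by simpa using h2.add_const (inDist δ z.rep y)) (fun n => ?_) (fun n => ?_)
    · have := h.inDist_le (isForwardCauchy_rep z) y (ρ n)
      simp only
      linarith
    · exact h.inDist_le (isForwardCauchy_rep z) (ρ n) y
  exact ((ENNReal.continuous_ofReal.tendsto _).comp h4).limsup_eq

theorem isForwardCauchy_of_dist_le {y : ℕ → X} {a b : ℕ → ℝ} (ha : Tendsto a atTop (𝓝 0))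
    (hb : Tendsto b atTop (𝓝 0)) (hab : ∀ n m, δ (y n) (y m) ≤ a n + b m) :
    IsForwardCauchy (ofRealDist δ) y ∧ IsForwardCauchy (ofRealDist fun x y => δ y x) y := by
  have key : ∀ ε > 0, ∃ n₀, ∀ n m, n₀ ≤ n → n₀ ≤ m → δ (y n) (y m) < ε := by
    intro ε hε
    obtain ⟨n₀, hn₀⟩ := eventually_atTop.1 ((ha.eventually_lt_const (half_pos hε)).and
      (hb.eventually_lt_const (half_pos hε)))
    exact ⟨n₀, fun n m hn hm => by
      have := hab n m
      have := (hn₀ n hn).1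
      have := (hn₀ m hm).2
      linarith⟩
  refine ⟨isForwardCauchy_iff.2 fun ε hε => ?_, isForwardCauchy_iff.2 fun ε hε => ?_⟩
  · obtain ⟨n₀, hn⟩ := key ε hε
    exact ⟨n₀, fun n m h1 h2 => hn n m h1 (h1.trans h2)⟩
  · obtain ⟨n₀, hn⟩ := key ε hε
    exact ⟨n₀, fun n m h1 h2 => hn m n (h1.trans h2) h1⟩

/-- If `d_Q` is a generalized distance, forward Cauchy sequences are backward Cauchy. -/
theorem isForwardCauchy_swap_of_isGeneralizedDist
    (hg : IsGeneralizedDist (CauchyCompl.quasiDist (d := ofRealDist δ)))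
    (hσ : IsForwardCauchy (ofRealDist δ) σ) : IsForwardCauchy (ofRealDist fun x y => δ y x) σ := by
  have he := h.inDist_rep_mk hσ
  -- The points `σ n` tend to the class of `σ` in one direction, hence by `lim_iff` in the other:
  -- the distances from the class to `σ n` tend to `0`.
  have h1 := (hg.lim_iff (fun n => h.toCompl (σ n)) (CauchyCompl.mk σ hσ)).1 (by
    simp only [h.quasiDist_toCompl_left, he]
    have := (ENNReal.continuous_ofReal.tendsto _).comp (h.tendsto_inDist_self hσ)
    rwa [ENNReal.ofReal_zero] at this)
  simp only [h.quasiDist_toCompl_right, h.outDist_congr (isForwardCauchy_rep _) hσ he] at h1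
  intro ε hε
  have hε2 : 0 < ε / 2 := ENNReal.half_pos hε.ne'
  obtain ⟨n₁, hn₁⟩ := eventually_atTop.1 (h1.eventually_lt_const hε2)
  obtain ⟨n₂, hn₂⟩ := hσ (ε / 2) hε2
  refine ⟨max n₁ n₂, fun n m hn hm => ?_⟩
  have h3 : ∀ᶠ k in atTop, ofRealDist δ (σ k) (σ n) < ε / 2 :=
    (h.tendsto_outDist hσ (σ n)).eventually_lt_const (hn₁ n (by omega))
  obtain ⟨k, hk1, hk2⟩ := (h3.and (eventually_ge_atTop m)).exists
  calc ofRealDist δ (σ m) (σ n) ≤ ofRealDist δ (σ m) (σ k) + ofRealDist δ (σ k) (σ n) :=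
        h.ofRealDist_triangle _ _ _
    _ < ε / 2 + ε / 2 := ENNReal.add_lt_add (hn₂ m k (by omega) hk2) hk1
    _ = ε := ENNReal.add_halves ε

/-- The equivalence `lim_iff` makes the two distance functions of the point small at the same
places. Local compactness then gives a subsequence that converges, in both directions, to some point
of the completion. Such a subsequence is Cauchy in both directions. -/
theorem isNicePoint_of_isGeneralizedDist
    (hg : IsGeneralizedDist (CauchyCompl.quasiDist (d := ofRealDist δ)))
    (hc : ∀ z : CauchyCompl (ofRealDist δ), ∃ ρ > 0, ∀ y : ℕ → CauchyCompl (ofRealDist δ),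
      (∀ k, (CauchyCompl.quasiDist z (y k) + CauchyCompl.quasiDist (y k) z) / 2 < ρ) →
      ∃ (w : CauchyCompl (ofRealDist δ)) (φ : ℕ → ℕ), StrictMono φ ∧
        Tendsto (fun k => (CauchyCompl.quasiDist w (y (φ k)) +
          CauchyCompl.quasiDist (y (φ k)) w) / 2) atTop (𝓝 0))
    (hσ : IsForwardCauchy (ofRealDist δ) σ) :
    IsNicePoint δ σ ∧ IsNicePoint (fun x y => δ y x) σ := by
  have hσ' := h.isForwardCauchy_swap_of_isGeneralizedDist hg hσ
  have hsw := fun z : CauchyCompl (ofRealDist δ) =>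
    h.isForwardCauchy_swap_of_isGeneralizedDist hg (isForwardCauchy_rep z)
  have he := h.inDist_rep_mk hσ
  set z := CauchyCompl.mk σ hσ with hz
  have heq : ∀ y, CauchyCompl.quasiDist z (h.toCompl y) =
      ENNReal.ofReal (inDist (fun x y => δ y x) σ y) := fun y => by
    rw [h.quasiDist_toCompl_right, h.outDist_congr (isForwardCauchy_rep _) hσ he, h.outDist_eq hσ']
  have heq' : ∀ y, CauchyCompl.quasiDist (h.toCompl y) z = ENNReal.ofReal (inDist δ σ y) :=
    fun y => by rw [h.quasiDist_toCompl_left, he]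
  have hz0 : ∀ f : ℕ → ℝ, (∀ n, 0 ≤ f n) →
      (Tendsto (fun n => ENNReal.ofReal (f n)) atTop (𝓝 0) ↔ Tendsto f atTop (𝓝 0)) := by
    intro f hf
    constructor
    · intro h1
      refine ((ENNReal.tendsto_toReal ENNReal.zero_ne_top).comp h1).congr fun n => ?_
      exact ENNReal.toReal_ofReal (hf n)
    · intro h1
      have := (ENNReal.continuous_ofReal.tendsto 0).comp h1
      rwa [ENNReal.ofReal_zero] at this
  have hlim : ∀ y : ℕ → X, Tendsto (fun n => inDist δ σ (y n)) atTop (𝓝 0) ↔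
      Tendsto (fun n => inDist (fun x y => δ y x) σ (y n)) atTop (𝓝 0) := fun y => by
    have := hg.lim_iff (fun n => h.toCompl (y n)) z
    simp only [heq, heq'] at this
    rwa [hz0 _ fun n => h.inDist_nonneg _ _, hz0 _ fun n => h.swap.inDist_nonneg _ _] at this
  have hcomp : ∀ f g : X → ℝ, (∀ x, 0 ≤ f x) → (∀ x, 0 ≤ g x) →
      (∀ y : ℕ → X, Tendsto (fun n => f (y n)) atTop (𝓝 0) →
        Tendsto (fun n => g (y n)) atTop (𝓝 0)) → ∀ ε > 0, ∃ η > 0, ∀ y, f y < η → g y < ε := by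
    intro f g hf hg hfg ε hε
    by_contra hcon
    push Not at hcon
    choose y hy1 hy2 using fun n : ℕ => hcon (1 / ((n : ℝ) + 1)) (by positivity)
    have h1 := hfg y (squeeze_zero (fun n => hf _) (fun n => (hy1 n).le)
      tendsto_one_div_add_atTop_nhds_zero_nat)
    obtain ⟨n, hn⟩ := (h1.eventually_lt_const hε).exists
    exact absurd hn (not_lt.2 (hy2 n))
  have hc1 := hcomp _ _ (h.swap.inDist_nonneg σ) (h.inDist_nonneg σ) fun y => (hlim y).2
  have hc2 := hcomp _ _ (h.inDist_nonneg σ) (h.swap.inDist_nonneg σ) fun y => (hlim y).1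
  obtain ⟨ρ', hρ', hcpt⟩ := hc z
  obtain ⟨ρ, h0, hρ⟩ := ENNReal.lt_iff_exists_nnreal_btwn.1 hρ'
  have hρ0 : (0 : ℝ) < ρ := by exact_mod_cast h0
  have hsub : ∀ y : ℕ → X, (∀ k, inDist δ σ (y k) < ρ ∧ inDist (fun x y => δ y x) σ (y k) < ρ) →
      ∃ φ : ℕ → ℕ, StrictMono φ ∧ IsForwardCauchy (ofRealDist δ) (y ∘ φ) ∧
        IsForwardCauchy (ofRealDist fun x y => δ y x) (y ∘ φ) := by
    intro y hy
    obtain ⟨w, φ, hφ, hw⟩ := hcpt (fun k => h.toCompl (y k)) fun k => by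
      rw [heq, heq']
      refine lt_of_le_of_lt ?_ hρ
      refine ENNReal.div_le_of_le_mul ?_
      rw [mul_two]
      refine add_le_add ?_ ?_
      · rw [← ENNReal.ofReal_coe_nnreal]
        exact ENNReal.ofReal_le_ofReal (hy k).2.le
      · rw [← ENNReal.ofReal_coe_nnreal]
        exact ENNReal.ofReal_le_ofReal (hy k).1.le
    have hw2 : Tendsto (fun k => CauchyCompl.quasiDist w (h.toCompl (y (φ k))) +
        CauchyCompl.quasiDist (h.toCompl (y (φ k))) w) atTop (𝓝 0) := by
      have := ENNReal.Tendsto.const_mul hw (a := 2) (Or.inr (by simp))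
      rw [mul_zero] at this
      refine this.congr fun k => ?_
      exact ENNReal.mul_div_cancel (by simp) (by simp)
    have hw3 := tendsto_of_tendsto_of_tendsto_of_le_of_le tendsto_const_nhds hw2
      (fun _ => zero_le) (fun k => le_self_add)
    have hw4 := tendsto_of_tendsto_of_tendsto_of_le_of_le tendsto_const_nhds hw2
      (fun _ => zero_le) (fun k => le_add_self)
    simp only [h.quasiDist_toCompl_right, h.quasiDist_toCompl_left, h.outDist_eq (hsw w)] at hw3 hw4
    rw [hz0 _ fun n => h.swap.inDist_nonneg _ _] at hw3
    rw [hz0 _ fun n => h.inDist_nonneg _ _] at hw4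
    exact ⟨φ, hφ, h.isForwardCauchy_of_dist_le hw4 hw3 fun n m =>
      h.dist_le_inDist_add (isForwardCauchy_rep w) (hsw w) _ _⟩
  refine ⟨⟨hσ, hσ', ?_, hc1⟩, ⟨hσ', hσ, ?_, hc2⟩⟩
  · obtain ⟨η, hη, h1⟩ := hc1 ρ hρ0
    refine ⟨min η ρ / 2, by positivity, fun y hy => hsub y fun k => ?_⟩
    have h2 := hy k
    have h3 := min_le_left η (ρ : ℝ)
    have h4 := min_le_right η (ρ : ℝ)
    have h5 : 0 < min η (ρ : ℝ) := lt_min hη hρ0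
    exact ⟨h1 _ (by linarith), by linarith⟩
  · obtain ⟨η, hη, h1⟩ := hc2 ρ hρ0
    refine ⟨min η ρ / 2, by positivity, fun y hy => ?_⟩
    obtain ⟨φ, h6, h7, h8⟩ := hsub y fun k => by
      have h2 : inDist δ σ (y k) ≤ min η ρ / 2 := hy k
      have h3 := min_le_left η (ρ : ℝ)
      have h4 := min_le_right η (ρ : ℝ)
      have h5 : 0 < min η (ρ : ℝ) := lt_min hη hρ0
      exact ⟨by linarith, h1 _ (by linarith)⟩
    exact ⟨φ, h6, h8, h7⟩

/-! #### Simplicity -/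

theorem mem_hatL_of_tendsto {f : X → EReal} {φ : ℕ → X → EReal} (hf : f ∈ chainFun δ)
    (hlim : ∀ x, Tendsto (fun n => φ n x) atTop (𝓝 (f x))) :
    pastOf f ∈ Causal.hatL (distRel δ) fun n => pastOf (φ n) :=
  h.mem_hatL_iff.2 ⟨hf, fun x => (hlim x).liminf_eq.ge, fun _ _ h1 h2 => funext fun x =>
    le_antisymm ((h2 x).trans (hlim x).limsup_eq.le) (h1 x)⟩

/-- An empty component is the past of the constant function `-∞`. Sequences of pairs become
sequences of functions without a case distinction. -/
theorem exists_pastOf_eq {P : Set (ℝ × X)} (hP : P ≠ ∅ → Causal.IsIP (distRel δ) P) :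
    ∃ f, P = pastOf f ∧ (P ≠ ∅ → f ∈ chainFun δ) := by
  by_cases h0 : P = ∅
  · refine ⟨fun _ => ⊥, ?_, fun hne => absurd h0 hne⟩
    rw [h0]
    ext p
    exact iff_of_false (notMem_empty p) fun hp => not_lt_bot (show (p.1 : EReal) < ⊥ from hp)
  · obtain ⟨f, hf, hPf⟩ := h.isIP_iff.1 (hP h0)
    exact ⟨f, hPf, fun _ => hf⟩

/-- Near nice points the partners converge. -/
theorem futurePoint_mem_hatL (hσ : IsNicePoint δ σ) {P F : ℕ → Set (ℝ × X)}
    (hPF : ∀ n, (P n, F n) ∈ Causal.cCompletion (distRel δ))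
    (hP : pastPoint δ Ω σ ∈ Causal.hatL (distRel δ) P) :
    futurePoint δ Ω σ ∈ Causal.hatL (fun p q => distRel δ q p) F := by
  choose f hfP hf using fun n => h.exists_pastOf_eq (Causal.mem_cCompletion_isIP (hPF n))
  have hFne : ∀ n, timeReflect X ⁻¹' F n ≠ ∅ →
      Causal.IsIP (distRel fun x y => δ y x) (timeReflect X ⁻¹' F n) := fun n hne =>
    isIP_swap_iff.1 (Causal.mem_cCompletion_isIP (Causal.mem_cCompletion_swap.2 (hPF n))
      fun h0 => hne (by rw [h0, preimage_empty]))
  choose g hgF hg using fun n => h.swap.exists_pastOf_eq (hFne n)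
  rw [hatL_swap_iff, ← neg_neg Ω, ← timeReflect_preimage_pastPoint, timeReflect_preimage_preimage]
  simp only [hgF]
  refine h.swap.mem_hatL_of_tendsto (h.swap.sub_inDist_mem_chainFun hσ.backward _) fun x => ?_
  have hne : ∀ᶠ n in atTop, f n ∈ chainFun δ := by
    obtain ⟨p, hp⟩ := (h.isIP_pastPoint hσ.forward Ω).nonempty
    refine (hP.1 hp).mono fun n hn => hf n (nonempty_iff_ne_empty.1 ⟨p, hn⟩)
  rw [show P = fun n => pastOf (f n) from funext hfP] at hP
  obtain ⟨-, hlow, hmax⟩ := h.mem_hatL_iff.1 hP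
  -- Eventually the pairs lie over symmetric points `(Ω', τ)` close to `(Ω, σ)`. Their second
  -- components are then the known unique partners, and the functions of these differ from the
  -- expected limit by at most `2 ε`.
  have hgn : ∀ ε > 0, ∀ᶠ n in atTop, ∃ c : ℝ, g n x = (c : EReal) ∧
      |c - (-Ω - inDist (fun x y => δ y x) σ x)| ≤ 2 * ε := by
    intro ε hε
    filter_upwards [h.eventually_eq_sub_inDist hσ hne hlow hmax hε] with n hn
    obtain ⟨Ω', τ, hτ, hτ', hΩ', hk, hfn⟩ := hn
    have h1 : F n = futurePoint δ Ω' τ := by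
      have h2 := hPF n
      rw [hfP, hfn] at h2
      exact (h.mem_cCompletion_pastPoint_iff hτ hτ').1 h2
    have h2 : g n = fun x => ((-Ω' - inDist (fun x y => δ y x) τ x : ℝ) : EReal) := by
      apply pastOf_injective
      rw [← hgF, h1, ← neg_neg Ω', ← timeReflect_preimage_pastPoint, timeReflect_preimage_preimage]
      simp [pastPoint]
    refine ⟨_, congrFun h2 x, ?_⟩
    have h3 : inDist (fun x y => δ y x) τ x ≤ ε + inDist (fun x y => δ y x) σ x :=
      le_of_tendsto' (h.swap.tendsto_inDist hτ' x) fun k =>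
        (h.dist_le_inDist_add hσ.forward hσ.backward (τ k) x).trans (by linarith [(hk k).2])
    have h4 : inDist (fun x y => δ y x) σ x ≤ inDist (fun x y => δ y x) τ x + ε :=
      ge_of_tendsto' ((h.swap.tendsto_inDist hτ' x).add_const ε) fun k =>
        (h.swap.inDist_le hσ.backward x (τ k)).trans (by linarith [(hk k).1])
    rw [abs_le] at hΩ' ⊢
    constructor <;> linarith
  have hc : ∀ᶠ n in atTop, g n x = (((g n x).toReal : ℝ) : EReal) := by
    filter_upwards [hgn 1 one_pos] with n hn
    obtain ⟨c, hc, -⟩ := hn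
    rw [hc, EReal.toReal_coe]
  have hT : Tendsto (fun n => (g n x).toReal) atTop
      (𝓝 (-Ω - inDist (fun x y => δ y x) σ x)) := by
    rw [Metric.tendsto_atTop]
    intro ε hε
    refine eventually_atTop.1 ?_
    filter_upwards [hgn (ε / 4) (by linarith)] with n hn
    obtain ⟨c, hc, hc'⟩ := hn
    rw [hc, EReal.toReal_coe, Real.dist_eq]
    linarith
  exact ((continuous_coe_real_ereal.tendsto _).comp hT).congr' (hc.mono fun n hn => hn.symm)

theorem pastPoint_mem_hatL (hσ : IsNicePoint (fun x y => δ y x) σ) {P F : ℕ → Set (ℝ × X)}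
    (hPF : ∀ n, (P n, F n) ∈ Causal.cCompletion (distRel δ))
    (hF : futurePoint δ Ω σ ∈ Causal.hatL (fun p q => distRel δ q p) F) :
    pastPoint δ Ω σ ∈ Causal.hatL (distRel δ) P := by
  rw [hatL_swap_iff, ← neg_neg Ω, ← timeReflect_preimage_pastPoint,
    timeReflect_preimage_preimage] at hF
  have h1 := h.swap.futurePoint_mem_hatL hσ
    (fun n => mem_cCompletion_reflect_iff.2 (hPF n)) hF
  rw [hatL_swap_iff, timeReflect_preimage_futurePoint, neg_neg] at h1
  simpa only [timeReflect_preimage_preimage] using h1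

/-- As all forward Cauchy sequences are symmetric, a pair with two non-empty components lies over a
nice point. For the other pairs there is no second component whose convergence is to be shown. -/
theorem isSimple_of_isNicePoint (hn : ∀ σ, IsForwardCauchy (ofRealDist δ) σ →
    IsNicePoint δ σ ∧ IsNicePoint (fun x y => δ y x) σ) : Causal.IsSimple (distRel δ) := by
  constructor
  · exact h.isPointSimple_of_outDist fun σ hσ _ _ => ⟨σ, hσ, (hn σ hσ).1.backward, rfl⟩
  · intro s p hp
    have hsym : p.1.1 ≠ ∅ → p.1.2 ≠ ∅ → ∃ Ω σ, IsForwardCauchy (ofRealDist δ) σ ∧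
        p.1.1 = pastPoint δ Ω σ ∧ p.1.2 = futurePoint δ Ω σ := by
      intro h1 h2
      have hS := Causal.mem_cCompletion_of_left p.2 h1 h2
      obtain ⟨h3, h4, h5, -, -⟩ := (Causal.sRelated_iff h.isChronological).1 hS
      obtain ⟨Ω, σ, hσ, hP⟩ := h.exists_pastPoint h3 h5 h4.nonempty
      rw [hP] at hS
      exact ⟨Ω, σ, hσ, hP, (h.sRelated_pastPoint_iff hσ (hn σ hσ).1.backward).1 hS⟩
    rcases hp with hp | hp
    · refine ⟨fun _ => hp, fun h2 => ?_⟩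
      obtain ⟨Ω, σ, hσ, hP, hF⟩ := hsym hp.2.1.ne_empty h2
      rw [hF]
      rw [hP] at hp
      exact h.futurePoint_mem_hatL (hn σ hσ).1 (fun n => (s n).2) hp
    · refine ⟨fun h2 => ?_, fun _ => hp⟩
      obtain ⟨Ω, σ, hσ, hP, hF⟩ := hsym h2 hp.2.1.ne_empty
      rw [hP]
      rw [hF] at hp
      exact h.pastPoint_mem_hatL (hn σ hσ).2 (fun n => (s n).2) hp

theorem existsUnique_right (hs : Causal.IsPointSimple (distRel δ)) {P : Set (ℝ × X)}
    (hP : Causal.IsIP (distRel δ) P) : ∃! F, (P, F) ∈ Causal.cCompletion (distRel δ) := by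
  by_cases hT : Causal.IsTIP (distRel δ) P
  · obtain ⟨F, hF, hu⟩ := hs.1 P hT
    exact ⟨F, hF.1, fun F' hF' => hu F' (Causal.mem_cBoundary_of_isTIP hF' hT)⟩
  · obtain ⟨v, rfl⟩ := not_not.1 fun hv => hT ⟨hP, hv⟩
    exact ⟨_, (h.mem_cCompletion_past_iff v).2 rfl, fun F' hF' => (h.mem_cCompletion_past_iff v).1 hF'⟩

theorem existsUnique_left (hs : Causal.IsPointSimple (distRel δ)) {F : Set (ℝ × X)}
    (hF : Causal.IsIP (fun p q => distRel δ q p) F) :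
    ∃! P, (P, F) ∈ Causal.cCompletion (distRel δ) := by
  by_cases hT : Causal.IsTIP (fun p q => distRel δ q p) F
  · obtain ⟨P, hP, hu⟩ := hs.2 F hT
    exact ⟨P, hP.1, fun P' hP' => hu P' (Causal.mem_cBoundary_of_isTIF hP' hT)⟩
  · obtain ⟨v, rfl⟩ := not_not.1 fun hv => hT ⟨hF, hv⟩
    exact ⟨_, (h.mem_cCompletion_future_iff v).2 rfl,
      fun P' hP' => (h.mem_cCompletion_future_iff v).1 hP'⟩

/-- The past causal boundary is closed. -/
theorem isClosed_boundary_swap : IsClosed (Causal.boundary fun p q => distRel δ q p) := by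
  rw [Causal.isClosed_completion_iff]
  intro σ hσ P hP
  have h1 : ∀ n, Causal.IsIP (distRel fun x y => δ y x) (timeReflect X ⁻¹' (σ n).1) := fun n =>
    isIP_swap_iff.1 (σ n).2
  have h2 : P.1 ∈ Causal.hatL (fun p q => distRel δ q p) fun n => (σ n).1 := hP
  rw [hatL_swap_iff] at h2
  have h3 := (Causal.isClosed_completion_iff.1 h.swap.isClosed_boundary)
    (fun n => ⟨_, h1 n⟩) (fun n => isTIP_swap_iff.1 (hσ n))
    (show (⟨_, isIP_swap_iff.1 P.2⟩ : Causal.Completion (distRel fun x y => δ y x)) ∈ _ from h2)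
  exact isTIP_swap_iff.2 h3

end LengthDist
end

/-! ### Chronological limits as pointwise limits. -/

section
variable {X : Type*} {δ : X → X → ℝ}

/-- Functions which are `1`-Lipschitz for the generalized distance. -/
def IsLip (δ : X → X → ℝ) (f : X → EReal) : Prop := ∀ x y, f y ≤ f x + (δ x y : EReal)

/-- The limits of a sequence of functions, maximal in the class `A`. -/
def IsUpperLim (A : Set (X → EReal)) (φ : ℕ → X → EReal) (f : X → EReal) : Prop :=
  (∀ x, f x ≤ liminf (fun n => φ n x) atTop) ∧
    ∀ g ∈ A, (∀ x, f x ≤ g x) → (∀ x, g x ≤ limsup (fun n => φ n x) atTop) → g = f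

/-- The finite Busemann functions. -/
def finChainFun (δ : X → X → ℝ) : Set (X → EReal) := {f | f ∈ chainFun δ ∧ ∀ x, f x ≠ ⊤}

theorem limsup_comp_le (u : ℕ → EReal) {φ : ℕ → ℕ} (hφ : Tendsto φ atTop atTop) :
    limsup (fun n => u (φ n)) atTop ≤ limsup u atTop := by
  have h : limsup (u ∘ φ) atTop = limsup u (map φ atTop) := rfl
  exact h.le.trans (limsup_le_limsup_of_le hφ)

theorem liminf_le_comp (u : ℕ → EReal) {φ : ℕ → ℕ} (hφ : Tendsto φ atTop atTop) :
    liminf u atTop ≤ liminf (fun n => u (φ n)) atTop := by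
  have h : liminf (u ∘ φ) atTop = liminf u (map φ atTop) := rfl
  exact (liminf_le_liminf_of_le hφ).trans h.ge

theorem IsUpperLim.comp {A : Set (X → EReal)} {φ : ℕ → X → EReal} {f : X → EReal}
    (h : IsUpperLim A φ f) {ν : ℕ → ℕ} (hν : Tendsto ν atTop atTop) :
    IsUpperLim A (fun n => φ (ν n)) f :=
  ⟨fun x => (h.1 x).trans (liminf_le_comp (fun n => φ n x) hν),
    fun g hg h1 h2 => h.2 g hg h1 fun x => (h2 x).trans (limsup_comp_le (fun n => φ n x) hν)⟩

theorem EReal.limsup_add_coe_le (u : ℕ → EReal) (c : ℝ) :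
    limsup (fun n => u n + (c : EReal)) atTop ≤ limsup u atTop + c := by
  have h1 : limsup (fun _ : ℕ => (c : EReal)) atTop = c := limsup_const _
  have h2 := EReal.limsup_add_le (u := u) (v := fun _ => (c : EReal)) (f := atTop)
    (Or.inr (by rw [h1]; exact EReal.coe_ne_top c)) (Or.inr (by rw [h1]; exact EReal.coe_ne_bot c))
  rwa [h1] at h2

theorem EReal.liminf_add_coe_le (u : ℕ → EReal) (c : ℝ) :
    liminf (fun n => u n + (c : EReal)) atTop ≤ liminf u atTop + c := by
  have h1 : limsup (fun _ : ℕ => (c : EReal)) atTop = c := limsup_const _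
  have h2 := EReal.liminf_add_le (u := fun _ => (c : EReal)) (v := u) (f := atTop)
    (Or.inl (by rw [h1]; exact EReal.coe_ne_bot c)) (Or.inl (by rw [h1]; exact EReal.coe_ne_top c))
  rw [h1, add_comm (c:EReal)] at h2
  refine le_trans (le_of_eq ?_) h2
  congr 1
  funext n
  exact add_comm _ _

theorem EReal.le_of_forall_le_add_coe {a b : EReal} (h : ∀ ε : ℝ, 0 < ε → a ≤ b + ε) : a ≤ b := by
  have h1 : Tendsto (fun n : ℕ => b + ((1 / ((n : ℝ) + 1) : ℝ) : EReal)) atTop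
      (𝓝 (b + ((0 : ℝ) : EReal))) := by
    have h2 := (EReal.continuousAt_add (p := (b, ((0 : ℝ) : EReal)))
      (Or.inr (EReal.coe_ne_bot 0)) (Or.inr (EReal.coe_ne_top 0))).tendsto
    exact h2.comp (tendsto_const_nhds.prodMk_nhds
      ((continuous_coe_real_ereal.tendsto 0).comp tendsto_one_div_add_atTop_nhds_zero_nat))
  rw [EReal.coe_zero, add_zero] at h1
  exact ge_of_tendsto' h1 fun n => h _ (by positivity)

theorem IsLip.limsup {φ : ℕ → X → EReal} (h : ∀ n, IsLip δ (φ n)) :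
    IsLip δ fun x => limsup (fun n => φ n x) atTop := fun x y =>
  (limsup_le_limsup (Eventually.of_forall fun n => h n x y)).trans
    (EReal.limsup_add_coe_le (fun n => φ n x) _)

theorem IsLip.liminf {φ : ℕ → X → EReal} (h : ∀ n, IsLip δ (φ n)) :
    IsLip δ fun x => liminf (fun n => φ n x) atTop := fun x y =>
  (liminf_le_liminf (Eventually.of_forall fun n => h n x y)).trans
    (EReal.liminf_add_coe_le (fun n => φ n x) _)

theorem IsLip.le_of_dense {D : ℕ → X} (hD : ∀ x, ∀ ε > 0, ∃ n, δ x (D n) < ε ∧ δ (D n) x < ε)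
    {a b : X → EReal} (ha : IsLip δ a) (hb : IsLip δ b) (hab : ∀ n, a (D n) ≤ b (D n)) (x : X) :
    a x ≤ b x := by
  refine EReal.le_of_forall_le_add_coe fun ε hε => ?_
  obtain ⟨n, h1, h2⟩ := hD x (ε / 2) (half_pos hε)
  calc a x ≤ a (D n) + (δ (D n) x : EReal) := ha _ _
    _ ≤ b (D n) + ((ε / 2 : ℝ) : EReal) := add_le_add (hab n) (EReal.coe_le_coe_iff.2 h2.le)
    _ ≤ b x + (δ x (D n) : EReal) + ((ε / 2 : ℝ) : EReal) := by gcongr; exact hb _ _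
    _ ≤ b x + ((ε / 2 : ℝ) : EReal) + ((ε / 2 : ℝ) : EReal) := by gcongr
    _ = b x + (ε : EReal) := by rw [add_assoc, ← EReal.coe_add, add_halves]

namespace LengthDist

variable (h : LengthDist δ)
include h

theorem isLip_chainFun {f : X → EReal} (hf : f ∈ chainFun δ) : IsLip δ f := h.chainFun_le hf

/-- Lipschitz functions are suprema of Busemann functions below them. -/
theorem exists_maximal_chainFun {g : X → EReal} (hg : IsLip δ g) {t : ℝ} {y : X}
    (hty : (t : EReal) ≤ g y) : ∃ f ∈ chainFun δ, (t : EReal) ≤ f y ∧ (∀ x, f x ≤ g x) ∧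
      ∀ k ∈ chainFun δ, (∀ x, f x ≤ k x) → (∀ x, k x ≤ g x) → k = f := by
  have h1 : ∀ x, ((t - δ x y : ℝ) : EReal) ≤ g x := fun x => by
    have := hty.trans (hg x y)
    rwa [← EReal.sub_le_iff_le_add (Or.inl (EReal.coe_ne_bot _)) (Or.inl (EReal.coe_ne_top _)),
      ← EReal.coe_sub] at this
  obtain ⟨P, hP1, hP2, hP3, hP4⟩ := h.isChronological.exists_isMaximalIPIn
    (h.isIP_pastOf (h.sub_dist_mem_chainFun t y)) (pastOf_subset_pastOf_iff.2 h1)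
  obtain ⟨f, hf, rfl⟩ := h.isIP_iff.1 hP2
  rw [pastOf_subset_pastOf_iff] at hP1 hP3
  refine ⟨f, hf, ?_, hP3, fun k hk h2 h3 => pastOf_injective (hP4 _ (h.isIP_pastOf hk)
    (pastOf_subset_pastOf_iff.2 h2) (pastOf_subset_pastOf_iff.2 h3))⟩
  simpa [h.self] using hP1 y

theorem fin_of_ne_top {f : X → EReal} (hf : f ∈ chainFun δ) {x : X} (hx : f x ≠ ⊤) :
    f ∈ finChainFun δ := ⟨hf, h.chainFun_ne_top hf hx⟩

theorem eq_top_of_eq_top {f : X → EReal} (hf : f ∈ chainFun δ) {x : X} (hx : f x = ⊤) :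
    f = fun _ => ⊤ := by
  funext y
  by_contra hy
  exact h.chainFun_ne_top hf hy x hx

omit h in
theorem fin_coe {f : X → EReal} (hf : f ∈ finChainFun δ) (x : X) : ((f x).toReal : EReal) = f x :=
  EReal.coe_toReal (hf.2 x) (bot_lt_chainFun hf.1 x).ne'

omit h in
theorem fin_add {f : X → EReal} (hf : f ∈ finChainFun δ) (k : ℝ) :
    (fun x => f x + (k : EReal)) ∈ finChainFun δ :=
  ⟨chainFun_add hf.1 k, fun x => EReal.add_ne_top (hf.2 x) (EReal.coe_ne_top k)⟩

omit h in
theorem fin_add_inj {f : X → EReal} (hf : f ∈ finChainFun δ) {k : ℝ} {x : X}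
    (he : f x + (k : EReal) = f x) : k = 0 := by
  rw [← fin_coe hf x, ← EReal.coe_add, EReal.coe_eq_coe_iff] at he
  linarith

/-- An upper limit which is finite is not exceeded everywhere by the upper limit of the sequence. -/
theorem not_limsup_eq_top {φ : ℕ → X → EReal} {f : X → EReal} [Nonempty X]
    (hf : f ∈ finChainFun δ) (hU : IsUpperLim (finChainFun δ) φ f) :
    ¬ ∀ x, limsup (fun n => φ n x) atTop = ⊤ := by
  intro ht
  obtain ⟨x⟩ := ‹Nonempty X›
  -- Otherwise `f + 1` would be a larger function below the upper limit.
  have h1 := hU.2 _ (fin_add hf 1) (fun x => by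
    rw [← fin_coe hf x, ← EReal.coe_add, EReal.coe_le_coe_iff]
    linarith) fun x => by rw [ht]; exact le_top
  exact one_ne_zero (fin_add_inj hf (congrFun h1 x))

/-- In the class of finite Busemann functions, unique limits (up to constants) are pointwise
limits. -/
theorem tendsto_of_isUpperLim_fin [Nonempty X]
    (hu : ∀ (φ : ℕ → X → EReal), (∀ n, φ n ∈ finChainFun δ) → ∀ f ∈ finChainFun δ,
      ∀ g ∈ finChainFun δ, IsUpperLim (finChainFun δ) φ f → IsUpperLim (finChainFun δ) φ g →
      ∃ k : ℝ, ∀ x, g x = f x + k)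
    {φ : ℕ → X → EReal} (hφ : ∀ n, φ n ∈ finChainFun δ) {f : X → EReal} (hf : f ∈ finChainFun δ)
    (hU : IsUpperLim (finChainFun δ) φ f) (x : X) :
    Tendsto (fun n => φ n x) atTop (𝓝 (f x)) := by
  obtain ⟨D, hD⟩ := h.dense
  -- A subsequence converges at all points of a dense sequence, by compactness of the extended
  -- reals. Since the functions are Lipschitz, its upper and lower limits then agree everywhere.
  refine tendsto_of_subseq_tendsto fun ns hns => ?_
  obtain ⟨ℓ, ms, hms, hℓ⟩ := SeqCompactSpace.tendsto_subseq fun n j => φ (ns n) (D j)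
  refine ⟨ms, ?_⟩
  set χ : ℕ → X → EReal := fun n => φ (ns (ms n)) with hχ
  have hχc : ∀ n, χ n ∈ finChainFun δ := fun n => hφ _
  have hlip : ∀ n, IsLip δ (χ n) := fun n => h.isLip_chainFun (hχc n).1
  have hUχ : IsUpperLim (finChainFun δ) χ f := hU.comp (hns.comp hms.tendsto_atTop)
  have hD' : ∀ j, Tendsto (fun n => χ n (D j)) atTop (𝓝 (ℓ j)) := fun j => (tendsto_pi_nhds.1 hℓ) j
  have hll : ∀ x, limsup (fun n => χ n x) atTop ≤ liminf (fun n => χ n x) atTop :=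
    (IsLip.limsup hlip).le_of_dense hD (IsLip.liminf hlip) fun j => by
      rw [(hD' j).limsup_eq, (hD' j).liminf_eq]
  have hgf : ∀ y, limsup (fun n => χ n y) atTop ≤ f y := by
    intro y
    refine le_of_forall_lt fun c hc => ?_
    obtain ⟨t, hct, ht⟩ := EReal.lt_iff_exists_real_btwn.1 hc
    refine hct.trans_le ?_
    -- A maximal Busemann function `f'` below the common limit, with `f' y ≥ t`, is again a
    -- chronological limit, hence `f + k` by uniqueness. Two comparable maximal functions are equal,
    -- so `f' = f` and `f y ≥ t`.
    obtain ⟨f', hf', h1, h2, h3⟩ := h.exists_maximal_chainFun (IsLip.limsup hlip) ht.le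
    have hfin : f' ∈ finChainFun δ := by
      refine h.fin_of_ne_top hf' (x := y) fun htop => ?_
      have h4 := h.eq_top_of_eq_top hf' htop
      rw [h4] at h2
      exact h.not_limsup_eq_top hf hUχ fun x => top_le_iff.1 (h2 x)
    have hUf' : IsUpperLim (finChainFun δ) χ f' :=
      ⟨fun x => (h2 x).trans (hll x), fun k hk => h3 k hk.1⟩
    obtain ⟨k, hk⟩ := hu χ hχc f hf f' hfin hUχ hUf'
    rcases le_total 0 k with hk0 | hk0
    · have h4 := hUχ.2 f' hfin (fun x => by
        rw [hk, ← fin_coe hf x, ← EReal.coe_add, EReal.coe_le_coe_iff]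
        linarith) h2
      rw [← h4]
      exact h1
    · have h4 := hUf'.2 f hf (fun x => by
        rw [hk, ← fin_coe hf x, ← EReal.coe_add, EReal.coe_le_coe_iff]
        linarith) fun x => (hUχ.1 x).trans (liminf_le_limsup)
      rw [h4]
      exact h1
  exact tendsto_of_le_liminf_of_limsup_le (hUχ.1 x) (hgf x)

/-- Reduction to finite functions: the limit `∞` is trivial, and if infinitely many terms were `∞`,
the upper limit would be `∞` everywhere. -/
theorem tendsto_of_isUpperLim [Nonempty X]
    (hu : ∀ (φ : ℕ → X → EReal), (∀ n, φ n ∈ finChainFun δ) → ∀ f ∈ finChainFun δ,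
      ∀ g ∈ finChainFun δ, IsUpperLim (finChainFun δ) φ f → IsUpperLim (finChainFun δ) φ g →
      ∃ k : ℝ, ∀ x, g x = f x + k)
    {φ : ℕ → X → EReal} (hφ : ∀ n, φ n ∈ chainFun δ) {f : X → EReal} (hf : f ∈ chainFun δ)
    (hU : IsUpperLim (chainFun δ) φ f) (x : X) :
    Tendsto (fun n => φ n x) atTop (𝓝 (f x)) := by
  by_cases hx : f x = ⊤
  · refine tendsto_of_le_liminf_of_limsup_le (hU.1 x) ?_
    rw [hx]
    exact le_top
  have hfin := h.fin_of_ne_top hf hx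
  have hU' : IsUpperLim (finChainFun δ) φ f := ⟨hU.1, fun g hg => hU.2 g hg.1⟩
  have hev : ∀ᶠ n in atTop, φ n ∈ finChainFun δ := by
    by_contra hcon
    rw [Filter.not_eventually] at hcon
    refine h.not_limsup_eq_top hfin hU' fun y => ?_
    rw [← top_le_iff]
    refine le_limsup_of_frequently_le (hcon.mono fun n hn => ?_) (by isBoundedDefault)
    have : φ n y = ⊤ := by
      by_contra hne
      exact hn (h.fin_of_ne_top (hφ n) hne)
    exact this.ge
  obtain ⟨N, hN⟩ := eventually_atTop.1 hev
  rw [← tendsto_add_atTop_iff_nat N]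
  exact h.tendsto_of_isUpperLim_fin hu (fun n => hN (n + N) (by omega)) hfin
    (hU'.comp (tendsto_add_atTop_nat N)) x

omit h in
theorem isUpperLim_of_tendsto {A : Set (X → EReal)} {φ : ℕ → X → EReal} {f : X → EReal}
    (hlim : ∀ x, Tendsto (fun n => φ n x) atTop (𝓝 (f x))) : IsUpperLim A φ f :=
  ⟨fun x => (hlim x).liminf_eq.ge, fun _ _ h1 h2 => funext fun x =>
    le_antisymm ((h2 x).trans (hlim x).limsup_eq.le) (h1 x)⟩

theorem tendsto_of_dense {D : ℕ → X}
    (hD : ∀ x, ∀ ε > 0, ∃ n, δ x (D n) < ε ∧ δ (D n) x < ε) {φ : ℕ → X → EReal}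
    (hφ : ∀ n, φ n ∈ chainFun δ) {f : X → EReal} (hf : f ∈ chainFun δ)
    (hlim : ∀ j, Tendsto (fun n => φ n (D j)) atTop (𝓝 (f (D j)))) (x : X) :
    Tendsto (fun n => φ n x) atTop (𝓝 (f x)) :=
  tendsto_of_le_liminf_of_limsup_le
    ((h.isLip_chainFun hf).le_of_dense hD (IsLip.liminf fun n => h.isLip_chainFun (hφ n))
      (fun j => (hlim j).liminf_eq.ge) x)
    ((IsLip.limsup fun n => h.isLip_chainFun (hφ n)).le_of_dense hD (h.isLip_chainFun hf)
      (fun j => (hlim j).limsup_eq.le) x)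

/-- Normalized Busemann functions which are not distance functions form a compact set. -/
theorem exists_limit_normalized [Nonempty X]
    (hu : ∀ (φ : ℕ → X → EReal), (∀ n, φ n ∈ finChainFun δ) → ∀ f ∈ finChainFun δ,
      ∀ g ∈ finChainFun δ, IsUpperLim (finChainFun δ) φ f → IsUpperLim (finChainFun δ) φ g →
      ∃ k : ℝ, ∀ x, g x = f x + k) {D : ℕ → X}
    (hD : ∀ x, ∀ ε > 0, ∃ n, δ x (D n) < ε ∧ δ (D n) x < ε) {φ : ℕ → X → EReal}
    (hφ : ∀ n, φ n ∈ finChainFun δ) (h0 : ∀ n, φ n (D 0) = 0)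
    (hb : ∀ n, ¬ ∃ (c : ℝ) (y : X), φ n = fun x => ((c - δ x y : ℝ) : EReal)) {ℓ : ℕ → EReal}
    (hℓ : ∀ j, Tendsto (fun n => φ n (D j)) atTop (𝓝 (ℓ j))) :
    ∃ f ∈ finChainFun δ, f (D 0) = 0 ∧
      (¬ ∃ (c : ℝ) (y : X), f = fun x => ((c - δ x y : ℝ) : EReal)) ∧ ∀ j, ℓ j = f (D j) := by
  have hlip : ∀ n, IsLip δ (φ n) := fun n => h.isLip_chainFun (hφ n).1
  have hll : ∀ x, limsup (fun n => φ n x) atTop ≤ liminf (fun n => φ n x) atTop :=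
    (IsLip.limsup hlip).le_of_dense hD (IsLip.liminf hlip) fun j => by
      rw [(hℓ j).limsup_eq, (hℓ j).liminf_eq]
  have hs0 : limsup (fun n => φ n (D 0)) atTop = 0 := by
    simp only [h0]
    exact limsup_const _
  -- The upper limit is `0` at `D 0`, so a maximal function below it that is at least `0` there
  -- vanishes there. It is a chronological limit because upper and lower limit agree, and therefore
  -- it is the pointwise limit.
  obtain ⟨f, hf, h1, h2, h3⟩ := h.exists_maximal_chainFun (IsLip.limsup hlip) (t := 0) (y := D 0)
    (by rw [hs0]; exact le_rfl)
  have hf0 : f (D 0) = 0 := le_antisymm ((h2 _).trans hs0.le) (by simpa using h1)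
  have hfin : f ∈ finChainFun δ := h.fin_of_ne_top hf (x := D 0) (by rw [hf0]; exact EReal.zero_ne_top)
  have hU : IsUpperLim (chainFun δ) φ f := ⟨fun x => (h2 x).trans (hll x), h3⟩
  have hlim := h.tendsto_of_isUpperLim hu (fun n => (hφ n).1) hf hU
  refine ⟨f, hfin, hf0, ?_, fun j => tendsto_nhds_unique (hℓ j) (hlim _)⟩
  -- The limit is not a point function, since point functions are reached only by point functions.
  rintro ⟨c, y, rfl⟩
  obtain ⟨n, hn⟩ := (h.eventually_eq_sub_dist (Eventually.of_forall fun n => (hφ n).1) hU.1 hU.2).exists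
  exact hb n hn

end LengthDist
end

/-! ### The cone structure and its topology. -/

section
variable {X : Type*} {δ : X → X → ℝ}

/-- The functions `c - δ(·, y)`, up to constants the distance functions to the points. -/
def IsPointFun (δ : X → X → ℝ) (f : X → EReal) : Prop :=
  ∃ (c : ℝ) (y : X), f = fun x => ((c - δ x y : ℝ) : EReal)

theorem IsPointFun.add {f : X → EReal} (hf : IsPointFun δ f) (k : ℝ) :
    IsPointFun δ fun x => f x + (k : EReal) := by
  obtain ⟨c, y, rfl⟩ := hf
  refine ⟨c + k, y, funext fun x => ?_⟩
  rw [← EReal.coe_add]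
  congr 1
  ring

theorem isPointFun_add_iff {f : X → EReal} {k : ℝ} :
    IsPointFun δ (fun x => f x + (k : EReal)) ↔ IsPointFun δ f := by
  refine ⟨fun hf => ?_, fun hf => hf.add k⟩
  have := hf.add (-k)
  simp only [add_assoc, ← EReal.coe_add, add_neg_cancel, EReal.coe_zero, add_zero] at this
  exact this

/-- The topology of `Y` is given by the limit operator of upper limits in the class `A`. -/
def IsUpperTopology {Y : Type*} [TopologicalSpace Y] (A : Set (X → EReal)) (v : Y → X → EReal) :
    Prop :=
  ∀ K : Set Y, IsClosed K ↔ ∀ σ : ℕ → Y, (∀ n, σ n ∈ K) → ∀ f,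
    IsUpperLim A (fun n => v (σ n)) (v f) → f ∈ K

/-- Limits are inherited by subsequences. A sequence leaving an open neighbourhood infinitely often
would have its limit in the closed complement. -/
theorem IsUpperTopology.tendsto {Y : Type*} [TopologicalSpace Y] {A : Set (X → EReal)}
    {v : Y → X → EReal} (ht : IsUpperTopology A v) {σ : ℕ → Y} {f : Y}
    (hf : IsUpperLim A (fun n => v (σ n)) (v f)) : Tendsto σ atTop (𝓝 f) := by
  rw [tendsto_nhds]
  intro U hU hfU
  by_contra hcon
  change ¬ ∀ᶠ n in atTop, σ n ∈ U at hcon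
  rw [Filter.not_eventually] at hcon
  obtain ⟨ν, hν, h1⟩ := extraction_of_frequently_atTop hcon
  exact (ht Uᶜ).1 hU.isClosed_compl (fun n => σ (ν n)) h1 f (hf.comp hν.tendsto_atTop) hfU

namespace LengthDist

variable (h : LengthDist δ)
include h

/-- If chronological limits are pointwise limits, the closed sets are those closed under pointwise
convergence of sequences. For Lipschitz functions a dense sequence of points suffices, so the
topology is induced from a countable product of extended reals. -/
theorem isInducing_eval {Y : Type*} [TopologicalSpace Y] {A : Set (X → EReal)}
    {v : Y → X → EReal} (ht : IsUpperTopology A v) (hv : ∀ y, v y ∈ chainFun δ)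
    (hpt : ∀ (σ : ℕ → Y) f, IsUpperLim A (fun n => v (σ n)) (v f) →
      ∀ x, Tendsto (fun n => v (σ n) x) atTop (𝓝 (v f x))) {D : ℕ → X}
    (hD : ∀ x, ∀ ε > 0, ∃ n, δ x (D n) < ε ∧ δ (D n) x < ε) :
    IsInducing (fun (y : Y) (n : ℕ) => v y (D n)) ∧ ∀ x, Continuous fun y => v y x := by
  have hc : ∀ x, Continuous fun y => v y x := fun x => by
    rw [continuous_iff_isClosed]
    intro Z hZ
    rw [ht]
    exact fun σ hσ f hf => hZ.mem_of_tendsto (hpt σ f hf x) (Eventually.of_forall hσ)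
  refine ⟨⟨TopologicalSpace.ext_isClosed fun K => ?_⟩, hc⟩
  rw [isClosed_induced_iff']
  constructor
  · intro hK f hf
    rw [mem_closure_iff_seq_limit] at hf
    obtain ⟨s, hs, hlim⟩ := hf
    choose σ hσ hσs using hs
    obtain rfl : (fun n j => v (σ n) (D j)) = s := funext hσs
    refine (ht K).1 hK σ hσ f (isUpperLim_of_tendsto ?_)
    exact h.tendsto_of_dense hD (fun n => hv _) (hv f) fun j => (tendsto_pi_nhds.1 hlim) j
  · intro hK
    rw [ht]
    refine fun σ hσ f hf => hK f ?_
    refine mem_closure_of_tendsto (tendsto_pi_nhds.2 fun j => hpt σ f hf (D j))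
      (Eventually.of_forall fun n => mem_image_of_mem _ (hσ n))

section Cone

variable {J B C : Type*} [TopologicalSpace J] [TopologicalSpace B] [TopologicalSpace C]
  (x₀ : X) {ι : J ≃ₜ Ioi (⊥ : EReal)} {top : J → Prop} (htop : ∀ j, top j ↔ (ι j).1 = ⊤)
  {val : B → X → EReal} (hval : Function.Injective val) (hvr : range val = finChainFun δ)
  (hB : IsUpperTopology (finChainFun δ) val)
  {s : Setoid B} (hs : ∀ f g, s.r f g ↔ ∃ k : ℝ, ∀ x, val g x = val f x + k)
  {T : Set (Quotient s)} (hT : ∀ f, Quotient.mk s f ∈ T ↔ ¬ IsPointFun δ (val f))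
  {cv : C → X → EReal} (hcv : Function.Injective cv) (hcr : range cv = chainFun δ)
  (hC : IsUpperTopology (chainFun δ) cv)
  {W : Set C} (hW : ∀ w, w ∈ W ↔ ¬ IsPointFun δ (cv w))

-- A class is represented by its function vanishing at `x₀`, and the point `(j, z)` of the cone is
-- sent to this function plus `ι j`. The interval `J` and the map `ι` are left abstract in order to
-- cover the backward cone, for which `ι` is negation. Continuity of the map is checked by
-- evaluation; that of the inverse rests on the compactness of the normalized boundary functions.
include x₀ htop hval hvr hB hs hT hcv hcr hC hW in
theorem exists_cone_equiv :
    ∃ e : Quot (fun a b : (J × T) ⊕ Unit => ∃ x : J × T, top x.1 ∧ a = Sum.inl x ∧ b = Sum.inr ())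
        ≃ W,
      (∀ (t : J) (f : B) (hf : Quotient.mk s f ∈ T), val f x₀ = (ι t).1 →
        cv (e (Quot.mk _ (Sum.inl (t, ⟨Quotient.mk s f, hf⟩)))).1 = val f) ∧
      cv (e (Quot.mk _ (Sum.inr ()))).1 = (fun _ => ⊤) ∧
      (T2Space (Quotient s) → IsHomeomorph e) := by
  have : Nonempty X := ⟨x₀⟩
  have hfin : ∀ f, val f ∈ finChainFun δ := fun f => hvr ▸ mem_range_self f
  have hcoe : ∀ f x, ((val f x).toReal : EReal) = val f x := fun f x => fin_coe (hfin f) x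
  have hcc : ∀ w, cv w ∈ chainFun δ := fun w => hcr ▸ mem_range_self w
  -- the normalized functions
  let nrm : Quotient s → X → EReal := Quotient.lift (fun f x => val f x - val f x₀) (by
    intro f g hfg
    obtain ⟨k, hk⟩ := (hs f g).1 hfg
    funext x
    rw [hk, hk, ← hcoe f x, ← hcoe f x₀]
    norm_cast
    ring_nf)
  have hnrm : ∀ f, nrm (Quotient.mk s f) = fun x => val f x + ((-(val f x₀).toReal : ℝ) : EReal) :=
    fun f => funext fun x => by
      change val f x - val f x₀ = _
      rw [sub_eq_add_neg, EReal.coe_neg, hcoe]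
  have hnrmr : ∀ z x, ((nrm z x).toReal : EReal) = nrm z x := by
    intro z x
    induction z using Quotient.inductionOn with
    | h f => rw [hnrm]; exact fin_coe (fin_add (hfin f) _) x
  have hnrm0 : ∀ z, nrm z x₀ = 0 := by
    intro z
    induction z using Quotient.inductionOn with
    | h f =>
      rw [hnrm]
      change val f x₀ + _ = 0
      rw [← hcoe f x₀]
      norm_cast
      rw [EReal.toReal_coe]
      exact add_neg_cancel _
  have hnrmi : ∀ z z', nrm z = nrm z' → z = z' := by
    intro z z' hz
    induction z using Quotient.inductionOn with
    | h f =>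
      induction z' using Quotient.inductionOn with
      | h g =>
        refine Quotient.sound ((hs f g).2 ⟨(val g x₀).toReal - (val f x₀).toReal, fun x => ?_⟩)
        have h1 := congrFun hz x
        rw [hnrm, hnrm] at h1
        change val f x + _ = val g x + _ at h1
        rw [← hcoe f x, ← hcoe g x] at h1 ⊢
        norm_cast at h1 ⊢
        linarith
  let G : J → Quotient s → X → EReal := fun j z x => nrm z x + (ι j).1
  have hGtop : ∀ j z, (ι j).1 = ⊤ → G j z = fun _ => ⊤ := fun j z hj => funext fun x => by
    change nrm z x + (ι j).1 = ⊤
    rw [hj, ← hnrmr]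
    exact EReal.coe_add_top _
  have hGcoe : ∀ j f, (ι j).1 ≠ ⊤ → ∃ k : ℝ, G j (Quotient.mk s f) = fun x => val f x + (k : EReal) := by
    intro j f hj
    refine ⟨-(val f x₀).toReal + (ι j).1.toReal, funext fun x => ?_⟩
    change nrm _ x + (ι j).1 = _
    rw [hnrm, EReal.coe_add, ← add_assoc, EReal.coe_toReal hj (ι j).2.ne']
  have hGv : ∀ j f, val f x₀ = (ι j).1 → G j (Quotient.mk s f) = val f := fun j f hj =>
    funext fun x => by
      change nrm _ x + (ι j).1 = _
      have h0 : ((-(val f x₀).toReal : ℝ) : EReal) + val f x₀ = 0 := by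
        nth_rw 2 [← hcoe f x₀]
        rw [← EReal.coe_add, neg_add_cancel, EReal.coe_zero]
      rw [hnrm, ← hj]
      change _ + _ + _ = _
      rw [add_assoc, h0, add_zero]
  have hG0 : ∀ j z, G j z x₀ = (ι j).1 := fun j z => by
    change nrm z x₀ + (ι j).1 = _
    rw [hnrm0, zero_add]
  have htopnp : ¬ IsPointFun δ (fun _ => ⊤ : X → EReal) := by
    rintro ⟨c, y, hcy⟩
    exact EReal.coe_ne_top _ (congrFun hcy x₀).symm
  have hGW : ∀ j (z : T), ∃ w : W, cv w.1 = G j z.1 := by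
    rintro j ⟨z, hz⟩
    induction z using Quotient.inductionOn with
    | h f =>
      have hz' := (hT f).1 hz
      have h1 : G j (Quotient.mk s f) ∈ chainFun δ ∧ ¬ IsPointFun δ (G j (Quotient.mk s f)) := by
        by_cases hj : (ι j).1 = ⊤
        · rw [hGtop j _ hj]
          exact ⟨h.top_mem_chainFun, htopnp⟩
        · obtain ⟨k, hk⟩ := hGcoe j f hj
          rw [hk, isPointFun_add_iff]
          exact ⟨chainFun_add (hfin f).1 k, hz'⟩
      rw [← hcr] at h1
      obtain ⟨⟨w, hw⟩, h2⟩ := h1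
      exact ⟨⟨w, (hW w).2 (hw ▸ h2)⟩, hw⟩
  choose E hE using hGW
  obtain ⟨wt, hwt⟩ : (fun _ => ⊤ : X → EReal) ∈ range cv := hcr ▸ h.top_mem_chainFun
  let a : W := ⟨wt, (hW wt).2 (hwt ▸ htopnp)⟩
  have hEt : ∀ j z, (ι j).1 = ⊤ → E j z = a := fun j z hj =>
    Subtype.ext (hcv ((hE j z).trans ((hGtop j _ hj).trans hwt.symm)))
  let e₀ : (J × T) ⊕ Unit → W := Sum.elim (fun x => E x.1 x.2) fun _ => a
  let e₁ : Quot (fun a b : (J × T) ⊕ Unit => ∃ x : J × T, top x.1 ∧ a = Sum.inl x ∧ b = Sum.inr ())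
      → W := Quot.lift e₀ (by
    rintro _ _ ⟨x, hx, rfl, rfl⟩
    exact hEt _ _ ((htop _).1 hx))
  have hbij : Function.Bijective e₁ := by
    constructor
    · have haux : ∀ j z, E j z = a → top j := fun j z hjz => by
        have h1 := congrFun (hE j z) x₀
        rw [hjz, hG0] at h1
        rw [htop, ← h1]
        exact congrFun hwt x₀
      rintro ⟨⟨j, z⟩ | u⟩ ⟨⟨j', z'⟩ | u'⟩ he
      · change E j z = E j' z' at he
        by_cases hj : top j
        · have hj' : top j' := haux j' z' (by rw [← he]; exact hEt _ _ ((htop _).1 hj))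
          exact (Quot.sound ⟨(j, z), hj, rfl, rfl⟩).trans
            (Quot.sound ⟨(j', z'), hj', rfl, rfl⟩).symm
        · have h1 : G j z.1 = G j' z'.1 := by rw [← hE, ← hE, he]
          have h2 := congrFun h1 x₀
          rw [hG0, hG0] at h2
          obtain rfl : j = j' := ι.injective (Subtype.ext h2)
          obtain rfl : z = z' := Subtype.ext (hnrmi _ _ (funext fun x => by
            have h3 := congrFun h1 x
            change nrm z.1 x + (ι j).1 = nrm z'.1 x + (ι j).1 at h3
            rw [htop] at hj
            rw [← hnrmr, ← hnrmr z'.1, ← EReal.coe_toReal hj (ι j).2.ne'] at h3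
            rw [← hnrmr, ← hnrmr z'.1]
            norm_cast at h3 ⊢
            linarith))
          rfl
      · exact Quot.sound ⟨(j, z), haux j z he, rfl, rfl⟩
      · exact (Quot.sound ⟨(j', z'), haux j' z' he.symm, rfl, rfl⟩).symm
      · rfl
    · rintro ⟨w, hw⟩
      by_cases hx : cv w x₀ = ⊤
      · exact ⟨Quot.mk _ (Sum.inr ()), Subtype.ext (hcv (hwt.trans
          (h.eq_top_of_eq_top (hcc w) hx).symm))⟩
      · obtain ⟨f, hf⟩ : cv w ∈ range val := hvr ▸ h.fin_of_ne_top (hcc w) hx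
        have hfT : Quotient.mk s f ∈ T := (hT f).2 (hf ▸ (hW w).1 hw)
        refine ⟨Quot.mk _ (Sum.inl (ι.symm ⟨cv w x₀, bot_lt_chainFun (hcc w) x₀⟩, ⟨_, hfT⟩)),
          Subtype.ext (hcv ((hE _ _).trans ?_))⟩
        rw [hGv _ _ (by rw [ι.apply_symm_apply, hf]), hf]
  let e := Equiv.ofBijective e₁ hbij
  refine ⟨e, fun t f hf hft => (hE t ⟨_, hf⟩).trans (hGv t f hft), hwt, fun hT2 => ?_⟩
  obtain ⟨D, hD⟩ := h.dense
  -- The base point is put in front of the dense sequence, so that the normalization takes place at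
  -- `D' 0`.
  obtain ⟨D', hD', hD0⟩ : ∃ D' : ℕ → X,
      (∀ x, ∀ ε > 0, ∃ n, δ x (D' n) < ε ∧ δ (D' n) x < ε) ∧ D' 0 = x₀ :=
    ⟨fun n => Nat.casesOn n x₀ D, fun x ε hε => (hD x ε hε).imp' Nat.succ fun n hn => hn, rfl⟩
  -- In the Hausdorff quotient two limits of a sequence have the same class, hence differ by a
  -- constant.
  have hu : ∀ (φ : ℕ → X → EReal), (∀ n, φ n ∈ finChainFun δ) → ∀ f ∈ finChainFun δ,
      ∀ g ∈ finChainFun δ, IsUpperLim (finChainFun δ) φ f → IsUpperLim (finChainFun δ) φ g →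
      ∃ k : ℝ, ∀ x, g x = f x + k := by
    intro φ hφ f hf g hg hUf hUg
    rw [← hvr] at hf hg
    obtain ⟨f, rfl⟩ := hf
    obtain ⟨g, rfl⟩ := hg
    have h1 : ∀ n, ∃ b, val b = φ n := fun n => by
      have := hφ n
      rwa [← hvr] at this
    choose σ hσ using h1
    obtain rfl : (fun n => val (σ n)) = φ := funext hσ
    have hmk : Continuous (Quotient.mk s) := continuous_quotient_mk'
    exact (hs f g).1 (Quotient.exact (tendsto_nhds_unique
      ((hmk.tendsto f).comp (hB.tendsto hUf)) ((hmk.tendsto g).comp (hB.tendsto hUg))))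
  obtain ⟨hBi, hBc⟩ := h.isInducing_eval hB (fun f => (hfin f).1) (fun σ f hU =>
    h.tendsto_of_isUpperLim_fin hu (fun n => hfin _) (hfin f) hU) hD'
  obtain ⟨hCi, hCc⟩ := h.isInducing_eval hC hcc (fun σ f hU =>
    h.tendsto_of_isUpperLim hu (fun n => hcc _) (hcc f) hU) hD'
  have hWi : IsInducing (fun (w : W) (n : ℕ) => cv w.1 (D' n)) := hCi.comp IsInducing.subtypeVal
  have hmk : Continuous (Quotient.mk s) := continuous_quotient_mk'
  have hec : Continuous e := by
    refine continuous_quot_lift _ (continuous_sum_dom.2 ⟨?_, continuous_const⟩)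
    rw [hWi.continuous_iff, continuous_pi_iff]
    intro n
    have hnc : Continuous fun z => nrm z (D' n) := by
      refine isQuotientMap_quotient_mk'.continuous_iff.2 (continuous_iff_continuousAt.2 ?_)
      intro f
      have h2 := (EReal.continuousAt_add (p := (val f (D' n), -val f x₀))
        (Or.inl ((hfin f).2 _)) (Or.inl (bot_lt_chainFun (hfin f).1 _).ne')).comp
        (f := fun f => (val f (D' n), -val f x₀))
        ((hBc _).prodMk (continuous_neg.comp (hBc x₀))).continuousAt
      exact h2
    have h3 : (fun x : J × T => G x.1 x.2.1 (D' n)) =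
        (fun (w : W) => cv w.1 (D' n)) ∘ (e₀ ∘ Sum.inl) := funext fun x =>
      (congrFun (hE x.1 x.2) (D' n)).symm
    refine Continuous.congr ?_ fun x => congrFun h3 x
    rw [continuous_iff_continuousAt]
    intro x
    have h4 : Continuous fun x : J × T => (nrm x.2.1 (D' n), (ι x.1).1) :=
      (hnc.comp (continuous_subtype_val.comp continuous_snd)).prodMk
        (continuous_subtype_val.comp (ι.continuous.comp continuous_fst))
    refine (EReal.continuousAt_add (p := (nrm x.2.1 (D' n), (ι x.1).1)) ?_ ?_).comp
      (f := fun x : J × T => (nrm x.2.1 (D' n), (ι x.1).1)) h4.continuousAt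
    · exact Or.inl (by rw [← hnrmr]; exact EReal.coe_ne_top _)
    · exact Or.inl (by rw [← hnrmr]; exact EReal.coe_ne_bot _)
  have : FirstCountableTopology W := hWi.firstCountableTopology
  have hW2 : T2Space W := by
    have hinj : Function.Injective (fun (w : W) (n : ℕ) => cv w.1 (D' n)) := by
      intro w w' hww
      refine Subtype.ext (hcv (funext fun x => le_antisymm ?_ ?_))
      · exact (h.isLip_chainFun (hcc _)).le_of_dense hD' (h.isLip_chainFun (hcc _))
          (fun n => (congrFun hww n).le) x
      · exact (h.isLip_chainFun (hcc _)).le_of_dense hD' (h.isLip_chainFun (hcc _))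
          (fun n => (congrFun hww n).ge) x
    exact T2Space.of_injective_continuous hinj hWi.continuous
  have hsc : Continuous e.symm := by
    -- `W` is first countable and Hausdorff and `e` is continuous. So it suffices that the preimages
    -- of each subsequence have some convergent subsequence; its limit is then the right one.
    refine continuous_iff_seqContinuous.2 fun w w' hw => tendsto_of_subseq_tendsto fun ns hns => ?_
    have hw' : Tendsto (fun n => w (ns n)) atTop (𝓝 w') := hw.comp hns
    have hlim : ∀ x, Tendsto (fun n => cv (w (ns n)).1 x) atTop (𝓝 (cv w'.1 x)) := fun x =>
      (((hCc x).comp continuous_subtype_val).tendsto w').comp hw'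
    suffices hsuf : ∃ (ms : ℕ → ℕ) (p : _), StrictMono ms ∧
        Tendsto (fun n => e.symm (w (ns (ms n)))) atTop (𝓝 p) by
      obtain ⟨ms, p, hms, hp⟩ := hsuf
      refine ⟨ms, ?_⟩
      have h1 : Tendsto (fun n => w (ns (ms n))) atTop (𝓝 (e p)) := by
        have := (hec.tendsto p).comp hp
        refine this.congr fun n => ?_
        exact e.apply_symm_apply _
      have h2 := tendsto_nhds_unique h1 (hw'.comp hms.tendsto_atTop)
      rwa [← h2, e.symm_apply_apply]
    by_cases hfr : ∃ᶠ n in atTop, w (ns n) = a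
    · obtain ⟨ms, hms, h1⟩ := extraction_of_frequently_atTop hfr
      refine ⟨ms, e.symm a, hms, ?_⟩
      simp only [h1]
      exact tendsto_const_nhds
    · rw [Filter.not_frequently] at hfr
      obtain ⟨N, hN⟩ := eventually_atTop.1 hfr
      have h1 : ∀ n, ∃ (j : J) (f : B) (hf : Quotient.mk s f ∈ T), val f x₀ = 0 ∧
          (ι j).1 = cv (w (ns (n + N))).1 x₀ ∧
          e.symm (w (ns (n + N))) = Quot.mk _ (Sum.inl (j, ⟨_, hf⟩)) := by
        intro n
        have h2 := hN (n + N) (by omega)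
        generalize w (ns (n + N)) = v at h2
        obtain ⟨q, rfl⟩ := e.surjective v
        rw [e.symm_apply_apply]
        rcases q with ⟨⟨j, ⟨z, hz⟩⟩ | u⟩
        · induction z using Quotient.inductionOn with
          | h f =>
            have h3 : (fun x => val f x + ((-(val f x₀).toReal : ℝ) : EReal)) ∈ range val :=
              hvr ▸ fin_add (hfin f) _
            obtain ⟨g, hg⟩ := h3
            have hfg : Quotient.mk s f = Quotient.mk s g :=
              Quotient.sound ((hs f g).2 ⟨_, congrFun hg⟩)
            refine ⟨j, g, hfg ▸ hz, ?_, ?_, ?_⟩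
            · rw [hg, ← hnrm, hnrm0]
            · exact ((congrFun (hE j _) x₀).trans (hG0 _ _)).symm
            · congr 4
        · exact absurd rfl h2
      choose j f hf h0 hj hq using h1
      obtain ⟨ℓ, ms, hms, hℓ⟩ := SeqCompactSpace.tendsto_subseq fun n i => val (f n) (D' i)
      -- Compactness of the base is essential near the apex: in the quotient topology of a cone,
      -- coordinates tending to `∞` need not force convergence to the apex.
      obtain ⟨g, hg, -, hgp, hgℓ⟩ := h.exists_limit_normalized hu hD' (φ := fun n => val (f (ms n)))
        (fun n => hfin _) (fun n => by rw [hD0]; exact h0 _) (fun n => (hT _).1 (hf _))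
        fun i => (tendsto_pi_nhds.1 hℓ) i
      rw [← hvr] at hg
      obtain ⟨g, rfl⟩ := hg
      have hlg : Tendsto (fun n => f (ms n)) atTop (𝓝 g) := by
        rw [hBi.tendsto_nhds_iff, tendsto_pi_nhds]
        intro i
        rw [← hgℓ i]
        exact (tendsto_pi_nhds.1 hℓ) i
      have hgT : Quotient.mk s g ∈ T := (hT g).2 hgp
      refine ⟨fun n => ms n + N, Quot.mk _ (Sum.inl
        (ι.symm ⟨cv w'.1 x₀, bot_lt_chainFun (hcc _) x₀⟩, ⟨_, hgT⟩)),
        fun m n hmn => by have := hms hmn; simpa using this, ?_⟩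
      simp only [hq]
      refine (continuous_quot_mk.tendsto _).comp ((continuous_inl.tendsto _).comp
        (Tendsto.prodMk_nhds ?_ ?_))
      · have h5 : ∀ n, j n = ι.symm ⟨cv (w (ns (n + N))).1 x₀, bot_lt_chainFun (hcc _) x₀⟩ :=
          fun n => by rw [ι.eq_symm_apply]; exact Subtype.ext (hj n)
        simp only [h5]
        refine (ι.symm.continuous.tendsto _).comp (tendsto_subtype_rng.2 ?_)
        exact (hlim x₀).comp ((tendsto_add_atTop_nat N).comp hms.tendsto_atTop)
      · exact tendsto_subtype_rng.2 ((hmk.tendsto g).comp hlg)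
  exact (Homeomorph.mk e hec hsc).isHomeomorph

end Cone

end LengthDist
end

section
variable {X : Type*} {δ : X → X → ℝ}

namespace LengthDist

variable (h : LengthDist δ)

theorem isPointFun_iff {P : Set (ℝ × X)} {f : X → EReal} (hP : P = pastOf f) :
    IsPointFun δ f ↔ ∃ p, P = Causal.past (distRel δ) {p} := by
  constructor
  · rintro ⟨c, y, rfl⟩
    exact ⟨(c, y), by rw [hP, past_singleton]⟩
  · rintro ⟨p, hp⟩
    rw [hP, past_singleton] at hp
    exact ⟨p.1, p.2, pastOf_injective hp⟩

include h

/-- The boundary of the indecomposable past sets as a cone, up to an identification `Φ` of the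
subsets of `ℝ × X`. -/
theorem exists_cone_boundary {r : ℝ × X → ℝ × X → Prop} {Φ : Set (ℝ × X) → Set (ℝ × X)}
    (hΦ : Function.Involutive Φ) (hIP : ∀ P, Causal.IsIP r P ↔ Causal.IsIP (distRel δ) (Φ P))
    (hTIP : ∀ P, Causal.IsTIP r P ↔ Causal.IsTIP (distRel δ) (Φ P))
    (hL : ∀ P σ, P ∈ Causal.hatL r σ ↔ Φ P ∈ Causal.hatL (distRel δ) fun n => Φ (σ n))
    {J B : Type*} [TopologicalSpace J] [TopologicalSpace B]
    (x₀ : X) {ι : J ≃ₜ Ioi (⊥ : EReal)} {top : J → Prop} (htop : ∀ j, top j ↔ (ι j).1 = ⊤)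
    {val : B → X → EReal} (hval : Function.Injective val) (hvr : range val = finChainFun δ)
    (hB : IsUpperTopology (finChainFun δ) val)
    {s : Setoid B} (hs : ∀ f g, s.r f g ↔ ∃ k : ℝ, ∀ x, val g x = val f x + k)
    {T : Set (Quotient s)} (hT : ∀ f, Quotient.mk s f ∈ T ↔ ¬ IsPointFun δ (val f)) :
    ∃ e : Quot (fun a b : (J × T) ⊕ Unit => ∃ x : J × T, top x.1 ∧ a = Sum.inl x ∧ b = Sum.inr ())
        ≃ Causal.boundary r,
      (∀ (t : J) (f : B) (hf : Quotient.mk s f ∈ T), val f x₀ = (ι t).1 →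
        Φ (e (Quot.mk _ (Sum.inl (t, ⟨Quotient.mk s f, hf⟩)))).1.1 = pastOf (val f)) ∧
      Φ (e (Quot.mk _ (Sum.inr ()))).1.1 = univ ∧
      (T2Space (Quotient s) → IsHomeomorph e) := by
  have h1 : ∀ P : Causal.Completion r, ∃ f ∈ chainFun δ, Φ P.1 = pastOf f := fun P =>
    h.isIP_iff.1 ((hIP _).1 P.2)
  choose cv hcv1 hcv2 using h1
  have hinj : Function.Injective cv := fun P Q hPQ =>
    Subtype.ext (hΦ.injective (by rw [hcv2, hcv2, hPQ]))
  have hr : range cv = chainFun δ := by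
    refine Subset.antisymm (range_subset_iff.2 hcv1) fun f hf => ?_
    have hP : Causal.IsIP r (Φ (pastOf f)) := (hIP _).2 (by rw [hΦ]; exact h.isIP_pastOf hf)
    exact ⟨⟨_, hP⟩, pastOf_injective ((hcv2 _).symm.trans (hΦ _))⟩
  have hC : IsUpperTopology (chainFun δ) cv := by
    intro K
    refine (isClosed_limitTopology _
      fun σ φ hφ _ hP => Causal.hatL_subseq r (fun n => (σ n).1) φ hφ hP).trans ?_
    refine forall_congr' fun σ => imp_congr_right fun _ => forall_congr' fun P => ?_
    refine imp_congr_left ?_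
    change P.1 ∈ Causal.hatL r _ ↔ _
    rw [hL, hcv2]
    simp only [hcv2]
    rw [h.mem_hatL_iff]
    exact ⟨fun h2 => h2.2, fun h2 => ⟨hcv1 P, h2⟩⟩
  have hW : ∀ P : Causal.Completion r, P ∈ Causal.boundary r ↔ ¬ IsPointFun δ (cv P) := by
    intro P
    rw [isPointFun_iff (hcv2 P)]
    change Causal.IsTIP r P.1 ↔ _
    rw [hTIP]
    exact ⟨fun h2 => h2.2, fun h2 => ⟨(hIP _).1 P.2, h2⟩⟩
  obtain ⟨e, he1, he2, he3⟩ :=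
    h.exists_cone_equiv x₀ htop hval hvr hB hs hT hinj hr hC hW
  exact ⟨e, fun t f hf hft => by rw [hcv2, he1 t f hf hft], by rw [hcv2, he2, pastOf_top], he3⟩

end LengthDist
end

/-! ### The two causal boundaries of the spacetime as cones. -/

namespace StandardStationary

variable {n : ℕ} {M : Type*} [TopologicalSpace M] [ChartedSpace (EuclideanSpace ℝ (Fin n)) M]
  [IsManifold (𝓡 n) ∞ M] [T2Space M] [SecondCountableTopology M] [ConnectedSpace M]
  (S : StandardStationary n M)

theorem chron_eq : S.chron = distRel S.dist := by
  funext p q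
  exact propext (S.chron_iff p q)

theorem BPlus_eq : S.BPlus = finChainFun S.dist := by
  ext f
  refine and_congr_left fun _ => ⟨?_, ?_⟩
  · rintro ⟨c, rfl⟩
    obtain ⟨u, hu, -, h⟩ := S.busemannPlus_eq_chain c
    exact ⟨u, hu, h⟩
  · rintro ⟨u, hu, rfl⟩
    obtain ⟨c, -, h⟩ := S.exists_busemannPlus_eq hu
    exact ⟨c, h.symm⟩

theorem neg_mem_BMinus_iff (f : M → EReal) :
    (fun x => -f x) ∈ S.BMinus ↔ f ∈ finChainFun fun x y => S.dist y x := by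
  constructor
  · rintro ⟨⟨c, hc⟩, h2⟩
    obtain ⟨u, hu, -, h⟩ := S.busemannMinus_eq_chain c
    refine ⟨⟨u, hu, ?_⟩, fun x hx => h2 x (congrArg Neg.neg hx)⟩
    rw [h] at hc
    exact funext fun x => neg_injective (congrFun hc x)
  · rintro ⟨⟨u, hu, rfl⟩, h2⟩
    obtain ⟨c, -, h⟩ := S.exists_busemannMinus_eq hu
    refine ⟨⟨c, h.symm⟩, fun x hx => h2 x ?_⟩
    rw [← neg_neg (chainBusemann _ u x)]
    exact congrArg Neg.neg hx

theorem coe_distMinus (x y : M) : (S.distMinus x y : EReal) = ((S.dist y x : ℝ) : EReal) := by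
  rw [S.distMinus_eq, S.coe_distPlus]

theorem modConst_mk_mem_busemannBdryPlus_iff (f : S.BPlus) :
    Quotient.mk (modConst S.BPlus) f ∈ S.busemannBdryPlus ↔ ¬ IsPointFun S.dist f.1 := by
  refine not_congr ⟨?_, ?_⟩
  · rintro ⟨g, y, hg, hy⟩
    obtain ⟨k, hk⟩ : ∃ k : ℝ, ∀ x, f.1 x = g.1 x + k := Quotient.exact hg
    refine ⟨k, y, funext fun x => ?_⟩
    rw [hk, hy, S.coe_distPlus, ← EReal.coe_neg, ← EReal.coe_add, neg_add_eq_sub]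
  · rintro ⟨c, y, hc⟩
    have hg : (fun x => ((-(S.dist x y) : ℝ) : EReal)) ∈ S.BPlus := by
      rw [S.BPlus_eq]
      have := S.lengthDist.sub_dist_mem_chainFun 0 y
      simp only [zero_sub] at this
      exact ⟨this, fun x => EReal.coe_ne_top _⟩
    refine ⟨⟨_, hg⟩, y, Quotient.sound (s := modConst S.BPlus) ⟨c, fun x => ?_⟩, fun x => ?_⟩
    · rw [hc]
      change _ = ((-(S.dist x y) : ℝ) : EReal) + c
      rw [← EReal.coe_add, neg_add_eq_sub]
    · rw [S.coe_distPlus, ← EReal.coe_neg]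

theorem modConst_mk_mem_busemannBdryMinus_iff (f : S.BMinus) :
    Quotient.mk (modConst S.BMinus) f ∈ S.busemannBdryMinus ↔
      ¬ IsPointFun (fun x y => S.dist y x) fun x => -f.1 x := by
  refine not_congr ⟨?_, ?_⟩
  · rintro ⟨g, y, hg, hy⟩
    obtain ⟨k, hk⟩ : ∃ k : ℝ, ∀ x, f.1 x = g.1 x + k := Quotient.exact hg
    refine ⟨-k, y, funext fun x => ?_⟩
    rw [hk, hy, S.coe_distMinus, ← EReal.coe_add, ← EReal.coe_neg]
    congr 1
    ring
  · rintro ⟨c, y, hc⟩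
    have hg : (fun x => -((-(S.dist y x) : ℝ) : EReal)) ∈ S.BMinus := by
      rw [S.neg_mem_BMinus_iff]
      have := S.lengthDist.swap.sub_dist_mem_chainFun 0 y
      simp only [zero_sub] at this
      exact ⟨this, fun x => EReal.coe_ne_top _⟩
    refine ⟨⟨_, hg⟩, y, Quotient.sound (s := modConst S.BMinus) ⟨-c, fun x => ?_⟩, fun x => ?_⟩
    · have := congrFun hc x
      rw [← neg_neg (f.1 x), this]
      change _ = -((-(S.dist y x) : ℝ) : EReal) + ((-c : ℝ) : EReal)
      rw [← EReal.coe_neg, ← EReal.coe_neg, ← EReal.coe_add]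
      congr 1
      ring
    · change -((-(S.dist y x) : ℝ) : EReal) = _
      rw [S.coe_distMinus, ← EReal.coe_neg, neg_neg]

theorem exists_forwardCone (x₀ : M) : ∃ e : ForwardCone S.busemannBdryPlus ≃ S.futureBdry,
    (∀ (t : Ioi (⊥ : EReal)) (f : S.BPlus) (hf : S.classPlus f ∈ S.busemannBdryPlus),
      f.1 x₀ = t.1 → (e (ForwardCone.mk t ⟨S.classPlus f, hf⟩)).1.1 = pastOf f.1) ∧
    (e ForwardCone.apex).1.1 = univ ∧ (T2Space S.BusemannPlus → IsHomeomorph e) := by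
  refine S.lengthDist.exists_cone_boundary (r := S.chron) (Φ := id) (fun _ => rfl)
    (fun P => by rw [S.chron_eq]; rfl) (fun P => by rw [S.chron_eq]; rfl)
    (fun P σ => by rw [S.chron_eq]; rfl) x₀ (ι := Homeomorph.refl _)
    (top := fun j : Ioi (⊥ : EReal) => j.1 = ⊤) (fun j => Iff.rfl)
    (val := fun f : S.BPlus => f.1) Subtype.val_injective (by rw [Subtype.range_coe, S.BPlus_eq])
    ?_ (s := modConst S.BPlus) (fun f g => Iff.rfl) (T := S.busemannBdryPlus)
    S.modConst_mk_mem_busemannBdryPlus_iff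
  intro K
  refine (isClosed_limitTopology _ (upperL_subseq _)).trans ?_
  refine forall_congr' fun σ => imp_congr_right fun _ => forall_congr' fun f => imp_congr_left ?_
  refine and_congr_right fun _ => ⟨fun h2 g hg h3 h4 => ?_, fun h2 g h3 h4 => ?_⟩
  · rw [← S.BPlus_eq] at hg
    exact congrArg Subtype.val (h2 ⟨g, hg⟩ h3 h4)
  · exact Subtype.ext (h2 g.1 (S.BPlus_eq ▸ g.2) h3 h4)

/-- Negation, from the functions with values in `[-∞, ∞)` to those with values in `(-∞, ∞]`. -/
def negIio : Iio (⊤ : EReal) ≃ₜ Ioi (⊥ : EReal) where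
  toFun t := ⟨-t.1, by
    rw [mem_Ioi, ← EReal.neg_top]
    exact EReal.neg_lt_neg_iff.2 t.2⟩
  invFun t := ⟨-t.1, by
    rw [mem_Iio, ← EReal.neg_bot]
    exact EReal.neg_lt_neg_iff.2 t.2⟩
  left_inv t := by simp
  right_inv t := by simp
  continuous_toFun := continuous_induced_rng.2 (continuous_neg.comp continuous_subtype_val)
  continuous_invFun := continuous_induced_rng.2 (continuous_neg.comp continuous_subtype_val)

/-- The past boundary is the future boundary for the reversed distance, with times and functions
negated. Negation also exchanges the two limit operators. -/
theorem exists_backwardCone (x₀ : M) : ∃ e : BackwardCone S.busemannBdryMinus ≃ S.pastBdry,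
    (∀ (t : Iio (⊤ : EReal)) (f : S.BMinus) (hf : S.classMinus f ∈ S.busemannBdryMinus),
      f.1 x₀ = t.1 → (e (BackwardCone.mk t ⟨S.classMinus f, hf⟩)).1.1 = futureOf f.1) ∧
    (e BackwardCone.apex).1.1 = univ ∧ (T2Space S.BusemannMinus → IsHomeomorph e) := by
  have hB : IsUpperTopology (finChainFun fun x y => S.dist y x)
      (fun (f : S.BMinus) x => -f.1 x) := by
    intro K
    refine (isClosed_limitTopology _ (lowerL_subseq _)).trans ?_
    refine forall_congr' fun σ => imp_congr_right fun _ => forall_congr' fun f => imp_congr_left ?_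
    refine and_congr (forall_congr' fun x => ?_) ⟨fun h2 g hg h3 h4 => ?_, fun h2 g h3 h4 => ?_⟩
    · have := EReal.liminf_neg (f := atTop) (v := fun n => (σ n).1 x)
      change _ ↔ _ ≤ liminf (-fun n => (σ n).1 x) atTop
      rw [this, EReal.neg_le_neg_iff]
    · have h5 := h2 ⟨fun x => -g x, (S.neg_mem_BMinus_iff g).2 hg⟩
        (fun x => by have := h3 x; rwa [EReal.neg_le] at this) (fun x => by
          have h6 := h4 x
          have := EReal.limsup_neg (f := atTop) (v := fun n => (σ n).1 x)
          change _ ≤ limsup (-fun n => (σ n).1 x) atTop at h6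
          rw [this] at h6
          rwa [EReal.le_neg] at h6)
      funext x
      rw [← neg_neg (g x)]
      exact congrArg Neg.neg (congrFun (congrArg Subtype.val h5) x)
    · have h5 := h2 (fun x => -g.1 x) ((S.neg_mem_BMinus_iff _).1 (by simp only [neg_neg]; exact g.2))
        (fun x => EReal.neg_le_neg_iff.2 (h3 x)) (fun x => by
          have := EReal.limsup_neg (f := atTop) (v := fun n => (σ n).1 x)
          change _ ≤ limsup (-fun n => (σ n).1 x) atTop
          rw [this, EReal.neg_le_neg_iff]
          exact h4 x)
      exact Subtype.ext (funext fun x => neg_injective (congrFun h5 x))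
  have hi : Function.Injective (fun (f : S.BMinus) x => -f.1 x) := fun f g hfg =>
    Subtype.ext (funext fun x => neg_injective (congrFun hfg x))
  have hr : range (fun (f : S.BMinus) x => -f.1 x) = finChainFun fun x y => S.dist y x := by
    ext f
    constructor
    · rintro ⟨g, rfl⟩
      exact (S.neg_mem_BMinus_iff _).1 (by simp only [neg_neg]; exact g.2)
    · intro hf
      exact ⟨⟨_, (S.neg_mem_BMinus_iff f).2 hf⟩, funext fun x => neg_neg _⟩
  have hs : ∀ f g : S.BMinus, (modConst S.BMinus).r f g ↔
      ∃ k : ℝ, ∀ x, -g.1 x = -f.1 x + k := by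
    intro f g
    have haux : ∀ (a b : EReal) (k : ℝ), a = b + k → -a = -b + ((-k : ℝ) : EReal) := by
      rintro a b k rfl
      rw [EReal.neg_add (Or.inr (EReal.coe_ne_top _)) (Or.inr (EReal.coe_ne_bot _)), EReal.coe_neg,
        sub_eq_add_neg]
    constructor
    · rintro ⟨k, hk⟩
      exact ⟨-k, fun x => haux _ _ _ (hk x)⟩
    · rintro ⟨k, hk⟩
      refine ⟨-k, fun x => ?_⟩
      have := haux _ _ _ (hk x)
      rwa [neg_neg, neg_neg] at this
  obtain ⟨e, h1, h2, h3⟩ := S.lengthDist.swap.exists_cone_boundary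
    (r := fun p q => S.chron q p) (Φ := fun A => timeReflect M ⁻¹' A)
    timeReflect_preimage_preimage (fun P => by rw [S.chron_eq]; exact isIP_swap_iff)
    (fun P => by rw [S.chron_eq]; exact isTIP_swap_iff)
    (fun P σ => by rw [S.chron_eq]; exact hatL_swap_iff) x₀ (ι := negIio)
    (top := fun j : Iio (⊤ : EReal) => j.1 = ⊥) (fun j => (EReal.neg_eq_top_iff (x := j.1)).symm)
    hi hr hB (s := modConst S.BMinus) hs (T := S.busemannBdryMinus)
    S.modConst_mk_mem_busemannBdryMinus_iff
  refine ⟨e, fun t f hf hft => ?_, ?_, h3⟩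
  · have h4 := congrArg (fun A => timeReflect M ⁻¹' A) (h1 t f hf (congrArg Neg.neg hft))
    simp only [timeReflect_preimage_preimage, timeReflect_preimage_pastOf, neg_neg] at h4
    exact h4
  · have h4 := congrArg (fun A => timeReflect M ⁻¹' A) h2
    simp only [timeReflect_preimage_preimage, preimage_univ] at h4
    exact h4

end StandardStationary

/-! ### The components of boundary pairs in terms of Cauchy boundary points. -/

section
variable {X : Type*} {δ : X → X → ℝ} {P F : Set (ℝ × X)} {σ τ : ℕ → X} {Ω Ω' : ℝ}

/-- The identification of the points of the forward and the backward completion. -/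
def IsSamePoint {d d' : X → X → ℝ≥0∞} (z : CauchyCompl d) (w : CauchyCompl d') : Prop :=
  ∃ (σ : ℕ → X) (h : IsForwardCauchy d σ) (h' : IsForwardCauchy d' σ),
    CauchyCompl.mk σ h = z ∧ CauchyCompl.mk σ h' = w

namespace LengthDist

variable (h : LengthDist δ)
include h

theorem sub_limDist_eq (hσ : IsForwardCauchy (ofRealDist δ) σ) :
    (fun x => (Ω : EReal) - (limDist (ofRealDist δ) x σ : EReal)) =
      fun x => ((Ω - inDist δ σ x : ℝ) : EReal) := by
  funext x
  rw [h.ofReal_inDist hσ, EReal.coe_ennreal_ofReal, max_eq_left (h.inDist_nonneg _ _),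
    EReal.coe_sub]

theorem add_limDist_eq (hτ : IsForwardCauchy (ofRealDist fun x y => δ y x) τ) :
    (fun x => (Ω : EReal) + (limDist (ofRealDist fun x y => δ y x) x τ : EReal)) =
      fun x => ((Ω + inDist (fun x y => δ y x) τ x : ℝ) : EReal) := by
  funext x
  rw [h.swap.ofReal_inDist hτ, EReal.coe_ennreal_ofReal, max_eq_left (h.swap.inDist_nonneg _ _),
    EReal.coe_add]

theorem pastOf_sub_limDist (hσ : IsForwardCauchy (ofRealDist δ) σ) :
    pastOf (fun x => (Ω : EReal) - (limDist (ofRealDist δ) x σ : EReal)) = pastPoint δ Ω σ := by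
  rw [h.sub_limDist_eq hσ, pastPoint]

theorem futureOf_add_limDist (hτ : IsForwardCauchy (ofRealDist fun x y => δ y x) τ) :
    futureOf (fun x => (Ω : EReal) + (limDist (ofRealDist fun x y => δ y x) x τ : EReal)) =
      futurePoint δ Ω τ := by
  rw [h.add_limDist_eq hτ, futurePoint]

omit h in
theorem timeReflect_preimage_futureOf_outDist (Ω : ℝ) :
    timeReflect X ⁻¹' (futureOf fun x => (Ω : EReal) + (outDist (fun x y => δ y x) σ x : EReal)) =
      pastOf fun x => ((-Ω : ℝ) : EReal) - (outDist (fun x y => δ y x) σ x : EReal) := by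
  rw [timeReflect_preimage_futureOf]
  congr 1
  funext x
  rw [EReal.neg_add (Or.inl (EReal.coe_ne_bot _)) (Or.inl (EReal.coe_ne_top _)), EReal.coe_neg]

theorem commonPast_symm (hσ : IsForwardCauchy (ofRealDist δ) σ)
    (hσ' : IsForwardCauchy (ofRealDist fun x y => δ y x) σ) :
    Causal.commonPast (distRel δ) (futurePoint δ Ω σ) = pastPoint δ Ω σ := by
  have h1 := h.swap.commonFuture_symm (Ω := -Ω) hσ' hσ
  have h2 : (fun p q => distRel (fun x y => δ y x) q p) =
    fun p q => distRel δ (timeReflect X p) (timeReflect X q) := distRel_swap_eq fun x y => δ y x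
  have h3 : pastPoint (fun x y => δ y x) (-Ω) σ = timeReflect X ⁻¹' futurePoint δ Ω σ := by
    rw [← neg_neg Ω, ← timeReflect_preimage_pastPoint, timeReflect_preimage_preimage, neg_neg]
  have h4 : futurePoint (fun x y => δ y x) (-Ω) σ = timeReflect X ⁻¹' pastPoint δ Ω σ := by
    rw [← neg_neg Ω, ← timeReflect_preimage_futurePoint, timeReflect_preimage_preimage, neg_neg]
  rw [h2, h3, h4, Causal.commonPast_preimage] at h1
  exact (timeReflect X).surjective.preimage_injective h1

theorem subset_pastOf_outDist (hτ : IsForwardCauchy (ofRealDist fun x y => δ y x) τ)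
    (hP : Causal.IsIP (distRel δ) P)
    (hPF : Causal.Precedes (distRel δ) P (futurePoint δ Ω τ)) :
    P ⊆ pastOf fun x => (Ω : EReal) - (outDist (fun x y => δ y x) τ x : EReal) := by
  rw [← neg_neg Ω, ← timeReflect_preimage_pastPoint, ← timeReflect_preimage_preimage P,
    precedes_reflect_iff] at hPF
  have h1 := h.swap.subset_futureOf_outDist hτ (F := timeReflect X ⁻¹' P)
    (by rw [isIP_swap_iff, timeReflect_preimage_preimage]; exact hP) hPF
  have h2 := preimage_mono (f := timeReflect X) h1
  rw [timeReflect_preimage_preimage, timeReflect_preimage_futureOf_outDist, neg_neg] at h2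
  exact h2

/-- The pairs whose past component comes from a chronological sequence with bounded times. -/
theorem past_component {d d' : X → X → ℝ≥0∞} {r : ℝ × X → ℝ × X → Prop} (hd : d = ofRealDist δ)
    (hd' : d' = ofRealDist fun x y => δ y x) (hr : r = distRel δ)
    (hm : (P, F) ∈ Causal.cBoundary r) {u : ℕ → ℝ × X} (hu : IsChronChain δ u)
    (hP : P = pastOf (chainBusemann δ u)) (hΩ : ∃ Ω, Tendsto (fun n => (u n).1) atTop (𝓝 Ω)) :
    ∃ (Ω : ℝ) (z : CauchyCompl d), ¬ z.IsInterior ∧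
      chainBusemann δ u = (fun x => (Ω : EReal) - (limDist d x z.rep : EReal)) ∧
      P = pastOf (fun x => (Ω : EReal) - (limDist d x z.rep : EReal)) ∧
      F ⊆ futureOf (fun x => (Ω : EReal) + (limDist d' x z.rep : EReal)) ∧
      Xor (F = ∅) (∃ (Ω' : ℝ) (w : CauchyCompl d'), ¬ w.IsInterior ∧
        F = futureOf (fun x => (Ω' : EReal) + (limDist d' x w.rep : EReal)) ∧
        ((Ω' - Ω : ℝ) : EReal) = (doubleLim d z.rep w.rep : EReal)) ∧
      ∀ w : CauchyCompl d', IsSamePoint z w →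
        F = futureOf (fun x => (Ω : EReal) + (limDist d' x w.rep : EReal)) ∧
        (∀ (Ω' : ℝ) (w' : CauchyCompl d'),
          F = futureOf (fun x => (Ω' : EReal) + (limDist d' x w'.rep : EReal)) → Ω' = Ω ∧ w' = w) ∧
        Causal.commonPast (fun p q => r q p) P =
          futureOf (fun x => (Ω : EReal) + (limDist d' x z.rep : EReal)) ∧
        ∀ F', (P, F') ∈ Causal.cCompletion r ↔
          F' = futureOf (fun x => (Ω : EReal) + (limDist d' x w.rep : EReal)) := by
  -- The distances and the relation are variables with equations, so that the real-valued versions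
  -- can be substituted although the types of the completions depend on them.
  subst hd hd' hr
  obtain ⟨Ω, hΩ⟩ := hΩ
  obtain ⟨hσ, hb⟩ := h.chain_bounded hu hΩ
  -- The conclusion uses the chosen representative of the class. It has the same distance function
  -- as the sequence of the chain.
  obtain ⟨z, hz⟩ : ∃ z, z = CauchyCompl.mk _ hσ := ⟨_, rfl⟩
  rw [← (h.eq_mk_iff z hσ).1 hz] at hb
  have hρ := isForwardCauchy_rep z
  rw [hb] at hP
  change P = pastPoint δ Ω z.rep at hP
  subst hP
  have hPi := h.isIP_pastPoint hρ Ω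
  have hSR : F ≠ ∅ → Causal.SRelated (distRel δ) (pastPoint δ Ω z.rep) F := fun hF =>
    Causal.mem_cCompletion_of_left hm.1 hPi.ne_empty hF
  refine ⟨Ω, z, ?_, by rw [h.sub_limDist_eq hρ, hb], by rw [h.pastOf_sub_limDist hρ], ?_, ?_,
    fun w hzw => ?_⟩
  · have := (h.isTIP_pastPoint_iff hρ).1 (h.isTIP_of_mem_cBoundary hm hPi.ne_empty)
    rwa [mk_rep] at this
  · by_cases hF : F = ∅
    · rw [hF]
      exact empty_subset _
    · obtain ⟨-, h1, h2, -⟩ := (Causal.sRelated_iff h.isChronological).1 (hSR hF)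
      exact h.subset_futureOf_outDist hρ h1 h2
  · by_cases hF : F = ∅
    · refine Or.inl ⟨hF, ?_⟩
      rintro ⟨Ω', w, -, hw, -⟩
      rw [h.futureOf_add_limDist (isForwardCauchy_rep w)] at hw
      exact (h.isIF_futurePoint (isForwardCauchy_rep w) Ω').ne_empty (hw.symm.trans hF)
    · refine Or.inr ⟨?_, hF⟩
      have hS := hSR hF
      obtain ⟨-, h1, h2, -⟩ := (Causal.sRelated_iff h.isChronological).1 hS
      obtain ⟨Ω', τ, hτ, hFe⟩ := h.exists_futurePoint h1 h2 hPi.nonempty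
      obtain ⟨w, hw⟩ : ∃ w, w = CauchyCompl.mk _ hτ := ⟨_, rfl⟩
      have hwρ := isForwardCauchy_rep w
      have hFw : F = futurePoint δ Ω' w.rep := by
        rw [hFe]
        exact (h.futurePoint_eq_iff hτ hwρ).2 ⟨rfl, ((h.swap.eq_mk_iff w hτ).1 hw).symm⟩
      refine ⟨Ω', w, ?_, by rw [h.futureOf_add_limDist hwρ, hFw], ?_⟩
      · have := h.isTIF_of_mem_cBoundary hm hF
        rw [hFw, h.isTIF_futurePoint_iff hwρ] at this
        rwa [mk_rep] at this
      · rw [hFw] at hS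
        exact h.coe_sub_eq_doubleLim hρ hwρ hS
  · obtain ⟨σ, h1, h2, h3, h4⟩ := hzw
    have e1 := (h.eq_mk_iff z h1).1 h3.symm
    have e2 := (h.swap.eq_mk_iff w h2).1 h4.symm
    have hwρ := isForwardCauchy_rep w
    have hPσ : pastPoint δ Ω z.rep = pastPoint δ Ω σ := (h.pastPoint_eq_iff hρ h1).2 ⟨rfl, e1⟩
    have hFσ : futurePoint δ Ω w.rep = futurePoint δ Ω σ :=
      (h.futurePoint_eq_iff hwρ h2).2 ⟨rfl, e2⟩
    have hiff : ∀ F', (pastPoint δ Ω z.rep, F') ∈ Causal.cCompletion (distRel δ) ↔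
        F' = futureOf (fun x => (Ω : EReal) +
          (limDist (ofRealDist fun x y => δ y x) x w.rep : EReal)) := fun F' => by
      rw [h.futureOf_add_limDist hwρ, hPσ, hFσ, h.mem_cCompletion_pastPoint_iff h1 h2]
    have hF := (hiff F).1 hm.1
    refine ⟨hF, fun Ω' w' hw' => ?_, ?_, hiff⟩
    · rw [h.futureOf_add_limDist (isForwardCauchy_rep w')] at hw'
      rw [h.futureOf_add_limDist hwρ] at hF
      obtain ⟨h5, h6⟩ := (h.futurePoint_eq_iff (isForwardCauchy_rep w') hwρ).1 (hw'.symm.trans hF)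
      exact ⟨h5, h.swap.ext_inDist.2 h6⟩
    · rw [hPσ, h.commonFuture_symm h1 h2, ← h.futureOf_outDist_eq h2,
        ← h.outDist_congr hρ h1 e1]
      rfl

/-- The pairs whose future component comes from a chronological sequence with bounded times. -/
theorem future_component {d d' : X → X → ℝ≥0∞} {r : ℝ × X → ℝ × X → Prop} (hd : d = ofRealDist δ)
    (hd' : d' = ofRealDist fun x y => δ y x) (hr : r = distRel δ)
    (hm : (P, F) ∈ Causal.cBoundary r) {u : ℕ → ℝ × X} (hu : IsChronChain (fun x y => δ y x) u)
    (hF : F = futureOf fun x => -chainBusemann (fun x y => δ y x) u x)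
    (hΩ : ∃ Ω, Tendsto (fun n => (u n).1) atTop (𝓝 Ω)) :
    ∃ (Ω : ℝ) (w : CauchyCompl d'), ¬ w.IsInterior ∧
      (fun x => -chainBusemann (fun x y => δ y x) u x) =
        (fun x => (Ω : EReal) + (limDist d' x w.rep : EReal)) ∧
      F = futureOf (fun x => (Ω : EReal) + (limDist d' x w.rep : EReal)) ∧
      P ⊆ pastOf (fun x => (Ω : EReal) - (limDist d x w.rep : EReal)) ∧
      Xor (P = ∅) (∃ (Ω' : ℝ) (z : CauchyCompl d), ¬ z.IsInterior ∧
        P = pastOf (fun x => (Ω' : EReal) - (limDist d x z.rep : EReal)) ∧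
        ((Ω - Ω' : ℝ) : EReal) = (doubleLim d z.rep w.rep : EReal)) ∧
      ∀ z : CauchyCompl d, IsSamePoint z w →
        P = pastOf (fun x => (Ω : EReal) - (limDist d x z.rep : EReal)) ∧
        (∀ (Ω' : ℝ) (z' : CauchyCompl d),
          P = pastOf (fun x => (Ω' : EReal) - (limDist d x z'.rep : EReal)) → Ω' = Ω ∧ z' = z) ∧
        Causal.commonPast r F = pastOf (fun x => (Ω : EReal) - (limDist d x w.rep : EReal)) ∧
        ∀ P', (P', F) ∈ Causal.cCompletion r ↔
          P' = pastOf (fun x => (Ω : EReal) - (limDist d x z.rep : EReal)) := by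
  subst hd hd' hr
  obtain ⟨Ω, hΩ⟩ := hΩ
  obtain ⟨hσ, hb⟩ := h.swap.chain_bounded hu hΩ
  obtain ⟨w, hw⟩ : ∃ w, w = CauchyCompl.mk _ hσ := ⟨_, rfl⟩
  rw [← (h.swap.eq_mk_iff w hσ).1 hw] at hb
  have hρ := isForwardCauchy_rep w
  have hb' : (fun x => -chainBusemann (fun x y => δ y x) u x) =
      fun x => ((-Ω + inDist (fun x y => δ y x) w.rep x : ℝ) : EReal) := by
    funext x
    rw [hb, ← EReal.coe_neg, neg_sub, ← neg_add_eq_sub]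
  rw [hb'] at hF
  change F = futurePoint δ (-Ω) w.rep at hF
  -- A sequence for the reversed distance runs backwards in time, so its limit time enters with the
  -- opposite sign.
  generalize -Ω = Ω at hb' hF
  subst hF
  have hFi := h.isIF_futurePoint hρ Ω
  have hSR : P ≠ ∅ → Causal.SRelated (distRel δ) P (futurePoint δ Ω w.rep) := fun hP =>
    Causal.mem_cCompletion_of_left hm.1 hP hFi.ne_empty
  refine ⟨Ω, w, ?_, by rw [h.add_limDist_eq hρ, hb'], by rw [h.futureOf_add_limDist hρ], ?_, ?_,
    fun z hzw => ?_⟩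
  · have := (h.isTIF_futurePoint_iff hρ).1 (h.isTIF_of_mem_cBoundary hm hFi.ne_empty)
    rwa [mk_rep] at this
  · by_cases hP : P = ∅
    · rw [hP]
      exact empty_subset _
    · obtain ⟨h1, -, h2, -⟩ := (Causal.sRelated_iff h.isChronological).1 (hSR hP)
      exact h.subset_pastOf_outDist hρ h1 h2
  · by_cases hP : P = ∅
    · refine Or.inl ⟨hP, ?_⟩
      rintro ⟨Ω', z, -, hz, -⟩
      rw [h.pastOf_sub_limDist (isForwardCauchy_rep z)] at hz
      exact (h.isIP_pastPoint (isForwardCauchy_rep z) Ω').ne_empty (hz.symm.trans hP)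
    · refine Or.inr ⟨?_, hP⟩
      have hS := hSR hP
      obtain ⟨h1, -, h2, -⟩ := (Causal.sRelated_iff h.isChronological).1 hS
      obtain ⟨Ω', τ, hτ, hPe⟩ := h.exists_pastPoint h1 h2 hFi.nonempty
      obtain ⟨z, hz⟩ : ∃ z, z = CauchyCompl.mk _ hτ := ⟨_, rfl⟩
      have hzρ := isForwardCauchy_rep z
      have hPz : P = pastPoint δ Ω' z.rep := by
        rw [hPe]
        exact (h.pastPoint_eq_iff hτ hzρ).2 ⟨rfl, ((h.eq_mk_iff z hτ).1 hz).symm⟩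
      refine ⟨Ω', z, ?_, by rw [h.pastOf_sub_limDist hzρ, hPz], ?_⟩
      · have := h.isTIP_of_mem_cBoundary hm hP
        rw [hPz, h.isTIP_pastPoint_iff hzρ] at this
        rwa [mk_rep] at this
      · rw [hPz] at hS
        exact h.coe_sub_eq_doubleLim hzρ hρ hS
  · obtain ⟨σ, h1, h2, h3, h4⟩ := hzw
    have e1 := (h.eq_mk_iff z h1).1 h3.symm
    have e2 := (h.swap.eq_mk_iff w h2).1 h4.symm
    have hzρ := isForwardCauchy_rep z
    have hPσ : pastPoint δ Ω z.rep = pastPoint δ Ω σ := (h.pastPoint_eq_iff hzρ h1).2 ⟨rfl, e1⟩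
    have hFσ : futurePoint δ Ω w.rep = futurePoint δ Ω σ :=
      (h.futurePoint_eq_iff hρ h2).2 ⟨rfl, e2⟩
    have hiff : ∀ P', (P', futurePoint δ Ω w.rep) ∈ Causal.cCompletion (distRel δ) ↔
        P' = pastOf (fun x => (Ω : EReal) - (limDist (ofRealDist δ) x z.rep : EReal)) :=
      fun P' => by
        rw [h.pastOf_sub_limDist hzρ, hPσ, hFσ, h.mem_cCompletion_futurePoint_iff h1 h2]
    have hP := (hiff P).1 hm.1
    refine ⟨hP, fun Ω' z' hz' => ?_, ?_, hiff⟩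
    · rw [h.pastOf_sub_limDist (isForwardCauchy_rep z')] at hz'
      rw [h.pastOf_sub_limDist hzρ] at hP
      obtain ⟨h5, h6⟩ := (h.pastPoint_eq_iff (isForwardCauchy_rep z') hzρ).1 (hz'.symm.trans hP)
      exact ⟨h5, h.ext_inDist.2 h6⟩
    · have e3 := h.swap.outDist_congr hρ h2 e2
      have e4 : ∀ x, limDist (ofRealDist δ) x w.rep = limDist (ofRealDist δ) x σ := congrFun e3
      simp only [e4]
      rw [hFσ, h.commonPast_symm h1 h2, h.pastOf_sub_limDist h1]

end LengthDist
end

/-! ### The trichotomy for pairs with a given non-empty component. -/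

namespace StandardStationary

variable {n : ℕ} {M : Type*} [TopologicalSpace M] [ChartedSpace (EuclideanSpace ℝ (Fin n)) M]
  [IsManifold (𝓡 n) ∞ M] [T2Space M] [SecondCountableTopology M] [ConnectedSpace M]
  (S : StandardStationary n M)

theorem distPlus_eq : S.distPlus = ofRealDist S.dist := by
  funext x y
  exact S.ofReal_dist x y

theorem distMinus_eq_ofRealDist : S.distMinus = ofRealDist fun x y => S.dist y x := by
  funext x y
  rw [S.distMinus_eq]
  exact S.ofReal_dist y x

theorem bounded_chain {δ : M → M → ℝ} (h : LengthDist δ) {u : ℕ → ℝ × M} (hu : IsChronChain δ u)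
    {L : EReal} (hL : Tendsto (fun j => ((u j).1 : EReal)) atTop (𝓝 L)) (hne : L ≠ ⊤) :
    ∃ Ω, Tendsto (fun n => (u n).1) atTop (𝓝 Ω) := by
  have h1 : ∀ n, ((u n).1 : EReal) ≤ L := fun n =>
    Monotone.ge_of_tendsto (fun i j hij => EReal.coe_le_coe_iff.2
      ((h.chain_strictMono hu).monotone hij)) hL n
  refine h.chain_of_bddAbove hu ⟨L.toReal, ?_⟩
  rintro _ ⟨n, rfl⟩
  rw [← EReal.coe_le_coe_iff, EReal.coe_toReal hne
    (ne_bot_of_le_ne_bot (EReal.coe_ne_bot _) (h1 0))]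
  exact h1 n

theorem not_tendsto_top {u : ℕ → ℝ × M} (h1 : Tendsto (fun j => ((u j).1 : EReal)) atTop (𝓝 ⊤))
    {Ω : ℝ} (h2 : Tendsto (fun n => (u n).1) atTop (𝓝 Ω)) : False :=
  EReal.coe_ne_top Ω (tendsto_nhds_unique ((continuous_coe_real_ereal.tendsto Ω).comp h2) h1)

/-- A non-empty `F` bounds the times of every sequence generating `P`. This excludes a partner for
the constant `∞` and for functions of curves with `Ω = ∞`. A function not of these kinds can only
come from curves with finite `Ω`, to which `LengthDist.past_component` applies. -/
theorem past_components (P F : Set (ℝ × M)) (hm : (P, F) ∈ Causal.cBoundary S.chron) (hP : P ≠ ∅) :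
    (∃ c, P = pastOf (S.busemannPlus c)) ∧
      ∀ c, P = pastOf (S.busemannPlus c) →
        ((∀ x, S.busemannPlus c x = ⊤) → P = univ ∧ F = ∅) ∧
        (S.busemannPlus c ∈ S.properBPlus → F = ∅) ∧
        (S.busemannPlus c ∈ S.BPlus \ S.properBPlus →
          ∃ (Ω : ℝ) (z : S.CauchyPlus), z ∈ S.cauchyBdryPlus ∧
            S.busemannPlus c = S.dPlusOf Ω z.rep ∧
            P = pastOf (S.dPlusOf Ω z.rep) ∧
            F ⊆ futureOf (S.dMinusOf Ω z.rep) ∧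
            Xor (F = ∅)
              (∃ (Ω' : ℝ) (w : S.CauchyMinus), w ∈ S.cauchyBdryMinus ∧
                F = futureOf (S.dMinusOf Ω' w.rep) ∧
                ((Ω' - Ω : ℝ) : EReal) = (doubleLim S.distPlus z.rep w.rep : EReal)) ∧
            (∀ w : S.CauchyMinus, z ∈ S.cauchyBdrySymm → S.SamePoint z w →
              F = futureOf (S.dMinusOf Ω w.rep) ∧
              (∀ (Ω' : ℝ) (w' : S.CauchyMinus), w' ∈ S.cauchyBdryMinus →
                F = futureOf (S.dMinusOf Ω' w'.rep) → Ω' = Ω ∧ w' = w) ∧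
              Causal.commonPast (fun p q => S.chron q p) P = futureOf (S.dMinusOf Ω z.rep) ∧
              ∀ F', (P, F') ∈ Causal.cCompletion S.chron ↔
                F' = futureOf (S.dMinusOf Ω w.rep))) := by
  have h := S.lengthDist
  have hm' := hm
  rw [S.chron_eq] at hm'
  have hPi := Causal.mem_cCompletion_isIP hm'.1 hP
  have hprec : F ≠ ∅ → Causal.Precedes (distRel S.dist) P F ∧ F.Nonempty := fun hF =>
    ⟨((Causal.sRelated_iff h.isChronological).1
      (Causal.mem_cCompletion_of_left hm'.1 hP hF)).2.2.1, nonempty_iff_ne_empty.2 hF⟩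
  refine ⟨?_, fun c hc => ⟨fun htop => ?_, fun hprop => ?_, fun hb => ?_⟩⟩
  · obtain ⟨_, ⟨u, hu, rfl⟩, hPu⟩ := h.isIP_iff.1 hPi
    obtain ⟨c, -, hc⟩ := S.exists_busemannPlus_eq hu
    exact ⟨c, by rw [hPu, hc]⟩
  · have htop' : S.busemannPlus c = fun _ => ⊤ := funext htop
    refine ⟨by rw [hc, htop', pastOf_top], ?_⟩
    by_contra hF
    obtain ⟨h1, h2⟩ := hprec hF
    obtain ⟨Ω, σ, -, hPσ⟩ := h.exists_pastPoint hPi h1 h2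
    have h3 := pastOf_injective ((hc.symm.trans hPσ : _))
    rw [htop'] at h3
    obtain ⟨⟨-, x⟩, -⟩ := hPi.nonempty
    exact EReal.coe_ne_top _ (congrFun h3 x).symm
  · by_contra hF
    obtain ⟨h1, h2⟩ := hprec hF
    obtain ⟨⟨c', hc', hcc'⟩, -⟩ := hprop
    obtain ⟨u, hu, hut, hub⟩ := S.busemannPlus_eq_chain c'
    rw [hc, hcc', hub] at h1
    obtain ⟨Ω, hΩ⟩ := h.eq_pastPoint_of_chain hu h1 h2
    rw [hc'] at hut
    exact not_tendsto_top hut hΩ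
  · obtain ⟨u, hu, hut, hub⟩ := S.busemannPlus_eq_chain c
    have hne : c.Ω ≠ ⊤ := fun hΩ => hb.2 ⟨⟨c, hΩ, rfl⟩, hb.1.2⟩
    obtain ⟨Ω, z, h1, h2, h3, h4, h5, h6⟩ := h.past_component S.distPlus_eq
      S.distMinus_eq_ofRealDist S.chron_eq hm hu (by rw [hc, hub]) (bounded_chain h hu hut hne)
    refine ⟨Ω, z, h1, hub.trans h2, h3, h4, h5, fun w _ hzw => ?_⟩
    obtain ⟨h7, h8, h9⟩ := h6 w hzw
    exact ⟨h7, fun Ω' w' _ => h8 Ω' w', h9⟩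

theorem future_components (P F : Set (ℝ × M)) (hm : (P, F) ∈ Causal.cBoundary S.chron)
    (hF : F ≠ ∅) :
    (∃ c, F = futureOf (S.busemannMinus c)) ∧
      ∀ c, F = futureOf (S.busemannMinus c) →
        ((∀ x, S.busemannMinus c x = ⊥) → F = univ ∧ P = ∅) ∧
        (S.busemannMinus c ∈ S.properBMinus → P = ∅) ∧
        (S.busemannMinus c ∈ S.BMinus \ S.properBMinus →
          ∃ (Ω : ℝ) (w : S.CauchyMinus), w ∈ S.cauchyBdryMinus ∧
            S.busemannMinus c = S.dMinusOf Ω w.rep ∧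
            F = futureOf (S.dMinusOf Ω w.rep) ∧
            P ⊆ pastOf (S.dPlusOf Ω w.rep) ∧
            Xor (P = ∅)
              (∃ (Ω' : ℝ) (z : S.CauchyPlus), z ∈ S.cauchyBdryPlus ∧
                P = pastOf (S.dPlusOf Ω' z.rep) ∧
                ((Ω - Ω' : ℝ) : EReal) = (doubleLim S.distPlus z.rep w.rep : EReal)) ∧
            (∀ z : S.CauchyPlus, w ∈ S.cauchyBdrySymm' → S.SamePoint z w →
              P = pastOf (S.dPlusOf Ω z.rep) ∧
              (∀ (Ω' : ℝ) (z' : S.CauchyPlus), z' ∈ S.cauchyBdryPlus →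
                P = pastOf (S.dPlusOf Ω' z'.rep) → Ω' = Ω ∧ z' = z) ∧
              Causal.commonPast S.chron F = pastOf (S.dPlusOf Ω w.rep) ∧
              ∀ P', (P', F) ∈ Causal.cCompletion S.chron ↔
                P' = pastOf (S.dPlusOf Ω z.rep))) := by
  have h := S.lengthDist
  have hm' := hm
  rw [S.chron_eq] at hm'
  have hFi := Causal.mem_cCompletion_isIP (Causal.mem_cCompletion_swap.2 hm'.1) hF
  have hprec : P ≠ ∅ → Causal.Precedes (distRel S.dist) P F ∧ P.Nonempty := fun hP =>
    ⟨((Causal.sRelated_iff h.isChronological).1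
      (Causal.mem_cCompletion_of_left hm'.1 hP hF)).2.2.1, nonempty_iff_ne_empty.2 hP⟩
  refine ⟨?_, fun c hc => ⟨fun hbot => ?_, fun hprop => ?_, fun hb => ?_⟩⟩
  · obtain ⟨_, ⟨u, hu, rfl⟩, hFu⟩ := h.isIF_iff.1 hFi
    obtain ⟨c, -, hc⟩ := S.exists_busemannMinus_eq hu
    exact ⟨c, by rw [hFu, hc]⟩
  · have hbot' : S.busemannMinus c = fun _ => ⊥ := funext hbot
    refine ⟨by rw [hc, hbot']; exact eq_univ_of_forall fun _ => EReal.bot_lt_coe _, ?_⟩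
    by_contra hP
    obtain ⟨h1, h2⟩ := hprec hP
    obtain ⟨Ω, σ, -, hFσ⟩ := h.exists_futurePoint hFi h1 h2
    have h3 := futureOf_injective ((hc.symm.trans hFσ : _))
    rw [hbot'] at h3
    obtain ⟨⟨-, x⟩, -⟩ := hFi.nonempty
    exact EReal.coe_ne_bot _ (congrFun h3 x).symm
  · by_contra hP
    obtain ⟨h1, h2⟩ := hprec hP
    obtain ⟨⟨c', hc', hcc'⟩, -⟩ := hprop
    obtain ⟨u, hu, hut, hub⟩ := S.busemannMinus_eq_chain c'
    rw [hc, hcc', hub, ← timeReflect_preimage_pastOf, ← timeReflect_preimage_preimage P,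
      ← precedes_reflect_iff] at h1
    simp only [timeReflect_preimage_preimage] at h1
    obtain ⟨Ω, hΩ⟩ := h.swap.eq_pastPoint_of_chain hu h1
      (h2.preimage (timeReflect M).surjective)
    rw [hc'] at hut
    exact not_tendsto_top hut hΩ
  · obtain ⟨u, hu, hut, hub⟩ := S.busemannMinus_eq_chain c
    have hne : c.Ω ≠ ⊤ := fun hΩ => hb.2 ⟨⟨c, hΩ, rfl⟩, hb.1.2⟩
    obtain ⟨Ω, w, h1, h2, h3, h4, h5, h6⟩ := h.future_component S.distPlus_eq
      S.distMinus_eq_ofRealDist S.chron_eq hm hu (by rw [hc, hub])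
      (bounded_chain h.swap hu hut hne)
    refine ⟨Ω, w, h1, hub.trans h2, h3, h4, h5, fun z _ hzw => ?_⟩
    obtain ⟨h7, h8, h9⟩ := h6 z hzw
    exact ⟨h7, fun Ω' w' _ => h8 Ω' w', h9⟩

end StandardStationary

/-! ### Evenly pairing boundaries, symmetric pairs and local compactness of the completion. -/

section
variable {X : Type*} {δ : X → X → ℝ} {P F : Set (ℝ × X)}

namespace LengthDist

variable (h : LengthDist δ)
include h

theorem isSamePoint_symmetric {z : CauchyCompl (ofRealDist δ)} {w : CauchyCompl (ofRealDist fun x y => δ y x)}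
    (hzw : IsSamePoint z w) : z.IsInterior ↔ w.IsInterior := by
  obtain ⟨σ, h1, h2, rfl, rfl⟩ := hzw
  exact h.isInterior_mk_iff_swap h1 h2

/-- A non-symmetric boundary point has infinite distance to some point of `M`, which excludes a
partner for its pasts. -/
theorem isPointSimple_of_evenlyPairing {d d' : X → X → ℝ≥0∞} {r : ℝ × X → ℝ × X → Prop}
    (hd : d = ofRealDist δ) (hd' : d' = ofRealDist fun x y => δ y x) (hr : r = distRel δ)
    (hp : ∀ z : CauchyCompl d, ¬ z.IsInterior → (¬ ∃ w : CauchyCompl d', IsSamePoint z w) →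
      ∃ y, limsup (fun n => d' y (z.rep n)) atTop = ⊤) : Causal.IsPointSimple r := by
  subst hd hd' hr
  refine h.isPointSimple_of_outDist fun σ hσ hn hf => ?_
  by_cases hs : ∃ w : CauchyCompl (ofRealDist fun x y => δ y x),
      IsSamePoint (CauchyCompl.mk σ hσ) w
  · obtain ⟨w, τ, h1, h2, h3, -⟩ := hs
    exact ⟨τ, h1, h2, ((h.mk_eq_mk_iff h1 hσ).1 h3).symm⟩
  · obtain ⟨y, hy⟩ := hp _ (by rwa [h.isInterior_mk_iff]) hs
    refine absurd ?_ (hf y)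
    rw [← h.outDist_congr (isForwardCauchy_rep _) hσ (h.inDist_rep_mk hσ)]
    exact hy

theorem isSymmPair_iff {d d' : X → X → ℝ≥0∞} (hd : d = ofRealDist δ)
    (hd' : d' = ofRealDist fun x y => δ y x) (hm : (P, F) ∈ Causal.cBoundary (distRel δ)) :
    IsSymmPair δ P F ↔ ∃ (Ω : ℝ) (z : CauchyCompl d) (w : CauchyCompl d'),
      (¬ z.IsInterior ∧ ∃ w : CauchyCompl d', ¬ w.IsInterior ∧ IsSamePoint z w) ∧
        IsSamePoint z w ∧ P = pastOf (fun x => (Ω : EReal) - (limDist d x z.rep : EReal)) ∧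
        F = futureOf (fun x => (Ω : EReal) + (limDist d' x w.rep : EReal)) := by
  subst hd hd'
  constructor
  · rintro ⟨Ω, σ, h1, h2, rfl, rfl⟩
    have hz := isForwardCauchy_rep (CauchyCompl.mk σ h1)
    have hw := isForwardCauchy_rep (CauchyCompl.mk σ h2)
    have hs : IsSamePoint (CauchyCompl.mk σ h1) (CauchyCompl.mk σ h2) := ⟨σ, h1, h2, rfl, rfl⟩
    have hi := (h.isTIP_pastPoint_iff h1).1
      (h.isTIP_of_mem_cBoundary hm (h.isIP_pastPoint h1 _).ne_empty)
    refine ⟨Ω, CauchyCompl.mk σ h1, CauchyCompl.mk σ h2,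
      ⟨hi, _, (h.isSamePoint_symmetric hs).not.1 hi, hs⟩, hs, ?_, ?_⟩
    · rw [h.pastOf_sub_limDist hz, h.pastPoint_eq_iff h1 hz]
      exact ⟨rfl, (h.inDist_rep_mk h1).symm⟩
    · rw [h.futureOf_add_limDist hw, h.futurePoint_eq_iff h2 hw]
      exact ⟨rfl, (h.swap.inDist_rep_mk h2).symm⟩
  · rintro ⟨Ω, z, w, -, ⟨σ, h1, h2, rfl, rfl⟩, rfl, rfl⟩
    refine ⟨Ω, σ, h1, h2, ?_, ?_⟩
    · have hz := isForwardCauchy_rep (CauchyCompl.mk σ h1)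
      rw [h.pastOf_sub_limDist hz, h.pastPoint_eq_iff hz h1]
      exact ⟨rfl, h.inDist_rep_mk h1⟩
    · have hw := isForwardCauchy_rep (CauchyCompl.mk σ h2)
      rw [h.futureOf_add_limDist hw, h.futurePoint_eq_iff hw h2]
      exact ⟨rfl, h.swap.inDist_rep_mk h2⟩

/-- Under the hypothesis on `d_Q⁺` all forward Cauchy sequences are symmetric, so `M_C^s` is the
whole of `M_C⁺` and its local compactness applies to every class. -/
theorem isNicePoint_of_locallyCompact {d d' : X → X → ℝ≥0∞} (hd : d = ofRealDist δ)
    (hd' : d' = ofRealDist fun x y => δ y x) {Q : CauchyCompl d → Prop}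
    (hQ : ∀ z, Q z ↔ z.IsInterior ∨
      (¬ z.IsInterior ∧ ∃ w : CauchyCompl d', ¬ w.IsInterior ∧ IsSamePoint z w))
    (T : TopologicalSpace {z // Q z})
    (hT : T = TopologicalSpace.generateFrom {B | ∃ (z : {z // Q z}) (ε : ℝ≥0∞),
      B = {w | (CauchyCompl.quasiDist z.1 w.1 + CauchyCompl.quasiDist w.1 z.1) / 2 < ε}})
    (hl : LocallyCompactSpace {z // Q z})
    (hg : IsGeneralizedDist (CauchyCompl.quasiDist (d := d))) {σ : ℕ → X}
    (hσ : IsForwardCauchy (ofRealDist δ) σ) :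
    IsNicePoint δ σ ∧ IsNicePoint (fun x y => δ y x) σ := by
  subst hd hd'
  have hall : ∀ z, Q z := by
    intro z
    rw [hQ]
    by_cases hz : z.IsInterior
    · exact Or.inl hz
    · have h1 := isForwardCauchy_rep z
      have h2 := h.isForwardCauchy_swap_of_isGeneralizedDist hg h1
      have hs : IsSamePoint z (CauchyCompl.mk _ h2) := ⟨_, h1, h2, mk_rep z, rfl⟩
      exact Or.inr ⟨hz, _, (h.isSamePoint_symmetric hs).not.1 hz, hs⟩
  have h0 : ∀ z : {z // Q z}, (CauchyCompl.quasiDist z.1 z.1 + CauchyCompl.quasiDist z.1 z.1) / 2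
      = 0 := fun z => by
    have := ((hg.eq_iff z.1 z.1).2 rfl).1
    rw [this]
    simp
  refine h.isNicePoint_of_isGeneralizedDist hg (fun z => ?_) hσ
  obtain ⟨ρ, hρ, h1⟩ := exists_subseq_of_locallyCompact
    (fun z w : {z // Q z} =>
      (CauchyCompl.quasiDist z.1 w.1 + CauchyCompl.quasiDist w.1 z.1) / 2) h0
    (fun x y z => by
      rw [← ENNReal.add_div]
      refine ENNReal.div_le_div_right ?_ _
      refine (add_le_add (hg.triangle x.1 y.1 z.1) (hg.triangle z.1 y.1 x.1)).trans_eq ?_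
      ring) hT ⟨z, hall z⟩
  refine ⟨ρ, hρ, fun y hy => ?_⟩
  obtain ⟨w, φ, hφ, hw⟩ := h1 (fun k => ⟨y k, hall _⟩) hy
  exact ⟨w.1, φ, hφ, hw⟩

end LengthDist
end

namespace StandardStationary

variable {n : ℕ} {M : Type*} [TopologicalSpace M] [ChartedSpace (EuclideanSpace ℝ (Fin n)) M]
  [IsManifold (𝓡 n) ∞ M] [T2Space M] [SecondCountableTopology M] [ConnectedSpace M]
  (S : StandardStationary n M)

theorem isPointSimple_of_evenlyPairing (hp : S.ForwardEvenlyPairing ∨ S.BackwardEvenlyPairing) :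
    Causal.IsPointSimple S.chron := by
  have h := S.lengthDist
  rcases hp with hp | hp
  · refine h.isPointSimple_of_evenlyPairing S.distPlus_eq S.distMinus_eq_ofRealDist S.chron_eq
      fun z hz hzw => ?_
    simp only [S.distMinus_eq]
    exact hp z ⟨hz, fun hs => hzw (hs.2.imp fun w hw => hw.2)⟩
  · rw [S.chron_eq, ← h.isPointSimple_swap_iff]
    refine h.swap.isPointSimple_of_evenlyPairing S.distMinus_eq_ofRealDist S.distPlus_eq rfl
      fun w hw hzw => ?_
    refine hp w ⟨hw, fun hs => hzw ?_⟩
    obtain ⟨-, z, -, σ, h1, h2, h3, h4⟩ := hs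
    exact ⟨z, σ, h2, h1, h4, h3⟩

theorem cBoundary_isTIP (P F : Set (ℝ × M)) (hm : (P, F) ∈ Causal.cBoundary S.chron)
    (hP : P ≠ ∅) : Causal.IsTIP S.chron P := by
  rw [S.chron_eq] at hm ⊢
  exact S.lengthDist.isTIP_of_mem_cBoundary hm hP

theorem cBoundary_isTIF (P F : Set (ℝ × M)) (hm : (P, F) ∈ Causal.cBoundary S.chron)
    (hF : F ≠ ∅) : Causal.IsTIP (fun p q => S.chron q p) F := by
  rw [S.chron_eq] at hm ⊢
  exact S.lengthDist.isTIF_of_mem_cBoundary hm hF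

theorem causality_lines (p : Set (ℝ × M) × Set (ℝ × M)) (hp : p ∈ Causal.cBoundary S.chron) :
    ((∃ (Ω : ℝ) (z : S.CauchyPlus) (w : S.CauchyMinus), z ∈ S.cauchyBdrySymm ∧
        S.SamePoint z w ∧ p.1 = pastOf (S.dPlusOf Ω z.rep) ∧
        p.2 = futureOf (S.dMinusOf Ω w.rep)) → IsTimelikeLine p) ∧
    ((p.1 = ∅ ∨ p.2 = ∅) → IsHorismoticLine p) ∧
    ((¬ ∃ (Ω : ℝ) (z : S.CauchyPlus) (w : S.CauchyMinus), z ∈ S.cauchyBdrySymm ∧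
        S.SamePoint z w ∧ p.1 = pastOf (S.dPlusOf Ω z.rep) ∧
        p.2 = futureOf (S.dMinusOf Ω w.rep)) → p.1 ≠ ∅ → p.2 ≠ ∅ →
      IsLocallyHorismoticLine p) := by
  have h := S.lengthDist
  rw [S.chron_eq] at hp
  have hiff := h.isSymmPair_iff (P := p.1) (F := p.2) S.distPlus_eq S.distMinus_eq_ofRealDist hp
  exact ⟨fun hs => h.isTimelikeLine_of_isSymmPair (hiff.2 hs),
    fun he => h.isHorismoticLine_of_eq_empty hp.1 he,
    fun hs h1 h2 => h.isLocallyHorismoticLine (Causal.mem_cCompletion_of_left hp.1 h1 h2)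
      fun hsp => hs (hiff.1 hsp)⟩

theorem isSimple_of_locallyCompact (hl : LocallyCompactSpace S.CauchySymm)
    (hg : IsGeneralizedDist (CauchyCompl.quasiDist (d := S.distPlus))) :
    Causal.IsSimple S.chron := by
  rw [S.chron_eq]
  exact S.lengthDist.isSimple_of_isNicePoint fun σ hσ =>
    S.lengthDist.isNicePoint_of_locallyCompact S.distPlus_eq S.distMinus_eq_ofRealDist
      (Q := fun z => z.IsInterior ∨ z ∈ S.cauchyBdrySymm) (fun z => Iff.rfl)
      (inferInstanceAs (TopologicalSpace S.CauchySymm)) rfl hl hg hσ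

theorem existsUnique_components (hs : Causal.IsPointSimple S.chron) :
    (∀ P, Causal.IsIP S.chron P → ∃! F, (P, F) ∈ Causal.cCompletion S.chron) ∧
      ∀ F, Causal.IsIP (fun p q => S.chron q p) F → ∃! P, (P, F) ∈ Causal.cCompletion S.chron := by
  rw [S.chron_eq] at hs ⊢
  exact ⟨fun P => S.lengthDist.existsUnique_right hs, fun F => S.lengthDist.existsUnique_left hs⟩

theorem isClosed_boundaries : IsClosed S.futureBdry ∧ IsClosed S.pastBdry := by
  unfold futureBdry pastBdry
  rw [S.chron_eq]
  exact ⟨S.lengthDist.isClosed_boundary, S.lengthDist.isClosed_boundary_swap⟩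

end StandardStationary

/-! ### Non-unique partners from distance estimates on a plane with three lanes. -/

section
variable {X : Type*} {δ : X → X → ℝ}

/-- A primitive of `sin²`. -/
def sinSqPrimitive (y : ℝ) : ℝ := y / 2 - Real.sin (2 * y) / 4

/-- Estimates for a distance on a plane with coordinates `a`, `b`, for which one can move quickly
to the right on the lane `b = 0`, and to the left on the two lanes `b = ±π`. -/
structure LaneEstimates (δ : X → X → ℝ) (a b : X → ℝ) (pt : ℝ → ℝ → X) : Prop where
  fst_pt : ∀ x y, a (pt x y) = x
  snd_pt : ∀ x y, b (pt x y) = y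
  pt_eta : ∀ p, pt (a p) (b p) = p
  le_cos_add : ∀ p q,
    Real.cos (b p) - Real.cos (b q) + (Real.exp (-a q) - Real.exp (-a p)) ≤ δ p q
  le_cos_sub : ∀ p q,
    Real.cos (b p) - Real.cos (b q) - (Real.exp (-a q) - Real.exp (-a p)) ≤ δ p q
  abs_le : ∀ p q, |sinSqPrimitive (b q) - sinSqPrimitive (b p)| ≤ δ p q
  le_right : ∀ R p q, (1 - Real.cos (b q)) * Real.arctan (a q - R) -
    (1 - Real.cos (b p)) * Real.arctan (a p - R) ≤ 4 * δ p q
  le_left : ∀ R p q, (1 + Real.cos (b p)) * Real.arctan (a p - R) -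
    (1 + Real.cos (b q)) * Real.arctan (a q - R) ≤ 4 * δ p q
  vertical : ∀ x y y', δ (pt x y) (pt x y') ≤ (1 + Real.exp (-x)) * |y' - y|
  right : ∀ x x', x ≤ x' → δ (pt x 0) (pt x' 0) ≤ Real.exp (-x) - Real.exp (-x')
  left : ∀ κ : ℝ, |κ| = 1 → ∀ x x', x ≤ x' →
    δ (pt x' (κ * Real.pi)) (pt x (κ * Real.pi)) ≤ Real.exp (-x) - Real.exp (-x')
  cross : ∀ κ : ℝ, |κ| = 1 → ∀ x s, 0 < s → s ≤ Real.pi / 2 →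
    δ (pt x (κ * s)) (pt x (κ * (Real.pi - s))) ≤ 2 + Real.pi * Real.exp (-x) / Real.sin s

theorem tendsto_exp_neg_nat : Tendsto (fun n : ℕ => Real.exp (-(n : ℝ))) atTop (𝓝 0) :=
  Real.tendsto_exp_neg_atTop_nhds_zero.comp tendsto_natCast_atTop_atTop

theorem cos_mul_pi_of_abs_eq_one {κ : ℝ} (hκ : |κ| = 1) : Real.cos (κ * Real.pi) = -1 := by
  rcases (abs_eq zero_le_one).1 hκ with rfl | rfl <;> simp

namespace LaneEstimates

variable {a b : X → ℝ} {pt : ℝ → ℝ → X} (e : LaneEstimates δ a b pt) (h : LengthDist δ)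
  {σ : ℕ → X} {κ Ω : ℝ}
include e

theorem isForwardCauchy_right : IsForwardCauchy (ofRealDist δ) fun n : ℕ => pt n 0 := by
  rw [LengthDist.isForwardCauchy_iff]
  intro ε hε
  obtain ⟨n₀, hn₀⟩ := eventually_atTop.1 (tendsto_exp_neg_nat.eventually_lt_const hε)
  refine ⟨n₀, fun n m h1 h2 => ?_⟩
  have := e.right n m (by exact_mod_cast h2)
  have := hn₀ n h1
  have := Real.exp_pos (-(m : ℝ))
  linarith

theorem isForwardCauchy_left (hκ : |κ| = 1) :
    IsForwardCauchy (ofRealDist fun x y => δ y x) fun n : ℕ => pt n (κ * Real.pi) := by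
  rw [LengthDist.isForwardCauchy_iff]
  intro ε hε
  obtain ⟨n₀, hn₀⟩ := eventually_atTop.1 (tendsto_exp_neg_nat.eventually_lt_const hε)
  refine ⟨n₀, fun n m h1 h2 => ?_⟩
  have := e.left κ hκ n m (by exact_mod_cast h2)
  have := hn₀ n h1
  have := Real.exp_pos (-(m : ℝ))
  linarith

/-- The way from the lane `b = 0` through `σ n` to the lane `b = κπ` has length almost `2`. In the
two calibrations the terms in `cos (b (σ n))` cancel, while `exp (-a (σ n))` is counted twice; so
the latter must vanish, and the cosine is then determined by the split of the length. -/
theorem tendsto_exp_cos (hκ : |κ| = 1)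
    (h1 : ∀ ε > 0, ∃ k : ℕ, Real.exp (-(k : ℝ)) < ε ∧ ∀ᶠ n in atTop, δ (pt k 0) (σ n) ≤ Ω + ε)
    (h2 : ∀ ε > 0, ∀ᶠ n in atTop, ∃ m : ℕ, Real.exp (-(m : ℝ)) < ε ∧
      δ (σ n) (pt m (κ * Real.pi)) ≤ 2 - Ω + ε) :
    Tendsto (fun n => Real.exp (-a (σ n))) atTop (𝓝 0) ∧
      Tendsto (fun n => Real.cos (b (σ n))) atTop (𝓝 (1 - Ω)) := by
  have key : ∀ ε > 0, ∀ᶠ n in atTop, Real.exp (-a (σ n)) < ε ∧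
      |Real.cos (b (σ n)) - (1 - Ω)| < ε := by
    intro ε hε
    obtain ⟨k, hk, h3⟩ := h1 (ε / 3) (by linarith)
    filter_upwards [h3, h2 (ε / 3) (by linarith)] with n h3 ⟨m, hm, h4⟩
    have h5 := e.le_cos_add (pt k 0) (σ n)
    have h6 := e.le_cos_sub (σ n) (pt m (κ * Real.pi))
    rw [e.fst_pt, e.snd_pt, Real.cos_zero] at h5
    rw [e.fst_pt, e.snd_pt, cos_mul_pi_of_abs_eq_one hκ] at h6
    have := Real.exp_pos (-a (σ n))
    refine ⟨by linarith, abs_lt.2 ⟨by linarith, by linarith⟩⟩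
  constructor
  · rw [Metric.tendsto_atTop']
    intro ε hε
    obtain ⟨N, hN⟩ := eventually_atTop.1 (key ε hε)
    exact ⟨N, fun n hn => by
      rw [Real.dist_eq, sub_zero, abs_of_pos (Real.exp_pos _)]
      exact (hN n hn.le).1⟩
  · rw [Metric.tendsto_atTop']
    intro ε hε
    obtain ⟨N, hN⟩ := eventually_atTop.1 (key ε hε)
    exact ⟨N, fun n hn => (hN n hn.le).2⟩

omit e in
theorem exists_large (h1 : Tendsto (fun n => Real.exp (-a (σ n))) atTop (𝓝 0)) (n : ℕ) (R : ℝ) :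
    ∃ m, n ≤ m ∧ R ≤ a (σ m) := by
  obtain ⟨m, hm, hnm⟩ := ((h1.eventually_lt_const (Real.exp_pos (-R))).and
    (eventually_ge_atTop n)).exists
  rw [Real.exp_lt_exp] at hm
  exact ⟨m, hnm, by linarith⟩

omit e in
theorem three_quarters_lt : (3 / 4 : ℝ) < Real.arctan 1 := by
  rw [Real.arctan_one]
  have := Real.pi_gt_three
  linarith

/-- A forward Cauchy sequence escaping to the right moves from `σ n` at least one unit to the right
at small cost. The estimate `le_right`, centred one unit to the right of `σ n`, bounds this cost
below by a multiple of `1 - cos (b (σ n))`. -/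
theorem tendsto_cos_of_forward (hσ : IsForwardCauchy (ofRealDist δ) σ)
    (h1 : Tendsto (fun n => Real.exp (-a (σ n))) atTop (𝓝 0)) :
    Tendsto (fun n => Real.cos (b (σ n))) atTop (𝓝 1) := by
  rw [Metric.tendsto_atTop]
  intro ε hε
  obtain ⟨n₀, hn₀⟩ := LengthDist.isForwardCauchy_iff.1 hσ (ε / 6) (by linarith)
  refine ⟨n₀, fun n hn => ?_⟩
  obtain ⟨m, hnm, hm⟩ := exists_large h1 n (a (σ n) + 1)
  have h2 := e.le_right (a (σ n) + 1) (σ n) (σ m)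
  have h3 := hn₀ n m hn hnm
  rw [show a (σ n) - (a (σ n) + 1) = -1 by ring, Real.arctan_neg] at h2
  have h4 : 0 ≤ (1 - Real.cos (b (σ m))) * Real.arctan (a (σ m) - (a (σ n) + 1)) :=
    mul_nonneg (by linarith [Real.cos_le_one (b (σ m))]) (Real.arctan_nonneg.2 (by linarith))
  have h5 := Real.cos_le_one (b (σ n))
  have h6 := three_quarters_lt
  rw [Real.dist_eq, abs_of_nonpos (by linarith)]
  nlinarith

theorem tendsto_cos_of_backward (hσ : IsForwardCauchy (ofRealDist fun x y => δ y x) σ)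
    (h1 : Tendsto (fun n => Real.exp (-a (σ n))) atTop (𝓝 0)) :
    Tendsto (fun n => Real.cos (b (σ n))) atTop (𝓝 (-1)) := by
  rw [Metric.tendsto_atTop]
  intro ε hε
  obtain ⟨n₀, hn₀⟩ := LengthDist.isForwardCauchy_iff.1 hσ (ε / 6) (by linarith)
  refine ⟨n₀, fun n hn => ?_⟩
  obtain ⟨m, hnm, hm⟩ := exists_large h1 n (a (σ n) + 1)
  have h2 := e.le_left (a (σ n) + 1) (σ m) (σ n)
  have h3 := hn₀ n m hn hnm
  rw [show a (σ n) - (a (σ n) + 1) = -1 by ring, Real.arctan_neg] at h2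
  have h4 : 0 ≤ (1 + Real.cos (b (σ m))) * Real.arctan (a (σ m) - (a (σ n) + 1)) :=
    mul_nonneg (by linarith [Real.neg_one_le_cos (b (σ m))]) (Real.arctan_nonneg.2 (by linarith))
  have h5 := Real.neg_one_le_cos (b (σ n))
  have h6 := three_quarters_lt
  rw [Real.dist_eq, abs_of_nonneg (by linarith)]
  nlinarith

include h

theorem inDist_right_le (y : ℝ) (x : ℝ) :
    inDist δ (fun n : ℕ => pt n 0) (pt x y) ≤ (1 + Real.exp (-x)) * |y| + Real.exp (-x) := by
  have hc := e.isForwardCauchy_right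
  have h1 := h.inDist_le hc (pt x y) (pt x 0)
  have h2 := e.vertical x y 0
  rw [zero_sub, abs_neg] at h2
  have h3 : inDist δ (fun n : ℕ => pt n 0) (pt x 0) ≤ Real.exp (-x) := by
    refine le_of_tendsto (h.tendsto_inDist hc _) ?_
    obtain ⟨N, hN⟩ := exists_nat_ge x
    filter_upwards [eventually_ge_atTop N] with n hn
    have := e.right x n (hN.trans (by exact_mod_cast hn))
    have := Real.exp_pos (-(n : ℝ))
    linarith
  linarith

theorem inDist_right_le_of_tendsto (h1 : Tendsto (fun n => Real.exp (-a (σ n))) atTop (𝓝 0))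
    (h2 : Tendsto (fun n => b (σ n)) atTop (𝓝 0)) (hσ : IsForwardCauchy (ofRealDist δ) σ) (x : X) :
    inDist δ (fun n : ℕ => pt n 0) x ≤ inDist δ σ x := by
  have h3 : Tendsto (fun n => (1 + Real.exp (-a (σ n))) * |b (σ n)| + Real.exp (-a (σ n)))
      atTop (𝓝 0) := by
    have := ((h1.const_add 1).mul h2.abs).add h1
    simpa using this
  have h4 := (h.tendsto_inDist hσ x).add h3
  rw [add_zero] at h4
  refine ge_of_tendsto' h4 fun n => ?_
  have h5 := h.inDist_le e.isForwardCauchy_right x (σ n)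
  have h6 := e.inDist_right_le h (b (σ n)) (a (σ n))
  rw [e.pt_eta] at h6
  linarith

/-- Leave the first lane up to height `s`, cross, and enter the other lane from distance `s`. The
two vertical pieces cost at most `2 s` each, and the excess of the crossing over `2` tends to `0`
with `exp (-n)`. -/
theorem exists_dist_le (hκ : |κ| = 1) {ε : ℝ} (hε : 0 < ε) :
    ∀ᶠ n : ℕ in atTop, δ (pt n 0) (pt n (κ * Real.pi)) ≤ 2 + ε := by
  obtain ⟨s, hs0, hs1, hs2⟩ : ∃ s : ℝ, 0 < s ∧ s ≤ Real.pi / 2 ∧ s ≤ ε / 8 :=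
    ⟨min (Real.pi / 2) (ε / 8), lt_min (by positivity) (by positivity), min_le_left _ _,
      min_le_right _ _⟩
  have hsin : 0 < Real.sin s := Real.sin_pos_of_pos_of_lt_pi hs0 (by linarith [Real.pi_pos])
  have h1 : Tendsto (fun n : ℕ => 4 * s + Real.pi * Real.exp (-(n : ℝ)) / Real.sin s) atTop
      (𝓝 (4 * s + Real.pi * 0 / Real.sin s)) :=
    ((tendsto_exp_neg_nat.const_mul _).div_const _).const_add _
  rw [mul_zero, zero_div, add_zero] at h1
  filter_upwards [h1.eventually_lt_const (show 4 * s < ε by linarith)] with n hn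
  have h2 := e.vertical n 0 (κ * s)
  have h3 := e.cross κ hκ n s hs0 hs1
  have h4 := e.vertical n (κ * (Real.pi - s)) (κ * Real.pi)
  rw [sub_zero, abs_mul, hκ, one_mul, abs_of_pos hs0] at h2
  rw [← mul_sub, sub_sub_cancel, abs_mul, hκ, one_mul, abs_of_pos hs0] at h4
  have h5 := h.triangle (pt n 0) (pt n (κ * s)) (pt n (κ * Real.pi))
  have h6 := h.triangle (pt n (κ * s)) (pt n (κ * (Real.pi - s))) (pt n (κ * Real.pi))
  have h7 : Real.exp (-(n : ℝ)) ≤ 1 := Real.exp_le_one_iff.2 (by simp)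
  nlinarith

theorem precedes_lane (hκ : |κ| = 1) : Causal.Precedes (distRel δ)
    (pastPoint δ 0 fun n : ℕ => pt n 0) (futurePoint δ 2 fun n : ℕ => pt n (κ * Real.pi)) := by
  intro p hp q hq
  rw [mem_pastPoint] at hp
  rw [mem_futurePoint] at hq
  unfold distRel
  suffices H : δ p.2 q.2 ≤ inDist δ (fun n : ℕ => pt n 0) p.2 + 2 +
      inDist (fun x y => δ y x) (fun n : ℕ => pt n (κ * Real.pi)) q.2 by linarith
  refine le_of_forall_pos_le_add fun ε hε => ?_
  have h1 := ((h.tendsto_inDist e.isForwardCauchy_right p.2).add_const (2 + ε)).add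
    (h.swap.tendsto_inDist (e.isForwardCauchy_left hκ) q.2)
  refine (ge_of_tendsto h1 ?_).trans_eq (by ring)
  filter_upwards [e.exists_dist_le h hκ hε] with n hn
  have := h.triangle p.2 (pt n 0) q.2
  have := h.triangle (pt n 0) (pt n (κ * Real.pi)) q.2
  linarith

/-- A larger past set preceding the same future comes from some `(Ω, σ)`. The estimates give `cos (b
(σ n)) → 1 - Ω`, and since `σ` is forward Cauchy the limit is `1`, so `Ω = 0`. Then `b (σ n) → 0`,
which makes the distance to the end of the lane at most that to the end of `σ`. -/
theorem isMaximalIPIn_right (hκ : |κ| = 1) : Causal.IsMaximalIPIn (distRel δ)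
    (pastPoint δ 0 fun n : ℕ => pt n 0)
    (Causal.commonPast (distRel δ) (futurePoint δ 2 fun n : ℕ => pt n (κ * Real.pi))) := by
  have hz := e.isForwardCauchy_right
  have hw := e.isForwardCauchy_left hκ
  refine ⟨h.isIP_pastPoint hz 0, (Causal.subset_commonPast_iff h.isChronological
    (h.isIP_pastPoint hz 0)).2 (e.precedes_lane h hκ), fun P' hP' h1 h2 => ?_⟩
  rw [Causal.subset_commonPast_iff h.isChronological hP'] at h2
  obtain ⟨Ω, σ, hσ, rfl⟩ := h.exists_pastPoint hP' h2 (h.isIF_futurePoint hw 2).nonempty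
  have h3 : ∀ x, inDist δ σ x ≤ Ω + inDist δ (fun n : ℕ => pt n 0) x := fun x => by
    have := EReal.coe_le_coe_iff.1 (pastOf_subset_pastOf_iff.1 h1 x)
    linarith
  have h4 : ∀ x y, δ x y ≤ 2 - Ω + inDist δ σ x +
      inDist (fun x y => δ y x) (fun n : ℕ => pt n (κ * Real.pi)) y := by
    intro x y
    refine le_of_forall_pos_le_add fun ε hε => ?_
    have := h2 (Ω - inDist δ σ x - ε / 2, x) (mem_pastPoint.2 (by simp only; linarith))
      (2 + inDist (fun x y => δ y x) (fun n : ℕ => pt n (κ * Real.pi)) y + ε / 2, y)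
      (mem_futurePoint.2 (by simp only; linarith))
    unfold distRel at this
    simp only at this
    linarith
  have h5 : ∀ ε > 0, ∃ k : ℕ, Real.exp (-(k : ℝ)) < ε ∧
      ∀ᶠ n in atTop, δ (pt k 0) (σ n) ≤ Ω + ε := by
    intro ε hε
    obtain ⟨k, hk1, hk2⟩ := ((tendsto_exp_neg_nat.eventually_lt_const hε).and
      ((h.tendsto_inDist_self hz).eventually_lt_const hε)).exists
    refine ⟨k, hk1, ?_⟩
    have := h3 (pt k 0)
    filter_upwards [(h.tendsto_inDist hσ (pt k 0)).eventually_lt_const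
      (show inDist δ σ (pt k 0) < Ω + ε by linarith)] with n hn using hn.le
  have h6 : ∀ ε > 0, ∀ᶠ n in atTop, ∃ m : ℕ, Real.exp (-(m : ℝ)) < ε ∧
      δ (σ n) (pt m (κ * Real.pi)) ≤ 2 - Ω + ε := by
    intro ε hε
    filter_upwards [(h.tendsto_inDist_self hσ).eventually_lt_const (half_pos hε)] with n hn
    obtain ⟨m, hm1, hm2⟩ := ((tendsto_exp_neg_nat.eventually_lt_const hε).and
      ((h.swap.tendsto_inDist_self hw).eventually_lt_const (half_pos hε))).exists
    have := h4 (σ n) (pt m (κ * Real.pi))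
    exact ⟨m, hm1, by linarith⟩
  obtain ⟨h7, h8⟩ := e.tendsto_exp_cos hκ h5 h6
  have h9 := e.tendsto_cos_of_forward hσ h7
  have hΩ : Ω = 0 := by linarith [tendsto_nhds_unique h8 h9]
  subst hΩ
  -- The limit of the cosine does not distinguish the multiples of `2π`; the monotone primitive of
  -- `sin²` does.
  have h10 : Tendsto (fun n => sinSqPrimitive (b (σ n))) atTop (𝓝 0) := by
    rw [Metric.tendsto_atTop]
    intro ε hε
    obtain ⟨k, -, hk⟩ := h5 (ε / 2) (half_pos hε)
    obtain ⟨N, hN⟩ := eventually_atTop.1 hk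
    refine ⟨N, fun n hn => ?_⟩
    have h11 := e.abs_le (pt k 0) (σ n)
    have h12 : sinSqPrimitive 0 = 0 := by simp [sinSqPrimitive]
    rw [e.snd_pt, h12] at h11
    rw [Real.dist_eq]
    linarith [hN n hn]
  have h11 : Tendsto (fun n => Real.sin (b (σ n))) atTop (𝓝 0) := by
    have h12 : Tendsto (fun n => 1 - Real.cos (b (σ n)) ^ 2) atTop (𝓝 (1 - 1 ^ 2)) :=
      (h9.pow 2).const_sub 1
    rw [one_pow, sub_self] at h12
    have h13 := h12.sqrt
    rw [Real.sqrt_zero] at h13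
    refine (tendsto_zero_iff_abs_tendsto_zero _).2 (h13.congr fun n => ?_)
    rw [← Real.abs_sin_eq_sqrt_one_sub_cos_sq]
    rfl
  -- The identity `b = 2 · sinSqPrimitive b + sin b · cos b` is used.
  have h12 : Tendsto (fun n => b (σ n)) atTop (𝓝 0) := by
    have h13 := (h10.const_mul 2).add (h11.mul h9)
    simp only [mul_zero, zero_mul, add_zero] at h13
    refine h13.congr fun n => ?_
    rw [sinSqPrimitive, Real.sin_two_mul]
    ring
  refine Subset.antisymm ?_ h1
  refine pastOf_subset_pastOf_iff.2 fun x => EReal.coe_le_coe_iff.2 ?_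
  linarith [e.inDist_right_le_of_tendsto h h7 h12 hσ x]

/-- For an IF containing both futures the estimates force `Ω = 2`, and its sequence `τ` comes within
cost `1` of both outer lanes. The values `±π / 2` of `sinSqPrimitive` on these lanes differ by more
than `2`. -/
theorem not_precedes_of_subset {F : Set (ℝ × X)} (hF : Causal.IsIP (fun p q => distRel δ q p) F)
    (hPF : Causal.Precedes (distRel δ) (pastPoint δ 0 fun n : ℕ => pt n 0) F) :
    ¬ ∀ κ : ℝ, |κ| = 1 → (futurePoint δ 2 fun n : ℕ => pt n (κ * Real.pi)) ⊆ F := by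
  intro hsub
  have hz := e.isForwardCauchy_right
  obtain ⟨Ω, τ, hτ, rfl⟩ := h.exists_futurePoint hF hPF (h.isIP_pastPoint hz 0).nonempty
  have h1 : ∀ κ : ℝ, |κ| = 1 → ∀ x, inDist (fun x y => δ y x) τ x ≤
      2 - Ω + inDist (fun x y => δ y x) (fun n : ℕ => pt n (κ * Real.pi)) x := fun κ hκ x => by
    refine le_of_forall_pos_le_add fun ε hε => ?_
    have hm : ((2 + inDist (fun x y => δ y x) (fun n : ℕ => pt n (κ * Real.pi)) x + ε, x) : ℝ × X) ∈
        futurePoint δ 2 fun n : ℕ => pt n (κ * Real.pi) :=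
      mem_futurePoint.2 (by simp only; linarith)
    have := mem_futurePoint.1 (hsub κ hκ hm)
    simp only at this
    linarith
  have h2 : ∀ x y, δ x y ≤ Ω + inDist δ (fun n : ℕ => pt n 0) x +
      inDist (fun x y => δ y x) τ y := by
    intro x y
    refine le_of_forall_pos_le_add fun ε hε => ?_
    have := hPF (0 - inDist δ (fun n : ℕ => pt n 0) x - ε / 2, x)
      (mem_pastPoint.2 (by simp only; linarith)) (Ω + inDist (fun x y => δ y x) τ y + ε / 2, y)
      (mem_futurePoint.2 (by simp only; linarith))
    unfold distRel at this
    simp only at this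
    linarith
  have h3 : ∀ ε > 0, ∃ k : ℕ, Real.exp (-(k : ℝ)) < ε ∧
      ∀ᶠ n in atTop, δ (pt k 0) (τ n) ≤ Ω + ε := by
    intro ε hε
    obtain ⟨k, hk1, hk2⟩ := ((tendsto_exp_neg_nat.eventually_lt_const hε).and
      ((h.tendsto_inDist_self hz).eventually_lt_const (half_pos hε))).exists
    refine ⟨k, hk1, ?_⟩
    filter_upwards [(h.swap.tendsto_inDist_self hτ).eventually_lt_const (half_pos hε)] with n hn
    linarith [h2 (pt k 0) (τ n)]
  have h4 : ∀ κ : ℝ, |κ| = 1 → ∀ ε > 0, ∀ᶠ n in atTop, ∃ m : ℕ, Real.exp (-(m : ℝ)) < ε ∧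
      δ (τ n) (pt m (κ * Real.pi)) ≤ 2 - Ω + ε := by
    intro κ hκ ε hε
    obtain ⟨m, hm1, hm2⟩ := ((tendsto_exp_neg_nat.eventually_lt_const hε).and
      ((h.swap.tendsto_inDist_self (e.isForwardCauchy_left hκ)).eventually_lt_const hε)).exists
    have h5 := h1 κ hκ (pt m (κ * Real.pi))
    filter_upwards [(h.swap.tendsto_inDist hτ (pt m (κ * Real.pi))).eventually_lt_const
      (show inDist (fun x y => δ y x) τ (pt m (κ * Real.pi)) < 2 - Ω + ε by linarith)] with n hn
    exact ⟨m, hm1, hn.le⟩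
  obtain ⟨h5, h6⟩ := e.tendsto_exp_cos abs_one h3 (h4 1 abs_one)
  have h7 := e.tendsto_cos_of_backward hτ h5
  have hΩ : Ω = 2 := by linarith [tendsto_nhds_unique h6 h7]
  subst hΩ
  obtain ⟨n, ⟨m, -, h8⟩, m', -, h9⟩ := ((h4 1 abs_one 1 one_pos).and
    (h4 (-1) (by simp) 1 one_pos)).exists
  have h10 := (_root_.abs_le.1 ((e.abs_le _ _).trans h8)).2
  have h11 := (_root_.abs_le.1 ((e.abs_le _ _).trans h9)).1
  rw [e.snd_pt] at h10 h11
  have h12 : sinSqPrimitive (1 * Real.pi) = Real.pi / 2 := by simp [sinSqPrimitive]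
  have h13 : sinSqPrimitive (-1 * Real.pi) = -(Real.pi / 2) := by
    simp [sinSqPrimitive, neg_div]
  rw [h12] at h10
  rw [h13] at h11
  linarith [Real.pi_gt_three]

/-- The past of the end of the lane `b = 0` has two different partners. -/
theorem exists_nonunique : ∃ P F F' : Set (ℝ × X), P ≠ ∅ ∧ F ≠ ∅ ∧ F' ≠ ∅ ∧ F ≠ F' ∧
    (P, F) ∈ Causal.cBoundary (distRel δ) ∧ (P, F') ∈ Causal.cBoundary (distRel δ) := by
  have hz := e.isForwardCauchy_right
  have hP := h.isIP_pastPoint hz 0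
  have hmax : ∀ κ : ℝ, |κ| = 1 → ∃ F, (futurePoint δ 2 fun n : ℕ => pt n (κ * Real.pi)) ⊆ F ∧
      Causal.SRelated (distRel δ) (pastPoint δ 0 fun n : ℕ => pt n 0) F := by
    intro κ hκ
    have hF := h.isIF_futurePoint (e.isForwardCauchy_left hκ) 2
    obtain ⟨F, h1, h2⟩ := h.isChronological.swap.exists_isMaximalIPIn hF
      ((Causal.subset_commonFuture_iff h.isChronological hF).2 (e.precedes_lane h hκ))
    obtain ⟨-, -, h4⟩ := e.isMaximalIPIn_right h hκ
    have h5 := (Causal.subset_commonFuture_iff h.isChronological h2.1).1 h2.2.1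
    -- A larger future set has a smaller common past, so the past set remains maximal.
    refine ⟨F, h1, h2, hP, (Causal.subset_commonPast_iff h.isChronological hP).2 h5,
      fun P' hP' h6 h7 => h4 P' hP' h6 ?_⟩
    rw [Causal.subset_commonPast_iff h.isChronological hP'] at h7 ⊢
    exact fun p hp q hq => h7 p hp q (h1 hq)
  obtain ⟨F, h1, h2⟩ := hmax 1 abs_one
  obtain ⟨F', h1', h2'⟩ := hmax (-1) (by simp)
  have hne : F ≠ F' := by
    rintro rfl
    refine e.not_precedes_of_subset h h2.1.1
      ((Causal.subset_commonFuture_iff h.isChronological h2.1.1).1 h2.1.2.1) fun κ hκ => ?_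
    rcases (abs_eq zero_le_one).1 hκ with rfl | rfl
    · exact h1
    · exact h1'
  have hT : Causal.IsTIP (distRel δ) (pastPoint δ 0 fun n : ℕ => pt n 0) := by
    refine ⟨hP, ?_⟩
    rintro ⟨v, hv⟩
    rw [hv] at h2 h2'
    exact hne (((h.mem_cCompletion_past_iff v).1 (Or.inl h2)).trans
      ((h.mem_cCompletion_past_iff v).1 (Or.inl h2')).symm)
  exact ⟨_, F, F', hP.ne_empty, h2.1.1.ne_empty, h2'.1.1.ne_empty, hne,
    Causal.mem_cBoundary_of_isTIP (Or.inl h2) hT, Causal.mem_cBoundary_of_isTIP (Or.inl h2') hT⟩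

end LaneEstimates
end

/-! ### The plane with three lanes as a standard stationary spacetime. -/

section
variable {E : Type*} [NormedAddCommGroup E] [NormedSpace ℝ E]

/-- On a vector space the trivializations of the tangent bundle are identities, so a section is
smooth if the corresponding map is. -/
theorem contMDiff_section_hom (f : ∀ x : E, TangentSpace 𝓘(ℝ, E) x →L[ℝ] ℝ)
    (hf : ContDiff ℝ ∞ (show E → E →L[ℝ] ℝ from f)) :
    ContMDiff 𝓘(ℝ, E) (𝓘(ℝ, E).prod 𝓘(ℝ, E →L[ℝ] ℝ)) ∞
    (fun x => Bundle.TotalSpace.mk' (E →L[ℝ] ℝ)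
      (E := fun x : E => TangentSpace 𝓘(ℝ, E) x →L[ℝ] ℝ) x (f x)) := by
  intro x
  rw [Bundle.contMDiffAt_section]
  convert! hf.contMDiff.contMDiffAt (x := x) using 1
  ext y v
  rw [hom_trivializationAt_apply]
  simp [ContinuousLinearMap.inCoordinates]
  rfl

theorem contMDiff_section_bilin
    (f : ∀ x : E, TangentSpace 𝓘(ℝ, E) x →L[ℝ] TangentSpace 𝓘(ℝ, E) x →L[ℝ] ℝ)
    (hf : ContDiff ℝ ∞ (show E → E →L[ℝ] E →L[ℝ] ℝ from f)) :
    ContMDiff 𝓘(ℝ, E) (𝓘(ℝ, E).prod 𝓘(ℝ, E →L[ℝ] E →L[ℝ] ℝ)) ∞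
    (fun x => Bundle.TotalSpace.mk' (E →L[ℝ] E →L[ℝ] ℝ)
      (E := fun x : E => TangentSpace 𝓘(ℝ, E) x →L[ℝ] TangentSpace 𝓘(ℝ, E) x →L[ℝ] ℝ) x (f x)) := by
  intro x
  rw [Bundle.contMDiffAt_section]
  convert! hf.contMDiff.contMDiffAt (x := x) using 1
  ext y v w
  rw [hom_trivializationAt_apply]
  simp [ContinuousLinearMap.inCoordinates]
  have h : y ∈ (trivializationAt (E →L[ℝ] ℝ)
      (fun x : E => TangentSpace 𝓘(ℝ, E) x →L[ℝ] ℝ) x).baseSet := by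
    exact ⟨mem_univ y, mem_univ y⟩
  refine (congrArg (fun L : E →L[ℝ] ℝ => L w) ((Bundle.Trivialization.linearMapAt_apply _ _).trans
    (if_pos h))).trans ?_
  rw [hom_trivializationAt_apply]
  simp [ContinuousLinearMap.inCoordinates]
  rfl

end

section
open ContinuousLinearMap

/-- The conformal factor of the metric of the lane plane. -/
def laneFactor (x : ℝ) : ℝ := 1 + Real.exp (-x)

theorem one_lt_laneFactor (x : ℝ) : 1 < laneFactor x := by
  unfold laneFactor
  linarith [Real.exp_pos (-x)]

/-- The bilinear form `(1 + e⁻ˣ)² (dx² + dy²) - cos² y dx²`. -/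
def laneMetric (p : EuclideanSpace ℝ (Fin 2)) :
    EuclideanSpace ℝ (Fin 2) →L[ℝ] EuclideanSpace ℝ (Fin 2) →L[ℝ] ℝ :=
  (laneFactor (p 0) ^ 2 - Real.cos (p 1) ^ 2) •
      (EuclideanSpace.proj (𝕜 := ℝ) (0 : Fin 2)).smulRight (EuclideanSpace.proj (0 : Fin 2)) +
    (laneFactor (p 0) ^ 2) •
      (EuclideanSpace.proj (𝕜 := ℝ) (1 : Fin 2)).smulRight (EuclideanSpace.proj (1 : Fin 2))

theorem laneMetric_apply (p v w : EuclideanSpace ℝ (Fin 2)) : laneMetric p v w =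
    (laneFactor (p 0) ^ 2 - Real.cos (p 1) ^ 2) * (v 0 * w 0) +
      laneFactor (p 0) ^ 2 * (v 1 * w 1) := by
  simp [laneMetric]

/-- The one-form `-cos y dx`. -/
def laneForm (p : EuclideanSpace ℝ (Fin 2)) : EuclideanSpace ℝ (Fin 2) →L[ℝ] ℝ :=
  (-Real.cos (p 1)) • EuclideanSpace.proj (𝕜 := ℝ) (0 : Fin 2)

theorem laneForm_apply (p v : EuclideanSpace ℝ (Fin 2)) :
    laneForm p v = -Real.cos (p 1) * v 0 := by
  simp [laneForm]

theorem contDiff_coord (i : Fin 2) : ContDiff ℝ ∞ fun p : EuclideanSpace ℝ (Fin 2) => p i :=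
  (EuclideanSpace.proj (𝕜 := ℝ) i).contDiff

theorem contDiff_laneMetric : ContDiff ℝ ∞ laneMetric := by
  have h0 := contDiff_coord 0
  have h1 := contDiff_coord 1
  have h2 : ContDiff ℝ ∞ fun p : EuclideanSpace ℝ (Fin 2) => (1 + Real.exp (-p 0)) ^ 2 :=
    (contDiff_const.add h0.neg.exp).pow 2
  refine contDiff_clm_apply_iff.2 fun v => contDiff_clm_apply_iff.2 fun w => ?_
  simp only [laneMetric_apply, laneFactor]
  exact ((h2.sub (h1.cos.pow 2)).mul contDiff_const).add (h2.mul contDiff_const)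

theorem contDiff_laneForm : ContDiff ℝ ∞ laneForm :=
  (contDiff_coord 1).cos.neg.smul contDiff_const

theorem laneFactor_sq_sub_le (p v : EuclideanSpace ℝ (Fin 2)) :
    (laneFactor (p 0) ^ 2 - 1) * ‖v‖ ^ 2 ≤ laneMetric p v v := by
  rw [laneMetric_apply, EuclideanSpace.real_norm_sq_eq, Fin.sum_univ_two]
  nlinarith [Real.cos_sq_le_one (p 1), sq_nonneg (v 0), sq_nonneg (v 1)]

theorem laneFactor_sq_sub_pos (x : ℝ) : 0 < laneFactor x ^ 2 - 1 := by
  nlinarith [one_lt_laneFactor x]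

/-- The plane with the Fermat metric `(1 + e⁻ˣ) √(dx² + dy²) - cos y dx`. -/
def lanePlane : StandardStationary 2 (EuclideanSpace ℝ (Fin 2)) where
  g₀ :=
    { inner := fun p => laneMetric p
      symm := fun p v w => by
        refine (laneMetric_apply p v w).trans ((laneMetric_apply p w v).trans ?_).symm
        ring
      pos := fun p v hv => by
        have h1 : 0 < ‖(show EuclideanSpace ℝ (Fin 2) from v)‖ := norm_pos_iff.2 hv
        exact lt_of_lt_of_le (mul_pos (laneFactor_sq_sub_pos (p 0)) (pow_pos h1 2))
          (laneFactor_sq_sub_le p v)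
      isVonNBounded := fun p => by
        have h := laneFactor_sq_sub_pos (p 0)
        refine (NormedSpace.isVonNBounded_ball ℝ (EuclideanSpace ℝ (Fin 2))
          (1 / (laneFactor (p 0) ^ 2 - 1) + 1)).subset fun v hv => ?_
        have h1 : laneMetric p v v < 1 := hv
        have h2 := (laneFactor_sq_sub_le p v).trans_lt h1
        refine mem_ball_zero_iff.2 ?_
        have h3 : ‖(show EuclideanSpace ℝ (Fin 2) from v)‖ ^ 2 < 1 / (laneFactor (p 0) ^ 2 - 1) := by
          rw [lt_div_iff₀ h]
          linarith
        change ‖(show EuclideanSpace ℝ (Fin 2) from v)‖ < _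
        nlinarith [sq_nonneg (‖(show EuclideanSpace ℝ (Fin 2) from v)‖ - 1)]
      contMDiff := contMDiff_section_bilin laneMetric contDiff_laneMetric }
  oneForm := fun p => laneForm p
  smooth_oneForm := contMDiff_section_hom laneForm contDiff_laneForm
  Λ := fun _ => 1
  smooth_Λ := contMDiff_const
  Λ_pos := fun _ => one_pos

/-- The term `cos² y dx²` subtracted in `laneMetric` is the square of the one-form and cancels under
the root. -/
theorem fermatPlus_lanePlane (p v : EuclideanSpace ℝ (Fin 2)) : lanePlane.fermatPlus p v =
    laneFactor (p 0) * √(v 0 ^ 2 + v 1 ^ 2) - Real.cos (p 1) * v 0 := by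
  change √(laneMetric p v v + laneForm p v ^ 2) + laneForm p v = _
  rw [laneMetric_apply, laneForm_apply, show (laneFactor (p 0) ^ 2 - Real.cos (p 1) ^ 2) *
    (v 0 * v 0) + laneFactor (p 0) ^ 2 * (v 1 * v 1) + (-Real.cos (p 1) * v 0) ^ 2 =
    laneFactor (p 0) ^ 2 * (v 0 ^ 2 + v 1 ^ 2) by ring, Real.sqrt_mul (sq_nonneg _),
    Real.sqrt_sq (zero_le_one.trans (one_lt_laneFactor _).le)]
  ring

end

/-! ### Lower bounds by calibrations and upper bounds by explicit curves. -/

section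

theorem cauchy_schwarz_plane {a b h v w : ℝ} (hh : 0 ≤ h) (hab : a ^ 2 + b ^ 2 ≤ h ^ 2) :
    a * v + b * w ≤ h * √(v ^ 2 + w ^ 2) := by
  rw [← Real.sqrt_sq hh, ← Real.sqrt_mul (sq_nonneg h)]
  refine Real.le_sqrt_of_sq_le ?_
  nlinarith [sq_nonneg (a * w - b * v), sq_nonneg v, sq_nonneg w]

/-- Calibration by `ψ` with `dψ = A dx + B dy`: by Cauchy–Schwarz the condition `hAB` implies `dψ ≤
F⁺`, the shift by `cos y` accounting for the one-form. -/
theorem sub_le_dist_lanePlane {ψ A B : EuclideanSpace ℝ (Fin 2) → ℝ} (hψ : ContDiff ℝ 1 ψ)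
    (hd : ∀ p, HasFDerivAt ψ (A p • EuclideanSpace.proj (𝕜 := ℝ) (0 : Fin 2) +
      B p • EuclideanSpace.proj (𝕜 := ℝ) (1 : Fin 2)) p)
    (hAB : ∀ p : EuclideanSpace ℝ (Fin 2),
      (A p + Real.cos (p 1)) ^ 2 + B p ^ 2 ≤ laneFactor (p 0) ^ 2) (p q : EuclideanSpace ℝ (Fin 2)) :
    ψ q - ψ p ≤ lanePlane.dist p q := by
  refine le_of_forall_pos_le_add fun ε hε => ?_
  have h0 : 0 ≤ lanePlane.dist p q := ENNReal.toReal_nonneg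
  have h1 : finslerDist (𝓡 2) lanePlane.fermatPlus p q <
      ENNReal.ofReal (lanePlane.dist p q + ε) := by
    refine (lanePlane.ofReal_dist p q).trans_lt ?_
    exact (ENNReal.ofReal_lt_ofReal_iff (by linarith)).2 (by linarith)
  have key : ∀ p v : EuclideanSpace ℝ (Fin 2),
      dirDeriv (𝓡 2) ψ p v ≤ 1 * lanePlane.fermatPlus p v := by
    intro p v
    rw [one_mul]
    refine le_of_le_of_eq ?_ (fermatPlus_lanePlane p v).symm
    have h3 : dirDeriv (𝓡 2) ψ p v = A p * v 0 + B p * v 1 := by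
      unfold dirDeriv
      rw [mfderiv_eq_fderiv, (hd p).fderiv]
      rfl
    have h4 := one_lt_laneFactor (p 0)
    have h5 := cauchy_schwarz_plane (v := v 0) (w := v 1) (zero_le_one.trans h4.le) (hAB p)
    rw [h3]
    linarith
  have h2 := sub_le_mul_of_finslerDist_lt lanePlane.isFinsler_plus zero_le_one hψ.contMDiff key h1
  rwa [one_mul] at h2

/-- The length of the curve is not computed; its speed is bounded by the derivative of a given
function `G`. -/
theorem dist_lanePlane_le {γ : ℝ → EuclideanSpace ℝ (Fin 2)} {x' y' G G' : ℝ → ℝ} {a b : ℝ} (hab : a ≤ b)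
    (hγ : ∀ i, ContDiffOn ℝ ∞ (fun s => γ s i) (Icc a b))
    (hx : ∀ s ∈ Icc a b, HasDerivAt (fun s => γ s 0) (x' s) s)
    (hy : ∀ s ∈ Icc a b, HasDerivAt (fun s => γ s 1) (y' s) s)
    (hG : ∀ s ∈ Icc a b, HasDerivAt G (G' s) s)
    (hle : ∀ s ∈ Icc a b, laneFactor (γ s 0) * √(x' s ^ 2 + y' s ^ 2) -
      Real.cos (γ s 1) * x' s ≤ G' s) :
    lanePlane.dist (γ a) (γ b) ≤ G b - G a := by
  rcases hab.eq_or_lt with rfl | hab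
  · rw [lanePlane.lengthDist.self, sub_self]
  have harc : SmoothArc (𝓡 2) (fun _ _ => True) γ a b :=
    ⟨(contDiffOn_euclidean.2 hγ).contMDiffOn, fun _ _ => trivial⟩
  have hvel : ∀ s ∈ Ioo a b, lanePlane.fermatPlus (γ s) (arcVel (𝓡 2) γ a b s) ≤ G' s := by
    intro s hs
    have hs' := Ioo_subset_Icc_self hs
    have h1 : HasDerivAt γ (!₂[x' s, y' s]) s := by
      rw [hasDerivAt_iff_hasFDerivAt, ← hasFDerivWithinAt_univ, hasFDerivWithinAt_euclidean]
      intro i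
      fin_cases i
      · exact (hx s hs').hasFDerivAt.hasFDerivWithinAt.congr_fderiv (by ext; simp)
      · exact (hy s hs').hasFDerivAt.hasFDerivWithinAt.congr_fderiv (by ext; simp)
    have h2 : arcVel (𝓡 2) γ a b s = !₂[x' s, y' s] := by
      unfold arcVel
      rw [mfderivWithin_eq_fderivWithin]
      exact h1.hasDerivWithinAt.derivWithin (uniqueDiffOn_Icc hab s hs')
    refine (fermatPlus_lanePlane _ _).trans_le ?_
    rw [h2]
    exact hle s hs'
  have h3 : finslerDist (𝓡 2) lanePlane.fermatPlus (γ a) (γ b) ≤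
      ENNReal.ofReal (∫ s in a..b, lanePlane.fermatPlus (γ s) (arcVel (𝓡 2) γ a b s)) := by
    refine sInf_le ⟨γ, a, b, ⟨1, fun i => if i = 0 then a else b, rfl, rfl, ?_⟩, rfl,
      rfl, (harc.lintegral_eq lanePlane.isFinsler_plus hab).symm⟩
    intro j hj
    obtain rfl : j = 0 := by omega
    exact ⟨hab, harc⟩
  refine (ENNReal.toReal_le_of_le_ofReal (intervalIntegral.integral_nonneg hab.le fun s _ =>
    lanePlane.isFinsler_plus.nonneg _ _) h3).trans ?_
  exact intervalIntegral.integral_le_sub_of_hasDeriv_right_of_le hab.le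
    (fun s hs => (hG s hs).continuousAt.continuousWithinAt)
    (fun s hs => (hG s (Ioo_subset_Icc_self hs)).hasDerivWithinAt)
    (harc.continuousOn_speed lanePlane.isFinsler_plus hab).integrableOn_Icc hvel

end

section
variable (p q : EuclideanSpace ℝ (Fin 2))

theorem hasFDerivAt_coord (i : Fin 2) : HasFDerivAt (fun p : EuclideanSpace ℝ (Fin 2) => p i)
    (EuclideanSpace.proj (𝕜 := ℝ) i) p :=
  (EuclideanSpace.proj (𝕜 := ℝ) i).hasFDerivAt

/-- Calibration by `-cos y + κ e⁻ˣ`, which is admissible because `(cos y - κ e⁻ˣ)² + sin² y ≤ (1 +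
e⁻ˣ)²`. -/
theorem lanePlane_le_cos {κ : ℝ} (hκ : |κ| = 1) :
    Real.cos (p 1) - Real.cos (q 1) + κ * (Real.exp (-q 0) - Real.exp (-p 0)) ≤
      lanePlane.dist p q := by
  have h := sub_le_dist_lanePlane (ψ := fun p => -Real.cos (p 1) + κ * Real.exp (-p 0))
    (A := fun p => -(κ * Real.exp (-p 0))) (B := fun p => Real.sin (p 1))
    (((contDiff_coord 1).cos.neg.add (contDiff_const.mul (contDiff_coord 0).neg.exp)).of_le
      (by norm_num))
    (fun p => (((hasFDerivAt_coord p 1).cos.neg.add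
      ((hasFDerivAt_coord p 0).neg.exp.const_mul κ))).congr_fderiv (by ext v; simp; ring))
    (fun p => by
      have h1 : κ ^ 2 = 1 := by rw [← sq_abs, hκ, one_pow]
      have h2 : |κ * Real.cos (p 1)| ≤ 1 := by
        rw [abs_mul, hκ, one_mul]
        exact Real.abs_cos_le_one _
      have h3 := (abs_le.1 h2).1
      have h4 := Real.sin_sq_add_cos_sq (p 1)
      have h5 := Real.exp_pos (-p 0)
      unfold laneFactor
      nlinarith) p q
  linarith

/-- A function of `y` alone can be a calibration only if its derivative vanishes on the lanes; `sin²
y` is admissible because `cos² y + sin⁴ y ≤ 1`. -/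
theorem lanePlane_le_sinSqPrimitive {κ : ℝ} (hκ : |κ| = 1) :
    κ * (sinSqPrimitive (q 1) - sinSqPrimitive (p 1)) ≤ lanePlane.dist p q := by
  have h := sub_le_dist_lanePlane (ψ := fun p => κ * sinSqPrimitive (p 1))
    (A := fun _ => 0) (B := fun p => κ * Real.sin (p 1) ^ 2)
    ((contDiff_const.mul (((contDiff_coord 1).div_const 2).sub
      ((contDiff_const.mul (contDiff_coord 1)).sin.div_const 4))).of_le (by norm_num))
    (fun p => by
      have h1 : ∀ y, HasDerivAt sinSqPrimitive (Real.sin y ^ 2) y := fun y => by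
        refine (((hasDerivAt_id y).div_const 2).sub
          (((hasDerivAt_id y).const_mul 2).sin.div_const 4)).congr_deriv ?_
        rw [id, Real.cos_two_mul, Real.cos_sq']
        ring
      exact (((h1 _).comp_hasFDerivAt p (hasFDerivAt_coord p 1)).const_mul κ).congr_fderiv
        (by ext v; simp; ring))
    (fun p => by
      have h1 : κ ^ 2 = 1 := by rw [← sq_abs, hκ, one_pow]
      have h4 := Real.sin_sq_add_cos_sq (p 1)
      have h5 := one_lt_laneFactor (p 0)
      simp only [mul_pow, h1]
      nlinarith [sq_nonneg (Real.sin (p 1)), sq_nonneg (Real.cos (p 1))]) p q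
  linarith

theorem arctan_sq_lt (u : ℝ) : Real.arctan u ^ 2 < 5 / 2 := by
  have h1 := Real.arctan_lt_pi_div_two u
  have h2 := Real.neg_pi_div_two_lt_arctan u
  have h3 := Real.pi_lt_d2
  nlinarith

/-- Here `c = κ cos y`, `s = sin y`, and `t`, `w` are derivative and value of `arctan`; `5 / 2`
bounds `(π / 2)²`. Already `1` is an upper bound: with `s² = (1 - c)(1 + c)` the factor `1 - c`
splits off, and `27 / 32 = 1 - (5 / 2) / 16`. -/
theorem lane_calibration_le {c s t w h : ℝ} (hc : s ^ 2 + c ^ 2 = 1) (ht0 : 0 < t) (ht1 : t ≤ 1)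
    (hw : w ^ 2 < 5 / 2) (hh : 1 < h) :
    ((1 - c) * t / 4 + c) ^ 2 + (s * w / 4) ^ 2 ≤ h ^ 2 := by
  have hc1 : c ≤ 1 := by nlinarith [sq_nonneg s]
  have hc2 : -1 ≤ c := by nlinarith [sq_nonneg s]
  have h1 : 0 ≤ (1 - c) * ((1 + c) * (27 / 32) - c * t / 2 - (1 - c) * t ^ 2 / 16) := by
    refine mul_nonneg (by linarith) ?_
    nlinarith [mul_nonneg (sub_nonneg.2 hc1) ht0.le, mul_nonneg (sub_nonneg.2 ht1) ht0.le,
      mul_nonneg (mul_nonneg (sub_nonneg.2 hc1) ht0.le) (sub_nonneg.2 ht1),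
      mul_nonneg (by linarith : 0 ≤ 1 + c) (sub_nonneg.2 ht1)]
  have h2 : s ^ 2 * w ^ 2 ≤ s ^ 2 * (5 / 2) := mul_le_mul_of_nonneg_left hw.le (sq_nonneg s)
  nlinarith

/-- Both estimates by `arctan`; `κ = 1` for the lane `y = 0` and `κ = -1` for the others. -/
theorem lanePlane_le_arctan {κ : ℝ} (hκ : |κ| = 1) (R : ℝ) :
    κ * ((1 - κ * Real.cos (q 1)) * Real.arctan (q 0 - R)) -
      κ * ((1 - κ * Real.cos (p 1)) * Real.arctan (p 0 - R)) ≤ 4 * lanePlane.dist p q := by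
  have h1 : κ ^ 2 = 1 := by rw [← sq_abs, hκ, one_pow]
  have h := sub_le_dist_lanePlane
    (ψ := fun p => κ / 4 * ((1 - κ * Real.cos (p 1)) * Real.arctan (p 0 - R)))
    (A := fun p => κ * ((1 - κ * Real.cos (p 1)) * (1 / (1 + (p 0 - R) ^ 2)) / 4))
    (B := fun p => Real.sin (p 1) * Real.arctan (p 0 - R) / 4)
    ((contDiff_const.mul ((contDiff_const.sub (contDiff_const.mul (contDiff_coord 1).cos)).mul
      (Real.contDiff_arctan.comp ((contDiff_coord 0).sub contDiff_const)))).of_le (by norm_num))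
    (fun p => ((((hasFDerivAt_coord p 1).cos.const_mul κ).const_sub 1).mul
      (((hasFDerivAt_coord p 0).sub_const R).arctan)).const_mul (κ / 4) |>.congr_fderiv (by
        ext v
        simp
        linear_combination (Real.arctan (p 0 - R) * Real.sin (p 1) * v 1 / 4) * h1))
    (fun p => by
      have h2 : 0 < 1 + (p 0 - R) ^ 2 := by positivity
      have h3 := lane_calibration_le (c := κ * Real.cos (p 1)) (s := Real.sin (p 1))
        (by rw [mul_pow, h1, one_mul]; exact Real.sin_sq_add_cos_sq (p 1))
        (one_div_pos.2 h2) ((div_le_one h2).2 (by nlinarith [sq_nonneg (p 0 - R)]))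
        (arctan_sq_lt (p 0 - R)) (one_lt_laneFactor (p 0))
      refine le_of_eq_of_le ?_ h3
      generalize (1 - κ * Real.cos (p 1)) * (1 / (1 + (p 0 - R) ^ 2)) / 4 = a
      linear_combination (a ^ 2 - Real.cos (p 1) ^ 2) * h1) p q
  linarith

end

/-! ### Upper bounds along the lanes and across them, and conclusion of the counterexample. -/

section

theorem dist_lanePlane_vertical_le {κ : ℝ} (hκ : |κ| = 1) (x : ℝ) {u v : ℝ} (huv : u ≤ v) :
    lanePlane.dist !₂[x, κ * u] !₂[x, κ * v] ≤ laneFactor x * (v - u) := by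
  have h1 : κ ^ 2 = 1 := by rw [← sq_abs, hκ, one_pow]
  have h := dist_lanePlane_le (γ := fun s => !₂[x, κ * s]) (x' := fun _ => 0) (y' := fun _ => κ)
    (G := fun s => laneFactor x * s) (G' := fun _ => laneFactor x) huv
    (fun i => by fin_cases i <;> simp <;> fun_prop)
    (fun s _ => by simpa using hasDerivAt_const s x)
    (fun s _ => by simpa using (hasDerivAt_id s).const_mul κ)
    (fun s _ => by simpa using (hasDerivAt_id s).const_mul (laneFactor x))
    (fun s _ => by simp [h1])
  linarith

theorem dist_lanePlane_horizontal_le {κ y : ℝ} (hκ : |κ| = 1) (hy : Real.cos y = κ) {u v : ℝ}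
    (huv : u ≤ v) : lanePlane.dist !₂[κ * u, y] !₂[κ * v, y] ≤
      κ * (Real.exp (-(κ * u)) - Real.exp (-(κ * v))) := by
  have h1 : κ ^ 2 = 1 := by rw [← sq_abs, hκ, one_pow]
  have h := dist_lanePlane_le (γ := fun s => !₂[κ * s, y]) (x' := fun _ => κ) (y' := fun _ => 0)
    (G := fun s => -(κ * Real.exp (-(κ * s)))) (G' := fun s => Real.exp (-(κ * s))) huv
    (fun i => by fin_cases i <;> simp <;> fun_prop)
    (fun s _ => by simpa using (hasDerivAt_id s).const_mul κ)
    (fun s _ => by simpa using hasDerivAt_const s y)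
    (fun s _ => ((((hasDerivAt_id s).const_mul κ).neg.exp.const_mul κ).neg).congr_deriv (by
      simp only [id]
      linear_combination Real.exp (-(κ * s)) * h1))
    (fun s _ => by simp [h1, hy, laneFactor, ← sq])
  linarith

/-- Without the term `e⁻ˣ`, the integrand `√(dx² + dy²) - cos y dx` is minimal for `dx = cot y dy`,
that is for `x = log (sin y)` up to a constant. It then equals `sin y dy`, with integral `2 cos s₀ ≤
2`. The term `e⁻ˣ` adds at most `e⁻ˣ / sin s₀`, taken at the initial `x`, per unit of `y`. -/
theorem dist_lanePlane_cross_le {κ : ℝ} (hκ : |κ| = 1) (x : ℝ) {s₀ : ℝ} (h0 : 0 < s₀)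
    (h1 : s₀ ≤ Real.pi / 2) : lanePlane.dist !₂[x, κ * s₀] !₂[x, κ * (Real.pi - s₀)] ≤
      2 + Real.pi * Real.exp (-x) / Real.sin s₀ := by
  have hκ2 : κ ^ 2 = 1 := by rw [← sq_abs, hκ, one_pow]
  have hcos : ∀ s, Real.cos (κ * s) = Real.cos s := fun s => by
    rcases (abs_eq zero_le_one).1 hκ with rfl | rfl <;> simp
  have hsin0 : 0 < Real.sin s₀ := Real.sin_pos_of_pos_of_lt_pi h0 (by linarith [Real.pi_pos])
  have hsin : ∀ s ∈ Icc s₀ (Real.pi - s₀), Real.sin s₀ ≤ Real.sin s := by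
    intro s hs
    rcases le_total s (Real.pi / 2) with h2 | h2
    · exact Real.sin_le_sin_of_le_of_le_pi_div_two (by linarith) h2 hs.1
    · rw [← Real.sin_pi_sub s]
      exact Real.sin_le_sin_of_le_of_le_pi_div_two (by linarith) (by linarith) (by linarith [hs.2])
  have hpos : ∀ s ∈ Icc s₀ (Real.pi - s₀), 0 < Real.sin s := fun s hs => hsin0.trans_le (hsin s hs)
  set K := Real.exp (-x) / Real.sin s₀ with hK
  have h := dist_lanePlane_le
    (γ := fun s => !₂[x - Real.log (Real.sin s₀) + Real.log (Real.sin s), κ * s])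
    (x' := fun s => Real.cos s / Real.sin s) (y' := fun _ => κ)
    (G := fun s => -Real.cos s + K * s) (G' := fun s => Real.sin s + K)
    (show s₀ ≤ Real.pi - s₀ by linarith)
    (fun i => by
      fin_cases i
      · exact contDiffOn_const.add (Real.contDiff_sin.contDiffOn.log fun s hs => (hpos s hs).ne')
      · exact contDiffOn_const.mul contDiffOn_id)
    (fun s hs => ((Real.hasDerivAt_sin s).log (hpos s hs).ne').const_add _)
    (fun s _ => by simpa using (hasDerivAt_id s).const_mul κ)
    (fun s _ => ((Real.hasDerivAt_cos s).neg.add ((hasDerivAt_id s).const_mul K)).congr_deriv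
      (by simp))
    (fun s hs => by
      have h2 := hpos s hs
      have h3 : √((Real.cos s / Real.sin s) ^ 2 + κ ^ 2) = 1 / Real.sin s := by
        rw [hκ2, show (Real.cos s / Real.sin s) ^ 2 + 1 = (1 / Real.sin s) ^ 2 by
          field_simp
          linarith [Real.sin_sq_add_cos_sq s]]
        exact Real.sqrt_sq (by positivity)
      have h4 : Real.exp (-(x - Real.log (Real.sin s₀) + Real.log (Real.sin s))) =
          Real.exp (-x) * Real.sin s₀ / Real.sin s := by
        rw [show -(x - Real.log (Real.sin s₀) + Real.log (Real.sin s)) =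
          -x + Real.log (Real.sin s₀) - Real.log (Real.sin s) by ring, Real.exp_sub, Real.exp_add,
          Real.exp_log hsin0, Real.exp_log h2]
      -- On the interval `sin s ≥ sin s₀`, so that the quotient by `sin² s` is largest at the end
      -- points.
      have h5 : Real.exp (-x) * Real.sin s₀ / Real.sin s * (1 / Real.sin s) ≤ K := by
        rw [hK, div_mul_div_comm, mul_one, div_le_div_iff₀ (by positivity) hsin0]
        have := mul_le_mul (hsin s hs) (hsin s hs) hsin0.le h2.le
        nlinarith [Real.exp_pos (-x)]
      change laneFactor (x - Real.log (Real.sin s₀) + Real.log (Real.sin s)) *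
        √((Real.cos s / Real.sin s) ^ 2 + κ ^ 2) - Real.cos (κ * s) * (Real.cos s / Real.sin s) ≤ _
      rw [h3, hcos, laneFactor, h4]
      have h6 : 1 / Real.sin s - Real.cos s * (Real.cos s / Real.sin s) = Real.sin s := by
        field_simp
        linarith [Real.sin_sq_add_cos_sq s]
      linarith)
  have hbase : x - Real.log (Real.sin s₀) + Real.log (Real.sin s₀) = x := by ring
  simp only [Real.sin_pi_sub, Real.cos_pi_sub, hbase] at h
  have h2 := Real.cos_le_one s₀
  have h3 : 0 < K := by positivity
  have h4 : Real.pi * Real.exp (-x) / Real.sin s₀ = Real.pi * K := by rw [hK, mul_div_assoc]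
  nlinarith

theorem laneEstimates_lanePlane : LaneEstimates lanePlane.dist (fun p => p 0) (fun p => p 1)
    fun x y => !₂[x, y] where
  fst_pt _ _ := rfl
  snd_pt _ _ := rfl
  pt_eta p := by ext i; fin_cases i <;> rfl
  le_cos_add p q := by simpa using lanePlane_le_cos p q abs_one
  le_cos_sub p q := by
    have := lanePlane_le_cos p q (κ := -1) (by simp)
    linarith
  abs_le p q := by
    have h1 := lanePlane_le_sinSqPrimitive p q abs_one
    have h2 := lanePlane_le_sinSqPrimitive p q (κ := -1) (by simp)
    exact abs_le.2 ⟨by linarith, by linarith⟩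
  le_right R p q := by simpa using lanePlane_le_arctan p q abs_one R
  le_left R p q := by
    have := lanePlane_le_arctan p q (κ := -1) (by simp) R
    simp only [neg_one_mul, sub_neg_eq_add] at this
    linarith
  vertical x y y' := by
    rcases le_total y y' with h | h
    · rw [abs_of_nonneg (sub_nonneg.2 h)]
      simpa [laneFactor] using dist_lanePlane_vertical_le abs_one x h
    · rw [abs_of_nonpos (sub_nonpos.2 h)]
      have := dist_lanePlane_vertical_le (κ := -1) (by simp) x (neg_le_neg h)
      simp only [neg_one_mul, neg_neg] at this
      refine this.trans_eq ?_
      rw [laneFactor]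
      ring
  right x x' h := by simpa using dist_lanePlane_horizontal_le abs_one Real.cos_zero h
  left κ hκ x x' h := by
    have := dist_lanePlane_horizontal_le (κ := -1) (by simp) (cos_mul_pi_of_abs_eq_one hκ)
      (neg_le_neg h)
    simp only [neg_one_mul, neg_neg] at this
    linarith
  cross _ hκ x _ h0 h1 := dist_lanePlane_cross_le hκ x h0 h1

theorem exists_nonunique_pairs : ∃ (S' : StandardStationary 2 (EuclideanSpace ℝ (Fin 2)))
    (P F F' : Set (ℝ × EuclideanSpace ℝ (Fin 2))), P ≠ ∅ ∧ F ≠ ∅ ∧ F' ≠ ∅ ∧ F ≠ F' ∧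
      (P, F) ∈ Causal.cBoundary S'.chron ∧ (P, F') ∈ Causal.cBoundary S'.chron := by
  refine ⟨lanePlane, ?_⟩
  rw [lanePlane.chron_eq]
  exact laneEstimates_lanePlane.exists_nonunique lanePlane.lengthDist

end

end

theorem theorem1p2 {n : ℕ} {M : Type*} [TopologicalSpace M]
    [ChartedSpace (EuclideanSpace ℝ (Fin n)) M] [IsManifold (𝓡 n) ∞ M]
    [T2Space M] [SecondCountableTopology M] [ConnectedSpace M] (S : StandardStationary n M) :
    -- (1A) and (3A): the future and past boundaries as cones, as point sets and topologically
    (∀ x₀ : M, ∃ e : ForwardCone S.busemannBdryPlus ≃ S.futureBdry,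
      (∀ (t : Ioi (⊥ : EReal)) (f : S.BPlus) (hf : S.classPlus f ∈ S.busemannBdryPlus),
        f.1 x₀ = t.1 → (e (ForwardCone.mk t ⟨S.classPlus f, hf⟩)).1.1 = pastOf f.1) ∧
      (e ForwardCone.apex).1.1 = univ ∧
      (T2Space S.BusemannPlus → IsHomeomorph e)) ∧
    (∀ x₀ : M, ∃ e : BackwardCone S.busemannBdryMinus ≃ S.pastBdry,
      (∀ (t : Iio (⊤ : EReal)) (f : S.BMinus) (hf : S.classMinus f ∈ S.busemannBdryMinus),
        f.1 x₀ = t.1 → (e (BackwardCone.mk t ⟨S.classMinus f, hf⟩)).1.1 = futureOf f.1) ∧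
      (e BackwardCone.apex).1.1 = univ ∧
      (T2Space S.BusemannMinus → IsHomeomorph e)) ∧
    -- (1B): the pairs with non-empty first component
    (∀ P F : Set (ℝ × M), (P, F) ∈ Causal.cBoundary S.chron → P ≠ ∅ →
      (∃ c, P = pastOf (S.busemannPlus c)) ∧
      ∀ c, P = pastOf (S.busemannPlus c) →
        ((∀ x, S.busemannPlus c x = ⊤) → P = univ ∧ F = ∅) ∧
        (S.busemannPlus c ∈ S.properBPlus → F = ∅) ∧
        (S.busemannPlus c ∈ S.BPlus \ S.properBPlus →
          ∃ (Ω : ℝ) (z : S.CauchyPlus), z ∈ S.cauchyBdryPlus ∧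
            S.busemannPlus c = S.dPlusOf Ω z.rep ∧
            P = pastOf (S.dPlusOf Ω z.rep) ∧
            F ⊆ futureOf (S.dMinusOf Ω z.rep) ∧
            Xor (F = ∅)
              (∃ (Ω' : ℝ) (w : S.CauchyMinus), w ∈ S.cauchyBdryMinus ∧
                F = futureOf (S.dMinusOf Ω' w.rep) ∧
                ((Ω' - Ω : ℝ) : EReal) = (doubleLim S.distPlus z.rep w.rep : EReal)) ∧
            (∀ w : S.CauchyMinus, z ∈ S.cauchyBdrySymm → S.SamePoint z w →
              F = futureOf (S.dMinusOf Ω w.rep) ∧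
              (∀ (Ω' : ℝ) (w' : S.CauchyMinus), w' ∈ S.cauchyBdryMinus →
                F = futureOf (S.dMinusOf Ω' w'.rep) → Ω' = Ω ∧ w' = w) ∧
              Causal.commonPast (fun p q => S.chron q p) P = futureOf (S.dMinusOf Ω z.rep) ∧
              ∀ F', (P, F') ∈ Causal.cCompletion S.chron ↔
                F' = futureOf (S.dMinusOf Ω w.rep)))) ∧
    -- (1B): the pairs with non-empty second component
    (∀ P F : Set (ℝ × M), (P, F) ∈ Causal.cBoundary S.chron → F ≠ ∅ →
      (∃ c, F = futureOf (S.busemannMinus c)) ∧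
      ∀ c, F = futureOf (S.busemannMinus c) →
        ((∀ x, S.busemannMinus c x = ⊥) → F = univ ∧ P = ∅) ∧
        (S.busemannMinus c ∈ S.properBMinus → P = ∅) ∧
        (S.busemannMinus c ∈ S.BMinus \ S.properBMinus →
          ∃ (Ω : ℝ) (w : S.CauchyMinus), w ∈ S.cauchyBdryMinus ∧
            S.busemannMinus c = S.dMinusOf Ω w.rep ∧
            F = futureOf (S.dMinusOf Ω w.rep) ∧
            P ⊆ pastOf (S.dPlusOf Ω w.rep) ∧
            Xor (P = ∅)
              (∃ (Ω' : ℝ) (z : S.CauchyPlus), z ∈ S.cauchyBdryPlus ∧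
                P = pastOf (S.dPlusOf Ω' z.rep) ∧
                ((Ω - Ω' : ℝ) : EReal) = (doubleLim S.distPlus z.rep w.rep : EReal)) ∧
            (∀ z : S.CauchyPlus, w ∈ S.cauchyBdrySymm' → S.SamePoint z w →
              P = pastOf (S.dPlusOf Ω z.rep) ∧
              (∀ (Ω' : ℝ) (z' : S.CauchyPlus), z' ∈ S.cauchyBdryPlus →
                P = pastOf (S.dPlusOf Ω' z'.rep) → Ω' = Ω ∧ z' = z) ∧
              Causal.commonPast S.chron F = pastOf (S.dPlusOf Ω w.rep) ∧
              ∀ P', (P', F) ∈ Causal.cCompletion S.chron ↔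
                P' = pastOf (S.dPlusOf Ω z.rep)))) ∧
    -- (1B): in general, the first component does not determine a non-empty second component
    (∃ (S' : StandardStationary 2 (EuclideanSpace ℝ (Fin 2)))
      (P F F' : Set (ℝ × EuclideanSpace ℝ (Fin 2))), P ≠ ∅ ∧ F ≠ ∅ ∧ F' ≠ ∅ ∧ F ≠ F' ∧
        (P, F) ∈ Causal.cBoundary S'.chron ∧ (P, F') ∈ Causal.cBoundary S'.chron) ∧
    -- (1B): the c-boundary is the disjoint union of the lines
    (Causal.cBoundary S.chron = ⋃ p ∈ Causal.cBoundary S.chron, line p) ∧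
    (∀ p ∈ Causal.cBoundary S.chron, ∀ q ∈ Causal.cBoundary S.chron,
      line p = line q ∨ Disjoint (line p) (line q)) ∧
    -- (1B): simplicity as a point set
    ((S.ForwardEvenlyPairing ∨ S.BackwardEvenlyPairing) → Causal.IsPointSimple S.chron) ∧
    (Causal.IsPointSimple S.chron →
      ∃ e : Causal.cBoundarySet S.chron → Causal.GluedBoundary S.chron,
        Function.Bijective e ∧ Causal.IsNaturalOnBoundary S.chron e) ∧
    -- (2): causality of the lines
    (∀ p ∈ Causal.cBoundary S.chron,
      ((∃ (Ω : ℝ) (z : S.CauchyPlus) (w : S.CauchyMinus), z ∈ S.cauchyBdrySymm ∧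
          S.SamePoint z w ∧ p.1 = pastOf (S.dPlusOf Ω z.rep) ∧
          p.2 = futureOf (S.dMinusOf Ω w.rep)) → IsTimelikeLine p) ∧
      ((p.1 = ∅ ∨ p.2 = ∅) → IsHorismoticLine p) ∧
      ((¬ ∃ (Ω : ℝ) (z : S.CauchyPlus) (w : S.CauchyMinus), z ∈ S.cauchyBdrySymm ∧
          S.SamePoint z w ∧ p.1 = pastOf (S.dPlusOf Ω z.rep) ∧
          p.2 = futureOf (S.dMinusOf Ω w.rep)) → p.1 ≠ ∅ → p.2 ≠ ∅ →
        IsLocallyHorismoticLine p)) ∧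
    -- (3B): topological simplicity
    (LocallyCompactSpace S.CauchySymm →
      IsGeneralizedDist (CauchyCompl.quasiDist (d := S.distPlus)) →
      Causal.IsSimple S.chron ∧
      ∃ e : Causal.CCompletion S.chron → Causal.GluedCompletion S.chron,
        IsHomeomorph e ∧ Causal.IsNaturalOnCompletion S.chron e) ∧
    -- the summary on the c-boundary
    (LocallyCompactSpace S.CauchySymm →
      IsGeneralizedDist (CauchyCompl.quasiDist (d := S.distPlus)) →
      T2Space S.BusemannPlus → T2Space S.BusemannMinus →
      ∃ e : Causal.cBoundarySet S.chron → Causal.GluedBoundary S.chron,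
        IsHomeomorph e ∧ Causal.IsNaturalOnBoundary S.chron e) := by
  exact ⟨S.exists_forwardCone, S.exists_backwardCone, S.past_components, S.future_components,
    exists_nonunique_pairs,
    by rw [S.chron_eq]; exact cBoundary_eq_iUnion_line,
    fun p _ q _ => line_eq_or_disjoint p q,
    S.isPointSimple_of_evenlyPairing,
    fun hs => (Causal.exists_natural_boundary S.cBoundary_isTIP S.cBoundary_isTIF hs).imp
      fun e he => ⟨he.1, he.2.1⟩,
    S.causality_lines,
    fun hl hg => by
      have hs := S.isSimple_of_locallyCompact hl hg
      obtain ⟨h1, h2⟩ := S.existsUnique_components hs.1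
      obtain ⟨-, -, e, he1, he2, -⟩ := Causal.exists_natural_completion h1 h2 hs
      exact ⟨hs, e, he1, he2⟩,
    fun hl hg _ _ => by
      have hs := S.isSimple_of_locallyCompact hl hg
      obtain ⟨h1, h2⟩ := S.existsUnique_components hs.1
      exact Causal.exists_natural_boundary_homeomorph S.cBoundary_isTIP S.cBoundary_isTIF h1 h2 hs
        S.isClosed_boundaries.1 S.isClosed_boundaries.2⟩
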